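/- Notation. Let $N\ge 1$ and $\sigma>0$. Functions are real-valued on $\mathbb R^N$, $\|f\|_{H^k}^2=\sum_{|\alpha|\le k}\|\partial^\alpha f\|_{L^2}^2$, and for $k\ge1$ $$H^k_{\sin}=\{v\in L^1_{\rm loc}:\ \nabla v\in H^{k-1},\ \sin v\in L^2\},\qquad d^k_{\sin}(v_1,v_2)=\big(\|\sin(v_1-v_2)\|_{L^2}^2+\|\nabla v_1-\nabla v_2\|_{H^{k-1}}^2\big)^{1/2}.$$ For $\varepsilon>0$ let $\mathcal{NV}^k_\varepsilon=\{(U,\Phi)\in H^k\times H^k_{\sin}:\ \varepsilon|U|<1\}$. Continuity in time with values in $H^k_{\sin}$ is with respect to $d^k_{\sin}$. Consider the rescaled hydrodynamical Landau–Lifshitz system $$(\mathrm{HLL}_\varepsilon)\quad\begin{cases}\partial_tU_\varepsilon=\operatorname{div}\big((1-\varepsilon^2U_\varepsilon^2)\nabla\Phi_\varepsilon\big)-\frac\sigma2(1-\varepsilon^2U_\varepsilon^2)\sin(2\Phi_\varepsilon),\\ \partial_t\Phi_\varepsilon=U_\varepsilon(1-\varepsilon^2\sigma\sin^2\Phi_\varepsilon)-\varepsilon^2\operatorname{div}\Big(\frac{\nabla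 U_\varepsilon}{1-\varepsilon^2U_\varepsilon^2}\Big)+\varepsilon^4U_\varepsilon\frac{|\nabla U_\varepsilon|^2}{(1-\varepsilon^2U_\varepsilon^2)^2}-\varepsilon^2U_\varepsilon|\nabla\Phi_\varepsilon|^2\end{cases}$$ and the Sine-Gordon system $$(\mathrm{SGS})\quad \partial_tU=\Delta\Phi-\tfrac\sigma2\sin(2\Phi),\qquad \partial_t\Phi=U,$$ both understood in the sense of distributions. Proposition. Let $k\in\mathbb N$ with $k>N/2+1$, let $\varepsilon,T>0$, and let $(U_\varepsilon,\Phi_\varepsilon)\in C^0([0,T],\mathcal{NV}^{k+1}_\varepsilon)$ be a solution of $(\mathrm{HLL}_\varepsilon)$ with initial datum $(U^0_\varepsilon,\Phi^0_\varepsilon)\in\mathcal{NV}^{k+2}_\varepsilon$ and $\varepsilon\|U_\varepsilon(\cdot,t)\|_{L^\infty}\le 1/\sqrt2$ for all $t\in[0,T]$. Let $(U,\Phi)\in C^0([0,T],L^2\times H^1_{\sin})$ be a solution of $(\mathrm{SGS})$ with initial datum $(U^0,\Phi^0)\in L^2\times H^1_{\sin}$. Set $u_\varepsilon=U_\varepsilon-U$,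 $\varphi_\varepsilon=\Phi_\varepsilon-\Phi$, with values $u_\varepsilon^0,\varphi_\varepsilon^0$ at $t=0$, and $$\mathcal K_\varepsilon(T)=\max_{t\in[0,T]}\big(\|U_\varepsilon\|_{H^k}+\varepsilon\|\nabla U_\varepsilon\|_{H^k}+\|\nabla\Phi_\varepsilon\|_{H^k}+\|\sin\Phi_\varepsilon\|_{H^k}\big)(t).$$ (i) There is $C_1>0$ depending only on $\sigma$ and $N$ such that, if $\Phi_\varepsilon^0-\Phi^0\in L^2$, then for all $t\in[0,T]$ $$\|\varphi_\varepsilon(\cdot,t)\|_{L^2}\le C_1\Big(\|\varphi^0_\varepsilon\|_{L^2}+\|u^0_\varepsilon\|_{L^2}+\varepsilon^2\mathcal K_\varepsilon(T)\big(1+\varepsilon^2\mathcal K_\varepsilon(T)^2+\mathcal K_\varepsilon(T)^3\big)\Big)e^{C_1t}.$$ (ii) There is $C_2>0$ depending only on $\sigma$ and $N$ such that, if $N\ge2$, or $N=1$ and $k>N/2+2$, then for all $t\in[0,T]$ $$\|u_\varepsilon(\cdot,t)\|_{L^2}+\|\nabla\varphi_\varepsilon(\cdot,t)\|_{L^2}+\|\sin\varphi_\varepsilon(\cdot,t)\|_{L^2}\le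 C_2\Big(\|u^0_\varepsilon\|_{L^2}+\|\nabla\varphi^0_\varepsilon\|_{L^2}+\|\sin\varphi^0_\varepsilon\|_{L^2}+\varepsilon^2\mathcal K_\varepsilon(T)\big(1+\varepsilon^2\mathcal K_\varepsilon(T)^2+\mathcal K_\varepsilon(T)^3\big)\Big)e^{C_2t}.$$ (iii) If $k>N/2+3$, there is $C_k>0$ depending only on $\sigma$, $k$ and $N$ such that, if $(U,\Phi)\in C^0([0,T],H^k\times H^{k+1}_{\sin})$ and $$\kappa_\varepsilon(T)=\mathcal K_\varepsilon(T)+\max_{t\in[0,T]}\big(\|U\|_{H^k}+\|\nabla\Phi\|_{H^k}+\|\sin\Phi\|_{H^k}\big)(t),$$ then for all $t\in[0,T]$ $$\begin{aligned}\|u_\varepsilon(\cdot,t)\|_{H^{k-3}}&+\|\nabla\varphi_\varepsilon(\cdot,t)\|_{H^{k-3}}+\|\sin\varphi_\varepsilon(\cdot,t)\|_{H^{k-3}}\\ &\le C_k\Big(\|u^0_\varepsilon\|_{H^{k-3}}+\|\nabla\varphi^0_\varepsilon\|_{H^{k-3}}+\|\sin\varphi^0_\varepsilon\|_{H^{k-3}}\\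 &\qquad+\varepsilon^2\kappa_\varepsilon(T)\big(1+\varepsilon^2\kappa_\varepsilon(T)^2+(1+\varepsilon^2)\kappa_\varepsilon(T)^3\big)\Big)e^{C_k(1+\kappa_\varepsilon(T)^2)t}.\end{aligned}$$ -/

import Mathlib

open MeasureTheory Filter Topology Set
open scoped ENNReal ContDiff

noncomputable section

namespace SineGordonRegime

/-- The Euclidean space `ℝ^N`. -/
abbrev Space (N : ℕ) : Type := EuclideanSpace ℝ (Fin N)

variable {N : ℕ}

/-! ### Weak derivatives -/

/-- Test functions: smooth real functions with compact support. -/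
def IsTest (ψ : Space N → ℝ) : Prop := ContDiff ℝ ∞ ψ ∧ HasCompactSupport ψ

/-- The classical partial derivative `∂_i ψ`. -/
def partialDeriv (i : Fin N) (ψ : Space N → ℝ) : Space N → ℝ :=
  fun x => fderiv ℝ ψ x (EuclideanSpace.single i 1)

/-- The classical derivative `∂^α ψ = ∂_1^{α_1} ⋯ ∂_N^{α_N} ψ`. -/
def multiDeriv (α : Fin N → ℕ) (ψ : Space N → ℝ) : Space N → ℝ :=
  (List.finRange N).foldr (fun i g => (partialDeriv i)^[α i] g) ψ

/-- `g` is the weak derivative `∂^α f` of the locally integrable function `f`. -/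
def IsWeakDeriv (α : Fin N → ℕ) (f g : Space N → ℝ) : Prop :=
  LocallyIntegrable f volume ∧ LocallyIntegrable g volume ∧
    ∀ ψ : Space N → ℝ, IsTest ψ →
      ∫ x, f x * multiDeriv α ψ x = (-1) ^ (∑ i, α i) * ∫ x, g x * ψ x

/-- `‖∂^α f‖_{L²} ∈ [0, ∞]`. A weak derivative is unique up to null sets, so the infimum runs over
a single value, and it is `∞` when `f` has no weak derivative `∂^α f`. -/
def weakDerivENorm (α : Fin N → ℕ) (f : Space N → ℝ) : ℝ≥0∞ :=
  ⨅ (g : Space N → ℝ) (_ : IsWeakDeriv α f g), eLpNorm g 2 volume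

open Classical in
/-- The weak partial derivative `∂_i f` (a representative of it; `0` if there is none). -/
def weakPartial (i : Fin N) (f : Space N → ℝ) : Space N → ℝ :=
  if h : ∃ g, IsWeakDeriv (Pi.single i 1) f g then h.choose else 0

/-- The weak gradient `∇ f`. -/
def weakGrad (f : Space N → ℝ) : Space N → Space N :=
  fun x => WithLp.toLp 2 fun i => weakPartial i f x

/-! ### Sobolev norms, with values in `[0, ∞]` -/

/-- The multi-indices `α ∈ ℕ^N` with `|α| ≤ k`. -/
def multiIndices (N k : ℕ) : Finset (Fin N → ℕ) :=
  (Finset.Iic fun _ => k).filter fun α => ∑ i, α i ≤ k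

/-- `‖f‖_{H^k} = (∑_{|α| ≤ k} ‖∂^α f‖_{L²}²)^{1/2}`, equal to `∞` if `f ∉ H^k`. -/
def sobNorm (k : ℕ) (f : Space N → ℝ) : ℝ≥0∞ :=
  (∑ α ∈ multiIndices N k, weakDerivENorm α f ^ 2) ^ (1 / 2 : ℝ)

/-- `‖∇ f‖_{H^k} = (∑_i ∑_{|α| ≤ k} ‖∂^α ∂_i f‖_{L²}²)^{1/2}`, equal to `∞` if `∇ f ∉ H^k`. -/
def gradSobNorm (k : ℕ) (f : Space N → ℝ) : ℝ≥0∞ :=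
  (∑ i, ∑ α ∈ multiIndices N k, weakDerivENorm (α + Pi.single i 1) f ^ 2) ^ (1 / 2 : ℝ)

/-- `‖f‖_{L²}`. -/
def l2Norm (f : Space N → ℝ) : ℝ≥0∞ := eLpNorm f 2 volume

/-- The pointwise sine `sin(v)` of a function `v`. -/
def sinOf (v : Space N → ℝ) : Space N → ℝ := fun x => Real.sin (v x)

/-- `f ∈ H^k(ℝ^N)`. -/
def MemH (k : ℕ) (f : Space N → ℝ) : Prop := sobNorm k f < ⊤

/-- `v ∈ H_sin^k(ℝ^N)` for `k ≥ 1`: `v ∈ L¹_loc`, `∇ v ∈ H^{k-1}` and `sin v ∈ L²`. -/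
def MemHsin (k : ℕ) (v : Space N → ℝ) : Prop :=
  LocallyIntegrable v volume ∧ gradSobNorm (k - 1) v < ⊤ ∧ l2Norm (sinOf v) < ⊤

/-- The pseudometric `d_sin^k(v₁, v₂)` for `k ≥ 1`. -/
def dsin (k : ℕ) (v₁ v₂ : Space N → ℝ) : ℝ≥0∞ :=
  (l2Norm (sinOf (v₁ - v₂)) ^ 2 + gradSobNorm (k - 1) (v₁ - v₂) ^ 2) ^ (1 / 2 : ℝ)

/-- The non-vanishing set of order `k` for the rescaled unknowns: `U ∈ H^k`, `Φ ∈ H_sin^k` and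
`|u| < 1` for the original variable `u = ε U`. -/
def MemNV (ε : ℝ) (k : ℕ) (U Φ : Space N → ℝ) : Prop :=
  MemH k U ∧ MemHsin k Φ ∧ ∀ᵐ x, |ε * U x| < 1

/-- `U ∈ C⁰(I, H^k(ℝ^N))`. -/
def ContInH (k : ℕ) (I : Set ℝ) (U : ℝ → Space N → ℝ) : Prop :=
  (∀ t ∈ I, MemH k (U t)) ∧
    ∀ t ∈ I, Tendsto (fun s => sobNorm k (U s - U t)) (𝓝[I] t) (𝓝 0)

/-- `Φ ∈ C⁰(I, H_sin^k(ℝ^N))`, for the pseudometric `d_sin^k`. -/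
def ContInHsin (k : ℕ) (I : Set ℝ) (Φ : ℝ → Space N → ℝ) : Prop :=
  (∀ t ∈ I, MemHsin k (Φ t)) ∧
    ∀ t ∈ I, Tendsto (fun s => dsin k (Φ s) (Φ t)) (𝓝[I] t) (𝓝 0)

/-! ### The two systems -/

/-- `(U, Φ) ∈ C⁰(I, NV^k)` solves, on the time interval `I`, the rescaled hydrodynamical
Landau-Lifshitz system
`∂_t U = div((1 - ε²U²)∇Φ) - (σ/2)(1 - ε²U²) sin(2Φ)`,
`∂_t Φ = U(1 - ε²σ sin²Φ) - ε² div(∇U/(1 - ε²U²)) + ε⁴U|∇U|²/(1 - ε²U²)² - ε²U|∇Φ|²`,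
the space derivatives being taken in the sense of distributions. -/
structure IsHLLSolution (σ ε : ℝ) (k : ℕ) (I : Set ℝ) (U Φ : ℝ → Space N → ℝ) : Prop where
  cont_U : ContInH k I U
  cont_Φ : ContInHsin k I Φ
  nonvanishing : ∀ t ∈ I, MemNV ε k (U t) (Φ t)
  eq_U : ∀ ψ : Space N → ℝ, IsTest ψ → ∀ t ∈ I,
    HasDerivWithinAt (fun s => ∫ x, U s x * ψ x)
      (-(∫ x, (1 - ε ^ 2 * U t x ^ 2) * inner ℝ (weakGrad (Φ t) x) (gradient ψ x))
        - σ / 2 * ∫ x, (1 - ε ^ 2 * U t x ^ 2) * Real.sin (2 * Φ t x) * ψ x) I t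
  eq_Φ : ∀ ψ : Space N → ℝ, IsTest ψ → ∀ t ∈ I,
    HasDerivWithinAt (fun s => ∫ x, Φ s x * ψ x)
      ((∫ x, U t x * (1 - ε ^ 2 * σ * Real.sin (Φ t x) ^ 2) * ψ x)
        + ε ^ 2 * (∫ x, inner ℝ (weakGrad (U t) x) (gradient ψ x) / (1 - ε ^ 2 * U t x ^ 2))
        + ε ^ 4 * (∫ x, U t x * ‖weakGrad (U t) x‖ ^ 2 / (1 - ε ^ 2 * U t x ^ 2) ^ 2 * ψ x)
        - ε ^ 2 * ∫ x, U t x * ‖weakGrad (Φ t) x‖ ^ 2 * ψ x) I t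

/-- `(U, Φ) ∈ C⁰(I, L² × H_sin^1)` solves, on the time interval `I`, the Sine-Gordon system
`∂_t U = ΔΦ - (σ/2) sin(2Φ)`, `∂_t Φ = U`,
the space derivatives being taken in the sense of distributions. -/
structure IsSGSolution (σ : ℝ) (I : Set ℝ) (U Φ : ℝ → Space N → ℝ) : Prop where
  cont_U : ContInH 0 I U
  cont_Φ : ContInHsin 1 I Φ
  eq_U : ∀ ψ : Space N → ℝ, IsTest ψ → ∀ t ∈ I,
    HasDerivWithinAt (fun s => ∫ x, U s x * ψ x)
      (-(∫ x, inner ℝ (weakGrad (Φ t) x) (gradient ψ x))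
        - σ / 2 * ∫ x, Real.sin (2 * Φ t x) * ψ x) I t
  eq_Φ : ∀ ψ : Space N → ℝ, IsTest ψ → ∀ t ∈ I,
    HasDerivWithinAt (fun s => ∫ x, Φ s x * ψ x) (∫ x, U t x * ψ x) I t

/-! ### The quantities that control the error -/

/-- `K_ε(T)`, the maximum over `t ∈ [0, T]` of
`‖U_ε‖_{H^k} + ε ‖∇U_ε‖_{H^k} + ‖∇Φ_ε‖_{H^k} + ‖sin Φ_ε‖_{H^k}`. -/
def Kquant (ε : ℝ) (k : ℕ) (T : ℝ) (Uε Φε : ℝ → Space N → ℝ) : ℝ≥0∞ :=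
  ⨆ t ∈ Icc 0 T, (sobNorm k (Uε t) + ENNReal.ofReal ε * gradSobNorm k (Uε t)
    + gradSobNorm k (Φε t) + sobNorm k (sinOf (Φε t)))

/-- `κ_ε(T)`, the sum of `K_ε(T)` and of the maximum over `t ∈ [0, T]` of
`‖U‖_{H^k} + ‖∇Φ‖_{H^k} + ‖sin Φ‖_{H^k}`. -/
def kappaQuant (ε : ℝ) (k : ℕ) (T : ℝ) (Uε Φε U Φ : ℝ → Space N → ℝ) : ℝ≥0∞ :=
  Kquant ε k T Uε Φε +
    ⨆ t ∈ Icc 0 T, (sobNorm k (U t) + gradSobNorm k (Φ t) + sobNorm k (sinOf (Φ t)))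

end SineGordonRegime

end

open SineGordonRegime

/-! The differences u = Uε − U and φ = Φε − Φ solve a perturbed wave equation. Subtracting the
Sine-Gordon system from the Landau-Lifshitz system gives ∂ₜu = Δφ − σ cos(Φε + Φ) sin φ + F − div G
and ∂ₜφ = u + R₀ − div R₁, where F, G, R₀ and R₁ depend on (Uε, Φε) only and carry a factor ε². It
remains to bound these four terms by ε²K(1 + ε²K² + K³), to prove an energy estimate for the wave
part, and to apply Gronwall's lemma.

Remainders. Since k > N/2 + 1, the embedding `sobolev` bounds Uε, ∇Uε and ∇Φε uniformly by a
multiple of K. Products are estimated by the tame inequality `reg_mul`, a consequence of the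
Gagliardo-Nirenberg interpolation between L^∞ and L². For a bounded factor this inequality uses only
derivatives of order at least one, so the factors cos Φ and 1/(1 − ε²U²), which are not in L², are
admissible; their gradients come from `weak_chain_rule`. Counting the factors in each product yields
`exists_remainderBound`.

Energy. For every word w, the pair formed by ∂^w u and −∇∂^w φ (up to a common sign) solves the
first-order system of `wave_energy`, which is proved by mollifying in space so that the two cross
terms cancel exactly. The quantity sin φ is not part of the wave energy; it is propagated by ∂ₜ sin
φ = cos φ ∂ₜφ. The three quantities are closed together in `energy_estimate`. Order m = 0 gives (ii)
and m = k − 3 gives (iii). In (iii), multiplication by cos(Φε ± Φ) in H^m costs 1 + κ², which is the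
rate in the exponential. Repeated differentiation of 1/(1 − ε²U²) produces powers of 1 + εκ. They
are harmless when εκ < 1; when ε ≥ 1 or εκ ≥ 1 the claimed bound already dominates the sizes of both
solutions.

Part (i) is the same argument one derivative lower. With W = −∫₀ᵗ ∇φ, the pair (φ, W) solves the
wave system with source u + div W + R₀ − div R₁, and integrating the equation of u in time bounds u
+ div W in L². This is `phase_estimate`.

Throughout, derivatives are handled by duality. `DB` bounds the pairing of f with ∂^w ψ by the L²
norm of ψ, which by the Riesz theorem means that ∂^w f lies in L² with the same bound. Such bounds
pass to limits, and a representative is chosen only when it is needed. -/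

open MeasureTheory Filter Topology Set
open scoped ENNReal ContDiff


noncomputable section

namespace SineGordonRegime

variable {N : ℕ}

/-! ### Iterated partial derivatives -/

/-- The iterated derivative `∂_{i₁} ⋯ ∂_{iₙ} ψ` along the word `w = [i₁, …, iₙ]`. -/
def D (w : List (Fin N)) (ψ : Space N → ℝ) : Space N → ℝ := w.foldr partialDeriv ψ

@[simp] theorem D_nil (ψ : Space N → ℝ) : D [] ψ = ψ := rfl

@[simp] theorem D_cons (i : Fin N) (w : List (Fin N)) (ψ : Space N → ℝ) :
    D (i :: w) ψ = partialDeriv i (D w ψ) := rfl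

theorem D_append (w w' : List (Fin N)) (ψ : Space N → ℝ) : D (w ++ w') ψ = D w (D w' ψ) := by
  simp [D, List.foldr_append]

theorem contDiff_partialDeriv {f : Space N → ℝ} (hf : ContDiff ℝ ∞ f) (i : Fin N) :
    ContDiff ℝ ∞ (partialDeriv i f) := by
  have : ContDiff ℝ ∞ (fderiv ℝ f) := hf.fderiv_right (by norm_cast)
  exact this.clm_apply contDiff_const

theorem contDiff_D {f : Space N → ℝ} (hf : ContDiff ℝ ∞ f) (w : List (Fin N)) :
    ContDiff ℝ ∞ (D w f) := by
  induction w with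
  | nil => exact hf
  | cons i w ih => exact contDiff_partialDeriv ih i

theorem _root_.ContDiff.differentiableAt_space {f : Space N → ℝ} (hf : ContDiff ℝ ∞ f)
    (x : Space N) : DifferentiableAt ℝ f x :=
  (hf.differentiable (by simp)) x

theorem hasCompactSupport_partialDeriv {f : Space N → ℝ} (hf : HasCompactSupport f) (i : Fin N) :
    HasCompactSupport (partialDeriv i f) := hf.fderiv_apply ℝ _

theorem IsTest.partialDeriv {ψ : Space N → ℝ} (h : IsTest ψ) (i : Fin N) :
    IsTest (partialDeriv i ψ) :=
  ⟨contDiff_partialDeriv h.1 i, hasCompactSupport_partialDeriv h.2 i⟩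

theorem IsTest.D {ψ : Space N → ℝ} (h : IsTest ψ) (w : List (Fin N)) : IsTest (D w ψ) := by
  induction w with
  | nil => exact h
  | cons i w ih => exact ih.partialDeriv i

theorem IsTest.continuous {ψ : Space N → ℝ} (h : IsTest ψ) : Continuous ψ := h.1.continuous

theorem IsTest.memLp {ψ : Space N → ℝ} (h : IsTest ψ) (p : ℝ≥0∞) : MemLp ψ p volume :=
  h.1.continuous.memLp_of_hasCompactSupport h.2

theorem IsTest.integrable {ψ : Space N → ℝ} (h : IsTest ψ) : Integrable ψ volume :=
  h.1.continuous.integrable_of_hasCompactSupport h.2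

theorem IsTest.mul_smooth {ψ f : Space N → ℝ} (h : IsTest ψ) (hf : ContDiff ℝ ∞ f) :
    IsTest (fun x => f x * ψ x) :=
  ⟨hf.mul h.1, h.2.mul_left⟩

theorem IsTest.add {ψ φ : Space N → ℝ} (h : IsTest ψ) (h' : IsTest φ) : IsTest (ψ + φ) :=
  ⟨h.1.add h'.1, h.2.add h'.2⟩

theorem IsTest.smul {ψ : Space N → ℝ} (h : IsTest ψ) (c : ℝ) : IsTest (c • ψ) :=
  ⟨contDiff_const.smul h.1, h.2.smul_left (f := fun _ => c)⟩

theorem isTest_zero : IsTest (0 : Space N → ℝ) := ⟨contDiff_const, HasCompactSupport.zero⟩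

theorem _root_.MeasureTheory.LocallyIntegrable.integrable_mul_test {f ψ : Space N → ℝ}
    (hf : LocallyIntegrable f volume) (h : IsTest ψ) : Integrable (fun x => f x * ψ x) volume := by
  simpa [mul_comm] using hf.integrable_smul_left_of_hasCompactSupport h.1.continuous h.2

theorem partialDeriv_add {f g : Space N → ℝ} (hf : ContDiff ℝ ∞ f) (hg : ContDiff ℝ ∞ g)
    (i : Fin N) : partialDeriv i (f + g) = partialDeriv i f + partialDeriv i g := by
  funext x
  simp [partialDeriv, fderiv_add (hf.differentiableAt_space x) (hg.differentiableAt_space x)]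

theorem partialDeriv_const_smul {f : Space N → ℝ} (hf : ContDiff ℝ ∞ f) (c : ℝ)
    (i : Fin N) : partialDeriv i (c • f) = c • partialDeriv i f := by
  funext x
  simp [partialDeriv, fderiv_const_smul (hf.differentiableAt_space x)]

theorem partialDeriv_mul {f g : Space N → ℝ} (hf : ContDiff ℝ ∞ f) (hg : ContDiff ℝ ∞ g)
    (i : Fin N) : partialDeriv i (fun x => f x * g x) =
      (fun x => partialDeriv i f x * g x) + fun x => f x * partialDeriv i g x := by
  funext x
  have := fderiv_mul (hf.differentiableAt_space x) (hg.differentiableAt_space x)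
  simp only [partialDeriv, Pi.add_apply]
  change (fderiv ℝ (f * g) x) _ = _
  rw [this]
  simp
  ring

theorem D_add {f g : Space N → ℝ} (hf : ContDiff ℝ ∞ f) (hg : ContDiff ℝ ∞ g)
    (w : List (Fin N)) : D w (f + g) = D w f + D w g := by
  induction w with
  | nil => rfl
  | cons i w ih => rw [D_cons, ih, partialDeriv_add (contDiff_D hf w) (contDiff_D hg w)]; rfl

theorem D_const_smul {f : Space N → ℝ} (hf : ContDiff ℝ ∞ f) (c : ℝ) (w : List (Fin N)) :
    D w (c • f) = c • D w f := by
  induction w with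
  | nil => rfl
  | cons i w ih => rw [D_cons, ih, partialDeriv_const_smul (contDiff_D hf w)]; rfl

theorem partialDeriv_comm {f : Space N → ℝ} (hf : ContDiff ℝ ∞ f) (i j : Fin N) :
    partialDeriv i (partialDeriv j f) = partialDeriv j (partialDeriv i f) := by
  funext x
  have hd : DifferentiableAt ℝ (fderiv ℝ f) x :=
    ((hf.fderiv_right (m := ∞) (by norm_cast)).differentiable (by simp)) x
  have key : ∀ a b : Fin N, partialDeriv a (partialDeriv b f) x =
      fderiv ℝ (fderiv ℝ f) x (EuclideanSpace.single a 1) (EuclideanSpace.single b 1) := by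
    intro a b
    have h1 := (hd.hasFDerivAt.clm_apply
      (hasFDerivAt_const (EuclideanSpace.single b (1 : ℝ)) x)).fderiv
    change fderiv ℝ (fun y => fderiv ℝ f y (EuclideanSpace.single b 1)) x _ = _
    rw [h1]
    simp
  rw [key, key]
  have hs : IsSymmSndFDerivAt ℝ f x := by
    refine (hf.contDiffAt (x := x)).isSymmSndFDerivAt ?_
    simp only [minSmoothness_of_isRCLikeNormedField]
    exact WithTop.coe_le_coe.2 (le_top : (2 : ℕ∞) ≤ ⊤)
  exact hs _ _

/-- Partial derivatives commute, so only the multiset of letters matters. This links words, which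
suit induction, to the multi-indices of the Sobolev norms. -/
theorem D_perm {f : Space N → ℝ} (hf : ContDiff ℝ ∞ f) {w w' : List (Fin N)} (h : w.Perm w') :
    D w f = D w' f := by
  induction h with
  | nil => rfl
  | cons i _ ih => rw [D_cons, D_cons, ih]
  | swap i j l => exact partialDeriv_comm (contDiff_D hf l) _ _
  | trans _ _ ih1 ih2 => rw [ih1, ih2]

/-- The word listing the directions of the multi-index `α`. -/
def word (α : Fin N → ℕ) : List (Fin N) :=
  (List.finRange N).flatMap fun i => List.replicate (α i) i

theorem multiDeriv_eq_D (α : Fin N → ℕ) (ψ : Space N → ℝ) : multiDeriv α ψ = D (word α) ψ := by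
  have h1 : ∀ (n : ℕ) (i : Fin N) (g : Space N → ℝ),
      (partialDeriv i)^[n] g = D (List.replicate n i) g := by
    intro n i g
    induction n with
    | zero => rfl
    | succ n ih => rw [Function.iterate_succ_apply', ih]; rfl
  unfold multiDeriv word
  induction List.finRange N with
  | nil => rfl
  | cons i l ih =>
    rw [List.foldr_cons, ih, h1, List.flatMap_cons, D_append]

theorem count_word (α : Fin N → ℕ) (i : Fin N) : (word α).count i = α i := by
  unfold word
  rw [List.count_flatMap]
  have : (List.count i ∘ fun j => List.replicate (α j) j) = fun j => if j = i then α j else 0 := by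
    funext j
    simp [List.count_replicate]
  rw [this, ← List.ofFn_eq_map, List.sum_ofFn]
  simp

theorem length_word (α : Fin N → ℕ) : (word α).length = ∑ i, α i := by
  unfold word
  rw [List.length_flatMap]
  simp only [List.length_replicate]
  rw [← List.ofFn_eq_map, List.sum_ofFn]

theorem perm_word (w : List (Fin N)) : (word fun i => w.count i).Perm w := by
  rw [List.perm_iff_count]
  intro i
  rw [count_word]

theorem sum_count_eq_length (w : List (Fin N)) : ∑ i, w.count i = w.length := by
  rw [← (perm_word w).length_eq, length_word]

theorem integral_mul_partialDeriv {f ψ : Space N → ℝ} (hf : ContDiff ℝ ∞ f) (h : IsTest ψ)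
    (i : Fin N) : ∫ x, f x * partialDeriv i ψ x = -∫ x, partialDeriv i f x * ψ x := by
  have hl : ∀ {g : Space N → ℝ}, ContDiff ℝ ∞ g → LocallyIntegrable g volume :=
    fun hg => hg.continuous.locallyIntegrable
  exact integral_mul_fderiv_eq_neg_fderiv_mul_of_integrable
    ((hl (contDiff_partialDeriv hf i)).integrable_mul_test h)
    ((hl hf).integrable_mul_test (h.partialDeriv i)) ((hl hf).integrable_mul_test h)
    (fun x _ => hf.differentiableAt_space x) (fun x _ => h.1.differentiableAt_space x)

theorem integral_mul_D {f ψ : Space N → ℝ} (hf : ContDiff ℝ ∞ f) (h : IsTest ψ)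
    (w : List (Fin N)) : ∫ x, f x * D w ψ x = (-1) ^ w.length * ∫ x, D w f x * ψ x := by
  induction w generalizing ψ with
  | nil => simp
  | cons i w ih =>
    have hp : D (i :: w) ψ = D w (partialDeriv i ψ) := by
      rw [D_perm h.1 (List.perm_append_singleton i w).symm, D_append]; rfl
    rw [hp, ih (h.partialDeriv i), integral_mul_partialDeriv (contDiff_D hf w) h]
    simp [pow_succ]

/-! ### The `L²` norm as a real number -/

/-- The `L²` norm, as a real number. -/
def nrm (f : Space N → ℝ) : ℝ := (eLpNorm f 2 volume).toReal

theorem nrm_nonneg (f : Space N → ℝ) : 0 ≤ nrm f := ENNReal.toReal_nonneg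

theorem nrm_congr {f g : Space N → ℝ} (h : f =ᵐ[volume] g) : nrm f = nrm g := by
  rw [nrm, nrm, eLpNorm_congr_ae h]

theorem norm_toLp_eq_nrm {f : Space N → ℝ} (hf : MemLp f 2 volume) : ‖hf.toLp f‖ = nrm f :=
  Lp.norm_toLp f hf

theorem nrm_coe (f : Lp ℝ 2 (volume : Measure (Space N))) : nrm (f : Space N → ℝ) = ‖f‖ :=
  (Lp.norm_def f).symm

theorem inner_toLp {f g : Space N → ℝ} (hf : MemLp f 2 volume) (hg : MemLp g 2 volume) :
    inner ℝ (hf.toLp f) (hg.toLp g) = ∫ x, f x * g x := by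
  rw [L2.inner_def]
  refine integral_congr_ae ?_
  filter_upwards [hf.coeFn_toLp, hg.coeFn_toLp] with x h1 h2
  rw [h1, h2]
  simp [mul_comm]

theorem abs_integral_mul_le {f g : Space N → ℝ} (hf : MemLp f 2 volume) (hg : MemLp g 2 volume) :
    |∫ x, f x * g x| ≤ nrm f * nrm g := by
  rw [← inner_toLp hf hg, ← norm_toLp_eq_nrm hf, ← norm_toLp_eq_nrm hg]
  exact abs_real_inner_le_norm _ _

theorem integral_sq_eq {f : Space N → ℝ} (hf : MemLp f 2 volume) : ∫ x, f x ^ 2 = nrm f ^ 2 := by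
  rw [← norm_toLp_eq_nrm hf, ← real_inner_self_eq_norm_sq, inner_toLp hf hf]
  simp [sq]

theorem nrm_add_le {f g : Space N → ℝ} (hf : MemLp f 2 volume) (hg : MemLp g 2 volume) :
    nrm (f + g) ≤ nrm f + nrm g := by
  rw [← norm_toLp_eq_nrm hf, ← norm_toLp_eq_nrm hg, ← norm_toLp_eq_nrm (hf.add hg),
    MemLp.toLp_add hf hg]
  exact norm_add_le _ _

theorem nrm_smul (c : ℝ) (f : Space N → ℝ) : nrm (c • f) = |c| * nrm f := by
  simp [nrm, eLpNorm_const_smul, ENNReal.toReal_mul]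

theorem nrm_mono {f g : Space N → ℝ} (hg : MemLp g 2 volume) (h : ∀ᵐ x, |f x| ≤ |g x|) :
    nrm f ≤ nrm g :=
  ENNReal.toReal_mono hg.eLpNorm_ne_top (eLpNorm_mono_ae h)

theorem _root_.MeasureTheory.MemLp.locallyIntegrable_two {f : Space N → ℝ}
    (hf : MemLp f 2 volume) : LocallyIntegrable f volume :=
  hf.locallyIntegrable (by norm_num)

theorem _root_.MeasureTheory.MemLp.mul_bdd {f g : Space N → ℝ} (hf : MemLp f 2 volume)
    (hg : AEStronglyMeasurable g volume) {A : ℝ} (hA : ∀ᵐ x, |g x| ≤ A) :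
    MemLp (fun x => g x * f x) 2 volume :=
  MemLp.of_le_mul (c := A) hf (hg.mul hf.1) (by
    filter_upwards [hA] with x hx
    simp only [norm_mul, Real.norm_eq_abs]
    gcongr)

theorem nrm_mul_le {f g : Space N → ℝ} (hf : MemLp f 2 volume) {A : ℝ} (hA0 : 0 ≤ A)
    (hA : ∀ᵐ x, |g x| ≤ A) : nrm (fun x => g x * f x) ≤ A * nrm f := by
  rw [← abs_of_nonneg hA0, ← nrm_smul]
  refine nrm_mono (hf.const_smul A) ?_
  filter_upwards [hA] with x hx
  simp only [abs_mul, Pi.smul_apply, smul_eq_mul, abs_of_nonneg hA0]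
  gcongr

end SineGordonRegime

end


noncomputable section

namespace SineGordonRegime

variable {N : ℕ}

/-! ### Riesz representation on test functions -/

/-- The classes of test functions in `L²`. -/
def testSubmodule (N : ℕ) : Submodule ℝ (Lp ℝ 2 (volume : Measure (Space N))) where
  carrier := {F | ∃ ψ : Space N → ℝ, IsTest ψ ∧ F =ᵐ[volume] ψ}
  add_mem' := by
    rintro F G ⟨ψ, hψ, h1⟩ ⟨φ, hφ, h2⟩
    exact ⟨ψ + φ, hψ.add hφ, (Lp.coeFn_add F G).trans (h1.add h2)⟩
  zero_mem' := ⟨0, isTest_zero, Lp.coeFn_zero _ _ _⟩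
  smul_mem' := by
    rintro c F ⟨ψ, hψ, h1⟩
    exact ⟨c • ψ, hψ.smul c, (Lp.coeFn_smul c F).trans (h1.const_smul c)⟩

/-- Hahn-Banach extends the functional from the classes of test functions to L² with the same norm,
and the Riesz theorem represents the extension. With ℓ ψ = ∫ f ∂^w ψ this turns a dual bound into an
actual L² derivative, up to sign. -/
theorem exists_rep_of_bound (ℓ : (Space N → ℝ) → ℝ)
    (hadd : ∀ ψ φ, IsTest ψ → IsTest φ → ℓ (ψ + φ) = ℓ ψ + ℓ φ)
    (hsmul : ∀ (c : ℝ) ψ, IsTest ψ → ℓ (c • ψ) = c * ℓ ψ) {M : ℝ} (hM : 0 ≤ M)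
    (hb : ∀ ψ, IsTest ψ → |ℓ ψ| ≤ M * nrm ψ) :
    ∃ g : Space N → ℝ, MemLp g 2 volume ∧ nrm g ≤ M ∧
      ∀ ψ, IsTest ψ → ℓ ψ = ∫ x, g x * ψ x := by
  -- Test functions are continuous, so almost everywhere equality is equality. Hence ℓ descends to
  -- L² classes and does not depend on the choice of representatives made next.
  have hwd : ∀ ψ φ, IsTest ψ → IsTest φ → ψ =ᵐ[volume] φ → ℓ ψ = ℓ φ := by
    intro ψ φ hψ hφ he
    rw [Continuous.ae_eq_iff_eq volume hψ.continuous hφ.continuous] at he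
    rw [he]
  choose! c hc using fun (F : Lp ℝ 2 (volume : Measure (Space N))) (hF : F ∈ testSubmodule N) => hF
  let L : testSubmodule N →ₗ[ℝ] ℝ :=
    { toFun := fun F => ℓ (c F)
      map_add' := fun F G => by
        rw [← hadd _ _ (hc F F.2).1 (hc G G.2).1]
        refine hwd _ _ (hc _ (F + G).2).1 ((hc F F.2).1.add (hc G G.2).1) ?_
        exact (hc _ (F + G).2).2.symm.trans
          ((Lp.coeFn_add _ _).trans ((hc F F.2).2.add (hc G G.2).2))
      map_smul' := fun a F => by
        rw [RingHom.id_apply, smul_eq_mul, ← hsmul _ _ (hc F F.2).1]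
        refine hwd _ _ (hc _ (a • F).2).1 ((hc F F.2).1.smul a) ?_
        exact (hc _ (a • F).2).2.symm.trans
          ((Lp.coeFn_smul _ _).trans ((hc F F.2).2.const_smul a)) }
  have hL : ∀ F : testSubmodule N, ‖L F‖ ≤ M * ‖F‖ := by
    intro F
    have h1 := hb _ (hc F F.2).1
    rw [← nrm_congr (hc F F.2).2, nrm_coe] at h1
    exact h1
  obtain ⟨E, hE1, hE2⟩ := exists_extension_norm_eq _ (L.mkContinuous M hL)
  set G := (InnerProductSpace.toDual ℝ (Lp ℝ 2 (volume : Measure (Space N)))).symm E with hG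
  refine ⟨G, Lp.memLp G, ?_, ?_⟩
  · rw [nrm_coe, hG, LinearIsometryEquiv.norm_map, hE2]
    exact L.mkContinuous_norm_le hM hL
  · intro ψ hψ
    have hm := hψ.memLp 2
    have hmem : hm.toLp ψ ∈ testSubmodule N := ⟨ψ, hψ, hm.coeFn_toLp⟩
    have h1 := hE1 ⟨_, hmem⟩
    have h2 : E (hm.toLp ψ) = inner ℝ G (hm.toLp ψ) := by
      rw [hG, InnerProductSpace.toDual_symm_apply]
    have h3 : L ⟨_, hmem⟩ = ℓ ψ :=
      hwd _ _ (hc _ hmem).1 hψ ((hc _ hmem).2.symm.trans hm.coeFn_toLp)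
    have h4 := inner_toLp (Lp.memLp G) hm
    rw [Lp.toLp_coeFn] at h4
    rw [← h3, ← h4, ← h2]
    exact h1.symm

/-! ### Bounds on distributional derivatives by duality -/

/-- The distributional derivative of `f` along `w` is in `L²` with norm at most `M`. -/
def DB (w : List (Fin N)) (M : ℝ) (f : Space N → ℝ) : Prop :=
  ∀ ψ : Space N → ℝ, IsTest ψ → |∫ x, f x * D w ψ x| ≤ M * nrm ψ

theorem DB.exists_rep {w : List (Fin N)} {M : ℝ} {f : Space N → ℝ} (h : DB w M f) (hM : 0 ≤ M)
    (hf : LocallyIntegrable f volume) :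
    ∃ g : Space N → ℝ, MemLp g 2 volume ∧ nrm g ≤ M ∧
      ∀ ψ, IsTest ψ → ∫ x, f x * D w ψ x = ∫ x, g x * ψ x := by
  refine exists_rep_of_bound (fun ψ => ∫ x, f x * D w ψ x) ?_ ?_ hM h
  · intro ψ φ hψ hφ
    rw [D_add hψ.1 hφ.1, ← integral_add (hf.integrable_mul_test (hψ.D w))
      (hf.integrable_mul_test (hφ.D w))]
    simp [mul_add]
  · intro c ψ hψ
    rw [D_const_smul hψ.1, ← integral_const_mul]
    congr 1
    funext x
    simp
    ring

theorem DB.mono {w : List (Fin N)} {M M' : ℝ} {f : Space N → ℝ} (h : DB w M f) (hM : M ≤ M') :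
    DB w M' f := fun ψ hψ => (h ψ hψ).trans (by gcongr; exact nrm_nonneg ψ)

theorem DB.perm {w w' : List (Fin N)} {M : ℝ} {f : Space N → ℝ} (h : DB w M f)
    (hw : w.Perm w') : DB w' M f := fun ψ hψ => by rw [← D_perm hψ.1 hw]; exact h ψ hψ

theorem DB.add {w : List (Fin N)} {M M' : ℝ} {f g : Space N → ℝ} (hf : DB w M f) (hg : DB w M' g)
    (hfl : LocallyIntegrable f volume) (hgl : LocallyIntegrable g volume) :
    DB w (M + M') (f + g) := by
  intro ψ hψ
  have : ∫ x, (f + g) x * D w ψ x = (∫ x, f x * D w ψ x) + ∫ x, g x * D w ψ x := by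
    rw [← integral_add (hfl.integrable_mul_test (hψ.D w)) (hgl.integrable_mul_test (hψ.D w))]
    simp [add_mul]
  rw [this, add_mul]
  exact (abs_add_le _ _).trans (add_le_add (hf ψ hψ) (hg ψ hψ))

theorem DB.smul {w : List (Fin N)} {M : ℝ} {f : Space N → ℝ} (hf : DB w M f) (c : ℝ) :
    DB w (|c| * M) (c • f) := by
  intro ψ hψ
  have : ∫ x, (c • f) x * D w ψ x = c * ∫ x, f x * D w ψ x := by
    rw [← integral_const_mul]
    simp [mul_assoc]
  rw [this, abs_mul, mul_assoc]
  exact mul_le_mul_of_nonneg_left (hf ψ hψ) (abs_nonneg c)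

theorem DB_nil_of_memLp {f : Space N → ℝ} (hf : MemLp f 2 volume) : DB [] (nrm f) f :=
  fun _ hψ => abs_integral_mul_le hf (hψ.memLp 2)

/-- The Riesz representative and f have the same integrals against all test functions, hence agree
almost everywhere. -/
theorem DB.memLp_of_nil {M : ℝ} {f : Space N → ℝ} (h : DB [] M f) (hM : 0 ≤ M)
    (hf : LocallyIntegrable f volume) : MemLp f 2 volume ∧ nrm f ≤ M := by
  obtain ⟨g, hg, hgM, hfg⟩ := h.exists_rep hM hf
  have : f =ᵐ[volume] g :=
    ae_eq_of_integral_contDiff_smul_eq hf hg.locallyIntegrable_two fun ψ h1 h2 => by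
      simpa [mul_comm] using hfg ψ ⟨h1, h2⟩
  exact ⟨(memLp_congr_ae this).2 hg, (nrm_congr this).trans_le hgM⟩

theorem weakDerivENorm_le_of_DB {α : Fin N → ℕ} {w : List (Fin N)} (hw : (word α).Perm w) {M : ℝ}
    (hM : 0 ≤ M) {f : Space N → ℝ} (hf : LocallyIntegrable f volume) (h : DB w M f) :
    weakDerivENorm α f ≤ ENNReal.ofReal M := by
  obtain ⟨g, hg, hgM, hfg⟩ := (h.perm hw.symm).exists_rep hM hf
  -- A weak derivative carries the sign (−1)^|α| from integration by parts, whereas the Riesz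
  -- representative of the pairing does not.
  refine (iInf₂_le ((-1 : ℝ) ^ (∑ i, α i) • g) ?_).trans ?_
  · refine ⟨hf, (hg.const_smul _).locallyIntegrable_two, fun ψ hψ => ?_⟩
    rw [multiDeriv_eq_D, hfg ψ hψ]
    simp only [Pi.smul_apply, smul_eq_mul, mul_assoc]
    rw [integral_const_mul, ← mul_assoc, ← mul_pow]
    simp
  · have h1 : eLpNorm ((-1 : ℝ) ^ (∑ i, α i) • g) 2 volume = eLpNorm g 2 volume := by
      rw [eLpNorm_const_smul]; simp
    rw [h1]
    rw [← ENNReal.ofReal_toReal hg.eLpNorm_ne_top]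
    exact ENNReal.ofReal_le_ofReal hgM

theorem exists_isWeakDeriv_of_lt_top {α : Fin N → ℕ} {f : Space N → ℝ}
    (h : weakDerivENorm α f < ⊤) : ∃ g, IsWeakDeriv α f g ∧ MemLp g 2 volume := by
  simp only [weakDerivENorm, iInf_lt_iff] at h
  obtain ⟨g, hg, h1⟩ := h
  exact ⟨g, hg, hg.2.1.aestronglyMeasurable, h1⟩

theorem IsWeakDeriv.ae_eq {α : Fin N → ℕ} {f g g' : Space N → ℝ} (h : IsWeakDeriv α f g)
    (h' : IsWeakDeriv α f g') : g =ᵐ[volume] g' := by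
  refine ae_eq_of_integral_contDiff_smul_eq h.2.1 h'.2.1 fun ψ h1 h2 => ?_
  have e1 := h.2.2 ψ ⟨h1, h2⟩
  rw [h'.2.2 ψ ⟨h1, h2⟩] at e1
  have := mul_left_cancel₀ (pow_ne_zero _ (by norm_num)) e1
  simpa [mul_comm] using this.symm

theorem IsWeakDeriv.weakDerivENorm_eq {α : Fin N → ℕ} {f g : Space N → ℝ}
    (h : IsWeakDeriv α f g) : weakDerivENorm α f = eLpNorm g 2 volume := by
  refine le_antisymm (iInf₂_le g h) (le_iInf₂ fun g' hg' => ?_)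
  rw [eLpNorm_congr_ae (h.ae_eq hg')]

theorem DB_of_weakDerivENorm_le {α : Fin N → ℕ} {w : List (Fin N)} (hw : (word α).Perm w) {M : ℝ}
    (hM : 0 ≤ M) {f : Space N → ℝ} (h : weakDerivENorm α f ≤ ENNReal.ofReal M) :
    LocallyIntegrable f volume ∧ DB w M f := by
  obtain ⟨g, hg, hg2⟩ := exists_isWeakDeriv_of_lt_top (h.trans_lt ENNReal.ofReal_lt_top)
  refine ⟨hg.1, DB.perm (fun ψ hψ => ?_) hw⟩
  rw [← multiDeriv_eq_D, hg.2.2 ψ hψ, abs_mul, abs_pow, abs_neg, abs_one, one_pow, one_mul]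
  refine (abs_integral_mul_le hg2 (hψ.memLp 2)).trans ?_
  refine mul_le_mul_of_nonneg_right ?_ (nrm_nonneg ψ)
  rw [hg.weakDerivENorm_eq] at h
  exact ENNReal.toReal_le_of_le_ofReal hM h

/-- All distributional derivatives of `f` of orders between `a` and `b` are in `L²`, with norm at
most `M`. -/
def Reg (a b : ℕ) (M : ℝ) (f : Space N → ℝ) : Prop :=
  LocallyIntegrable f volume ∧ ∀ w : List (Fin N), a ≤ w.length → w.length ≤ b → DB w M f

theorem Reg.mono {a b a' b' : ℕ} {M M' : ℝ} {f : Space N → ℝ} (h : Reg a b M f) (ha : a ≤ a')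
    (hb : b' ≤ b) (hM : M ≤ M') : Reg a' b' M' f :=
  ⟨h.1, fun w h1 h2 => (h.2 w (ha.trans h1) (h2.trans hb)).mono hM⟩

theorem Reg.add {a b : ℕ} {M M' : ℝ} {f g : Space N → ℝ} (hf : Reg a b M f) (hg : Reg a b M' g) :
    Reg a b (M + M') (f + g) :=
  ⟨hf.1.add hg.1, fun w h1 h2 => (hf.2 w h1 h2).add (hg.2 w h1 h2) hf.1 hg.1⟩

theorem Reg.smul {a b : ℕ} {M : ℝ} {f : Space N → ℝ} (hf : Reg a b M f) (c : ℝ) :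
    Reg a b (|c| * M) (c • f) :=
  ⟨hf.1.smul c, fun w h1 h2 => (hf.2 w h1 h2).smul c⟩

theorem Reg.memLp {b : ℕ} {M : ℝ} {f : Space N → ℝ} (hf : Reg 0 b M f) (hM : 0 ≤ M) :
    MemLp f 2 volume ∧ nrm f ≤ M :=
  (hf.2 [] (by simp) (by simp)).memLp_of_nil hM hf.1

/-! ### Comparison of the dual bounds with the Sobolev norms -/

theorem mem_multiIndices {k : ℕ} {α : Fin N → ℕ} : α ∈ multiIndices N k ↔ ∑ i, α i ≤ k := by
  simp only [multiIndices, Finset.mem_filter, Finset.mem_Iic, and_iff_right_iff_imp]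
  intro h i
  exact (Finset.single_le_sum (fun _ _ => Nat.zero_le _) (Finset.mem_univ i)).trans h

/-- The crude inequality card · M² ≤ (card · M)² suffices: only a combinatorial constant is lost in
passing from a maximum of norms to a Sobolev norm. -/
theorem sum_sq_rpow_le {ι : Type*} (s : Finset ι) (f : ι → ℝ≥0∞) {M : ℝ}
    (h : ∀ i ∈ s, f i ≤ ENNReal.ofReal M) :
    (∑ i ∈ s, f i ^ 2) ^ (1 / 2 : ℝ) ≤ ENNReal.ofReal (s.card * M) := by
  have h1 : ∑ i ∈ s, f i ^ 2 ≤ ENNReal.ofReal (s.card * M) ^ 2 := by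
    calc ∑ i ∈ s, f i ^ 2 ≤ ∑ _i ∈ s, ENNReal.ofReal M ^ 2 :=
          Finset.sum_le_sum fun i hi => by gcongr; exact h i hi
      _ = s.card * ENNReal.ofReal M ^ 2 := by simp
      _ ≤ ENNReal.ofReal (s.card * M) ^ 2 := by
          rw [ENNReal.ofReal_mul (by positivity), mul_pow]
          gcongr
          rw [ENNReal.ofReal_natCast]
          exact_mod_cast Nat.le_self_pow (by norm_num) s.card
  calc (∑ i ∈ s, f i ^ 2) ^ (1 / 2 : ℝ) ≤ (ENNReal.ofReal (s.card * M) ^ 2) ^ (1 / 2 : ℝ) := by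
        gcongr
    _ = ENNReal.ofReal (s.card * M) := by
        rw [← ENNReal.rpow_natCast, ← ENNReal.rpow_mul]; norm_num

theorem le_sum_sq_rpow {ι : Type*} (s : Finset ι) (f : ι → ℝ≥0∞) {i : ι} (hi : i ∈ s) :
    f i ≤ (∑ i ∈ s, f i ^ 2) ^ (1 / 2 : ℝ) := by
  calc f i = (f i ^ 2) ^ (1 / 2 : ℝ) := by
        rw [← ENNReal.rpow_natCast, ← ENNReal.rpow_mul]; norm_num
    _ ≤ _ := by gcongr; exact Finset.single_le_sum (f := fun i => f i ^ 2) (by simp) hi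

theorem Reg.sobNorm_le {k : ℕ} {M : ℝ} {f : Space N → ℝ} (h : Reg 0 k M f) (hM : 0 ≤ M) :
    sobNorm k f ≤ ENNReal.ofReal ((multiIndices N k).card * M) :=
  sum_sq_rpow_le _ _ fun α hα =>
    weakDerivENorm_le_of_DB (List.Perm.refl _) hM h.1
      (h.2 _ (by simp) (by rw [length_word]; exact mem_multiIndices.1 hα))

theorem reg_of_sobNorm_le {k : ℕ} {M : ℝ} (hM : 0 ≤ M) {f : Space N → ℝ}
    (h : sobNorm k f ≤ ENNReal.ofReal M) : Reg 0 k M f := by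
  have key : ∀ w : List (Fin N), w.length ≤ k → LocallyIntegrable f volume ∧ DB w M f := by
    intro w hw
    refine DB_of_weakDerivENorm_le (perm_word w) hM ((le_sum_sq_rpow (multiIndices N k)
      (fun α => weakDerivENorm α f) ?_).trans h)
    rw [mem_multiIndices, sum_count_eq_length]
    exact hw
  exact ⟨(key [] (by simp)).1, fun w _ h2 => (key w h2).2⟩

theorem gradSobNorm_eq (k : ℕ) (f : Space N → ℝ) : gradSobNorm k f =
    (∑ p ∈ (Finset.univ : Finset (Fin N)) ×ˢ multiIndices N k,
      weakDerivENorm (p.2 + Pi.single p.1 1) f ^ 2) ^ (1 / 2 : ℝ) := by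
  rw [gradSobNorm, Finset.sum_product]

theorem Reg.gradSobNorm_le {k : ℕ} {M : ℝ} {f : Space N → ℝ} (h : Reg 1 (k + 1) M f)
    (hM : 0 ≤ M) :
    gradSobNorm k f ≤ ENNReal.ofReal ((N * (multiIndices N k).card : ℕ) * M) := by
  rw [gradSobNorm_eq]
  refine (sum_sq_rpow_le (M := M) _ (fun p : Fin N × (Fin N → ℕ) =>
    weakDerivENorm (p.2 + Pi.single p.1 1) f) ?_).trans_eq (by simp)
  rintro ⟨i, α⟩ hp
  have hα : ∑ i, α i ≤ k := by simpa [mem_multiIndices] using hp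
  have hs : ∑ j, (α + Pi.single i 1 : Fin N → ℕ) j = ∑ j, α j + 1 := by
    simp [Finset.sum_add_distrib]
  exact weakDerivENorm_le_of_DB (List.Perm.refl _) hM h.1
      (h.2 _ (by rw [length_word, hs]; omega) (by rw [length_word, hs]; omega))

theorem reg_of_gradSobNorm_le {k : ℕ} {M : ℝ} (hM : 0 ≤ M) {f : Space N → ℝ}
    (hf : LocallyIntegrable f volume)
    (h : gradSobNorm k f ≤ ENNReal.ofReal M) : Reg 1 (k + 1) M f := by
  refine ⟨hf, fun w h1 h2 => ?_⟩
  obtain ⟨i, v, rfl⟩ : ∃ i v, w = i :: v := by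
    cases w with
    | nil => simp at h1
    | cons i v => exact ⟨i, v, rfl⟩
  rw [gradSobNorm_eq] at h
  have hlen : v.length ≤ k := by simpa using h2
  have hp : (word ((fun j => v.count j) + Pi.single i 1)).Perm (i :: v) := by
    rw [List.perm_iff_count]
    intro j
    rw [count_word, List.count_cons]
    rcases eq_or_ne j i with rfl | hj
    · simp
    · simp [hj, hj.symm]
  have hmem : ((i, fun j => v.count j) : Fin N × (Fin N → ℕ)) ∈
      (Finset.univ : Finset (Fin N)) ×ˢ multiIndices N k := by
    rw [Finset.mem_product, mem_multiIndices, sum_count_eq_length]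
    exact ⟨Finset.mem_univ _, hlen⟩
  have hle := le_sum_sq_rpow _
    (fun p : Fin N × (Fin N → ℕ) => weakDerivENorm (p.2 + Pi.single p.1 1) f) hmem
  exact (DB_of_weakDerivENorm_le hp hM (hle.trans h)).2

/-! ### The weak gradient -/

theorem multiDeriv_single (i : Fin N) (ψ : Space N → ℝ) (hψ : ContDiff ℝ ∞ ψ) :
    multiDeriv (Pi.single i 1) ψ = partialDeriv i ψ := by
  rw [multiDeriv_eq_D]
  have : (word (Pi.single i 1)).Perm [i] := by
    rw [List.perm_iff_count]
    intro j
    rw [count_word]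
    rcases eq_or_ne j i with rfl | hj
    · simp
    · simp [hj, hj.symm]
  rw [D_perm hψ this]
  rfl

theorem isWeakDeriv_weakPartial {f : Space N → ℝ} {i : Fin N} {g : Space N → ℝ}
    (hf : LocallyIntegrable f volume) (hg : LocallyIntegrable g volume)
    (h : ∀ ψ, IsTest ψ → ∫ x, f x * partialDeriv i ψ x = -∫ x, g x * ψ x) :
    weakPartial i f =ᵐ[volume] g := by
  have hw : IsWeakDeriv (Pi.single i 1) f g := by
    refine ⟨hf, hg, fun ψ hψ => ?_⟩
    rw [multiDeriv_single i ψ hψ.1, h ψ hψ]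
    simp
  have hex : ∃ g, IsWeakDeriv (Pi.single i 1) f g := ⟨g, hw⟩
  rw [weakPartial, dif_pos hex]
  exact hex.choose_spec.ae_eq hw

/-- `weakPartial` is an arbitrary choice among weak derivatives. These agree almost everywhere, so
the chosen one inherits the properties of the Riesz representative. -/
theorem Reg.weakPartial_spec {b : ℕ} {M : ℝ} {f : Space N → ℝ} (h : Reg 1 (b + 1) M f)
    (hM : 0 ≤ M) (i : Fin N) : MemLp (weakPartial i f) 2 volume ∧
      ∀ ψ, IsTest ψ → ∫ x, f x * partialDeriv i ψ x = -∫ x, weakPartial i f x * ψ x := by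
  obtain ⟨g, hg, -, hfg⟩ := (h.2 [i] (by simp) (by simp)).exists_rep hM h.1
  have he := isWeakDeriv_weakPartial (f := f) (i := i) (g := -g) h.1 hg.neg.locallyIntegrable_two
    (fun ψ hψ => by
      have := hfg ψ hψ
      simp only [D_cons, D_nil] at this
      simp [this, integral_neg])
  refine ⟨(memLp_congr_ae he).2 hg.neg, fun ψ hψ => ?_⟩
  have h1 : ∫ x, weakPartial i f x * ψ x = ∫ x, (-g) x * ψ x :=
    integral_congr_ae (he.mul (ae_eq_refl ψ))
  have := hfg ψ hψ
  simp only [D_cons, D_nil] at this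
  rw [h1, this]
  simp [integral_neg]

theorem Reg.weakPartial {b : ℕ} {M : ℝ} {f : Space N → ℝ} (h : Reg 1 (b + 1) M f)
    (hM : 0 ≤ M) (i : Fin N) : Reg 0 b M (weakPartial i f) := by
  obtain ⟨hm, hs⟩ := h.weakPartial_spec hM i
  refine ⟨hm.locallyIntegrable_two, fun w _ h2 ψ hψ => ?_⟩
  have := h.2 (i :: w) (by simp) (by simpa using h2) ψ hψ
  rwa [D_cons, hs _ (hψ.D w), abs_neg] at this

theorem reg_of_partials {b : ℕ} {M : ℝ} {f : Space N → ℝ} (hf : LocallyIntegrable f volume)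
    (g : Fin N → Space N → ℝ)
    (hg : ∀ i ψ, IsTest ψ → ∫ x, f x * partialDeriv i ψ x = -∫ x, g i x * ψ x)
    (h : ∀ i, Reg 0 b M (g i)) : Reg 1 (b + 1) M f := by
  refine ⟨hf, fun w h1 h2 ψ hψ => ?_⟩
  cases w with
  | nil => simp at h1
  | cons i v =>
    rw [D_cons, hg i _ (hψ.D v), abs_neg]
    exact (h i).2 v (by simp) (by simpa using h2) ψ hψ

theorem inner_gradient (ψ : Space N → ℝ) (a : Space N) (x : Space N) :
    inner ℝ a (gradient ψ x) = ∑ i, a i * partialDeriv i ψ x := by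
  rw [real_inner_comm, gradient, InnerProductSpace.toDual_symm_apply]
  have : a = ∑ i, a i • EuclideanSpace.single i (1 : ℝ) := by
    ext j
    simp [Pi.single_apply]
  conv_lhs => rw [this]
  simp [map_sum, partialDeriv]

end SineGordonRegime

end


noncomputable section

namespace SineGordonRegime

variable {N : ℕ}

/-! ### Convolution with test functions -/

/-- The convolution `k * f`. -/
def cv (k f : Space N → ℝ) : Space N → ℝ :=
  convolution k f (ContinuousLinearMap.lsmul ℝ ℝ) volume

theorem cv_apply (k f : Space N → ℝ) (x : Space N) : cv k f x = ∫ y, k (x - y) * f y := by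
  rw [cv, convolution_eq_swap]
  simp

theorem cv_apply' (k f : Space N → ℝ) (x : Space N) : cv k f x = ∫ y, k y * f (x - y) := by
  rw [cv, convolution_def]
  simp

theorem cv_comm (k f : Space N → ℝ) : cv k f = cv f k := by
  funext x
  rw [cv_apply, cv_apply']
  simp [mul_comm]

theorem contDiff_cv {k f : Space N → ℝ} (hk : IsTest k) (hf : LocallyIntegrable f volume) :
    ContDiff ℝ ∞ (cv k f) :=
  hk.2.contDiff_convolution_left _ hk.1 hf

theorem IsTest.cv {k f : Space N → ℝ} (hk : IsTest k) (hf : IsTest f) : IsTest (cv k f) :=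
  ⟨contDiff_cv hk hf.integrable.locallyIntegrable, hk.2.convolution _ hf.2⟩

theorem IsTest.comp_sub {k : Space N → ℝ} (hk : IsTest k) (x : Space N) :
    IsTest fun y => k (x - y) :=
  ⟨hk.1.comp (contDiff_const.sub contDiff_id),
    hk.2.comp_homeomorph (Homeomorph.subLeft x)⟩

theorem partialDeriv_cv {k f : Space N → ℝ} (hk : IsTest k) (hf : LocallyIntegrable f volume)
    (i : Fin N) : partialDeriv i (cv k f) = cv (partialDeriv i k) f := by
  funext x
  have h := hk.2.hasFDerivAt_convolution_left (ContinuousLinearMap.lsmul ℝ ℝ)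
    (hk.1.of_le (by norm_cast)) hf x
  rw [partialDeriv, cv, h.fderiv, cv_apply, convolution_eq_swap,
    ContinuousLinearMap.integral_apply]
  · simp [partialDeriv]
  · have hc : HasCompactSupport (fderiv ℝ k) := hk.2.fderiv ℝ
    have hcont : Continuous (fderiv ℝ k) := (hk.1.fderiv_right (m := ∞) (by norm_cast)).continuous
    have := hc.convolutionExists_left (μ := volume) (f := fderiv ℝ k) (g := f)
      ((ContinuousLinearMap.lsmul ℝ ℝ).precompL (Space N)) hcont hf x
    exact this.integrable_swap

theorem D_cv {k f : Space N → ℝ} (hk : IsTest k) (hf : LocallyIntegrable f volume)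
    (w : List (Fin N)) : D w (cv k f) = cv (D w k) f := by
  induction w with
  | nil => rfl
  | cons i w ih => rw [D_cons, ih, partialDeriv_cv (hk.D w) hf, D_cons]

theorem D_cv_test {k f : Space N → ℝ} (hk : IsTest k) (hf : IsTest f)
    (w : List (Fin N)) : D w (cv k f) = cv k (D w f) := by
  rw [cv_comm, D_cv hf hk.integrable.locallyIntegrable, cv_comm]

/-- Fubini's theorem. As f is only locally integrable, it is first cut off to the compact set B =
supp ψ − supp k, outside which k(x − y) ψ(x) vanishes. -/
theorem integral_cv_mul {k f ψ : Space N → ℝ} (hk : IsTest k) (hf : LocallyIntegrable f volume)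
    (hψ : IsTest ψ) :
    ∫ x, cv k f x * ψ x = ∫ y, f y * cv (fun z => k (-z)) ψ y := by
  set B : Set (Space N) := (fun p : Space N × Space N => p.1 - p.2) ''
    (tsupport ψ ×ˢ tsupport k) with hB
  have hBc : IsCompact B := (hψ.2.isCompact.prod hk.2.isCompact).image (by fun_prop)
  have hzero : ∀ x y, y ∉ B → k (x - y) * ψ x = 0 := by
    intro x y hy
    by_contra h
    have h1 := left_ne_zero_of_mul h
    have h2 := right_ne_zero_of_mul h
    exact hy ⟨(x, x - y), ⟨subset_tsupport _ h2, subset_tsupport _ h1⟩, by simp⟩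
  have hfB : Integrable (B.indicator f) volume :=
    (integrable_indicator_iff hBc.measurableSet).2 (hf.integrableOn_isCompact hBc)
  have hprod : Integrable (fun p : Space N × Space N => ψ p.1 * B.indicator f p.2)
      (volume.prod volume) := hψ.integrable.mul_prod hfB
  obtain ⟨C, hC⟩ := hk.2.exists_bound_of_continuous hk.continuous
  have hF : Integrable (fun p : Space N × Space N => k (p.1 - p.2) *
      (ψ p.1 * B.indicator f p.2)) (volume.prod volume) :=
    hprod.bdd_mul (c := C) (hk.continuous.comp (by fun_prop)).aestronglyMeasurable
      (.of_forall fun p => hC _)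
  have e1 : ∀ x y, k (x - y) * (ψ x * B.indicator f y) = k (x - y) * f y * ψ x := by
    intro x y
    by_cases hy : y ∈ B
    · simp [hy]; ring
    · have := hzero x y hy
      simp only [hy, not_false_eq_true, indicator_of_notMem, mul_zero]
      linear_combination (-f y) * this
  have := integral_integral_swap (f := fun x y => k (x - y) * (ψ x * B.indicator f y)) hF
  simp only [e1] at this
  calc ∫ x, cv k f x * ψ x = ∫ x, ∫ y, k (x - y) * f y * ψ x := by
        simp_rw [integral_mul_const, cv_apply]
    _ = ∫ y, ∫ x, k (x - y) * f y * ψ x := this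
    _ = _ := by
        congr 1
        funext y
        rw [cv_apply, ← integral_const_mul]
        congr 1
        funext x
        simp
        ring

theorem nrm_comp_sub (k : Space N → ℝ) (hk : AEStronglyMeasurable k volume) (x : Space N) :
    nrm (fun y => k (x - y)) = nrm k := by
  rw [nrm, nrm]
  congr 1
  exact eLpNorm_comp_measurePreserving hk (Measure.measurePreserving_sub_left volume x)

theorem abs_cv_le {k f : Space N → ℝ} (hk : IsTest k) (hf : MemLp f 2 volume) (x : Space N) :
    |cv k f x| ≤ nrm k * nrm f := by
  rw [cv_apply, ← nrm_comp_sub k hk.continuous.aestronglyMeasurable x]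
  exact abs_integral_mul_le ((hk.comp_sub x).memLp 2) hf

/-- Cauchy-Schwarz after splitting |k| = √|k| · √|k| and leaving one root on each side. -/
theorem cv_sq_le {k f : Space N → ℝ} (hk : IsTest k) (hf : MemLp f 2 volume) (x : Space N) :
    cv k f x ^ 2 ≤ (∫ y, |k y|) * cv (fun y => |k y|) (fun y => f y ^ 2) x := by
  have hkx := hk.comp_sub x
  set a : Space N → ℝ := fun y => √|k (x - y)| with ha
  have hac : Continuous a := by
    have := hkx.continuous
    exact Real.continuous_sqrt.comp this.abs
  have hacs : HasCompactSupport a := hkx.2.comp_left (g := fun t => √|t|) (by simp)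
  obtain ⟨C, hC⟩ := hacs.exists_bound_of_continuous hac
  have ha2 : MemLp a 2 volume := hac.memLp_of_hasCompactSupport hacs
  have hb2 : MemLp (fun y => a y * f y) 2 volume :=
    hf.mul_bdd hac.aestronglyMeasurable (.of_forall hC)
  have hle : |cv k f x| ≤ ∫ y, a y * (a y * |f y|) := by
    rw [cv_apply]
    refine (abs_integral_le_integral_abs).trans_eq ?_
    congr 1
    funext y
    rw [abs_mul, ← mul_assoc, ha]
    simp [Real.mul_self_sqrt]
  have habs : MemLp (fun y => a y * |f y|) 2 volume :=
    hf.abs.mul_bdd hac.aestronglyMeasurable (.of_forall hC)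
  have hCS := (le_abs_self _).trans (abs_integral_mul_le ha2 habs)
  have h1 : nrm a ^ 2 = ∫ y, |k y| := by
    rw [← integral_sq_eq ha2]
    simp only [ha, Real.sq_sqrt (abs_nonneg _)]
    exact integral_sub_left_eq_self (fun y => |k y|) volume x
  have h2 : nrm (fun y => a y * |f y|) ^ 2 = cv (fun y => |k y|) (fun y => f y ^ 2) x := by
    rw [← integral_sq_eq habs, cv_apply]
    congr 1
    funext y
    rw [mul_pow, ha, Real.sq_sqrt (abs_nonneg _), sq_abs]
  rw [← h1, ← h2, ← mul_pow, ← sq_abs]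
  exact pow_le_pow_left₀ (abs_nonneg _) (hle.trans hCS) 2

/-- Young's inequality for L¹ * L²: integrate the pointwise bound `cv_sq_le` and use ∫ |k| * f² =
‖k‖₁ ‖f‖₂². -/
theorem memLp_cv {k f : Space N → ℝ} (hk : IsTest k) (hf : MemLp f 2 volume) :
    MemLp (cv k f) 2 volume ∧ nrm (cv k f) ≤ (∫ y, |k y|) * nrm f := by
  have hka : Integrable (fun y => |k y|) volume := hk.integrable.abs
  have hf2 : Integrable (fun y => f y ^ 2) volume := hf.integrable_sq
  have hG : Integrable (cv (fun y => |k y|) (fun y => f y ^ 2)) volume :=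
    hka.integrable_convolution _ hf2
  have hGi : ∫ x, cv (fun y => |k y|) (fun y => f y ^ 2) x = (∫ y, |k y|) * nrm f ^ 2 := by
    have := integral_convolution (ContinuousLinearMap.lsmul ℝ ℝ) hka hf2
    rw [← integral_sq_eq hf]
    simpa [cv] using this
  have hc := (contDiff_cv hk hf.locallyIntegrable_two).continuous
  have hsq : Integrable (fun x => cv k f x ^ 2) volume := by
    refine (hG.const_mul (∫ y, |k y|)).mono' (hc.pow 2).aestronglyMeasurable
      (.of_forall fun x => ?_)
    rw [Real.norm_of_nonneg (sq_nonneg _)]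
    exact cv_sq_le hk hf x
  have hm : MemLp (cv k f) 2 volume :=
    (memLp_two_iff_integrable_sq hc.aestronglyMeasurable).2 hsq
  refine ⟨hm, ?_⟩
  have hK : 0 ≤ ∫ y, |k y| := integral_nonneg fun _ => abs_nonneg _
  refine le_of_sq_le_sq ?_ (mul_nonneg hK (nrm_nonneg f))
  rw [← integral_sq_eq hm, mul_pow, sq (∫ y, |k y|), mul_assoc, ← hGi, ← integral_const_mul]
  exact integral_mono hsq (hG.const_mul _) (fun x => cv_sq_le hk hf x)

/-! ### Mollification -/

/-- A sequence of bump functions shrinking to the origin. -/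
def bump (N n : ℕ) : ContDiffBump (0 : Space N) :=
  ⟨1 / (n + 1), 2 / (n + 1), by positivity, by gcongr; norm_num⟩

/-- A sequence of even mollifiers. -/
def ker (N n : ℕ) : Space N → ℝ := (bump N n).normed volume

theorem isTest_ker (N n : ℕ) : IsTest (ker N n) :=
  ⟨(bump N n).contDiff_normed, (bump N n).hasCompactSupport_normed⟩

theorem ker_neg (n : ℕ) (x : Space N) : ker N n (-x) = ker N n x := (bump N n).normed_neg x

theorem ker_nonneg (n : ℕ) (x : Space N) : 0 ≤ ker N n x := (bump N n).nonneg_normed x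

theorem integral_ker (N n : ℕ) : ∫ x, ker N n x = 1 := (bump N n).integral_normed

theorem integral_abs_ker (N n : ℕ) : ∫ x, |ker N n x| = 1 := by
  simp_rw [abs_of_nonneg (ker_nonneg n _), integral_ker]

/-- The mollification of `f`. -/
def mol (n : ℕ) (f : Space N → ℝ) : Space N → ℝ := cv (ker N n) f

theorem contDiff_mol {f : Space N → ℝ} (hf : LocallyIntegrable f volume) (n : ℕ) :
    ContDiff ℝ ∞ (mol n f) := contDiff_cv (isTest_ker N n) hf

theorem integral_mol_mul {f ψ : Space N → ℝ} (hf : LocallyIntegrable f volume)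
    (hψ : IsTest ψ) (n : ℕ) : ∫ x, mol n f x * ψ x = ∫ x, f x * mol n ψ x := by
  rw [mol, integral_cv_mul (isTest_ker N n) hf hψ]
  simp only [ker_neg]
  rfl

theorem memLp_mol {f : Space N → ℝ} (hf : MemLp f 2 volume) (n : ℕ) :
    MemLp (mol n f) 2 volume ∧ nrm (mol n f) ≤ nrm f := by
  have := memLp_cv (isTest_ker N n) hf
  rwa [integral_abs_ker, one_mul] at this

theorem mol_ae_tendsto {f : Space N → ℝ} (hf : LocallyIntegrable f volume) :
    ∀ᵐ x, Tendsto (fun n => mol n f x) atTop (𝓝 (f x)) := by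
  refine ContDiffBump.ae_convolution_tendsto_right_of_locallyIntegrable (K := 2) ?_ ?_ hf
  · change Tendsto (fun n : ℕ => (2 : ℝ) / (n + 1)) atTop (𝓝 0)
    exact tendsto_const_div_atTop_nhds_zero_nat 2 |>.comp (tendsto_add_atTop_nat 1) |>.congr
      (by simp)
  · refine .of_forall fun n => ?_
    change (2 : ℝ) / (n + 1) ≤ 2 * (1 / (n + 1))
    ring_nf
    rfl

theorem abs_mol_le {f : Space N → ℝ} (hf : LocallyIntegrable f volume) {A : ℝ}
    (hA : ∀ᵐ x, |f x| ≤ A) (n : ℕ) (x : Space N) : |mol n f x| ≤ A := by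
  rw [mol, cv_apply]
  have ht := (isTest_ker N n).comp_sub x
  have hi : ∫ y, ker N n (x - y) = 1 := by
    rw [integral_sub_left_eq_self (ker N n) volume x, integral_ker]
  calc |∫ y, ker N n (x - y) * f y| ≤ ∫ y, |ker N n (x - y) * f y| := abs_integral_le_integral_abs
    _ ≤ ∫ y, ker N n (x - y) * A := by
        refine integral_mono_ae ?_ (ht.integrable.mul_const A) ?_
        · simpa [mul_comm] using (hf.integrable_mul_test ht).abs
        · filter_upwards [hA] with y hy
          rw [abs_mul, abs_of_nonneg (ker_nonneg n _)]
          exact mul_le_mul_of_nonneg_left hy (ker_nonneg n _)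
    _ = A := by rw [integral_mul_const, hi, one_mul]

/-- The kernel is even, so mollification is self-adjoint and can be moved to the test function,
where it commutes with derivatives. Equality then holds everywhere because both sides are
continuous. -/
theorem D_mol_eq {f g : Space N → ℝ} (hf : LocallyIntegrable f volume)
    (hg : LocallyIntegrable g volume) {w : List (Fin N)}
    (h : ∀ ψ, IsTest ψ → ∫ x, f x * D w ψ x = ∫ x, g x * ψ x) (n : ℕ) :
    D w (mol n f) = (-1 : ℝ) ^ w.length • mol n g := by
  have hc1 := (contDiff_D (contDiff_mol hf n) w).continuous
  have hc2 : Continuous ((-1 : ℝ) ^ w.length • mol n g) :=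
    (contDiff_mol hg n).continuous.const_smul _
  rw [← Continuous.ae_eq_iff_eq volume hc1 hc2]
  refine ae_eq_of_integral_contDiff_smul_eq hc1.locallyIntegrable hc2.locallyIntegrable
    fun ψ h1 h2 => ?_
  have ht : IsTest ψ := ⟨h1, h2⟩
  have e1 := integral_mul_D (contDiff_mol hf n) ht w
  rw [integral_mol_mul hf (ht.D w), mol, ← D_cv_test (isTest_ker N n) ht,
    h _ ((isTest_ker N n).cv ht)] at e1
  have e2 := integral_mol_mul hg ht n
  rw [mol, mol] at e2
  rw [← e2] at e1
  have e3 : ∫ x, D w (mol n f) x * ψ x = (-1) ^ w.length * ∫ x, mol n g x * ψ x := by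
    change _ = _ * ∫ x, cv (ker N n) g x * ψ x
    rw [e1, ← mul_assoc, ← mul_pow]
    simp
  simp only [smul_eq_mul, Pi.smul_apply]
  calc ∫ x, ψ x * D w (mol n f) x = ∫ x, D w (mol n f) x * ψ x := by simp_rw [mul_comm]
    _ = _ := by
      rw [e3, ← integral_const_mul]
      congr 1
      funext x
      ring

/-- The L² bound survives uniformly in n. The supremum bound depends on n and only serves to make
integrals converge. -/
theorem DB.mol {f : Space N → ℝ} (hf : LocallyIntegrable f volume) {w : List (Fin N)} {M : ℝ}
    (hM : 0 ≤ M) (h : DB w M f) (n : ℕ) :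
    MemLp (D w (mol n f)) 2 volume ∧ nrm (D w (mol n f)) ≤ M ∧ ∃ C, ∀ x, |D w (mol n f) x| ≤ C := by
  obtain ⟨g, hg, hgM, hfg⟩ := h.exists_rep hM hf
  rw [D_mol_eq hf hg.locallyIntegrable_two hfg n]
  have h1 := memLp_mol hg n
  refine ⟨h1.1.const_smul _, ?_, nrm (ker N n) * nrm g, fun x => ?_⟩
  · rw [nrm_smul]
    simpa using h1.2.trans hgM
  · have := abs_cv_le (isTest_ker N n) hg x
    simpa [abs_mul, SineGordonRegime.mol] using this

theorem mol_sub {f g : Space N → ℝ} (hf : LocallyIntegrable f volume)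
    (hg : LocallyIntegrable g volume) (n : ℕ) : mol n (f - g) = mol n f - mol n g := by
  funext x
  have ht := (isTest_ker N n).comp_sub x
  simp only [mol, cv_apply, Pi.sub_apply, mul_sub]
  refine integral_sub ?_ ?_
  · simpa [mul_comm] using hf.integrable_mul_test ht
  · simpa [mul_comm] using hg.integrable_mul_test ht

theorem ker_eq_zero {n : ℕ} {x : Space N} (hx : 2 ≤ ‖x‖) : ker N n x = 0 := by
  have : x ∉ Function.support (ker N n) := by
    rw [ker, ContDiffBump.support_normed_eq]
    simp only [Metric.mem_ball, dist_zero_right, not_lt]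
    refine le_trans ?_ hx
    change (2 : ℝ) / (n + 1) ≤ 2
    exact div_le_self (by norm_num) (by linarith [(Nat.cast_nonneg n : (0 : ℝ) ≤ n)])
  simpa using this

/-- Dominated convergence: all kernels live in the ball of radius 2, so every difference is
supported in one fixed ball and bounded by 2C. -/
theorem mol_tendsto_of_test {h : Space N → ℝ} (hh : IsTest h) :
    Tendsto (fun n => nrm (mol n h - h)) atTop (𝓝 0) := by
  obtain ⟨C, hC⟩ := hh.2.exists_bound_of_continuous hh.continuous
  obtain ⟨R, hR⟩ := hh.2.isCompact.isBounded.subset_closedBall (0 : Space N)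
  have hl : LocallyIntegrable h volume := hh.integrable.locallyIntegrable
  have hm : ∀ n, MemLp (mol n h - h) 2 volume := fun n =>
    (memLp_mol (hh.memLp 2) n).1.sub (hh.memLp 2)
  have hsupp : ∀ y : Space N, R < ‖y‖ → h y = 0 := by
    intro y hy
    by_contra hne
    have := hR (subset_tsupport _ hne)
    simp at this
    linarith
  have hC0 : 0 ≤ C := (norm_nonneg _).trans (hC 0)
  have hlim : Tendsto (fun n => ∫ x, (mol n h - h) x ^ 2) atTop (𝓝 (∫ _x : Space N, (0 : ℝ))) := by
    refine tendsto_integral_of_dominated_convergence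
      ((Metric.closedBall (0 : Space N) (R + 2)).indicator fun _ => (2 * C) ^ 2)
      (fun n => (hm n).integrable_sq.1) ?_ ?_ ?_
    · rw [integrable_indicator_iff Metric.isClosed_closedBall.measurableSet]
      exact integrableOn_const (isCompact_closedBall (0 : Space N) (R + 2)).measure_ne_top
    · intro n
      refine .of_forall fun x => ?_
      by_cases hx : x ∈ Metric.closedBall (0 : Space N) (R + 2)
      · rw [indicator_of_mem hx, Real.norm_of_nonneg (sq_nonneg _), ← sq_abs]
        refine pow_le_pow_left₀ (abs_nonneg _) ?_ 2
        have := abs_mol_le hl (.of_forall hC) n x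
        have h2 := hC x
        rw [Real.norm_eq_abs] at h2
        calc |(mol n h - h) x| ≤ |mol n h x| + |h x| := abs_sub _ _
          _ ≤ 2 * C := by linarith
      · rw [indicator_of_notMem hx]
        simp only [Metric.mem_closedBall, dist_zero_right, not_le] at hx
        have h1 : mol n h x = 0 := by
          rw [mol, cv_apply]
          refine integral_eq_zero_of_ae (.of_forall fun y => ?_)
          by_cases hy : R < ‖y‖
          · simp [hsupp y hy]
          · have : 2 ≤ ‖x - y‖ := by linarith [norm_sub_norm_le x y]
            simp [ker_eq_zero this]
        have h2 : h x = 0 := hsupp x (by linarith)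
        simp [h1, h2]
    · filter_upwards [mol_ae_tendsto hl] with x hx
      have := ((hx.sub_const (h x)).pow 2)
      simpa using this
  rw [integral_zero] at hlim
  have := hlim.sqrt
  rw [Real.sqrt_zero] at this
  refine this.congr fun n => ?_
  rw [integral_sq_eq (hm n), Real.sqrt_sq (nrm_nonneg _)]

/-- Density of test functions together with the fact that mollification is a contraction of L². -/
theorem mol_tendsto_L2 {f : Space N → ℝ} (hf : MemLp f 2 volume) :
    Tendsto (fun n => nrm (mol n f - f)) atTop (𝓝 0) := by
  rw [Metric.tendsto_atTop]
  intro ε hε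
  obtain ⟨h, h1, h2, h3⟩ := hf.exist_eLpNorm_sub_le (p := 2) (by norm_num) (by norm_num)
    (show 0 < ε / 4 by positivity)
  have hh : IsTest h := ⟨h2, h1⟩
  have hh2 := hh.memLp 2
  obtain ⟨n₀, hn₀⟩ := Metric.tendsto_atTop.1 (mol_tendsto_of_test hh) (ε / 4) (by positivity)
  refine ⟨n₀, fun n hn => ?_⟩
  have h4 : nrm (f - h) ≤ ε / 4 := ENNReal.toReal_le_of_le_ofReal (by positivity) h3
  have h5 := hn₀ n hn
  rw [Real.dist_eq, sub_zero, abs_of_nonneg (nrm_nonneg _)] at h5 ⊢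
  have hfh : MemLp (f - h) 2 volume := hf.sub hh2
  have h6 := memLp_mol hfh n
  have h7 := memLp_mol hh2 n
  have e : mol n f - f = mol n (f - h) + ((mol n h - h) + (-1 : ℝ) • (f - h)) := by
    rw [mol_sub hf.locallyIntegrable_two hh2.locallyIntegrable_two]
    funext x
    simp
  rw [e]
  have h8 := nrm_add_le h6.1 ((h7.1.sub hh2).add (hfh.const_smul (-1 : ℝ)))
  have h9 := nrm_add_le (h7.1.sub hh2) (hfh.const_smul (-1 : ℝ))
  rw [nrm_smul] at h9
  simp only [abs_neg, abs_one, one_mul] at h9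
  linarith [h6.2]

end SineGordonRegime

end


noncomputable section

namespace SineGordonRegime

variable {N : ℕ}

/-! ### Gagliardo-Nirenberg inequalities -/

/-- Weighted AM-GM applied to ηa, b/2 and νc. Since w₃ > 0, the number ν can be chosen so that η^w₁
(1/2)^w₂ ν^w₃ = K, which pushes the whole constant onto c. -/
theorem young_three {w₁ w₂ w₃ : ℝ} (h₁ : 0 ≤ w₁) (h₂ : 0 ≤ w₂) (h₃ : 0 < w₃)
    (h : w₁ + w₂ + w₃ = 1) {K η : ℝ} (hK : 0 ≤ K) (hη : 0 < η) :
    ∃ C, 0 ≤ C ∧ ∀ a b c : ℝ, 0 ≤ a → 0 ≤ b → 0 ≤ c →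
      K * (a ^ w₁ * b ^ w₂ * c ^ w₃) ≤ η * a + 1 / 2 * b + C * c := by
  set P : ℝ := η ^ w₁ * (1 / 2) ^ w₂ with hP
  have hP0 : 0 < P := by positivity
  set ν : ℝ := (K / P) ^ (1 / w₃) with hν
  have hν0 : 0 ≤ ν := by positivity
  refine ⟨ν, hν0, fun a b c ha hb hc => ?_⟩
  have key := Real.geom_mean_le_arith_mean3_weighted h₁ h₂ h₃.le
    (mul_nonneg hη.le ha) (show 0 ≤ 1 / 2 * b by positivity) (mul_nonneg hν0 hc) h
  rw [Real.mul_rpow hη.le ha, Real.mul_rpow (by norm_num) hb, Real.mul_rpow hν0 hc] at key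
  have e : ν ^ w₃ = K / P := by
    rw [hν, ← Real.rpow_mul (by positivity)]
    rw [one_div_mul_cancel h₃.ne', Real.rpow_one]
  rw [e] at key
  have e2 : η ^ w₁ * a ^ w₁ * ((1 / 2) ^ w₂ * b ^ w₂) * (K / P * c ^ w₃) =
      K * (a ^ w₁ * b ^ w₂ * c ^ w₃) := by
    rw [hP]
    field_simp
  rw [e2] at key
  have hw₁ : w₁ ≤ 1 := by linarith
  have hw₂ : w₂ ≤ 1 := by linarith
  have hw₃ : w₃ ≤ 1 := by linarith
  refine key.trans (add_le_add (add_le_add ?_ ?_) ?_)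
  · exact mul_le_of_le_one_left (by positivity) hw₁
  · exact mul_le_of_le_one_left (by positivity) hw₂
  · exact mul_le_of_le_one_left (by positivity) hw₃

theorem hasDerivAt_mul_abs_rpow {s : ℝ} (hs : 0 < s) (t : ℝ) :
    HasDerivAt (fun t : ℝ => t * |t| ^ s) ((s + 1) * |t| ^ s) t := by
  rcases eq_or_ne t 0 with rfl | ht
  · rw [hasDerivAt_iff_tendsto_slope]
    have h1 : Tendsto (fun t : ℝ => |t| ^ s) (𝓝[≠] 0) (𝓝 ((s + 1) * |(0 : ℝ)| ^ s)) := by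
      have : Continuous fun t : ℝ => |t| ^ s := continuous_abs.rpow_const fun _ => Or.inr hs.le
      have h2 := this.tendsto 0
      simp only [abs_zero, Real.zero_rpow hs.ne'] at h2
      simpa [Real.zero_rpow hs.ne'] using h2.mono_left nhdsWithin_le_nhds
    refine h1.congr' ?_
    filter_upwards [self_mem_nhdsWithin] with t ht
    have : t ≠ 0 := ht
    simp [slope_def_field, this]
  · have h1 : HasDerivAt (fun t : ℝ => |t| ^ s) (SignType.sign t * s * |t| ^ (s - 1)) t :=
      (hasDerivAt_abs ht).rpow_const (Or.inl (abs_ne_zero.2 ht))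
    have h2 := (hasDerivAt_id t).mul h1
    refine h2.congr_deriv ?_
    have h3 : |t| ^ s = |t| ^ (s - 1) * |t| := by
      rw [← Real.rpow_add_one (abs_ne_zero.2 ht)]
      ring_nf
    have h4 : t * (SignType.sign t : ℝ) = |t| := by
      rw [mul_comm, sign_mul_self]
    simp only [id]
    linear_combination (s * |t| ^ (s - 1)) * h4 - s * h3

/-- Bounded smooth functions, whose derivatives of orders `1, …, m` are bounded and in `L²`. -/
structure Tame (m : ℕ) (A : ℝ) (f : Space N → ℝ) : Prop where
  smooth : ContDiff ℝ ∞ f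
  bound : ∀ x, |f x| ≤ A
  memLp : ∀ w : List (Fin N), 1 ≤ w.length → w.length ≤ m → MemLp (D w f) 2 volume
  bdd : ∀ w : List (Fin N), 1 ≤ w.length → w.length ≤ m → ∃ C, ∀ x, |D w f x| ≤ C

theorem integrable_abs_rpow {f : Space N → ℝ} (hf : MemLp f 2 volume) {C : ℝ}
    (hC : ∀ x, |f x| ≤ C) {p : ℝ} (hp : 2 ≤ p) : Integrable (fun x => |f x| ^ p) volume := by
  refine (hf.integrable_sq.const_mul (C ^ (p - 2))).mono' ?_ (.of_forall fun x => ?_)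
  · exact (hf.1.aemeasurable.abs.pow_const p).aestronglyMeasurable
  · rw [Real.norm_of_nonneg (by positivity)]
    have h1 : |f x| ^ p = |f x| ^ (p - 2) * f x ^ 2 := by
      rw [← sq_abs, ← Real.rpow_natCast, ← Real.rpow_add_of_nonneg (abs_nonneg _)
        (by linarith) (by positivity)]
      norm_num
    rw [h1]
    gcongr
    exact hC x

/-- For G = ∂g and H = ∂G, integration by parts gives ∫|G|^(s+2) = −(s+1) ∫ g |G|^s H. The
three-term Young inequality splits the right side, and the half of ∫|G|^(s+2) it produces is
absorbed on the left. The function a stands for |g|^(1/w₁). -/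
theorem integral_abs_rpow_le {g G H a : Space N → ℝ} (hg : ContDiff ℝ ∞ g) {i : Fin N}
    (hG : G = partialDeriv i g) (hH : H = partialDeriv i G)
    {s w₁ w₃ η C : ℝ} (hs : 0 < s) (hC : ∀ a b c : ℝ, 0 ≤ a → 0 ≤ b → 0 ≤ c →
      (s + 1) * (a ^ w₁ * b ^ (s / (s + 2)) * c ^ w₃) ≤ η * a + 1 / 2 * b + C * c)
    (hw₃ : 0 < w₃)
    (ha0 : ∀ x, 0 ≤ a x) (hga : ∀ x, |g x| ≤ a x ^ w₁)
    (hai : Integrable a volume)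
    (hi1 : Integrable (fun x => |G x| ^ (s + 2)) volume)
    (hi2 : Integrable (fun x => g x * ((s + 1) * |G x| ^ s * H x)) volume)
    (hi3 : Integrable (fun x => g x * (G x * |G x| ^ s)) volume)
    (hi4 : Integrable (fun x => |H x| ^ (1 / w₃)) volume) :
    ∫ x, |G x| ^ (s + 2) ≤ 2 * η * (∫ x, a x) + 2 * C * ∫ x, |H x| ^ (1 / w₃) := by
  have hGs : ContDiff ℝ ∞ G := hG ▸ contDiff_partialDeriv hg i
  have hfd : ∀ x, HasFDerivAt (fun x => G x * |G x| ^ s)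
      (((s + 1) * |G x| ^ s) • fderiv ℝ G x) x := fun x =>
    (hasDerivAt_mul_abs_rpow hs (G x)).comp_hasFDerivAt x
      (hGs.differentiableAt_space x).hasFDerivAt
  have hpp : ∀ x, G x * (G x * |G x| ^ s) = |G x| ^ (s + 2) := by
    intro x
    rw [← mul_assoc, ← abs_mul_abs_self (G x), Real.rpow_add_of_nonneg (abs_nonneg _) hs.le
      (by norm_num)]
    simp only [Real.rpow_ofNat]
    ring
  have hHx : ∀ x, (((s + 1) * |G x| ^ s) • fderiv ℝ G x) (EuclideanSpace.single i 1) =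
      (s + 1) * |G x| ^ s * H x := by
    intro x
    simp [hH, partialDeriv]
  have hbp := integral_bilinear_hasFDerivAt_right_eq_neg_left_of_integrable (μ := volume)
    (B := ContinuousLinearMap.mul ℝ ℝ) (f := g) (f' := fun x => fderiv ℝ g x)
    (g := fun x => G x * |G x| ^ s)
    (g' := fun x => ((s + 1) * |G x| ^ s) • fderiv ℝ G x) (v := EuclideanSpace.single i 1)
    (by
      refine hi1.congr (.of_forall fun x => ?_)
      simp only [ContinuousLinearMap.mul_apply']
      rw [← hpp, hG]; rfl)
    (by simpa only [ContinuousLinearMap.mul_apply', hHx] using hi2)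
    (by simpa only [ContinuousLinearMap.mul_apply'] using hi3)
    (fun x _ => (hg.differentiableAt_space x).hasFDerivAt) (fun x _ => hfd x)
  simp only [ContinuousLinearMap.mul_apply', hHx] at hbp
  have hbp2 : ∫ x, |G x| ^ (s + 2) = -∫ x, g x * ((s + 1) * |G x| ^ s * H x) := by
    rw [hbp, neg_neg]
    congr 1
    funext x
    rw [← hpp, hG]; rfl
  have hpt : ∀ x, |g x * ((s + 1) * |G x| ^ s * H x)| ≤
      η * a x + 1 / 2 * |G x| ^ (s + 2) + C * |H x| ^ (1 / w₃) := by
    intro x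
    refine le_trans ?_ (hC (a x) (|G x| ^ (s + 2)) (|H x| ^ (1 / w₃)) (ha0 x) (by positivity)
      (by positivity))
    rw [← Real.rpow_mul (abs_nonneg _), ← Real.rpow_mul (abs_nonneg _)]
    have e1 : (s + 2) * (s / (s + 2)) = s := by field_simp
    have e2 : 1 / w₃ * w₃ = 1 := by field_simp
    rw [e1, e2, Real.rpow_one, abs_mul, abs_mul, abs_mul,
      abs_of_nonneg (by positivity : 0 ≤ s + 1), abs_of_nonneg (by positivity : 0 ≤ |G x| ^ s)]
    calc |g x| * ((s + 1) * |G x| ^ s * |H x|) ≤ a x ^ w₁ * ((s + 1) * |G x| ^ s * |H x|) := by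
          gcongr
          exact hga x
      _ = _ := by ring
  have hfin : ∫ x, |G x| ^ (s + 2) ≤
      η * (∫ x, a x) + 1 / 2 * (∫ x, |G x| ^ (s + 2)) + C * ∫ x, |H x| ^ (1 / w₃) := by
    calc ∫ x, |G x| ^ (s + 2) ≤ |∫ x, g x * ((s + 1) * |G x| ^ s * H x)| := by
          rw [hbp2]; exact neg_le_abs _
      _ ≤ ∫ x, |g x * ((s + 1) * |G x| ^ s * H x)| := abs_integral_le_integral_abs
      _ ≤ ∫ x, (η * a x + 1 / 2 * |G x| ^ (s + 2) + C * |H x| ^ (1 / w₃)) :=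
          integral_mono hi2.abs (((hai.const_mul _).add (hi1.const_mul _)).add
            (hi4.const_mul _)) hpt
      _ = _ := by
          have e1 := integral_add ((hai.const_mul η).add (hi1.const_mul (1 / 2)))
            (hi4.const_mul C)
          have e2 := integral_add (hai.const_mul η) (hi1.const_mul (1 / 2))
          simp only [integral_const_mul, Pi.add_apply] at e1 e2
          rw [e1, e2]
  linarith

/-- The sum of `∫ |∂^w f|^{2m/j}` over the words `w` of length `j`. -/
def gnSum (m j : ℕ) (f : Space N → ℝ) : ℝ :=
  ∑ v : Fin j → Fin N, ∫ x, |D (List.ofFn v) f x| ^ (2 * m / j : ℝ)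

theorem le_gnSum (m : ℕ) (f : Space N → ℝ) (w : List (Fin N)) :
    ∫ x, |D w f x| ^ (2 * m / w.length : ℝ) ≤ gnSum m w.length f := by
  have h := Finset.single_le_sum (s := Finset.univ)
    (f := fun v : Fin w.length → Fin N => ∫ x, |D (List.ofFn v) f x| ^ (2 * m / w.length : ℝ))
    (fun v _ => integral_nonneg fun x => by positivity) (Finset.mem_univ w.get)
  simp only [List.ofFn_get] at h
  exact h

theorem gnSum_nonneg (m j : ℕ) (f : Space N → ℝ) : 0 ≤ gnSum m j f :=
  Finset.sum_nonneg fun _ _ => integral_nonneg fun _ => by positivity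

theorem gnSum_le {m j : ℕ} {f : Space N → ℝ} {B : ℝ}
    (h : ∀ w : List (Fin N), w.length = j → ∫ x, |D w f x| ^ (2 * m / j : ℝ) ≤ B) :
    gnSum m j f ≤ (N : ℝ) ^ j * B := by
  calc gnSum m j f ≤ ∑ _v : Fin j → Fin N, B :=
        Finset.sum_le_sum fun v _ => h _ (List.length_ofFn)
    _ = _ := by simp

/-- The exponents 2m/j interpolate between L^∞ at j = 0 and L² at j = m. With s + 2 = 2m/j the Young
weights (j−1)/2m, 1 − j/m and (j+1)/2m add up to one, so level j is controlled by its two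
neighbours, with a small constant on the lower one. -/
theorem gn_word {m j : ℕ} (hj : 1 ≤ j) (hjm : j + 1 ≤ m) {η : ℝ} (hη : 0 < η) :
    ∃ C, 0 ≤ C ∧ ∀ f : Space N → ℝ, Tame m 1 f → ∀ w : List (Fin N), w.length = j →
      ∫ x, |D w f x| ^ (2 * m / j : ℝ) ≤
        2 * η * (if j = 1 then 0 else gnSum m (j - 1) f) + 2 * C * gnSum m (j + 1) f := by
  have hj0 : (0 : ℝ) < j := by exact_mod_cast hj
  have hm0 : (0 : ℝ) < m := by
    have : (0 : ℕ) < m := by omega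
    exact_mod_cast this
  have hjm' : (j : ℝ) + 1 ≤ m := by exact_mod_cast hjm
  set s : ℝ := 2 * m / j - 2 with hs
  have hs0 : 0 < s := by
    rw [hs, sub_pos, lt_div_iff₀ hj0]
    linarith
  have hs2 : s + 2 = 2 * m / j := by rw [hs]; ring
  set w₁ : ℝ := (j - 1) / (2 * m) with hw₁
  set w₃ : ℝ := (j + 1) / (2 * m) with hw₃
  have hj1 : (1 : ℝ) ≤ j := by exact_mod_cast hj
  have hw₁0 : 0 ≤ w₁ := div_nonneg (by linarith) (by positivity)
  have hw₃0 : 0 < w₃ := by positivity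
  have hsum : w₁ + s / (s + 2) + w₃ = 1 := by
    rw [hs2, hs, hw₁, hw₃]
    field_simp
    ring
  obtain ⟨C, hC0, hC⟩ := young_three hw₁0 (by positivity : 0 ≤ s / (s + 2)) hw₃0 hsum
    (K := s + 1) (by positivity) hη
  refine ⟨C, hC0, fun f hf w hw => ?_⟩
  obtain ⟨i, v, rfl⟩ : ∃ i v, w = i :: v := by
    cases w with
    | nil => simp at hw; omega
    | cons i v => exact ⟨i, v, rfl⟩
  have hv : v.length = j - 1 := by simp at hw; omega
  obtain ⟨CG, hCG⟩ := hf.bdd (i :: v) (by simp) (by rw [hw]; omega)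
  have hGm := hf.memLp (i :: v) (by simp) (by rw [hw]; omega)
  obtain ⟨CH, hCH⟩ := hf.bdd (i :: i :: v) (by simp) (by rw [List.length_cons, hw]; omega)
  have hHm := hf.memLp (i :: i :: v) (by simp) (by rw [List.length_cons, hw]; omega)
  have hCG0 : 0 ≤ CG := (abs_nonneg _).trans (hCG 0)
  have hw3i : 1 / w₃ = 2 * m / ((j + 1 : ℕ) : ℝ) := by
    rw [hw₃]; push_cast; field_simp
  have hw3ge : 2 ≤ 1 / w₃ := by
    rw [hw3i, le_div_iff₀ (by positivity)]
    push_cast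
    linarith
  have hHle : ∫ x, |D (i :: i :: v) f x| ^ (1 / w₃) ≤ gnSum m (j + 1) f := by
    have := le_gnSum m f (i :: i :: v)
    rwa [List.length_cons, hw, ← hw3i] at this
  have hi1 : Integrable (fun x => |D (i :: v) f x| ^ (s + 2)) volume :=
    integrable_abs_rpow hGm hCG (by linarith)
  have hi4 := integrable_abs_rpow hHm hCH hw3ge
  have hGc := (contDiff_D hf.smooth (i :: v)).continuous
  have hgc := (contDiff_D hf.smooth v).continuous
  have hHc := (contDiff_D hf.smooth (i :: i :: v)).continuous
  have hGsc : Continuous fun x => |D (i :: v) f x| ^ s :=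
    hGc.abs.rpow_const fun _ => Or.inr hs0.le
  have hGsb : ∀ x, |D (i :: v) f x| ^ s ≤ CG ^ s := fun x => by gcongr; exact hCG x
  rw [← hs2]
  by_cases h1 : j = 1
  · have hvn : v = [] := by
      apply List.eq_nil_of_length_eq_zero
      omega
    subst hvn
    have hs2' : 2 ≤ s := by
      rw [hs, h1]
      have : (2 : ℝ) ≤ m := by
        have : 2 ≤ m := by omega
        exact_mod_cast this
      push_cast
      linarith
    have hGs2 : MemLp (fun x => |D [i] f x| ^ s) 2 volume := by
      refine (memLp_two_iff_integrable_sq hGsc.aestronglyMeasurable).2 ?_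
      refine (integrable_abs_rpow hGm hCG (p := 2 * s) (by linarith)).congr (.of_forall fun x => ?_)
      simp only
      rw [← Real.rpow_natCast, ← Real.rpow_mul (abs_nonneg _)]
      ring_nf
    -- For j = 1 the lower neighbour is f itself and w₁ = 0. Taking a = 0, the convention 0 ^ 0 = 1
    -- makes the hypothesis |f| ≤ a ^ w₁ the bound |f| ≤ 1, and the a term disappears.
    have h := integral_abs_rpow_le (a := fun _ => 0) hf.smooth (G := D [i] f) (i := i)
      (H := D [i, i] f) rfl rfl hs0 hC hw₃0 (fun _ => le_rfl)
      (fun x => by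
        have : w₁ = 0 := by rw [hw₁, h1]; simp
        rw [this]
        simpa using hf.bound x)
      (integrable_zero _ _ _) hi1
      (by
        have := ((hGs2.integrable_mul hHm).const_mul (s + 1)).bdd_mul (c := 1)
          hf.smooth.continuous.aestronglyMeasurable (.of_forall hf.bound)
        simpa [mul_assoc] using this)
      (by
        exact (hGm.integrable_mul hGs2).bdd_mul (c := 1)
          hf.smooth.continuous.aestronglyMeasurable (.of_forall hf.bound)) hi4
    simp only [integral_zero, mul_zero, zero_add] at h
    rw [if_pos h1, mul_zero, zero_add]
    exact h.trans (by gcongr)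
  · have hj2 : 2 ≤ j := by omega
    obtain ⟨Cg, hCg⟩ := hf.bdd v (by omega) (by omega)
    have hgm := hf.memLp v (by omega) (by omega)
    have hj2' : (2 : ℝ) ≤ j := by exact_mod_cast hj2
    have hq : 2 * m / v.length = (1 / w₁ : ℝ) := by
      rw [hv, hw₁, Nat.cast_sub hj]
      push_cast
      rw [one_div_div]
    have hw₁p : 0 < w₁ := div_pos (by linarith) (by positivity)
    have hq2 : 2 ≤ 1 / w₁ := by
      rw [hw₁, one_div_div, le_div_iff₀ (by linarith)]
      linarith
    have hgle := le_gnSum m f v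
    rw [hq, hv] at hgle
    have h := integral_abs_rpow_le (a := fun x => |D v f x| ^ (1 / w₁)) (contDiff_D hf.smooth v)
      (G := D (i :: v) f) (i := i)
      (H := D (i :: i :: v) f) rfl rfl hs0 hC hw₃0 (fun _ => by positivity)
      (fun x => by
        rw [← Real.rpow_mul (abs_nonneg _)]
        rw [one_div_mul_cancel hw₁p.ne', Real.rpow_one])
      (integrable_abs_rpow hgm hCg hq2) hi1
      (by
        have := ((hgm.integrable_mul hHm).const_mul (s + 1)).bdd_mul (c := CG ^ s)
          hGsc.aestronglyMeasurable (.of_forall fun x => by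
            rw [Real.norm_of_nonneg (by positivity)]; exact hGsb x)
        refine this.congr (.of_forall fun x => ?_)
        simp only [Pi.mul_apply]
        ring)
      (by
        have := (hgm.integrable_mul hGm).bdd_mul (c := CG ^ s)
          hGsc.aestronglyMeasurable (.of_forall fun x => by
            rw [Real.norm_of_nonneg (by positivity)]; exact hGsb x)
        refine this.congr (.of_forall fun x => ?_)
        simp only [Pi.mul_apply]
        ring) hi4
    rw [if_neg h1]
    exact h.trans (by gcongr)

/-- Induction on j: level j is already controlled by level j + 1, so in the three-level inequality
at j + 1 the lower neighbour can be absorbed. -/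
theorem gnSum_le_succ {m j : ℕ} (hj : 1 ≤ j) (hjm : j + 1 ≤ m) :
    ∃ C, 0 ≤ C ∧ ∀ f : Space N → ℝ, Tame m 1 f → gnSum m j f ≤ C * gnSum m (j + 1) f := by
  induction j, hj using Nat.le_induction with
  | base =>
    obtain ⟨C, hC, h⟩ := gn_word (N := N) le_rfl hjm one_pos
    refine ⟨(N : ℝ) ^ 1 * (2 * C), by positivity, fun f hf => ?_⟩
    rw [mul_assoc]
    refine gnSum_le fun w hw => ?_
    simpa using h f hf w hw
  | succ j hj ih =>
    obtain ⟨C₀, hC₀, h₀⟩ := ih (by omega)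
    -- Chosen so that N^(j+1) · 2η · C₀ ≤ 1/2, which is what the absorption requires.
    set η : ℝ := 1 / (4 * (N ^ (j + 1) * C₀ + 1)) with hη
    have hη0 : 0 < η := by positivity
    obtain ⟨C, hC, h⟩ := gn_word (N := N) (by omega : 1 ≤ j + 1) hjm hη0
    refine ⟨2 * ((N : ℝ) ^ (j + 1) * (2 * C)), by positivity, fun f hf => ?_⟩
    have h1 := gnSum_le (fun w hw => h f hf w hw)
    rw [if_neg (by omega), Nat.add_sub_cancel] at h1
    have h2 := h₀ f hf
    have hx := gnSum_nonneg m (j + 1) f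
    have h3 : (N : ℝ) ^ (j + 1) * (2 * η * gnSum m j f) ≤ 1 / 2 * gnSum m (j + 1) f := by
      calc (N : ℝ) ^ (j + 1) * (2 * η * gnSum m j f)
          ≤ (N : ℝ) ^ (j + 1) * (2 * η * (C₀ * gnSum m (j + 1) f)) := by gcongr
        _ = (2 * η * (N ^ (j + 1) * C₀)) * gnSum m (j + 1) f := by ring
        _ ≤ 1 / 2 * gnSum m (j + 1) f := by
            refine mul_le_mul_of_nonneg_right ?_ hx
            rw [hη]
            have : 0 ≤ (N : ℝ) ^ (j + 1) * C₀ := by positivity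
            field_simp
            linarith
    linarith

/-- Chaining the comparisons of consecutive levels up to level m, where the exponent is 2 and the L²
bounds apply. The normalisation |f| ≤ 1 is removed later by scaling. -/
theorem gagliardo_nirenberg (m : ℕ) : ∃ C, 0 ≤ C ∧ ∀ f : Space N → ℝ, Tame m 1 f → ∀ M : ℝ,
    (∀ w : List (Fin N), w.length = m → nrm (D w f) ≤ M) →
    ∀ w : List (Fin N), 1 ≤ w.length → w.length ≤ m →
      ∫ x, |D w f x| ^ (2 * m / w.length : ℝ) ≤ C * M ^ 2 := by
  have key : ∀ d j : ℕ, 1 ≤ j → j + d = m → ∃ C, 0 ≤ C ∧ ∀ f : Space N → ℝ, Tame m 1 f →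
      gnSum m j f ≤ C * gnSum m m f := by
    intro d
    induction d with
    | zero => intro j _ hj; exact ⟨1, zero_le_one, fun f _ => by simp at hj; rw [hj, one_mul]⟩
    | succ d ih =>
      intro j h1 h2
      obtain ⟨C₁, hC₁, h₁⟩ := ih (j + 1) (by omega) (by omega)
      obtain ⟨C₂, hC₂, h₂⟩ := gnSum_le_succ (N := N) (m := m) h1 (by omega)
      refine ⟨C₂ * C₁, by positivity, fun f hf => (h₂ f hf).trans ?_⟩
      rw [mul_assoc]
      exact mul_le_mul_of_nonneg_left (h₁ f hf) hC₂
  have key2 : ∀ j : ℕ, ∃ C, 0 ≤ C ∧ (1 ≤ j → j ≤ m → ∀ f : Space N → ℝ, Tame m 1 f →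
      gnSum m j f ≤ C * gnSum m m f) := by
    intro j
    by_cases h : 1 ≤ j ∧ j ≤ m
    · obtain ⟨C, hC, h'⟩ := key (m - j) j h.1 (by omega)
      exact ⟨C, hC, fun _ _ => h'⟩
    · exact ⟨0, le_rfl, fun h1 h2 => absurd ⟨h1, h2⟩ h⟩
  choose C hC hCj using key2
  refine ⟨(∑ j ∈ Finset.range (m + 1), C j) * N ^ m, by
    have := Finset.sum_nonneg (s := Finset.range (m + 1)) fun j _ => hC j
    positivity, fun f hf M hM w h1 h2 => ?_⟩
  have hm0 : (m : ℝ) ≠ 0 := by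
    have : m ≠ 0 := by omega
    exact_mod_cast this
  have hmm : gnSum m m f ≤ (N : ℝ) ^ m * M ^ 2 := by
    refine gnSum_le fun w hw => ?_
    have e : (2 * m / m : ℝ) = 2 := by field_simp
    rw [e]
    simp only [Real.rpow_ofNat, sq_abs]
    rw [integral_sq_eq (hf.memLp w (by omega) (by omega))]
    exact pow_le_pow_left₀ (nrm_nonneg _) (hM w hw) 2
  calc _ ≤ gnSum m w.length f := le_gnSum m f w
    _ ≤ C w.length * gnSum m m f := hCj _ h1 h2 f hf
    _ ≤ (∑ j ∈ Finset.range (m + 1), C j) * gnSum m m f := by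
        refine mul_le_mul_of_nonneg_right ?_ (gnSum_nonneg m m f)
        exact Finset.single_le_sum (fun j _ => hC j) (Finset.mem_range.2 (by omega))
    _ ≤ (∑ j ∈ Finset.range (m + 1), C j) * ((N : ℝ) ^ m * M ^ 2) := by
        refine mul_le_mul_of_nonneg_left hmm ?_
        exact Finset.sum_nonneg fun j _ => hC j
    _ = _ := by ring

end SineGordonRegime

end


noncomputable section

namespace SineGordonRegime

variable {N : ℕ}

/-! ### Tame product estimates -/

/-- Young's inequality with weights a/m and b/m; its exponents are those of the Gagliardo-Nirenberg
inequality for derivatives of orders a and b. -/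
theorem mul_rpow_young {m a b : ℕ} (ha : 1 ≤ a) (hb : 1 ≤ b) (hab : a + b = m) (s t : ℝ) :
    (s * t) ^ 2 ≤ |s| ^ (2 * m / a : ℝ) + |t| ^ (2 * m / b : ℝ) := by
  have ha0 : (0 : ℝ) < a := by exact_mod_cast ha
  have hb0 : (0 : ℝ) < b := by exact_mod_cast hb
  have hm : (m : ℝ) = a + b := by exact_mod_cast hab.symm
  have hm0 : (0 : ℝ) < m := by rw [hm]; positivity
  have h := Real.geom_mean_le_arith_mean2_weighted (w₁ := a / m) (w₂ := b / m)
    (p₁ := |s| ^ (2 * m / a : ℝ)) (p₂ := |t| ^ (2 * m / b : ℝ)) (by positivity) (by positivity)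
    (by positivity) (by positivity) (by rw [hm]; field_simp)
  have e1 : (2 * m / a : ℝ) * (a / m) = 2 := by field_simp
  have e2 : (2 * m / b : ℝ) * (b / m) = 2 := by field_simp
  rw [← Real.rpow_mul (abs_nonneg _), ← Real.rpow_mul (abs_nonneg _), e1, e2] at h
  simp only [Real.rpow_ofNat, sq_abs] at h
  rw [mul_pow]
  refine h.trans (add_le_add ?_ ?_)
  · refine mul_le_of_le_one_left (by positivity) ?_
    rw [div_le_one hm0]; linarith
  · refine mul_le_of_le_one_left (by positivity) ?_
    rw [div_le_one hm0]; linarith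

/-- Leibniz' rule in inductive form: each letter of w falls on one of the two factors, giving 2^|w|
terms of total order m. -/
theorem nrm_D_mul_le {f g : Space N → ℝ} (hf : ContDiff ℝ ∞ f) (hg : ContDiff ℝ ∞ g) {m : ℕ}
    {K : ℝ} (h : ∀ u v : List (Fin N), u.length + v.length = m →
      MemLp (fun x => D u f x * D v g x) 2 volume ∧ nrm (fun x => D u f x * D v g x) ≤ K)
    (w u v : List (Fin N)) (hl : w.length + u.length + v.length = m) :
    MemLp (D w (fun x => D u f x * D v g x)) 2 volume ∧
      nrm (D w (fun x => D u f x * D v g x)) ≤ 2 ^ w.length * K := by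
  induction w generalizing u v with
  | nil => simpa using h u v (by simpa using hl)
  | cons i w ih =>
    have hu := contDiff_D hf u
    have hv := contDiff_D hg v
    have e : D (i :: w) (fun x => D u f x * D v g x) =
        D w (fun x => D (i :: u) f x * D v g x) + D w (fun x => D u f x * D (i :: v) g x) := by
      rw [D_perm (hu.mul hv) (List.perm_append_singleton i w).symm, D_append]
      change D w (partialDeriv i (fun x => D u f x * D v g x)) = _
      rw [partialDeriv_mul hu hv, D_add ((contDiff_partialDeriv hu i).mul hv)
        (hu.mul (contDiff_partialDeriv hv i))]
      rfl
    obtain ⟨a1, a2⟩ := ih (i :: u) v (by simp at hl ⊢; omega)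
    obtain ⟨b1, b2⟩ := ih u (i :: v) (by simp at hl ⊢; omega)
    rw [e]
    refine ⟨a1.add b1, (nrm_add_le a1 b1).trans ?_⟩
    rw [List.length_cons, pow_succ]
    linarith

theorem nrm_le_sqrt {f : Space N → ℝ} (hf : MemLp f 2 volume) {B : ℝ}
    (h : ∫ x, f x ^ 2 ≤ B ^ 2) (hB : 0 ≤ B) : nrm f ≤ B := by
  rw [integral_sq_eq hf] at h
  exact le_of_sq_le_sq h hB

/-- In the Leibniz expansion, the two extreme terms use |f|, |g| ≤ 1, and each mixed term is split
by `mul_rpow_young` into powers controlled by Gagliardo-Nirenberg. -/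
theorem tame_mul_normalized (m : ℕ) : ∃ C, 0 ≤ C ∧ ∀ f g : Space N → ℝ, Tame m 1 f →
    Tame m 1 g → ∀ Mf Mg : ℝ,
    (∀ w : List (Fin N), w.length = m → nrm (D w f) ≤ Mf) →
    (∀ w : List (Fin N), w.length = m → nrm (D w g) ≤ Mg) →
    0 ≤ Mf → 0 ≤ Mg → 1 ≤ m →
    ∀ w : List (Fin N), w.length = m → MemLp (D w fun x => f x * g x) 2 volume ∧
      nrm (D w fun x => f x * g x) ≤ C * (Mf + Mg) := by
  obtain ⟨C, hC0, hC⟩ := gagliardo_nirenberg (N := N) m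
  refine ⟨2 ^ m * (C + 1), by positivity, fun f g hf hg Mf Mg hMf hMg hMf0 hMg0 hm w hw => ?_⟩
  have key := nrm_D_mul_le hf.smooth hg.smooth (m := m) (K := (C + 1) * (Mf + Mg)) ?_ w [] []
    (by simpa using hw)
  · simp only [D_nil, hw] at key
    exact ⟨key.1, key.2.trans_eq (by ring)⟩
  · intro u v huv
    have hcont : AEStronglyMeasurable (fun x => D u f x * D v g x) volume :=
      ((contDiff_D hf.smooth u).continuous.mul
        (contDiff_D hg.smooth v).continuous).aestronglyMeasurable
    have hS : 0 ≤ Mf + Mg := by positivity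
    rcases Nat.eq_zero_or_pos u.length with hu | hu
    · obtain rfl : u = [] := List.eq_nil_of_length_eq_zero hu
      have hv : v.length = m := by simpa using huv
      have hvm := hg.memLp v (by omega) (by omega)
      refine ⟨hvm.mul_bdd hf.smooth.continuous.aestronglyMeasurable (.of_forall hf.bound),
        (nrm_mul_le hvm zero_le_one (.of_forall hf.bound)).trans ?_⟩
      have := hMg v hv
      nlinarith
    rcases Nat.eq_zero_or_pos v.length with hv | hv
    · obtain rfl : v = [] := List.eq_nil_of_length_eq_zero hv
      have hu : u.length = m := by simpa using huv
      have hum := hf.memLp u (by omega) (by omega)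
      have e : (fun x => D u f x * D [] g x) = fun x => g x * D u f x := by
        funext x
        simp [mul_comm]
      rw [e]
      refine ⟨hum.mul_bdd hg.smooth.continuous.aestronglyMeasurable (.of_forall hg.bound),
        (nrm_mul_le hum zero_le_one (.of_forall hg.bound)).trans ?_⟩
      have := hMf u hu
      nlinarith
    obtain ⟨Cu, hCu⟩ := hf.bdd u hu (by omega)
    obtain ⟨Cv, hCv⟩ := hg.bdd v hv (by omega)
    have hum := hf.memLp u hu (by omega)
    have hvm := hg.memLp v hv (by omega)
    have hml : MemLp (fun x => D u f x * D v g x) 2 volume :=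
      hvm.mul_bdd hum.1 (.of_forall hCu)
    refine ⟨hml, nrm_le_sqrt hml ?_ (by positivity)⟩
    have hexp : ∀ a b : ℕ, 1 ≤ a → a + b = m → (2 : ℝ) ≤ 2 * m / a := by
      intro a b ha hab
      have ha0 : (0 : ℝ) < a := by exact_mod_cast ha
      rw [le_div_iff₀ ha0]
      have : (a : ℝ) ≤ m := by exact_mod_cast (by omega : a ≤ m)
      linarith
    have hi1 := integrable_abs_rpow hum hCu (hexp _ _ hu huv)
    have hi2 := integrable_abs_rpow hvm hCv (hexp _ u.length hv (by omega))
    calc ∫ x, (D u f x * D v g x) ^ 2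
        ≤ ∫ x, (|D u f x| ^ (2 * m / u.length : ℝ) + |D v g x| ^ (2 * m / v.length : ℝ)) :=
          integral_mono hml.integrable_sq (hi1.add hi2)
            fun x => mul_rpow_young hu hv huv _ _
      _ = _ := integral_add hi1 hi2
      _ ≤ C * Mf ^ 2 + C * Mg ^ 2 :=
          add_le_add (hC f hf Mf hMf u hu (by omega)) (hC g hg Mg hMg v hv (by omega))
      _ ≤ ((C + 1) * (Mf + Mg)) ^ 2 := by
          have h1 : C ≤ (C + 1) ^ 2 := by nlinarith
          have h2 : Mf ^ 2 + Mg ^ 2 ≤ (Mf + Mg) ^ 2 := by nlinarith [mul_nonneg hMf0 hMg0]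
          calc C * Mf ^ 2 + C * Mg ^ 2 = C * (Mf ^ 2 + Mg ^ 2) := by ring
            _ ≤ (C + 1) ^ 2 * (Mf + Mg) ^ 2 := by gcongr
            _ = _ := by ring

theorem Tame.const_smul {m : ℕ} {A : ℝ} {f : Space N → ℝ} (hf : Tame m A f) (c : ℝ) :
    Tame m (|c| * A) (c • f) where
  smooth := hf.smooth.const_smul c
  bound x := by
    simp only [Pi.smul_apply, smul_eq_mul, abs_mul]
    exact mul_le_mul_of_nonneg_left (hf.bound x) (abs_nonneg c)
  memLp w h1 h2 := by
    rw [D_const_smul hf.smooth]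
    exact (hf.memLp w h1 h2).const_smul c
  bdd w h1 h2 := by
    obtain ⟨C, hC⟩ := hf.bdd w h1 h2
    refine ⟨|c| * C, fun x => ?_⟩
    rw [D_const_smul hf.smooth]
    simp only [Pi.smul_apply, smul_eq_mul, abs_mul]
    exact mul_le_mul_of_nonneg_left (hC x) (abs_nonneg c)

/-- Apply the normalised estimate to f/A and g/B; homogeneity attaches each supremum to the
derivatives of the other factor. -/
theorem tame_mul (m : ℕ) : ∃ C, 0 ≤ C ∧ ∀ (f g : Space N → ℝ) (A B : ℝ), 0 < A → 0 < B →
    Tame m A f → Tame m B g → ∀ Mf Mg : ℝ,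
    (∀ w : List (Fin N), w.length = m → nrm (D w f) ≤ Mf) →
    (∀ w : List (Fin N), w.length = m → nrm (D w g) ≤ Mg) →
    0 ≤ Mf → 0 ≤ Mg → 1 ≤ m →
    ∀ w : List (Fin N), w.length = m → MemLp (D w fun x => f x * g x) 2 volume ∧
      nrm (D w fun x => f x * g x) ≤ C * (A * Mg + B * Mf) := by
  obtain ⟨C, hC0, hC⟩ := tame_mul_normalized (N := N) m
  refine ⟨C, hC0, fun f g A B hA hB hf hg Mf Mg hMf hMg hMf0 hMg0 hm w hw => ?_⟩
  have hf' := hf.const_smul A⁻¹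
  have hg' := hg.const_smul B⁻¹
  rw [abs_of_pos (inv_pos.2 hA), inv_mul_cancel₀ hA.ne'] at hf'
  rw [abs_of_pos (inv_pos.2 hB), inv_mul_cancel₀ hB.ne'] at hg'
  obtain ⟨h1, h2⟩ := hC _ _ hf' hg' (A⁻¹ * Mf) (B⁻¹ * Mg)
    (fun w hw => by
      rw [D_const_smul hf.smooth, nrm_smul, abs_of_pos (inv_pos.2 hA)]
      exact mul_le_mul_of_nonneg_left (hMf w hw) (inv_pos.2 hA).le)
    (fun w hw => by
      rw [D_const_smul hg.smooth, nrm_smul, abs_of_pos (inv_pos.2 hB)]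
      exact mul_le_mul_of_nonneg_left (hMg w hw) (inv_pos.2 hB).le)
    (by positivity) (by positivity) hm w hw
  have e : (fun x => f x * g x) = (A * B) • fun x => (A⁻¹ • f) x * (B⁻¹ • g) x := by
    funext x
    simp only [Pi.smul_apply, smul_eq_mul]
    field_simp
  rw [e, D_const_smul (hf'.smooth.mul hg'.smooth), nrm_smul]
  refine ⟨h1.const_smul _, ?_⟩
  rw [abs_of_pos (mul_pos hA hB)]
  calc A * B * _ ≤ A * B * (C * (A⁻¹ * Mf + B⁻¹ * Mg)) := by gcongr
    _ = C * (A * Mg + B * Mf) := by field_simp; ring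

theorem Reg.tame_mol {m : ℕ} {M A : ℝ} (hM : 0 ≤ M) {f : Space N → ℝ} (h : Reg 1 m M f)
    (hA : ∀ᵐ x, |f x| ≤ A) (n : ℕ) : Tame m A (mol n f) where
  smooth := contDiff_mol h.1 n
  bound := abs_mol_le h.1 hA n
  memLp w h1 h2 := ((h.2 w h1 h2).mol h.1 hM n).1
  bdd w h1 h2 := ((h.2 w h1 h2).mol h.1 hM n).2.2

theorem locallyIntegrable_of_bdd {f : Space N → ℝ} (hf : AEStronglyMeasurable f volume) {A : ℝ}
    (hA : ∀ᵐ x, |f x| ≤ A) : LocallyIntegrable f volume := by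
  have : MemLp f ⊤ volume := memLp_top_of_bound hf A hA
  exact this.locallyIntegrable le_top

theorem locallyIntegrable_mul_bdd {f g : Space N → ℝ} (hf : LocallyIntegrable f volume)
    (hg : AEStronglyMeasurable g volume) {A : ℝ} (hA : ∀ᵐ x, |g x| ≤ A) :
    LocallyIntegrable (fun x => g x * f x) volume := fun x => by
  obtain ⟨s, hs, hi⟩ := hf x
  exact ⟨s, hs, Integrable.bdd_mul (c := A) hi hg.restrict (ae_restrict_of_ae hA)⟩

/-- The tame estimate holds for the mollified factors with bounds independent of n. Tested against
∂^w ψ it passes to the limit by dominated convergence, so no Leibniz rule for weak derivatives is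
needed. Neither factor has to be in L². -/
theorem reg_mul (m : ℕ) : ∃ C, 1 ≤ C ∧ ∀ (f g : Space N → ℝ) (A B Mf Mg : ℝ), 0 ≤ A → 0 ≤ B →
    0 ≤ Mf → 0 ≤ Mg → Reg 1 m Mf f → Reg 1 m Mg g → (∀ᵐ x, |f x| ≤ A) → (∀ᵐ x, |g x| ≤ B) →
    Reg 1 m (C * (A * Mg + B * Mf)) (fun x => f x * g x) := by
  choose C hC0 hC using fun j => tame_mul (N := N) j
  have hS : ∀ j ∈ Finset.range (m + 1), C j ≤ ∑ j ∈ Finset.range (m + 1), C j := fun j hj =>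
    Finset.single_le_sum (fun j _ => hC0 j) hj
  refine ⟨1 + ∑ j ∈ Finset.range (m + 1), C j, by
    linarith [Finset.sum_nonneg (s := Finset.range (m + 1)) fun j _ => hC0 j],
    fun f g A B Mf Mg hA0 hB0 hMf hMg hf hg hA hB => ?_⟩
  refine ⟨locallyIntegrable_mul_bdd hg.1 hf.1.aestronglyMeasurable hA, fun w h1 h2 ψ hψ => ?_⟩
  set Cw := C w.length
  -- The scaling argument needs positive supremum bounds, hence A + δ and B + δ, with δ → 0 at the
  -- end.
  have key : ∀ δ : ℝ, 0 < δ → |∫ x, f x * g x * D w ψ x| ≤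
      (Cw * ((A + δ) * Mg + (B + δ) * Mf)) * nrm ψ := by
    intro δ hδ
    have hn : ∀ n, |∫ x, mol n f x * mol n g x * D w ψ x| ≤
        (Cw * ((A + δ) * Mg + (B + δ) * Mf)) * nrm ψ := by
      intro n
      have hf' : Reg 1 w.length Mf f := hf.mono le_rfl h2 le_rfl
      have hg' : Reg 1 w.length Mg g := hg.mono le_rfl h2 le_rfl
      have htf := hf'.tame_mol hMf (hA.mono fun x hx => hx.trans (by linarith : A ≤ A + δ)) n
      have htg := hg'.tame_mol hMg (hB.mono fun x hx => hx.trans (by linarith : B ≤ B + δ)) n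
      have := hC w.length _ _ _ _ (by positivity) (by positivity) htf htg Mf Mg
        (fun v hv => ((hf'.2 v (by omega) (by omega)).mol hf.1 hMf n).2.1)
        (fun v hv => ((hg'.2 v (by omega) (by omega)).mol hg.1 hMg n).2.1) hMf hMg h1 w rfl
      rw [integral_mul_D (htf.smooth.mul htg.smooth) hψ, abs_mul]
      simp only [abs_pow, abs_neg, abs_one, one_pow, one_mul]
      refine (abs_integral_mul_le this.1 (hψ.memLp 2)).trans ?_
      exact mul_le_mul_of_nonneg_right this.2 (nrm_nonneg ψ)
    have hlim : Tendsto (fun n => ∫ x, mol n f x * mol n g x * D w ψ x) atTop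
        (𝓝 (∫ x, f x * g x * D w ψ x)) := by
      refine tendsto_integral_of_dominated_convergence (fun x => A * B * |D w ψ x|)
        (fun n => ?_) ((hψ.D w).integrable.abs.const_mul _) (fun n => .of_forall fun x => ?_) ?_
      · exact (((contDiff_mol hf.1 n).continuous.mul (contDiff_mol hg.1 n).continuous).mul
          (hψ.D w).continuous).aestronglyMeasurable
      · rw [norm_mul, norm_mul]
        simp only [Real.norm_eq_abs]
        have h1 := abs_mol_le hf.1 hA n x
        have h2 := abs_mol_le hg.1 hB n x
        gcongr
      · filter_upwards [mol_ae_tendsto hf.1, mol_ae_tendsto hg.1] with x hx1 hx2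
        exact (hx1.mul hx2).mul_const _
    exact le_of_tendsto hlim.abs (.of_forall hn)
  have hlim2 : Tendsto (fun δ : ℝ => (Cw * ((A + δ) * Mg + (B + δ) * Mf)) * nrm ψ) (𝓝[>] 0)
      (𝓝 ((Cw * ((A + 0) * Mg + (B + 0) * Mf)) * nrm ψ)) := by
    have : Continuous fun δ : ℝ => (Cw * ((A + δ) * Mg + (B + δ) * Mf)) * nrm ψ := by fun_prop
    exact (this.tendsto 0).mono_left nhdsWithin_le_nhds
  have h3 := ge_of_tendsto hlim2 (eventually_mem_nhdsWithin.mono fun δ hδ => key δ hδ)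
  simp only [add_zero] at h3
  refine h3.trans (mul_le_mul_of_nonneg_right (mul_le_mul_of_nonneg_right ?_ (by positivity))
    (nrm_nonneg ψ))
  have := hS w.length (Finset.mem_range.2 (by omega))
  linarith

theorem reg_zero_of_one {m : ℕ} {M M' : ℝ} {f : Space N → ℝ} (h : Reg 1 m M f)
    (h' : DB [] M' f) : Reg 0 m (max M M') f := by
  refine ⟨h.1, fun w _ h2 => ?_⟩
  rcases Nat.eq_zero_or_pos w.length with hw | hw
  · obtain rfl : w = [] := List.eq_nil_of_length_eq_zero hw
    exact h'.mono (le_max_right _ _)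
  · exact (h.2 w hw h2).mono (le_max_left _ _)

/-- If one factor is in L² and the other is bounded, the product is in L² as well, which adds order
zero to `reg_mul`. -/
theorem reg_mul_zero (m : ℕ) : ∃ C, 1 ≤ C ∧ ∀ (f g : Space N → ℝ) (A B Mf Mg : ℝ), 0 ≤ A → 0 ≤ B →
    0 ≤ Mf → 0 ≤ Mg → Reg 1 m Mf f → Reg 0 m Mg g → (∀ᵐ x, |f x| ≤ A) → (∀ᵐ x, |g x| ≤ B) →
    Reg 0 m (C * (A * Mg + B * Mf)) (fun x => f x * g x) := by
  obtain ⟨C, hC1, hC⟩ := reg_mul (N := N) m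
  refine ⟨C, hC1, fun f g A B Mf Mg hA0 hB0 hMf hMg hf hg hA hB => ?_⟩
  have h1 := hC f g A B Mf Mg hA0 hB0 hMf hMg hf (hg.mono zero_le_one le_rfl le_rfl) hA hB
  obtain ⟨hg2, hgM⟩ := hg.memLp hMg
  have h2 := DB_nil_of_memLp (hg2.mul_bdd hf.1.aestronglyMeasurable hA)
  refine (reg_zero_of_one h1 h2).mono le_rfl le_rfl (max_le le_rfl ?_)
  refine (nrm_mul_le hg2 hA0 hA).trans ?_
  have h3 : A * nrm g ≤ A * Mg := by gcongr
  have h4 : 0 ≤ A * Mg + B * Mf := by positivity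
  nlinarith [mul_nonneg hB0 hMf]

end SineGordonRegime

end


noncomputable section

namespace SineGordonRegime

variable {N : ℕ}

/-! ### The Sobolev embedding -/

open FourierTransform SchwartzMap LineDeriv in
/-- A test function, as a complex-valued Schwartz function. -/
def toSchwartz {h : Space N → ℝ} (hh : IsTest h) : SchwartzMap (Space N) ℂ :=
  (hh.2.comp_left (g := fun t : ℝ => (t : ℂ)) (by simp)).toSchwartzMap
    (Complex.ofRealCLM.contDiff.comp hh.1)

theorem toSchwartz_apply {h : Space N → ℝ} (hh : IsTest h) (x : Space N) :
    toSchwartz hh x = (h x : ℂ) := rfl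

open FourierTransform SchwartzMap LineDeriv

theorem toSchwartz_partialDeriv {h : Space N → ℝ} (hh : IsTest h) (i : Fin N) :
    toSchwartz (hh.partialDeriv i) = ∂_{EuclideanSpace.single i (1 : ℝ)} (toSchwartz hh) := by
  ext x
  rw [lineDerivOp_apply_eq_fderiv, toSchwartz_apply]
  have h1 : HasFDerivAt (toSchwartz hh) (Complex.ofRealCLM.comp (fderiv ℝ h x)) x :=
    Complex.ofRealCLM.hasFDerivAt.comp x (hh.1.differentiableAt_space x).hasFDerivAt
  rw [h1.fderiv]
  rfl

theorem norm_fourier_partialDeriv {h : Space N → ℝ} (hh : IsTest h) (i : Fin N) (ξ : Space N) :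
    ‖𝓕 (toSchwartz (hh.partialDeriv i)) ξ‖ = 2 * Real.pi * |ξ i| * ‖𝓕 (toSchwartz hh) ξ‖ := by
  have ht : (fun x : Space N => inner ℝ x (EuclideanSpace.single i (1 : ℝ))).HasTemperateGrowth :=
    ((innerSL ℝ).flip (EuclideanSpace.single i (1 : ℝ))).hasTemperateGrowth
  rw [toSchwartz_partialDeriv hh, fourier_lineDerivOp_eq, _root_.smul_apply,
    smulLeftCLM_apply_apply ht, norm_smul, norm_smul]
  have e : inner ℝ ξ (EuclideanSpace.single i (1 : ℝ)) = ξ i := by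
    simp [EuclideanSpace.inner_single_right]
  rw [e]
  simp [abs_of_pos Real.pi_pos]
  ring

theorem norm_fourier_D_replicate {h : Space N → ℝ} (hh : IsTest h) (i : Fin N) (s : ℕ)
    (ξ : Space N) : |ξ i| ^ s * ‖𝓕 (toSchwartz hh) ξ‖ ≤
      ‖𝓕 (toSchwartz (hh.D (List.replicate s i))) ξ‖ := by
  induction s with
  | zero => simp
  | succ s ih =>
    have e : ‖𝓕 (toSchwartz (hh.D (List.replicate (s + 1) i))) ξ‖ =
      2 * Real.pi * |ξ i| * ‖𝓕 (toSchwartz (hh.D (List.replicate s i))) ξ‖ :=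
      norm_fourier_partialDeriv (hh.D (List.replicate s i)) i ξ
    rw [e, pow_succ]
    have hpi : 1 ≤ 2 * Real.pi := by linarith [Real.pi_gt_three]
    calc |ξ i| ^ s * |ξ i| * ‖𝓕 (toSchwartz hh) ξ‖
        = 1 * |ξ i| * (|ξ i| ^ s * ‖𝓕 (toSchwartz hh) ξ‖) := by ring
      _ ≤ _ := by gcongr

theorem integral_norm_sq_fourier_toSchwartz {h : Space N → ℝ} (hh : IsTest h) :
    ∫ ξ, ‖𝓕 (toSchwartz hh) ξ‖ ^ 2 = nrm h ^ 2 := by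
  rw [SchwartzMap.integral_norm_sq_fourier, ← integral_sq_eq (hh.memLp 2)]
  congr 1
  funext x
  simp [toSchwartz_apply]

theorem integrable_norm_sq_schwartz (F : SchwartzMap (Space N) ℂ) :
    Integrable (fun ξ => ‖F ξ‖ ^ 2) volume :=
  (F.memLp 2 volume).integrable_norm_pow (by norm_num)

theorem abs_le_integral_norm_fourier {h : Space N → ℝ} (hh : IsTest h) (x : Space N) :
    |h x| ≤ ∫ ξ, ‖𝓕 (toSchwartz hh) ξ‖ := by
  have h1 : toSchwartz hh x = (𝓕⁻ (𝓕 (toSchwartz hh))) x := by simp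
  have h2 : |h x| = ‖toSchwartz hh x‖ := by simp [toSchwartz_apply]
  rw [h2, h1, SchwartzMap.fourierInv_coe, Real.fourierInv_eq]
  refine (norm_integral_le_integral_norm _).trans_eq ?_
  congr 1
  funext ξ
  rw [Circle.norm_smul]

/-- With b the maximum of 1 and the squares of the coordinates of ξ, the left side is at most ((N +
1) b)^s, and b^s is one of the terms on the right. Thus only pure derivatives ∂ᵢ^s are needed. -/
theorem one_add_norm_sq_pow_le (s : ℕ) (ξ : Space N) :
    (1 + ‖ξ‖ ^ 2) ^ s ≤ ((N : ℝ) + 1) ^ s * (1 + ∑ i, (|ξ i| ^ s) ^ 2) := by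
  have key : ∀ b : ℝ, 1 ≤ b → (∀ i, ξ i ^ 2 ≤ b) →
      (1 + ‖ξ‖ ^ 2) ^ s ≤ ((N : ℝ) + 1) ^ s * b ^ s := by
    intro b h1 h2
    rw [← mul_pow]
    refine pow_le_pow_left₀ (by positivity) ?_ s
    rw [EuclideanSpace.real_norm_sq_eq]
    calc 1 + ∑ i, ξ i ^ 2 ≤ b + ∑ _i : Fin N, b := by
          gcongr with i
          exact h2 i
      _ = ((N : ℝ) + 1) * b := by simp; ring
  have hpow : ∀ i, (|ξ i| ^ s) ^ 2 = (ξ i ^ 2) ^ s := by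
    intro i
    rw [← pow_mul, mul_comm, pow_mul, sq_abs]
  by_cases hall : ∀ i, ξ i ^ 2 ≤ 1
  · refine (key 1 le_rfl hall).trans ?_
    gcongr
    simp only [one_pow, le_add_iff_nonneg_right]
    positivity
  · push Not at hall
    obtain ⟨i₀, hi₀⟩ := hall
    obtain ⟨j, -, hj⟩ := Finset.exists_max_image Finset.univ (fun i => ξ i ^ 2) ⟨i₀, Finset.mem_univ _⟩
    refine (key (ξ j ^ 2) (hi₀.le.trans (hj i₀ (Finset.mem_univ _)))
      (fun i => hj i (Finset.mem_univ _))).trans ?_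
    gcongr
    rw [← hpow]
    have := Finset.single_le_sum (f := fun i => (|ξ i| ^ s) ^ 2) (fun i _ => by positivity)
      (Finset.mem_univ j)
    simp only at this
    linarith

/-- Fourier inversion bounds |h| by the L¹ norm of its transform. Cauchy-Schwarz with the weight (1
+ |ξ|²)^(−s/2), square integrable because 2s > N, and Plancherel conclude. -/
theorem sobolev_test {s : ℕ} (hs : (N : ℝ) / 2 < s) : ∃ C, 0 ≤ C ∧ ∀ (h : Space N → ℝ),
    IsTest h → ∀ M, 0 ≤ M → (∀ w : List (Fin N), w.length ≤ s → nrm (D w h) ≤ M) →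
    ∀ x, |h x| ≤ C * M := by
  set a : Space N → ℝ := fun ξ => √((1 + ‖ξ‖ ^ 2) ^ s)⁻¹ with ha
  have hpos : ∀ ξ : Space N, 0 < (1 + ‖ξ‖ ^ 2) ^ s := fun ξ => by positivity
  have hac : Continuous a := by
    refine Real.continuous_sqrt.comp (Continuous.inv₀ (by fun_prop) fun ξ => (hpos ξ).ne')
  have ha2 : MemLp a 2 volume := by
    refine (memLp_two_iff_integrable_sq hac.aestronglyMeasurable).2 ?_
    have h1 := integrable_rpow_neg_one_add_norm_sq (E := Space N) (μ := volume) (r := 2 * s)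
      (by rw [finrank_euclideanSpace_fin]; linarith)
    refine h1.congr (.of_forall fun ξ => ?_)
    simp only [ha]
    rw [Real.sq_sqrt (inv_nonneg.2 (hpos ξ).le)]
    have e : (-(2 * (s : ℝ)) / 2) = -(s : ℝ) := by ring
    rw [e, Real.rpow_neg (by positivity), Real.rpow_natCast]
  set Q : ℝ := ((N : ℝ) + 1) ^ s * (N + 1) with hQ
  refine ⟨nrm a * √Q, mul_nonneg (nrm_nonneg a) (Real.sqrt_nonneg _), fun h hh M hM hMw x => ?_⟩
  set F := 𝓕 (toSchwartz hh) with hF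
  set b : Space N → ℝ := fun ξ => √((1 + ‖ξ‖ ^ 2) ^ s) * ‖F ξ‖ with hb
  have hbc : Continuous b :=
    (Real.continuous_sqrt.comp (by fun_prop)).mul F.continuous.norm
  have hbsq : ∀ ξ, b ξ ^ 2 ≤ ((N : ℝ) + 1) ^ s * (‖F ξ‖ ^ 2 +
      ∑ i, ‖𝓕 (toSchwartz (hh.D (List.replicate s i))) ξ‖ ^ 2) := by
    intro ξ
    simp only [hb]
    rw [mul_pow, Real.sq_sqrt (hpos ξ).le]
    calc (1 + ‖ξ‖ ^ 2) ^ s * ‖F ξ‖ ^ 2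
        ≤ (((N : ℝ) + 1) ^ s * (1 + ∑ i, (|ξ i| ^ s) ^ 2)) * ‖F ξ‖ ^ 2 := by
          gcongr
          exact one_add_norm_sq_pow_le s ξ
      _ = ((N : ℝ) + 1) ^ s * (‖F ξ‖ ^ 2 + ∑ i, (|ξ i| ^ s * ‖F ξ‖) ^ 2) := by
          simp only [mul_pow, ← Finset.sum_mul]
          ring
      _ ≤ _ := by
          gcongr with i
          exact norm_fourier_D_replicate hh i s ξ
  have hi : Integrable (fun ξ => ((N : ℝ) + 1) ^ s * (‖F ξ‖ ^ 2 +
      ∑ i, ‖𝓕 (toSchwartz (hh.D (List.replicate s i))) ξ‖ ^ 2)) volume :=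
    ((integrable_norm_sq_schwartz F).add
      (integrable_finsetSum _ fun i _ => integrable_norm_sq_schwartz _)).const_mul _
  have hb2i : Integrable (fun ξ => b ξ ^ 2) volume :=
    hi.mono' (hbc.pow 2).aestronglyMeasurable (.of_forall fun ξ => by
      rw [Real.norm_of_nonneg (sq_nonneg _)]; exact hbsq ξ)
  have hb2 : MemLp b 2 volume := (memLp_two_iff_integrable_sq hbc.aestronglyMeasurable).2 hb2i
  have hbn : nrm b ≤ √Q * M := by
    refine nrm_le_sqrt hb2 ?_ (by positivity)
    rw [mul_pow, Real.sq_sqrt (by positivity)]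
    refine (integral_mono hb2i hi hbsq).trans ?_
    rw [integral_const_mul]
    have e1 : ∫ ξ, (‖F ξ‖ ^ 2 + ∑ i, ‖𝓕 (toSchwartz (hh.D (List.replicate s i))) ξ‖ ^ 2) =
        nrm h ^ 2 + ∑ i, nrm (D (List.replicate s i) h) ^ 2 := by
      rw [integral_add (integrable_norm_sq_schwartz F)
        (integrable_finsetSum _ fun i _ => integrable_norm_sq_schwartz _),
        integral_finsetSum _ fun i _ => integrable_norm_sq_schwartz _,
        integral_norm_sq_fourier_toSchwartz]
      congr 1
      exact Finset.sum_congr rfl fun i _ => integral_norm_sq_fourier_toSchwartz _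
    rw [e1, hQ, mul_assoc]
    gcongr
    calc nrm h ^ 2 + ∑ i, nrm (D (List.replicate s i) h) ^ 2 ≤ M ^ 2 + ∑ _i : Fin N, M ^ 2 := by
          gcongr with i
          · exact nrm_nonneg h
          · exact hMw [] (by simp)
          · exact nrm_nonneg _
          · exact hMw _ (by simp)
      _ = _ := by simp; ring
  calc |h x| ≤ ∫ ξ, ‖F ξ‖ := abs_le_integral_norm_fourier hh x
    _ = ∫ ξ, a ξ * b ξ := by
        congr 1
        funext ξ
        simp only [ha, hb]
        rw [← mul_assoc, ← Real.sqrt_mul (inv_nonneg.2 (hpos ξ).le),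
          inv_mul_cancel₀ (hpos ξ).ne', Real.sqrt_one, one_mul]
    _ ≤ nrm a * nrm b := (le_abs_self _).trans (abs_integral_mul_le ha2 hb2)
    _ ≤ nrm a * (√Q * M) := mul_le_mul_of_nonneg_left hbn (nrm_nonneg a)
    _ = _ := by ring

theorem D_comp_sub (χ : Space N → ℝ) (x₀ : Space N) (w : List (Fin N)) :
    D w (fun y => χ (y - x₀)) = fun y => D w χ (y - x₀) := by
  induction w with
  | nil => rfl
  | cons i w ih =>
    rw [D_cons, ih]
    funext y
    simp only [partialDeriv, D_cons]
    rw [fderiv_comp_sub]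

theorem exists_bound_D {χ : Space N → ℝ} (hχ : IsTest χ) (s : ℕ) :
    ∃ C, 0 ≤ C ∧ ∀ w : List (Fin N), w.length ≤ s → ∀ x, |D w χ x| ≤ C := by
  choose C hC using fun w : List (Fin N) =>
    (hχ.D w).2.exists_bound_of_continuous (hχ.D w).continuous
  obtain ⟨B, hB⟩ := ((List.finite_length_le (Fin N) s).image C).bddAbove
  refine ⟨max B 0, le_max_right _ _, fun w hw x => ?_⟩
  exact (hC w x).trans ((hB ⟨w, hw, rfl⟩).trans (le_max_left _ _))

/-- Multiply by a cutoff centred at the point of evaluation. Its derivative bounds are translation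
invariant, so the constant does not depend on the point. -/
theorem sobolev_smooth {s : ℕ} (hs : (N : ℝ) / 2 < s) : ∃ C, 0 ≤ C ∧ ∀ (f : Space N → ℝ),
    ContDiff ℝ ∞ f → ∀ M, 0 ≤ M →
    (∀ w : List (Fin N), w.length ≤ s → MemLp (D w f) 2 volume ∧ nrm (D w f) ≤ M) →
    ∀ x, |f x| ≤ C * M := by
  obtain ⟨C, hC0, hC⟩ := sobolev_test hs
  let χ₀ : ContDiffBump (0 : Space N) := ⟨1, 2, one_pos, one_lt_two⟩
  set χ : Space N → ℝ := fun x => χ₀ x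
  have hχ : IsTest χ := ⟨χ₀.contDiff, χ₀.hasCompactSupport⟩
  have hχ0 : χ 0 = 1 := χ₀.one_of_mem_closedBall (by simp [χ₀])
  obtain ⟨B, hB0, hB⟩ := exists_bound_D hχ s
  refine ⟨C * (2 ^ s * B), by positivity, fun f hf M hM hMw x₀ => ?_⟩
  have hsm : ContDiff ℝ ∞ fun y => χ (y - x₀) := hχ.1.comp (contDiff_id.sub contDiff_const)
  have hχx : IsTest fun y => χ (y - x₀) :=
    ⟨hsm, hχ.2.comp_homeomorph (Homeomorph.subRight x₀)⟩
  have ht : IsTest fun y => χ (y - x₀) * f y := by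
    have := hχx.mul_smooth hf
    simpa only [mul_comm] using this
  have hw : ∀ w : List (Fin N), w.length ≤ s →
      nrm (D w fun y => χ (y - x₀) * f y) ≤ 2 ^ s * B * M := by
    intro w hw
    have := (nrm_D_mul_le hsm hf (m := w.length) (K := B * M) ?_ w [] [] (by simp)).2
    · simp only [D_nil] at this
      refine this.trans ?_
      rw [mul_assoc]
      gcongr
      norm_num
    · intro u v huv
      obtain ⟨h1, h2⟩ := hMw v (by omega)
      have hb : ∀ x, |D u (fun y => χ (y - x₀)) x| ≤ B := fun x => by
        rw [D_comp_sub]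
        exact hB u (by omega) _
      refine ⟨h1.mul_bdd (contDiff_D hsm u).continuous.aestronglyMeasurable (.of_forall hb),
        (nrm_mul_le h1 hB0 (.of_forall hb)).trans ?_⟩
      gcongr
  have := hC _ ht (2 ^ s * B * M) (by positivity) hw x₀
  simp only [sub_self, hχ0, one_mul] at this
  linarith

theorem sobolev {s : ℕ} (hs : (N : ℝ) / 2 < s) : ∃ C, 1 ≤ C ∧ ∀ (f : Space N → ℝ) (M : ℝ), 0 ≤ M →
    Reg 0 s M f → ∀ᵐ x, |f x| ≤ C * M := by
  obtain ⟨C, _, hC⟩ := sobolev_smooth hs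
  refine ⟨C + 1, by linarith, fun f M hM hf => ?_⟩
  have hn : ∀ n x, |mol n f x| ≤ C * M := fun n =>
    hC _ (contDiff_mol hf.1 n) M hM fun w hw => by
      have := (hf.2 w (by simp) hw).mol hf.1 hM n
      exact ⟨this.1, this.2.1⟩
  filter_upwards [mol_ae_tendsto hf.1] with x hx
  have := le_of_tendsto hx.abs (.of_forall fun n => hn n x)
  linarith

end SineGordonRegime

end


noncomputable section

namespace SineGordonRegime

variable {N : ℕ}

/-! ### The weak chain rule -/

/-- The classical chain rule for the mollified f, followed by a limit. F need only be controlled on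
a set J that contains the values of f and of its mollifications: the whole line for the cosine, |t|
≤ 1/√2 for 1/(1 − t²). -/
theorem weak_chain_rule {F F' : ℝ → ℝ} {J : Set ℝ} {A B : ℝ} (hF : ∀ t ∈ J, HasDerivAt F (F' t) t)
    (hFA : ∀ t ∈ J, |F t| ≤ A) (hF'c : ContinuousOn F' J) (hF'B : ∀ t ∈ J, |F' t| ≤ B)
    {f g : Space N → ℝ} (hf : LocallyIntegrable f volume) (hg : MemLp g 2 volume) {i : Fin N}
    (hfg : ∀ ψ, IsTest ψ → ∫ x, f x * partialDeriv i ψ x = ∫ x, g x * ψ x)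
    (hfJ : ∀ᵐ x, f x ∈ J) (hmol : ∀ n x, mol n f x ∈ J) :
    AEStronglyMeasurable (fun x => F (f x)) volume ∧
    AEStronglyMeasurable (fun x => F' (f x)) volume ∧
    ∀ ψ, IsTest ψ → ∫ x, F (f x) * partialDeriv i ψ x = ∫ x, F' (f x) * g x * ψ x := by
  have hFc : ContinuousOn F J := fun t ht => (hF t ht).continuousAt.continuousWithinAt
  have hmc : ∀ n, Continuous (mol n f) := fun n => (contDiff_mol hf n).continuous
  have hFm : ∀ n, Continuous fun x => F (mol n f x) := fun n =>
    hFc.comp_continuous (hmc n) (hmol n)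
  have hF'm : ∀ n, Continuous fun x => F' (mol n f x) := fun n =>
    hF'c.comp_continuous (hmc n) (hmol n)
  have hlimF : ∀ᵐ x, Tendsto (fun n => F (mol n f x)) atTop (𝓝 (F (f x))) := by
    filter_upwards [mol_ae_tendsto hf, hfJ] with x hx hxJ
    exact (hF _ hxJ).continuousAt.tendsto.comp hx
  have hlimF' : ∀ᵐ x, Tendsto (fun n => F' (mol n f x)) atTop (𝓝 (F' (f x))) := by
    filter_upwards [mol_ae_tendsto hf, hfJ] with x hx hxJ
    exact (hF'c _ hxJ).tendsto.comp
      (tendsto_nhdsWithin_iff.2 ⟨hx, .of_forall fun n => hmol n x⟩)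
  have hFmeas : AEStronglyMeasurable (fun x => F (f x)) volume :=
    aestronglyMeasurable_of_tendsto_ae atTop (fun n => (hFm n).aestronglyMeasurable) hlimF
  have hF'meas : AEStronglyMeasurable (fun x => F' (f x)) volume :=
    aestronglyMeasurable_of_tendsto_ae atTop (fun n => (hF'm n).aestronglyMeasurable) hlimF'
  refine ⟨hFmeas, hF'meas, fun ψ hψ => ?_⟩
  have hD : ∀ n, partialDeriv i (mol n f) = -mol n g := fun n => by
    have := D_mol_eq hf hg.locallyIntegrable_two (w := [i]) (by simpa using hfg) n
    simpa using this
  have hB0 : 0 ≤ B := (abs_nonneg _).trans (hF'B _ (hmol 0 0))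
  have hmg : ∀ n, MemLp (mol n g) 2 volume := fun n => (memLp_mol hg n).1
  have hψ2 := hψ.memLp 2
  have hstep : ∀ n, ∫ x, F (mol n f x) * partialDeriv i ψ x =
      ∫ x, F' (mol n f x) * (mol n g x * ψ x) := by
    intro n
    have hd : ∀ x, HasFDerivAt (fun x => F (mol n f x)) (F' (mol n f x) • fderiv ℝ (mol n f) x) x :=
      fun x => (hF _ (hmol n x)).comp_hasFDerivAt x
        ((contDiff_mol hf n).differentiableAt_space x).hasFDerivAt
    have hDx : ∀ x, (F' (mol n f x) • fderiv ℝ (mol n f) x) (EuclideanSpace.single i 1) * ψ x =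
        -(F' (mol n f x) * (mol n g x * ψ x)) := by
      intro x
      have := congrFun (hD n) x
      simp only [partialDeriv, Pi.neg_apply] at this
      simp only [_root_.smul_apply, smul_eq_mul, this]
      ring
    have hi : Integrable (fun x => F' (mol n f x) * (mol n g x * ψ x)) volume :=
      ((hmg n).integrable_mul hψ2).bdd_mul (c := B) (hF'm n).aestronglyMeasurable
        (.of_forall fun x => hF'B _ (hmol n x))
    have := integral_bilinear_hasFDerivAt_right_eq_neg_left_of_integrable (μ := volume)
      (B := ContinuousLinearMap.mul ℝ ℝ) (f := fun x => F (mol n f x))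
      (f' := fun x => F' (mol n f x) • fderiv ℝ (mol n f) x) (g := ψ) (g' := fderiv ℝ ψ)
      (v := EuclideanSpace.single i 1)
      (by simp only [ContinuousLinearMap.mul_apply', hDx]; exact hi.neg)
      (by
        simp only [ContinuousLinearMap.mul_apply']
        exact (hFm n).locallyIntegrable.integrable_mul_test (hψ.partialDeriv i))
      (by
        simp only [ContinuousLinearMap.mul_apply']
        exact (hFm n).locallyIntegrable.integrable_mul_test hψ)
      (fun x _ => hd x) (fun x _ => (hψ.1.differentiableAt_space x).hasFDerivAt)
    simp only [ContinuousLinearMap.mul_apply', hDx, integral_neg, neg_neg] at this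
    exact this
  have hL : Tendsto (fun n => ∫ x, F (mol n f x) * partialDeriv i ψ x) atTop
      (𝓝 (∫ x, F (f x) * partialDeriv i ψ x)) := by
    refine tendsto_integral_of_dominated_convergence (fun x => A * |partialDeriv i ψ x|)
      (fun n => ((hFm n).mul (hψ.partialDeriv i).continuous).aestronglyMeasurable)
      ((hψ.partialDeriv i).integrable.abs.const_mul A) (fun n => .of_forall fun x => ?_) ?_
    · rw [norm_mul]
      exact mul_le_mul_of_nonneg_right (hFA _ (hmol n x)) (abs_nonneg _)
    · filter_upwards [hlimF] with x hx
      exact hx.mul_const _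
  have hR1 : Tendsto (fun n => ∫ x, F' (mol n f x) * (g x * ψ x)) atTop
      (𝓝 (∫ x, F' (f x) * (g x * ψ x))) := by
    have hi : Integrable (fun x => g x * ψ x) volume := hg.integrable_mul hψ2
    refine tendsto_integral_of_dominated_convergence (fun x => B * |g x * ψ x|)
      (fun n => (hF'm n).aestronglyMeasurable.mul hi.1)
      (hi.abs.const_mul B) (fun n => .of_forall fun x => ?_) ?_
    · rw [norm_mul]
      exact mul_le_mul_of_nonneg_right (hF'B _ (hmol n x)) (abs_nonneg _)
    · filter_upwards [hlimF'] with x hx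
      exact hx.mul_const _
  -- The product of two converging sequences is split: with g fixed, dominated convergence applies
  -- to F' of the mollified f; the error from replacing g by its mollification tends to zero in L².
  have hR2 : Tendsto (fun n => ∫ x, F' (mol n f x) * ((mol n g - g) x * ψ x)) atTop (𝓝 0) := by
    have h0 : Tendsto (fun n => B * nrm (mol n g - g) * nrm ψ) atTop (𝓝 (B * 0 * nrm ψ)) :=
      ((mol_tendsto_L2 hg).const_mul B).mul_const _
    rw [mul_zero, zero_mul] at h0
    refine squeeze_zero_norm (fun n => ?_) h0
    have hm : MemLp (mol n g - g) 2 volume := (hmg n).sub hg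
    have hm2 := hm.mul_bdd (hF'm n).aestronglyMeasurable (.of_forall fun x => hF'B _ (hmol n x))
    have := abs_integral_mul_le hm2 hψ2
    simp only [mul_assoc] at this
    rw [Real.norm_eq_abs]
    refine this.trans (mul_le_mul_of_nonneg_right ?_ (nrm_nonneg ψ))
    exact nrm_mul_le hm hB0 (.of_forall fun x => hF'B _ (hmol n x))
  have hsum := hR1.add hR2
  rw [add_zero] at hsum
  have heq : ∀ n, ∫ x, F (mol n f x) * partialDeriv i ψ x =
      (∫ x, F' (mol n f x) * (g x * ψ x)) + ∫ x, F' (mol n f x) * ((mol n g - g) x * ψ x) := by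
    intro n
    rw [hstep, ← integral_add]
    · congr 1
      funext x
      simp only [Pi.sub_apply]
      ring
    · exact (hg.integrable_mul hψ2).bdd_mul (c := B) (hF'm n).aestronglyMeasurable
        (.of_forall fun x => hF'B _ (hmol n x))
    · exact (((hmg n).sub hg).integrable_mul hψ2).bdd_mul (c := B) (hF'm n).aestronglyMeasurable
        (.of_forall fun x => hF'B _ (hmol n x))
  simp only [heq] at hL
  rw [tendsto_nhds_unique hL hsum]
  simp only [mul_assoc]

/-! ### Bounded regular functions -/

/-- `f` is bounded by `A`, and its derivatives of orders `a, …, m` are bounded by `M` in `L²`. -/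
def BReg (a m : ℕ) (A M : ℝ) (f : Space N → ℝ) : Prop :=
  Reg a m M f ∧ ∀ᵐ x, |f x| ≤ A

theorem BReg.mono {a m a' m' : ℕ} {A M A' M' : ℝ} {f : Space N → ℝ} (h : BReg a m A M f)
    (ha : a ≤ a') (hm : m' ≤ m) (hA : A ≤ A') (hM : M ≤ M') : BReg a' m' A' M' f :=
  ⟨h.1.mono ha hm hM, h.2.mono fun _ hx => hx.trans hA⟩

theorem BReg.smul {a m : ℕ} {A M : ℝ} {f : Space N → ℝ} (h : BReg a m A M f) (c : ℝ) :
    BReg a m (|c| * A) (|c| * M) (fun x => c * f x) :=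
  ⟨h.1.smul c, h.2.mono fun x hx => by
    rw [abs_mul]; exact mul_le_mul_of_nonneg_left hx (abs_nonneg c)⟩

/-- No order lies between 1 and 0, so the derivative bound is vacuous and M is arbitrary. -/
theorem BReg.ofZero {A M : ℝ} {f : Space N → ℝ} (hf : AEStronglyMeasurable f volume)
    (hA : ∀ᵐ x, |f x| ≤ A) : BReg 1 0 A M f :=
  ⟨⟨locallyIntegrable_of_bdd hf hA, fun w h1 h2 => by omega⟩, hA⟩

/-- A constant for the product estimates up to order `m`. -/
theorem exists_mul_const (N m : ℕ) : ∃ C, 1 ≤ C ∧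
    (∀ (f g : Space N → ℝ) (A B Mf Mg : ℝ), 0 ≤ A → 0 ≤ B → 0 ≤ Mf → 0 ≤ Mg →
      BReg 1 m A Mf f → BReg 1 m B Mg g →
      BReg 1 m (A * B) (C * (A * Mg + B * Mf)) (fun x => f x * g x)) ∧
    (∀ (f g : Space N → ℝ) (A B Mf Mg : ℝ), 0 ≤ A → 0 ≤ B → 0 ≤ Mf → 0 ≤ Mg →
      BReg 1 m A Mf f → BReg 0 m B Mg g →
      BReg 0 m (A * B) (C * (A * Mg + B * Mf)) (fun x => f x * g x)) := by
  obtain ⟨C, hC1, hC⟩ := reg_mul (N := N) m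
  obtain ⟨C', hC1', hC'⟩ := reg_mul_zero (N := N) m
  have hAB : ∀ (f g : Space N → ℝ) (A B : ℝ), 0 ≤ A → (∀ᵐ x, |f x| ≤ A) → (∀ᵐ x, |g x| ≤ B) →
      ∀ᵐ x, |f x * g x| ≤ A * B := by
    intro f g A B hA h1 h2
    filter_upwards [h1, h2] with x h1 h2
    rw [abs_mul]
    exact mul_le_mul h1 h2 (abs_nonneg _) hA
  refine ⟨max C C', le_max_of_le_left hC1, ?_, ?_⟩
  · intro f g A B Mf Mg hA hB hMf hMg hf hg
    refine ⟨(hC f g A B Mf Mg hA hB hMf hMg hf.1 hg.1 hf.2 hg.2).mono le_rfl le_rfl ?_,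
      hAB f g A B hA hf.2 hg.2⟩
    gcongr
    exact le_max_left _ _
  · intro f g A B Mf Mg hA hB hMf hMg hf hg
    refine ⟨(hC' f g A B Mf Mg hA hB hMf hMg hf.1 hg.1 hf.2 hg.2).mono le_rfl le_rfl ?_,
      hAB f g A B hA hf.2 hg.2⟩
    gcongr
    exact le_max_right _ _

/-- If `Φ` has a bounded gradient in `H^m` and `sin Φ ∈ H^m`, then `∇ cos Φ ∈ H^m`. -/
theorem breg_cos (N m : ℕ) : ∃ C, 1 ≤ C ∧ ∀ (Φ : Space N → ℝ) (K S : ℝ), 0 ≤ K → 0 ≤ S →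
    Reg 1 (m + 1) K Φ → (∀ i, ∀ᵐ x, |weakPartial i Φ x| ≤ S) →
    Reg 0 m K (fun x => Real.sin (Φ x)) →
    BReg 1 (m + 1) 1 (C * (K + S * K)) (fun x => Real.cos (Φ x)) := by
  obtain ⟨C, hC1, -, hC⟩ := exists_mul_const N m
  refine ⟨C, hC1, fun Φ K S hK hS hΦ hgrad hsin => ?_⟩
  have hcosm : AEStronglyMeasurable (fun x => Real.cos (Φ x)) volume :=
    Real.continuous_cos.comp_aestronglyMeasurable hΦ.1.aestronglyMeasurable
  have hcosb : ∀ᵐ x, |Real.cos (Φ x)| ≤ 1 := .of_forall fun x => Real.abs_cos_le_one _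
  refine ⟨reg_of_partials (locallyIntegrable_of_bdd hcosm hcosb)
    (fun i x => -(Real.sin (Φ x) * weakPartial i Φ x)) ?_ ?_, hcosb⟩
  · intro i ψ hψ
    obtain ⟨h1, h2⟩ := hΦ.weakPartial_spec hK i
    have := (weak_chain_rule (F := Real.cos) (F' := fun t => -Real.sin t) (J := Set.univ)
      (A := 1) (B := 1) (fun t _ => Real.hasDerivAt_cos t) (fun t _ => Real.abs_cos_le_one t)
      (by fun_prop) (fun t _ => by rw [abs_neg]; exact Real.abs_sin_le_one t) hΦ.1 h1.neg (i := i)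
      (fun ψ hψ => by simp [h2 ψ hψ, integral_neg]) (by simp) (by simp)).2.2 ψ hψ
    rw [this, ← integral_neg]
    congr 1
    funext x
    simp
  · intro i
    -- The partial derivative of cos Φ is −sin Φ ∂ᵢΦ, a product of bounded H^m functions.
    have hg := hΦ.weakPartial hK i
    have := (hC (fun x => Real.sin (Φ x)) (weakPartial i Φ) 1 S K K zero_le_one hS hK hK
      ⟨hsin.mono zero_le_one le_rfl le_rfl, .of_forall fun x => Real.abs_sin_le_one _⟩
      ⟨hg, hgrad i⟩).smul (-1)
    simp only [abs_neg, abs_one, one_mul] at this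
    simpa only [neg_mul, one_mul] using this.1

/-- Regularity of `1 / (1 - y²)` for `|y| ≤ 1/√2`. -/
theorem breg_inv (N n : ℕ) : ∃ C, 0 ≤ C ∧ ∀ (y : Space N → ℝ) (Y Y' : ℝ), 0 ≤ Y → 0 ≤ Y' →
    Reg 1 (n + 1) Y y → (∀ᵐ x, |y x| ≤ 1 / √2) → (∀ i, ∀ᵐ x, |weakPartial i y x| ≤ Y') →
    BReg 1 n 2 (C * Y * (1 + Y') ^ (n - 1)) (fun x => (1 - y x ^ 2)⁻¹) := by
  have hsq : ∀ t : ℝ, |t| ≤ 1 / √2 → t ^ 2 ≤ 1 / 2 := by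
    intro t ht
    have := pow_le_pow_left₀ (abs_nonneg t) ht 2
    rw [sq_abs, div_pow, Real.sq_sqrt (by norm_num)] at this
    simpa using this
  have hinv : ∀ t : ℝ, |t| ≤ 1 / √2 → |(1 - t ^ 2)⁻¹| ≤ 2 := by
    intro t ht
    have := hsq t ht
    rw [abs_inv, abs_of_pos (by linarith), inv_le_comm₀ (by linarith) (by norm_num)]
    linarith
  have hr1 : (1 : ℝ) / √2 ≤ 1 := by
    rw [div_le_one (by positivity)]
    exact Real.one_le_sqrt.2 (by norm_num)
  have hmeas : ∀ y : Space N → ℝ, LocallyIntegrable y volume →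
      AEStronglyMeasurable (fun x => (1 - y x ^ 2)⁻¹) volume := fun y hy =>
    ((hy.aestronglyMeasurable.aemeasurable.pow_const 2).const_sub 1).inv.aestronglyMeasurable
  induction n with
  | zero =>
    refine ⟨0, le_rfl, fun y Y Y' _ _ hy hb _ => ?_⟩
    exact BReg.ofZero (hmeas y hy.1) (hb.mono fun x hx => hinv _ hx)
  | succ n ih =>
    -- Induction on the order: q = 1/(1 − y²) satisfies ∂q = 2 y q² ∂y. The tame estimate keeps the
    -- bound linear in Y and costs one factor 1 + Y' per further order.
    obtain ⟨C₀, hC₀, h₀⟩ := ih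
    obtain ⟨C, hC1, hC, hCz⟩ := exists_mul_const N n
    have hC0 : 0 ≤ C := by linarith
    refine ⟨C * (8 + 2 * (C * (4 + C * (4 * C₀)))), by positivity,
      fun y Y Y' hY hY' hy hb hgrad => ?_⟩
    have hq0 := h₀ y Y Y' hY hY' (hy.mono le_rfl (by omega) le_rfl) hb hgrad
    -- At n = 0 the truncated exponent n − 1 is 0, and Y' times that bound would exceed the target
    -- power (1 + Y')^0. There the derivative bound is vacuous, so 0 is used; Z below follows the
    -- same pattern.
    set Q : ℝ := if n = 0 then 0 else C₀ * Y * (1 + Y') ^ (n - 1) with hQ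
    have hQ0 : 0 ≤ Q := by rw [hQ]; split_ifs <;> positivity
    have hq : BReg 1 n 2 Q (fun x => (1 - y x ^ 2)⁻¹) := by
      rw [hQ]
      split_ifs with hn
      · subst hn
        exact BReg.ofZero (hmeas y hy.1) (hb.mono fun x hx => hinv _ hx)
      · exact hq0
    have hyB : BReg 1 n 1 (if n = 0 then 0 else Y) y := by
      split_ifs with hn
      · subst hn
        exact BReg.ofZero hy.1.aestronglyMeasurable (hb.mono fun x hx => hx.trans hr1)
      · exact ⟨hy.mono le_rfl (by omega) le_rfl, hb.mono fun x hx => hx.trans hr1⟩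
    set Z : ℝ := if n = 0 then 0 else Y with hZ
    have hZ0 : 0 ≤ Z := by rw [hZ]; split_ifs <;> positivity
    have hq2 := hC _ _ 2 2 Q Q (by norm_num) (by norm_num) hQ0 hQ0 hq hq
    have hyq := hC _ _ 1 (2 * 2) Z (C * (2 * Q + 2 * Q)) zero_le_one (by norm_num) hZ0
      (by positivity) hyB hq2
    refine ⟨reg_of_partials (locallyIntegrable_of_bdd (hmeas y hy.1)
      (hb.mono fun x hx => hinv _ hx)) (fun i x =>
        2 * (y x * ((1 - y x ^ 2)⁻¹ * (1 - y x ^ 2)⁻¹) * weakPartial i y x)) ?_ ?_,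
      hb.mono fun x hx => hinv _ hx⟩
    · intro i ψ hψ
      obtain ⟨h1, h2⟩ := hy.weakPartial_spec hY i
      have hne : ∀ t : ℝ, t ∈ {t : ℝ | |t| ≤ 1 / √2} → 1 - t ^ 2 ≠ 0 := fun t ht => by
        have := hsq t ht
        linarith
      have := (weak_chain_rule (F := fun t => (1 - t ^ 2)⁻¹)
        (F' := fun t => 2 * t * ((1 - t ^ 2)⁻¹ * (1 - t ^ 2)⁻¹)) (J := {t : ℝ | |t| ≤ 1 / √2})
        (A := 2) (B := 8) (fun t ht => by
          have h3 : HasDerivAt (fun t : ℝ => 1 - t ^ 2) (-(2 * t)) t := by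
            simpa using (hasDerivAt_pow 2 t).const_sub 1
          refine (h3.inv (hne t ht)).congr_deriv ?_
          have := hne t ht
          field_simp
          try ring) (fun t ht => hinv t ht)
        (by
          have : ContinuousOn (fun t : ℝ => (1 - t ^ 2)⁻¹) {t : ℝ | |t| ≤ 1 / √2} :=
            ContinuousOn.inv₀ (by fun_prop) hne
          fun_prop)
        (fun t ht => by
          rw [abs_mul, abs_mul, abs_mul, abs_two]
          have h4 := hinv t ht
          have h5 : |t| ≤ 1 := le_trans ht hr1
          calc 2 * |t| * (|(1 - t ^ 2)⁻¹| * |(1 - t ^ 2)⁻¹|) ≤ 2 * 1 * (2 * 2) := by gcongr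
            _ = 8 := by norm_num)
        hy.1 h1.neg (i := i)
        (fun ψ hψ => by simp [h2 ψ hψ, integral_neg]) hb (abs_mol_le hy.1 hb)).2.2 ψ hψ
      rw [this, ← integral_neg]
      congr 1
      funext x
      simp only [Pi.neg_apply]
      ring
    · intro i
      have hg := hy.weakPartial hY i
      have := (hCz _ _ _ Y' _ Y (by norm_num) hY' (by positivity) hY hyq ⟨hg.mono le_rfl (by omega) le_rfl, hgrad i⟩).smul 2
      refine this.1.mono le_rfl le_rfl ?_
      rw [abs_two]
      have hQle : Y' * Q ≤ C₀ * Y * (1 + Y') ^ n := by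
        rw [hQ]
        split_ifs with hn
        · rw [mul_zero]; positivity
        · obtain ⟨k, rfl⟩ := Nat.exists_eq_succ_of_ne_zero hn
          rw [Nat.succ_sub_one, pow_succ]
          calc Y' * (C₀ * Y * (1 + Y') ^ k) = C₀ * Y * ((1 + Y') ^ k * Y') := by ring
            _ ≤ C₀ * Y * ((1 + Y') ^ k * (1 + Y')) := by gcongr; linarith
      have hZle : Y' * Z ≤ Y * (1 + Y') ^ n := by
        rw [hZ]
        split_ifs with hn
        · rw [mul_zero]; positivity
        · obtain ⟨k, rfl⟩ := Nat.exists_eq_succ_of_ne_zero hn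
          rw [pow_succ]
          have : 1 ≤ (1 + Y') ^ k := one_le_pow₀ (by linarith)
          calc Y' * Y ≤ Y * (1 * (1 + Y')) := by nlinarith
            _ ≤ Y * ((1 + Y') ^ k * (1 + Y')) := by gcongr
      have h1 : Y ≤ Y * (1 + Y') ^ n := le_mul_of_one_le_right hY (one_le_pow₀ (by linarith))
      rw [Nat.add_sub_cancel]
      set P := Y * (1 + Y') ^ n with hP
      have hQle' : Y' * Q ≤ C₀ * P := by rw [hP]; linarith
      calc 2 * (C * (1 * (2 * 2) * Y + Y' * (C * (1 * (C * (2 * Q + 2 * Q)) + 2 * 2 * Z))))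
          = C * (8 * Y + 2 * (C * (C * (4 * (Y' * Q)) + 4 * (Y' * Z)))) := by ring
        _ ≤ C * (8 * P + 2 * (C * (C * (4 * (C₀ * P)) + 4 * P))) := by gcongr
        _ = C * (8 + 2 * (C * (4 + C * (4 * C₀)))) * P := by ring
        _ = _ := by rw [hP]; ring

end SineGordonRegime

end


noncomputable section

namespace SineGordonRegime

variable {N : ℕ}

/-! ### Weakly differentiable curves in `L²` -/

theorem nrm_neg (f : Space N → ℝ) : nrm (-f) = nrm f := by
  simp [nrm]

theorem nrm_sub_comm (f g : Space N → ℝ) : nrm (f - g) = nrm (g - f) := by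
  rw [← nrm_neg, neg_sub]

theorem exists_test_near {χ : Space N → ℝ} (hχ : MemLp χ 2 volume) {δ : ℝ} (hδ : 0 < δ) :
    ∃ ψ, IsTest ψ ∧ nrm (χ - ψ) < δ := by
  have hd := Lp.dense_hasCompactSupport_contDiff (p := 2) (F := ℝ)
    (μ := (volume : Measure (Space N))) (by norm_num)
  obtain ⟨f, hf, ψ, hfψ, hψ1, hψ2⟩ := Metric.dense_iff.1 hd (hχ.toLp χ) δ hδ
  refine ⟨ψ, ⟨hψ2, hψ1⟩, ?_⟩
  rw [Metric.mem_ball, dist_eq_norm, ← nrm_coe] at hf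
  rw [nrm_sub_comm]
  refine lt_of_eq_of_lt (nrm_congr ?_) hf
  filter_upwards [hfψ, hχ.coeFn_toLp, Lp.coeFn_sub f (hχ.toLp χ)] with x h1 h2 h3
  rw [h3, Pi.sub_apply, Pi.sub_apply, h1, h2]

theorem _root_.MeasureTheory.MemLp.integrable_mul_fun {f g : Space N → ℝ}
    (hf : MemLp f 2 volume) (hg : MemLp g 2 volume) : Integrable (fun x => f x * g x) volume :=
  hf.integrable_mul hg

theorem integral_sub_mul {f g h : Space N → ℝ} (hf : MemLp f 2 volume) (hg : MemLp g 2 volume)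
    (hh : MemLp h 2 volume) :
    ∫ x, (f - g) x * h x = (∫ x, f x * h x) - ∫ x, g x * h x := by
  rw [← integral_sub (hf.integrable_mul_fun hh) (hg.integrable_mul_fun hh)]
  congr 1
  funext x
  simp [sub_mul]

/-- A weak derivative bounded in `L²` gives a Lipschitz bound. -/
theorem nrm_sub_le_of_weak_deriv {I : Set ℝ} (hI : Convex ℝ I) {a : ℝ → Space N → ℝ} {B : ℝ}
    (hB : 0 ≤ B) {s t : ℝ} (hs : s ∈ I) (ht : t ∈ I)
    (ha : LocallyIntegrable (a s) volume) (ha' : LocallyIntegrable (a t) volume)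
    (h : ∀ ψ, IsTest ψ → ∀ r ∈ I, ∃ d, |d| ≤ B * nrm ψ ∧
      HasDerivWithinAt (fun s => ∫ x, a s x * ψ x) d I r) :
    MemLp (a s - a t) 2 volume ∧ nrm (a s - a t) ≤ B * |s - t| := by
  refine DB.memLp_of_nil (fun ψ hψ => ?_) (by positivity) (ha.sub ha')
  have hi : ∫ x, (a s - a t) x * D [] ψ x = (∫ x, a s x * ψ x) - ∫ x, a t x * ψ x := by
    rw [← integral_sub (ha.integrable_mul_test hψ) (ha'.integrable_mul_test hψ)]
    congr 1
    funext x
    simp [sub_mul]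
  rw [hi]
  choose! d hd hd' using h ψ hψ
  have := hI.norm_image_sub_le_of_norm_hasDerivWithin_le hd' hd ht hs
  calc _ ≤ B * nrm ψ * |s - t| := this
    _ = _ := by ring

theorem nrm_sub_le_of_weak_deriv_memLp {I : Set ℝ} (hI : Convex ℝ I) {a w : ℝ → Space N → ℝ}
    {B : ℝ} (ha : ∀ t ∈ I, MemLp (a t) 2 volume) (hw : ∀ t ∈ I, MemLp (w t) 2 volume)
    (hB : ∀ t ∈ I, nrm (w t) ≤ B)
    (h : ∀ ψ, IsTest ψ → ∀ t ∈ I,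
      HasDerivWithinAt (fun s => ∫ x, a s x * ψ x) (∫ x, w t x * ψ x) I t)
    {s t : ℝ} (hs : s ∈ I) (ht : t ∈ I) : nrm (a s - a t) ≤ B * |s - t| :=
  (nrm_sub_le_of_weak_deriv hI ((nrm_nonneg _).trans (hB t ht)) hs ht
    (ha s hs).locallyIntegrable_two (ha t ht).locallyIntegrable_two (fun ψ hψ r hr => ⟨_,
      (abs_integral_mul_le (hw r hr) (hψ.memLp 2)).trans (mul_le_mul_of_nonneg_right (hB r hr)
        (nrm_nonneg _)), h ψ hψ r hr⟩)).2

/-- The curve is Lipschitz in L², so replacing χ by a nearby test function changes the difference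
quotient by a small amount, uniformly in s. -/
theorem hasDerivWithinAt_integral_mul {I : Set ℝ} (hI : Convex ℝ I) {a w : ℝ → Space N → ℝ}
    {B : ℝ} (ha : ∀ t ∈ I, MemLp (a t) 2 volume) (hw : ∀ t ∈ I, MemLp (w t) 2 volume)
    (hB : ∀ t ∈ I, nrm (w t) ≤ B)
    (h : ∀ ψ, IsTest ψ → ∀ t ∈ I,
      HasDerivWithinAt (fun s => ∫ x, a s x * ψ x) (∫ x, w t x * ψ x) I t)
    {χ : Space N → ℝ} (hχ : MemLp χ 2 volume) {t : ℝ} (ht : t ∈ I) :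
    HasDerivWithinAt (fun s => ∫ x, a s x * χ x) (∫ x, w t x * χ x) I t := by
  have hB0 : 0 ≤ B := (nrm_nonneg _).trans (hB t ht)
  have hlip : ∀ s ∈ I, nrm (a s - a t) ≤ B * |s - t| := fun s hs =>
    nrm_sub_le_of_weak_deriv_memLp hI ha hw hB h hs ht
  rw [hasDerivWithinAt_iff_isLittleO, Asymptotics.isLittleO_iff]
  intro c hc
  obtain ⟨ψ, hψ, hψ'⟩ := exists_test_near hχ (δ := c / 2 / (2 * (B + 1))) (by positivity)
  have h1 := (Asymptotics.isLittleO_iff.1 (hasDerivWithinAt_iff_isLittleO.1 (h ψ hψ t ht)))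
    (half_pos hc)
  filter_upwards [h1, self_mem_nhdsWithin] with s h1 hs
  have hψ2 := hψ.memLp 2
  have hd : MemLp (χ - ψ) 2 volume := hχ.sub hψ2
  have e1 : ∀ f : Space N → ℝ, MemLp f 2 volume →
      ∫ x, f x * χ x = (∫ x, f x * ψ x) + ∫ x, f x * (χ - ψ) x := by
    intro f hf
    rw [← integral_add (hf.integrable_mul_fun hψ2) (hf.integrable_mul_fun hd)]
    congr 1
    funext x
    simp only [Pi.sub_apply]
    ring
  have e2 : (∫ x, a s x * (χ - ψ) x) - ∫ x, a t x * (χ - ψ) x =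
      ∫ x, (a s - a t) x * (χ - ψ) x := (integral_sub_mul (ha s hs) (ha t ht) hd).symm
  have b1 : |∫ x, (a s - a t) x * (χ - ψ) x| ≤ B * |s - t| * nrm (χ - ψ) :=
    (abs_integral_mul_le ((ha s hs).sub (ha t ht)) hd).trans
      (mul_le_mul_of_nonneg_right (hlip s hs) (nrm_nonneg _))
  have b2 : |∫ x, w t x * (χ - ψ) x| ≤ B * nrm (χ - ψ) :=
    (abs_integral_mul_le (hw t ht) hd).trans
      (mul_le_mul_of_nonneg_right (hB t ht) (nrm_nonneg _))
  rw [e1 _ (ha s hs), e1 _ (ha t ht), e1 _ (hw t ht)]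
  simp only [Real.norm_eq_abs, smul_eq_mul] at h1 ⊢
  have hBψ : 2 * (B * nrm (χ - ψ)) ≤ c / 2 := by
    have h3 : nrm (χ - ψ) * (2 * (B + 1)) ≤ c / 2 :=
      (le_div_iff₀ (by positivity)).1 hψ'.le
    nlinarith [nrm_nonneg (χ - ψ)]
  have hdecomp : (∫ x, a s x * ψ x) + (∫ x, a s x * (χ - ψ) x) -
      ((∫ x, a t x * ψ x) + ∫ x, a t x * (χ - ψ) x) -
      (s - t) * ((∫ x, w t x * ψ x) + ∫ x, w t x * (χ - ψ) x) =
      ((∫ x, a s x * ψ x) - (∫ x, a t x * ψ x) - (s - t) * ∫ x, w t x * ψ x) +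
      ((∫ x, (a s - a t) x * (χ - ψ) x) - (s - t) * ∫ x, w t x * (χ - ψ) x) := by
    rw [← e2]; ring
  rw [hdecomp]
  refine (abs_add_le _ _).trans ?_
  have b3 : |(∫ x, (a s - a t) x * (χ - ψ) x) - (s - t) * ∫ x, w t x * (χ - ψ) x| ≤
      c / 2 * |s - t| := by
    refine (abs_sub _ _).trans ?_
    rw [abs_mul]
    have := mul_le_mul_of_nonneg_left b2 (abs_nonneg (s - t))
    have := mul_le_mul_of_nonneg_right hBψ (abs_nonneg (s - t))
    linarith
  linarith

/-- Write ‖a(s)‖² = 2⟨a(s), a(t)⟩ + ‖a(s) − a(t)‖² − ‖a(t)‖². The pairing with the fixed vector a(t)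
is differentiable, and the square is O(|s − t|²). Strong differentiability of a is not needed. -/
theorem hasDerivWithinAt_nrm_sq {I : Set ℝ} (hI : Convex ℝ I) {a w : ℝ → Space N → ℝ} {B : ℝ}
    (ha : ∀ t ∈ I, MemLp (a t) 2 volume) (hw : ∀ t ∈ I, MemLp (w t) 2 volume)
    (hB : ∀ t ∈ I, nrm (w t) ≤ B)
    (h : ∀ ψ, IsTest ψ → ∀ t ∈ I,
      HasDerivWithinAt (fun s => ∫ x, a s x * ψ x) (∫ x, w t x * ψ x) I t)
    {t : ℝ} (ht : t ∈ I) :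
    HasDerivWithinAt (fun s => nrm (a s) ^ 2) (2 * ∫ x, w t x * a t x) I t := by
  have hB0 : 0 ≤ B := (nrm_nonneg _).trans (hB t ht)
  have hlip : ∀ s ∈ I, nrm (a s - a t) ≤ B * |s - t| := fun s hs =>
    nrm_sub_le_of_weak_deriv_memLp hI ha hw hB h hs ht
  have hgen := hasDerivWithinAt_integral_mul hI ha hw hB h (ha t ht) ht
  have hr : HasDerivWithinAt (fun s => nrm (a s - a t) ^ 2) 0 I t := by
    rw [hasDerivWithinAt_iff_isLittleO, Asymptotics.isLittleO_iff]
    intro c hc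
    have : ∀ᶠ s in 𝓝[I] t, |s - t| < c / (B ^ 2 + 1) := by
      refine Filter.Tendsto.eventually_lt_const (v := 0) (by positivity) ?_
      refine Tendsto.mono_left ?_ nhdsWithin_le_nhds
      have : Continuous fun s : ℝ => |s - t| := by fun_prop
      simpa using this.tendsto t
    filter_upwards [this, self_mem_nhdsWithin] with s h1 hs
    have h2 := pow_le_pow_left₀ (nrm_nonneg _) (hlip s hs) 2
    rw [lt_div_iff₀ (by positivity)] at h1
    have h0 : nrm (a t - a t) = 0 := by simp [nrm]
    rw [h0, smul_zero, Real.norm_eq_abs, Real.norm_eq_abs]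
    have h3 : nrm (a s - a t) ^ 2 - 0 ^ 2 - 0 = nrm (a s - a t) ^ 2 := by ring
    rw [h3, abs_of_nonneg (by positivity)]
    have h4 := mul_le_mul_of_nonneg_right h1.le (abs_nonneg (s - t))
    nlinarith [abs_nonneg (s - t), mul_nonneg (abs_nonneg (s - t)) (abs_nonneg (s - t))]
  have := ((hgen.const_mul 2).add hr).sub_const (nrm (a t) ^ 2)
  rw [add_zero] at this
  have heq : ∀ s ∈ I, nrm (a s) ^ 2 =
      2 * (∫ x, a s x * a t x) + nrm (a s - a t) ^ 2 - nrm (a t) ^ 2 := by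
    intro s hs
    have has := ha s hs
    have hat := ha t ht
    have hs2 : Integrable (fun x => (a s - a t) x ^ 2) volume := (has.sub hat).integrable_sq
    have hs1 : Integrable (fun x => 2 * (a s x * a t x)) volume :=
      (has.integrable_mul_fun hat).const_mul 2
    have hs3 : Integrable (fun x => 2 * (a s x * a t x) + (a s - a t) x ^ 2) volume := hs1.add hs2
    rw [← integral_sq_eq has, ← integral_sq_eq hat, ← integral_sq_eq (has.sub hat),
      ← integral_const_mul, ← integral_add hs1 hs2, ← integral_sub hs3 hat.integrable_sq]
    congr 1
    funext x
    simp only [Pi.sub_apply]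
    ring
  exact this.congr heq (heq t ht)

theorem integral_mul_partialDeriv_of_memLp {f g : Space N → ℝ} {i : Fin N} (hf : ContDiff ℝ ∞ f)
    (hg : ContDiff ℝ ∞ g) (hf2 : MemLp f 2 volume) (hg2 : MemLp g 2 volume)
    (hf' : MemLp (partialDeriv i f) 2 volume) (hg' : MemLp (partialDeriv i g) 2 volume) :
    ∫ x, f x * partialDeriv i g x = -∫ x, partialDeriv i f x * g x := by
  exact integral_bilinear_hasFDerivAt_right_eq_neg_left_of_integrable (μ := volume)
      (B := ContinuousLinearMap.mul ℝ ℝ) (f := f) (f' := fderiv ℝ f) (g := g) (g' := fderiv ℝ g)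
      (v := EuclideanSpace.single i 1) (hf'.integrable_mul_fun hg2) (hf2.integrable_mul_fun hg')
      (hf2.integrable_mul_fun hg2)
      (fun x _ => (hf.differentiableAt_space x).hasFDerivAt)
      (fun x _ => (hg.differentiableAt_space x).hasFDerivAt)

theorem partialDeriv_mol {f : Space N → ℝ} (hf : LocallyIntegrable f volume) (n : ℕ) (i : Fin N) :
    partialDeriv i (mol n f) = cv (partialDeriv i (ker N n)) f :=
  partialDeriv_cv (isTest_ker N n) hf i

theorem mol_partialDeriv {ψ : Space N → ℝ} (hψ : IsTest ψ) (n : ℕ) (i : Fin N) :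
    partialDeriv i (mol n ψ) = mol n (partialDeriv i ψ) :=
  D_cv_test (isTest_ker N n) hψ [i]

theorem add_sum_le_sqrt (a : ℝ) (b : Fin N → ℝ) :
    a + ∑ i, b i ≤ √(N + 1) * √(a ^ 2 + ∑ i, b i ^ 2) := by
  rw [← Real.sqrt_mul (by positivity)]
  refine Real.le_sqrt_of_sq_le ?_
  have := sq_sum_le_card_mul_sum_sq (s := Finset.univ)
    (f := fun o : Option (Fin N) => o.elim a b)
  simpa [Fintype.sum_option] using this

theorem nrm_sub_le {f g : Space N → ℝ} (hf : MemLp f 2 volume) (hg : MemLp g 2 volume) :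
    nrm (f - g) ≤ nrm f + nrm g := by
  rw [sub_eq_add_neg, ← nrm_neg g]
  exact nrm_add_le hf hg.neg

theorem nrm_sum_le {ι : Type*} (s : Finset ι) (f : ι → Space N → ℝ)
    (hf : ∀ i ∈ s, MemLp (f i) 2 volume) : nrm (∑ i ∈ s, f i) ≤ ∑ i ∈ s, nrm (f i) := by
  classical
  induction s using Finset.induction_on with
  | empty => simp [nrm]
  | insert i s hi ih =>
    rw [Finset.sum_insert hi, Finset.sum_insert hi]
    have h1 : ∀ j ∈ s, MemLp (f j) 2 volume := fun j hj => hf j (Finset.mem_insert_of_mem hj)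
    exact (nrm_add_le (hf i (Finset.mem_insert_self i s)) (memLp_finsetSum' _ h1)).trans
      (add_le_add le_rfl (ih h1))

/-! ### The energy inequality for the wave system -/

/-- The square root is not differentiable where e vanishes, so the argument is run for √(e + δ²) and
δ tends to 0. -/
theorem sqrt_le_of_deriv_le {T : ℝ} {e d g : ℝ → ℝ} (he : ∀ t ∈ Icc 0 T, 0 ≤ e t)
    (hd : ∀ t ∈ Icc 0 T, HasDerivWithinAt e (d t) (Icc 0 T) t) (hg : Continuous g) {c : ℝ}
    (hc : 0 ≤ c) (hg0 : ∀ t ∈ Icc 0 T, 0 ≤ g t)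
    (h : ∀ t ∈ Icc 0 T, d t ≤ 2 * (c * g t * √(e t))) {t : ℝ} (ht : t ∈ Icc 0 T) :
    √(e t) ≤ √(e 0) + c * ∫ s in (0 : ℝ)..t, g s := by
  have h0 : (0 : ℝ) ∈ Icc 0 T := ⟨le_rfl, ht.1.trans ht.2⟩
  refine le_of_forall_pos_le_add fun δ hδ => ?_
  have hpos : ∀ s ∈ Icc 0 T, 0 < e s + δ ^ 2 := fun s hs => by have := he s hs; positivity
  have hF : ∀ s ∈ Icc 0 T, HasDerivWithinAt
      (fun s => √(e s + δ ^ 2) - c * ∫ r in (0 : ℝ)..s, g r)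
      (d s / (2 * √(e s + δ ^ 2)) - c * g s) (Icc 0 T) s := by
    intro s hs
    exact (((hd s hs).add_const _).sqrt (hpos s hs).ne').sub
      ((intervalIntegral.integral_hasDerivAt_right (hg.intervalIntegrable _ _)
        hg.aestronglyMeasurable.stronglyMeasurableAtFilter hg.continuousAt).const_mul
          c).hasDerivWithinAt
  have hnp : ∀ s ∈ Icc 0 T, d s / (2 * √(e s + δ ^ 2)) - c * g s ≤ 0 := by
    intro s hs
    have hp := Real.sqrt_pos.2 (hpos s hs)
    rw [sub_nonpos, div_le_iff₀ (by positivity)]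
    have h1 : √(e s) ≤ √(e s + δ ^ 2) := Real.sqrt_le_sqrt (by nlinarith)
    have h2 := mul_le_mul_of_nonneg_left h1 (mul_nonneg hc (hg0 s hs))
    linarith [h s hs]
  have hanti := antitoneOn_of_deriv_nonpos (convex_Icc 0 T)
    (fun s hs => (hF s hs).continuousWithinAt)
    (fun s hs => (hF s (interior_subset hs)).differentiableWithinAt.mono interior_subset)
    (fun s hs => by
      have hs' := interior_subset hs
      rw [((hF s hs').hasDerivAt (mem_interior_iff_mem_nhds.1 hs)).deriv]
      exact hnp s hs')
  have := hanti h0 ht ht.1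
  simp only [intervalIntegral.integral_same, mul_zero, sub_zero] at this
  have h1 : √(e t) ≤ √(e t + δ ^ 2) := Real.sqrt_le_sqrt (by nlinarith)
  have h2 : √(e 0 + δ ^ 2) ≤ √(e 0) + δ := by
    refine Real.sqrt_le_iff.2 ⟨by positivity, ?_⟩
    have h3 := Real.sq_sqrt (he 0 h0)
    nlinarith [Real.sqrt_nonneg (e 0)]
  linarith

theorem nrm_mol_tendsto {f : Space N → ℝ} (hf : MemLp f 2 volume) :
    Tendsto (fun n => nrm (mol n f)) atTop (𝓝 (nrm f)) := by
  refine tendsto_iff_norm_sub_tendsto_zero.2 (squeeze_zero (fun _ => norm_nonneg _) (fun n => ?_)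
    (mol_tendsto_L2 hf))
  have hm := (memLp_mol hf n).1
  have h1 := nrm_add_le (hm.sub hf) hf
  have h2 := nrm_add_le (hf.sub hm) hm
  rw [sub_add_cancel] at h1 h2
  rw [nrm_sub_comm] at h2
  rw [Real.norm_eq_abs, abs_le]
  constructor <;> linarith

section Wave

variable {T B : ℝ} {v f : ℝ → Space N → ℝ} {W h : Fin N → ℝ → Space N → ℝ} {g : ℝ → ℝ}

/-- Mollification in space turns ∂ᵢ into a convolution operator bounded on L², so the mollified
unknowns have time derivatives in L² and their squared norms can be differentiated. -/
theorem wave_energy_mol (hg : Continuous g)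
    (hv : ∀ t ∈ Icc 0 T, MemLp (v t) 2 volume ∧ nrm (v t) ≤ B)
    (hW : ∀ i, ∀ t ∈ Icc 0 T, MemLp (W i t) 2 volume ∧ nrm (W i t) ≤ B)
    (hf : ∀ t ∈ Icc 0 T, MemLp (f t) 2 volume ∧ nrm (f t) ≤ g t)
    (hh : ∀ i, ∀ t ∈ Icc 0 T, MemLp (h i t) 2 volume ∧ nrm (h i t) ≤ g t)
    (eqv : ∀ ψ, IsTest ψ → ∀ t ∈ Icc 0 T, HasDerivWithinAt (fun s => ∫ x, v s x * ψ x)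
      ((∑ i, ∫ x, W i t x * partialDeriv i ψ x) + ∫ x, f t x * ψ x) (Icc 0 T) t)
    (eqW : ∀ i ψ, IsTest ψ → ∀ t ∈ Icc 0 T, HasDerivWithinAt (fun s => ∫ x, W i s x * ψ x)
      ((∫ x, v t x * partialDeriv i ψ x) + ∫ x, h i t x * ψ x) (Icc 0 T) t)
    (n : ℕ) {t : ℝ} (ht : t ∈ Icc 0 T) :
    √(nrm (mol n (v t)) ^ 2 + ∑ i, nrm (mol n (W i t)) ^ 2) ≤
      √(nrm (mol n (v 0)) ^ 2 + ∑ i, nrm (mol n (W i 0)) ^ 2) +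
        √(N + 1) * ∫ s in (0 : ℝ)..t, g s := by
  set k : Fin N → Space N → ℝ := fun i => partialDeriv i (ker N n) with hk
  have hkt : ∀ i, IsTest (k i) := fun i => (isTest_ker N n).partialDeriv i
  obtain ⟨G, hG⟩ : ∃ G, ∀ t ∈ Icc 0 T, g t ≤ G := by
    obtain ⟨G, hG⟩ := isCompact_Icc.bddAbove_image (hg.continuousOn (s := Icc 0 T))
    exact ⟨G, fun t ht => hG ⟨t, ht, rfl⟩⟩
  have hg0 : ∀ t ∈ Icc 0 T, 0 ≤ g t := fun t ht => (nrm_nonneg _).trans (hf t ht).2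
  have hB0 : 0 ≤ B := (nrm_nonneg _).trans (hv t ht).2
  have hG0 : 0 ≤ G := (hg0 t ht).trans (hG t ht)
  have mv := fun t (ht : t ∈ Icc 0 T) => memLp_mol (hv t ht).1 n
  have mW := fun i t (ht : t ∈ Icc 0 T) => memLp_mol (hW i t ht).1 n
  have mf := fun t (ht : t ∈ Icc 0 T) => memLp_mol (hf t ht).1 n
  have mh := fun i t (ht : t ∈ Icc 0 T) => memLp_mol (hh i t ht).1 n
  have kv := fun i t (ht : t ∈ Icc 0 T) => memLp_cv (hkt i) (hv t ht).1
  have kW := fun i t (ht : t ∈ Icc 0 T) => memLp_cv (hkt i) (hW i t ht).1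
  have hkey : ∀ (F : Space N → ℝ) (i : Fin N) (ψ : Space N → ℝ), MemLp F 2 volume → IsTest ψ →
      ∫ x, F x * partialDeriv i (mol n ψ) x = -∫ x, cv (k i) F x * ψ x := by
    intro F i ψ hF hψ
    rw [mol_partialDeriv hψ, ← integral_mol_mul hF.locallyIntegrable_two (hψ.partialDeriv i),
      integral_mul_partialDeriv (contDiff_mol hF.locallyIntegrable_two n) hψ,
      partialDeriv_mol hF.locallyIntegrable_two]
  have hmolψ : ∀ {ψ : Space N → ℝ}, IsTest ψ → IsTest (mol n ψ) := fun hψ =>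
    (isTest_ker N n).cv hψ
  -- the mollified equations
  set wv : ℝ → Space N → ℝ := fun t => mol n (f t) - ∑ i, cv (k i) (W i t) with hwv
  set wW : Fin N → ℝ → Space N → ℝ := fun i t => mol n (h i t) - cv (k i) (v t) with hwW
  have hsumW : ∀ t ∈ Icc 0 T, MemLp (∑ i, cv (k i) (W i t)) 2 volume := fun t ht =>
    memLp_finsetSum' _ fun i _ => (kW i t ht).1
  have hwvm : ∀ t ∈ Icc 0 T, MemLp (wv t) 2 volume := fun t ht => (mf t ht).1.sub (hsumW t ht)
  have hwWm : ∀ i, ∀ t ∈ Icc 0 T, MemLp (wW i t) 2 volume := fun i t ht =>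
    (mh i t ht).1.sub (kv i t ht).1
  have hintv : ∀ t ∈ Icc 0 T, ∀ χ, MemLp χ 2 volume → ∫ x, wv t x * χ x =
      (∫ x, mol n (f t) x * χ x) - ∑ i, ∫ x, cv (k i) (W i t) x * χ x := by
    intro t ht χ hχ
    rw [hwv, integral_sub_mul (mf t ht).1 (hsumW t ht) hχ,
      ← integral_finsetSum _ fun i _ => (kW i t ht).1.integrable_mul_fun hχ]
    congr 2
    funext x
    rw [Finset.sum_apply, Finset.sum_mul]
  have hdv : ∀ ψ, IsTest ψ → ∀ t ∈ Icc 0 T, HasDerivWithinAt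
      (fun s => ∫ x, mol n (v s) x * ψ x) (∫ x, wv t x * ψ x) (Icc 0 T) t := by
    intro ψ hψ t ht
    have := eqv _ (hmolψ hψ) t ht
    rw [hintv t ht ψ (hψ.memLp 2)]
    refine (this.congr_deriv ?_).congr
      (fun s hs => integral_mol_mul (hv s hs).1.locallyIntegrable_two hψ n)
      (integral_mol_mul (hv t ht).1.locallyIntegrable_two hψ n)
    rw [← integral_mol_mul (hf t ht).1.locallyIntegrable_two hψ,
      Finset.sum_congr rfl fun i _ => hkey _ i ψ (hW i t ht).1 hψ, Finset.sum_neg_distrib]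
    ring
  have hdW : ∀ i ψ, IsTest ψ → ∀ t ∈ Icc 0 T, HasDerivWithinAt
      (fun s => ∫ x, mol n (W i s) x * ψ x) (∫ x, wW i t x * ψ x) (Icc 0 T) t := by
    intro i ψ hψ t ht
    have := eqW i _ (hmolψ hψ) t ht
    rw [hwW, integral_sub_mul (mh i t ht).1 (kv i t ht).1 (hψ.memLp 2)]
    refine (this.congr_deriv ?_).congr
      (fun s hs => integral_mol_mul (hW i s hs).1.locallyIntegrable_two hψ n)
      (integral_mol_mul (hW i t ht).1.locallyIntegrable_two hψ n)
    rw [← integral_mol_mul (hh i t ht).1.locallyIntegrable_two hψ, hkey _ i ψ (hv t ht).1 hψ]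
    ring
  have hwvB : ∀ t ∈ Icc 0 T, nrm (wv t) ≤ G + ∑ i, (∫ y, |k i y|) * B := by
    intro t ht
    refine (nrm_sub_le (mf t ht).1 (hsumW t ht)).trans (add_le_add
      ((mf t ht).2.trans ((hf t ht).2.trans (hG t ht))) ?_)
    refine (nrm_sum_le _ _ fun i _ => (kW i t ht).1).trans (Finset.sum_le_sum fun i _ => ?_)
    exact (kW i t ht).2.trans (mul_le_mul_of_nonneg_left (hW i t ht).2 (integral_nonneg
      fun _ => abs_nonneg _))
  have hwWB : ∀ i, ∀ t ∈ Icc 0 T, nrm (wW i t) ≤ G + (∫ y, |k i y|) * B := by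
    intro i t ht
    refine (nrm_sub_le (mh i t ht).1 (kv i t ht).1).trans (add_le_add
      ((mh i t ht).2.trans ((hh i t ht).2.trans (hG t ht))) ?_)
    exact (kv i t ht).2.trans (mul_le_mul_of_nonneg_left (hv t ht).2 (integral_nonneg
      fun _ => abs_nonneg _))
  have hderiv : ∀ t ∈ Icc 0 T, HasDerivWithinAt
      (fun t => nrm (mol n (v t)) ^ 2 + ∑ i, nrm (mol n (W i t)) ^ 2)
      (2 * (∫ x, wv t x * mol n (v t) x) + ∑ i, 2 * ∫ x, wW i t x * mol n (W i t) x)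
      (Icc 0 T) t := fun t ht =>
    (hasDerivWithinAt_nrm_sq (convex_Icc 0 T) (fun t ht => (mv t ht).1) hwvm hwvB hdv ht).add
      (HasDerivWithinAt.fun_sum fun i _ => hasDerivWithinAt_nrm_sq (convex_Icc 0 T)
        (fun t ht => (mW i t ht).1) (hwWm i) (hwWB i) (hdW i) ht)
  refine sqrt_le_of_deriv_le (fun t _ => by positivity) hderiv hg (Real.sqrt_nonneg _) hg0
    (fun t ht => ?_) ht
  -- Divergence and gradient are antisymmetric adjoints. Hence the terms involving `cv (k i)`, whose
  -- norms blow up with n, cancel and only the sources remain.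
  have hcancel : ∀ i, ∫ x, cv (k i) (v t) x * mol n (W i t) x =
      -∫ x, cv (k i) (W i t) x * mol n (v t) x := by
    intro i
    have lv := (hv t ht).1.locallyIntegrable_two
    have lW := (hW i t ht).1.locallyIntegrable_two
    have := integral_mul_partialDeriv_of_memLp (i := i) (contDiff_mol lW n)
      (contDiff_mol lv n) (mW i t ht).1 (mv t ht).1
      (by rw [partialDeriv_mol lW]; exact (kW i t ht).1)
      (by rw [partialDeriv_mol lv]; exact (kv i t ht).1)
    rw [partialDeriv_mol lW, partialDeriv_mol lv] at this
    rw [← this]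
    simp only [mul_comm]
    rfl
  have hE : 2 * (∫ x, wv t x * mol n (v t) x) + ∑ i, 2 * ∫ x, wW i t x * mol n (W i t) x =
      2 * ((∫ x, mol n (f t) x * mol n (v t) x) + ∑ i, ∫ x, mol n (h i t) x * mol n (W i t) x) := by
    rw [hintv t ht _ (mv t ht).1, ← Finset.mul_sum]
    have : ∀ i, ∫ x, wW i t x * mol n (W i t) x = (∫ x, mol n (h i t) x * mol n (W i t) x) +
        ∫ x, cv (k i) (W i t) x * mol n (v t) x := by
      intro i
      rw [hwW, integral_sub_mul (mh i t ht).1 (kv i t ht).1 (mW i t ht).1, hcancel]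
      ring
    rw [Finset.sum_congr rfl fun i _ => this i, Finset.sum_add_distrib]
    ring
  rw [hE]
  refine mul_le_mul_of_nonneg_left ?_ zero_le_two
  have hb : (∫ x, mol n (f t) x * mol n (v t) x) +
      ∑ i, ∫ x, mol n (h i t) x * mol n (W i t) x ≤
      g t * (nrm (mol n (v t)) + ∑ i, nrm (mol n (W i t))) := by
    rw [mul_add, Finset.mul_sum]
    refine add_le_add ?_ (Finset.sum_le_sum fun i _ => ?_)
    · exact (le_abs_self _).trans ((abs_integral_mul_le (mf t ht).1 (mv t ht).1).trans
        (mul_le_mul_of_nonneg_right ((mf t ht).2.trans (hf t ht).2) (nrm_nonneg _)))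
    · exact (le_abs_self _).trans ((abs_integral_mul_le (mh i t ht).1 (mW i t ht).1).trans
        (mul_le_mul_of_nonneg_right ((mh i t ht).2.trans (hh i t ht).2) (nrm_nonneg _)))
  refine hb.trans ?_
  rw [mul_comm √(N + 1 : ℝ), mul_assoc]
  refine mul_le_mul_of_nonneg_left ?_ (hg0 t ht)
  exact add_sum_le_sqrt _ _

/-- The energy inequality for the wave system `∂_t v = -div W + f`, `∂_t W = -∇ v + h`. -/
theorem wave_energy (hg : Continuous g)
    (hv : ∀ t ∈ Icc 0 T, MemLp (v t) 2 volume ∧ nrm (v t) ≤ B)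
    (hW : ∀ i, ∀ t ∈ Icc 0 T, MemLp (W i t) 2 volume ∧ nrm (W i t) ≤ B)
    (hf : ∀ t ∈ Icc 0 T, MemLp (f t) 2 volume ∧ nrm (f t) ≤ g t)
    (hh : ∀ i, ∀ t ∈ Icc 0 T, MemLp (h i t) 2 volume ∧ nrm (h i t) ≤ g t)
    (eqv : ∀ ψ, IsTest ψ → ∀ t ∈ Icc 0 T, HasDerivWithinAt (fun s => ∫ x, v s x * ψ x)
      ((∑ i, ∫ x, W i t x * partialDeriv i ψ x) + ∫ x, f t x * ψ x) (Icc 0 T) t)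
    (eqW : ∀ i ψ, IsTest ψ → ∀ t ∈ Icc 0 T, HasDerivWithinAt (fun s => ∫ x, W i s x * ψ x)
      ((∫ x, v t x * partialDeriv i ψ x) + ∫ x, h i t x * ψ x) (Icc 0 T) t)
    {t : ℝ} (ht : t ∈ Icc 0 T) :
    nrm (v t) + ∑ i, nrm (W i t) ≤
      (N + 1) * (nrm (v 0) + ∑ i, nrm (W i 0) + ∫ s in (0 : ℝ)..t, g s) := by
  have h0 : (0 : ℝ) ∈ Icc 0 T := ⟨le_rfl, ht.1.trans ht.2⟩
  have hlim : ∀ s ∈ Icc 0 T, Tendsto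
      (fun n => √(nrm (mol n (v s)) ^ 2 + ∑ i, nrm (mol n (W i s)) ^ 2)) atTop
      (𝓝 √(nrm (v s) ^ 2 + ∑ i, nrm (W i s) ^ 2)) := fun s hs =>
    (((nrm_mol_tendsto (hv s hs).1).pow 2).add
      (tendsto_finsetSum _ fun i _ => (nrm_mol_tendsto (hW i s hs).1).pow 2)).sqrt
  have hmain := le_of_tendsto_of_tendsto' (hlim t ht) ((hlim 0 h0).add_const _)
    fun n => wave_energy_mol hg hv hW hf hh eqv eqW n ht
  -- One factor √(N + 1) comes from the sources and a second one from replacing the Euclidean norm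
  -- by the sum of norms.
  have h1 := add_sum_le_sqrt (nrm (v t)) fun i => nrm (W i t)
  have h2 : √(nrm (v 0) ^ 2 + ∑ i, nrm (W i 0) ^ 2) ≤ nrm (v 0) + ∑ i, nrm (W i 0) := by
    have hs : 0 ≤ ∑ i, nrm (W i 0) := Finset.sum_nonneg fun i _ => nrm_nonneg _
    have hv0 := nrm_nonneg (v 0)
    refine Real.sqrt_le_iff.2 ⟨add_nonneg hv0 hs, ?_⟩
    have := Finset.sum_sq_le_sq_sum_of_nonneg (s := Finset.univ) (f := fun i => nrm (W i 0))
      fun i _ => nrm_nonneg (W i 0)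
    nlinarith
  have hsq : √(N + 1 : ℝ) * √(N + 1 : ℝ) = N + 1 := Real.mul_self_sqrt (by positivity)
  have hs1 : √(N + 1 : ℝ) ≤ N + 1 := by
    have : (1 : ℝ) ≤ √(N + 1 : ℝ) := Real.one_le_sqrt.2 (by simp)
    nlinarith
  have hs0 : 0 ≤ √(N + 1 : ℝ) := Real.sqrt_nonneg _
  have hX : 0 ≤ nrm (v 0) + ∑ i, nrm (W i 0) :=
    add_nonneg (nrm_nonneg _) (Finset.sum_nonneg fun i _ => nrm_nonneg _)
  set E := √(nrm (v t) ^ 2 + ∑ i, nrm (W i t) ^ 2)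
  set E₀ := √(nrm (v 0) ^ 2 + ∑ i, nrm (W i 0) ^ 2)
  set X := nrm (v 0) + ∑ i, nrm (W i 0)
  set J := ∫ s in (0 : ℝ)..t, g s
  set r := √(N + 1 : ℝ)
  have h3 : E ≤ X + r * J := by linarith
  have h4 : r * E ≤ r * (X + r * J) := mul_le_mul_of_nonneg_left h3 hs0
  have h5 : r * X ≤ (N + 1) * X := mul_le_mul_of_nonneg_right hs1 hX
  have h6 : r * (X + r * J) = r * X + (r * r) * J := by ring
  rw [hsq] at h6
  linarith

end Wave

end SineGordonRegime

end


noncomputable section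

namespace SineGordonRegime

variable {N : ℕ}

/-! ### The least constant of regularity -/

/-- The supremum of the `L²` norms of the derivatives of `f` of orders `a, …, b`. -/
def rn (a b : ℕ) (f : Space N → ℝ) : ℝ := sInf {M | 0 ≤ M ∧ Reg a b M f}

theorem rn_nonneg (a b : ℕ) (f : Space N → ℝ) : 0 ≤ rn a b f :=
  Real.sInf_nonneg fun _ h => h.1

theorem rn_le {a b : ℕ} {f : Space N → ℝ} {M : ℝ} (hM : 0 ≤ M) (h : Reg a b M f) :
    rn a b f ≤ M :=
  csInf_le ⟨0, fun _ h => h.1⟩ ⟨hM, h⟩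

/-- The infimum is attained because `Reg` is a family of inequalities that are non-strict and linear
in M. -/
theorem Reg.rn {a b : ℕ} {f : Space N → ℝ} {M : ℝ} (hM : 0 ≤ M) (h : Reg a b M f) :
    Reg a b (rn a b f) f := by
  refine ⟨h.1, fun w h1 h2 ψ hψ => le_of_forall_pos_le_add fun δ hδ => ?_⟩
  have hne : ({M | 0 ≤ M ∧ Reg a b M f} : Set ℝ).Nonempty := ⟨M, hM, h⟩
  have hδ' : 0 < δ / (nrm ψ + 1) := div_pos hδ (by have := nrm_nonneg ψ; linarith)
  obtain ⟨M', ⟨-, h3⟩, h4⟩ := exists_lt_of_csInf_lt hne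
    (lt_add_of_pos_right (sInf {M | 0 ≤ M ∧ Reg a b M f}) hδ')
  have h5 := nrm_nonneg ψ
  refine (h3.2 w h1 h2 ψ hψ).trans ((mul_le_mul_of_nonneg_right h4.le h5).trans ?_)
  rw [add_mul]
  refine add_le_add le_rfl ?_
  rw [div_mul_eq_mul_div, div_le_iff₀ (by linarith)]
  nlinarith

theorem Reg.neg {a b : ℕ} {M : ℝ} {f : Space N → ℝ} (h : Reg a b M f) : Reg a b M (-f) := by
  have := h.smul (-1)
  rwa [abs_neg, abs_one, one_mul, neg_one_smul] at this

theorem Reg.sub {a b : ℕ} {M M' : ℝ} {f g : Space N → ℝ} (hf : Reg a b M f) (hg : Reg a b M' g) :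
    Reg a b (M + M') (f - g) := by
  rw [sub_eq_add_neg]; exact hf.add hg.neg

theorem Reg.zero (a b : ℕ) : Reg a b 0 (0 : Space N → ℝ) :=
  ⟨locallyIntegrable_const 0, fun w _ _ ψ _ => by simp⟩

theorem Reg.sum {ι : Type*} {a b : ℕ} {s : Finset ι} {M : ι → ℝ} {f : ι → Space N → ℝ}
    (h : ∀ i ∈ s, Reg a b (M i) (f i)) : Reg a b (∑ i ∈ s, M i) (∑ i ∈ s, f i) := by
  classical
  induction s using Finset.induction_on with
  | empty => exact Reg.zero a b
  | insert i s hi ih =>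
    rw [Finset.sum_insert hi, Finset.sum_insert hi]
    exact (h i (Finset.mem_insert_self i s)).add
      (ih fun j hj => h j (Finset.mem_insert_of_mem hj))

theorem continuousOn_rn {a b : ℕ} {I : Set ℝ} {f : ℝ → Space N → ℝ}
    (hf : ∀ t ∈ I, ∃ M, 0 ≤ M ∧ Reg a b M (f t))
    (hc : ∀ t ∈ I, ∀ δ > 0, ∀ᶠ s in 𝓝[I] t, Reg a b δ (f s - f t)) :
    ContinuousOn (fun t => rn a b (f t)) I := by
  intro t ht
  refine Metric.tendsto_nhds.2 fun δ hδ => ?_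
  filter_upwards [hc t ht (δ / 2) (half_pos hδ), self_mem_nhdsWithin] with s hs hsI
  obtain ⟨M, hM, h1⟩ := hf t ht
  obtain ⟨M', hM', h2⟩ := hf s hsI
  have h3 := hs.add (h1.rn hM)
  rw [sub_add_cancel] at h3
  have h4 := hs.neg.add (h2.rn hM')
  rw [neg_sub, sub_add_cancel] at h4
  have h5 := rn_le (by have := rn_nonneg a b (f t); positivity) h3
  have h6 := rn_le (by have := rn_nonneg a b (f s); positivity) h4
  rw [Real.dist_eq, abs_lt]
  constructor <;> linarith

/-- The representative of a weak derivative of a regular function is regular. -/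
theorem Reg.of_rep {a b : ℕ} {M : ℝ} {f g : Space N → ℝ} {w : List (Fin N)}
    (h : Reg a (b + w.length) M f) (ha : a ≤ w.length) (hg : MemLp g 2 volume)
    (hfg : ∀ ψ, IsTest ψ → ∫ x, f x * D w ψ x = ∫ x, g x * ψ x) : Reg 0 b M g := by
  refine ⟨hg.locallyIntegrable_two, fun w' _ hw' ψ hψ => ?_⟩
  rw [← hfg _ (hψ.D w'), ← D_append]
  exact h.2 _ (by rw [List.length_append]; omega) (by rw [List.length_append]; omega) ψ hψ

/-! ### Two scalar inequalities -/

theorem le_add_integral_of_deriv_le {T : ℝ} {F d g : ℝ → ℝ}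
    (hF : ∀ t ∈ Icc 0 T, HasDerivWithinAt F (d t) (Icc 0 T) t) (hg : Continuous g)
    (h : ∀ t ∈ Icc 0 T, d t ≤ g t) {t : ℝ} (ht : t ∈ Icc 0 T) :
    F t ≤ F 0 + ∫ s in (0 : ℝ)..t, g s := by
  have h0 : (0 : ℝ) ∈ Icc 0 T := ⟨le_rfl, ht.1.trans ht.2⟩
  have hH : ∀ s ∈ Icc 0 T, HasDerivWithinAt (fun s => F s - ∫ r in (0 : ℝ)..s, g r)
      (d s - g s) (Icc 0 T) s := fun s hs =>
    (hF s hs).sub (intervalIntegral.integral_hasDerivAt_right (hg.intervalIntegrable _ _)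
      hg.aestronglyMeasurable.stronglyMeasurableAtFilter hg.continuousAt).hasDerivWithinAt
  have := antitoneOn_of_deriv_nonpos (convex_Icc 0 T)
    (fun s hs => (hH s hs).continuousWithinAt)
    (fun s hs => (hH s (interior_subset hs)).differentiableWithinAt.mono interior_subset)
    (fun s hs => by
      have hs' := interior_subset hs
      rw [((hH s hs').hasDerivAt (mem_interior_iff_mem_nhds.1 hs)).deriv]
      exact sub_nonpos.2 (h s hs')) h0 ht ht.1
  simp only [intervalIntegral.integral_same, sub_zero] at this
  linarith

theorem abs_sub_le_integral_of_abs_deriv_le {T : ℝ} {F d g : ℝ → ℝ}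
    (hF : ∀ t ∈ Icc 0 T, HasDerivWithinAt F (d t) (Icc 0 T) t) (hg : Continuous g)
    (h : ∀ t ∈ Icc 0 T, |d t| ≤ g t) {t : ℝ} (ht : t ∈ Icc 0 T) :
    |F t - F 0| ≤ ∫ s in (0 : ℝ)..t, g s := by
  have h1 := le_add_integral_of_deriv_le hF hg (fun t ht => (le_abs_self _).trans (h t ht)) ht
  have h2 := le_add_integral_of_deriv_le (fun t ht => (hF t ht).neg) hg
    (fun t ht => (neg_le_abs _).trans (h t ht)) ht
  simp only [Pi.neg_apply] at h2
  rw [abs_le]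
  constructor <;> linarith

theorem gronwall_integral {T : ℝ} {Y : ℝ → ℝ} (hY : Continuous Y) {c₀ c : ℝ} (hc : 0 ≤ c)
    (h : ∀ t ∈ Icc 0 T, Y t ≤ c₀ + c * ∫ s in (0 : ℝ)..t, Y s) {t : ℝ} (ht : t ∈ Icc 0 T) :
    Y t ≤ c₀ * Real.exp (c * t) := by
  set Z : ℝ → ℝ := fun t => c₀ + c * ∫ s in (0 : ℝ)..t, Y s with hZ
  have hd : ∀ t, HasDerivAt Z (c * Y t) t := fun t =>
    ((intervalIntegral.integral_hasDerivAt_right (hY.intervalIntegrable _ _)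
      hY.aestronglyMeasurable.stronglyMeasurableAtFilter hY.continuousAt).const_mul c).const_add c₀
  have he : ∀ t, HasDerivAt (fun t => Real.exp (-(c * t)) * Z t)
      (Real.exp (-(c * t)) * -(c * 1) * Z t + Real.exp (-(c * t)) * (c * Y t)) t := fun t =>
    (((hasDerivAt_id t).const_mul c).neg.exp).mul (hd t)
  have := le_add_integral_of_deriv_le (T := T) (g := fun _ => 0)
    (fun t _ => (he t).hasDerivWithinAt) continuous_const (fun t ht => by
      have := mul_le_mul_of_nonneg_left (h t ht) hc
      have := mul_le_mul_of_nonneg_left this (Real.exp_pos (-(c * t))).le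
      simp only [hZ]
      linarith) ht
  simp only [mul_zero, neg_zero, Real.exp_zero, one_mul, intervalIntegral.integral_zero,
    add_zero] at this
  have hZ0 : Z 0 = c₀ := by simp [hZ]
  rw [hZ0] at this
  refine (h t ht).trans ?_
  have h2 : Z t = Real.exp (c * t) * (Real.exp (-(c * t)) * Z t) := by
    rw [← mul_assoc, ← Real.exp_add, add_neg_cancel, Real.exp_zero, one_mul]
  change Z t ≤ _
  rw [h2, mul_comm c₀]
  exact mul_le_mul_of_nonneg_left this (Real.exp_pos _).le

/-! ### The time derivative of `sin φ` -/

theorem abs_sin_sub_sub_le (a b : ℝ) :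
    |Real.sin b - Real.sin a - Real.cos a * (b - a)| ≤ (b - a) ^ 2 := by
  have hd : ∀ x ∈ uIcc a b, HasDerivWithinAt (fun x => Real.sin x - Real.cos a * x)
      (Real.cos x - Real.cos a * 1) (uIcc a b) x := fun x _ =>
    ((Real.hasDerivAt_sin x).sub ((hasDerivAt_id x).const_mul _)).hasDerivWithinAt
  have hb : ∀ x ∈ uIcc a b, ‖Real.cos x - Real.cos a * 1‖ ≤ |b - a| := by
    intro x hx
    rw [mul_one]
    have h1 := Real.lipschitzWith_cos.norm_sub_le x a
    simp only [NNReal.coe_one, one_mul] at h1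
    exact h1.trans (abs_sub_left_of_mem_uIcc hx)
  have := (convex_uIcc a b).norm_image_sub_le_of_norm_hasDerivWithin_le hd hb
    left_mem_uIcc right_mem_uIcc
  rw [Real.norm_eq_abs, Real.norm_eq_abs, abs_mul_abs_self] at this
  calc _ = |Real.sin b - Real.cos a * b - (Real.sin a - Real.cos a * a)| := by congr 1; ring
    _ ≤ _ := this
    _ = _ := by ring

/-- The functions φ(t) need not be in L², but their increments are, with norm at most B|s − t|. The
linear part of the Taylor expansion of the sine is differentiated by duality, and its quadratic
remainder is O(|s − t|²). -/
theorem hasDerivWithinAt_integral_sin {I : Set ℝ} (hI : Convex ℝ I) {φ p : ℝ → Space N → ℝ}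
    {B : ℝ} (hφ : ∀ t ∈ I, LocallyIntegrable (φ t) volume) (hp : ∀ t ∈ I, MemLp (p t) 2 volume)
    (hB : ∀ t ∈ I, nrm (p t) ≤ B)
    (h : ∀ ψ, IsTest ψ → ∀ t ∈ I,
      HasDerivWithinAt (fun s => ∫ x, φ s x * ψ x) (∫ x, p t x * ψ x) I t)
    {χ : Space N → ℝ} (hχ : IsTest χ) {t : ℝ} (ht : t ∈ I) :
    HasDerivWithinAt (fun s => ∫ x, Real.sin (φ s x) * χ x)
      (∫ x, Real.cos (φ t x) * p t x * χ x) I t := by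
  have hB0 : 0 ≤ B := (nrm_nonneg _).trans (hB t ht)
  have hlip : ∀ s ∈ I, MemLp (φ s - φ t) 2 volume ∧ nrm (φ s - φ t) ≤ B * |s - t| := fun s hs =>
    nrm_sub_le_of_weak_deriv hI hB0 hs ht (hφ s hs) (hφ t ht) fun ψ hψ r hr => ⟨_,
      (abs_integral_mul_le (hp r hr) (hψ.memLp 2)).trans (mul_le_mul_of_nonneg_right (hB r hr)
        (nrm_nonneg _)), h ψ hψ r hr⟩
  have hcm : AEStronglyMeasurable (fun x => Real.cos (φ t x)) volume :=
    Real.continuous_cos.comp_aestronglyMeasurable (hφ t ht).aestronglyMeasurable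
  have hcχ : MemLp (fun x => Real.cos (φ t x) * χ x) 2 volume :=
    (hχ.memLp 2).mul_bdd hcm (.of_forall fun x => Real.abs_cos_le_one _)
  have h1 := hasDerivWithinAt_integral_mul (a := fun s => φ s - φ t) hI
    (fun s hs => (hlip s hs).1) hp hB
    (fun ψ hψ r hr => ((h ψ hψ r hr).sub_const (∫ x, φ t x * ψ x)).congr
      (fun s hs => by
        rw [← integral_sub ((hφ s hs).integrable_mul_test hψ) ((hφ t ht).integrable_mul_test hψ)]
        simp only [Pi.sub_apply, sub_mul]) (by
        rw [← integral_sub ((hφ r hr).integrable_mul_test hψ) ((hφ t ht).integrable_mul_test hψ)]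
        simp only [Pi.sub_apply, sub_mul])) hcχ ht
  obtain ⟨A, hA⟩ := hχ.continuous.bounded_above_of_compact_support hχ.2
  have hsm : ∀ s ∈ I, AEStronglyMeasurable (fun x => Real.sin (φ s x)) volume := fun s hs =>
    Real.continuous_sin.comp_aestronglyMeasurable (hφ s hs).aestronglyMeasurable
  have hsi : ∀ s ∈ I, Integrable (fun x => Real.sin (φ s x) * χ x) volume := fun s hs =>
    (locallyIntegrable_of_bdd (hsm s hs)
      (.of_forall fun x => Real.abs_sin_le_one _)).integrable_mul_test hχ
  set r : ℝ → ℝ := fun s => (∫ x, Real.sin (φ s x) * χ x) - (∫ x, Real.sin (φ t x) * χ x) -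
    ∫ x, (φ s - φ t) x * (Real.cos (φ t x) * χ x) with hr
  have hrb : ∀ s ∈ I, |r s| ≤ A * B ^ 2 * |s - t| ^ 2 := by
    intro s hs
    have hi := (hlip s hs).1.integrable_mul_fun hcχ
    have hi2 : Integrable (fun x => (φ s - φ t) x ^ 2) volume := (hlip s hs).1.integrable_sq
    have hi3 : Integrable (fun x => Real.sin (φ s x) * χ x - Real.sin (φ t x) * χ x) volume :=
      (hsi s hs).sub (hsi t ht)
    have hA0 : 0 ≤ A := (norm_nonneg _).trans (hA 0)
    have h2 : |r s| ≤ ∫ x, A * (φ s - φ t) x ^ 2 := by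
      simp only [hr]
      rw [← integral_sub (hsi s hs) (hsi t ht), ← integral_sub hi3 hi]
      refine (abs_integral_le_integral_abs).trans (integral_mono_of_nonneg
        (.of_forall fun x => abs_nonneg _) (hi2.const_mul A) (.of_forall fun x => ?_))
      have e : Real.sin (φ s x) * χ x - Real.sin (φ t x) * χ x -
          (φ s - φ t) x * (Real.cos (φ t x) * χ x) =
          (Real.sin (φ s x) - Real.sin (φ t x) - Real.cos (φ t x) * (φ s x - φ t x)) * χ x := by
        simp only [Pi.sub_apply]; ring
      beta_reduce
      rw [e, abs_mul, mul_comm A]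
      exact mul_le_mul (abs_sin_sub_sub_le _ _) (hA x) (abs_nonneg _) (sq_nonneg _)
    rw [integral_const_mul, integral_sq_eq (hlip s hs).1] at h2
    refine h2.trans ?_
    rw [mul_assoc, ← mul_pow]
    exact mul_le_mul_of_nonneg_left (pow_le_pow_left₀ (nrm_nonneg _) (hlip s hs).2 2) hA0
  have hr0 : r t = 0 := by simp [hr]
  have hrd : HasDerivWithinAt r 0 I t := by
    rw [hasDerivWithinAt_iff_isLittleO, Asymptotics.isLittleO_iff]
    intro c hc
    have hAB : 0 ≤ A * B ^ 2 := mul_nonneg ((norm_nonneg _).trans (hA 0)) (sq_nonneg _)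
    have : ∀ᶠ s in 𝓝[I] t, |s - t| < c / (A * B ^ 2 + 1) := by
      refine Filter.Tendsto.eventually_lt_const (v := 0) (by positivity) ?_
      refine Tendsto.mono_left ?_ nhdsWithin_le_nhds
      have : Continuous fun s : ℝ => |s - t| := by fun_prop
      simpa using this.tendsto t
    filter_upwards [this, self_mem_nhdsWithin] with s h3 hs
    rw [lt_div_iff₀ (by positivity)] at h3
    rw [hr0, smul_zero, sub_zero, sub_zero, Real.norm_eq_abs, Real.norm_eq_abs]
    have h4 := mul_le_mul_of_nonneg_right h3.le (abs_nonneg (s - t))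
    nlinarith [hrb s hs, mul_nonneg (abs_nonneg (s - t)) (abs_nonneg (s - t))]
  have := (h1.add hrd).add_const (∫ x, Real.sin (φ t x) * χ x)
  have e : ∫ x, Real.cos (φ t x) * p t x * χ x = ∫ x, p t x * (Real.cos (φ t x) * χ x) := by
    congr 1
    funext x
    ring
  rw [add_zero, ← e] at this
  exact this.congr (fun s _ => by simp only [hr, Pi.add_apply]; ring)
    (by simp only [hr, Pi.add_apply]; ring)

end SineGordonRegime

end


noncomputable section

namespace SineGordonRegime

variable {N : ℕ}

/-! ### The energy estimate for the perturbed Sine-Gordon system -/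

/-- Pairing sin φ with ∂^w ψ and differentiating in time leaves cos φ ∂ₜφ, whose derivatives are
bounded by hypothesis. Integration in time propagates the regularity of sin φ from t = 0 without
differentiating sin φ in space. -/
theorem continuousOn_rn_sin {m : ℕ} {T a b : ℝ} {φ p : ℝ → Space N → ℝ} {P : ℝ → ℝ}
    (hφ : ∀ t ∈ Icc 0 T, LocallyIntegrable (φ t) volume)
    (hP : Continuous P) (hP0 : ∀ t ∈ Icc 0 T, 0 ≤ P t)
    (hp : ∀ t ∈ Icc 0 T, Reg 0 m (P t) (p t))
    (hcos : ∀ t ∈ Icc 0 T, Reg 0 m (a * P t) fun x => Real.cos (φ t x) * p t x) (ha : 0 ≤ a)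
    (hd : ∀ ψ, IsTest ψ → ∀ t ∈ Icc 0 T,
      HasDerivWithinAt (fun s => ∫ x, φ s x * ψ x) (∫ x, p t x * ψ x) (Icc 0 T) t)
    (hb : 0 ≤ b) (h0 : Reg 0 m b fun x => Real.sin (φ 0 x)) :
    ContinuousOn (fun t => rn 0 m fun x => Real.sin (φ t x)) (Icc 0 T) ∧
    ∀ t ∈ Icc 0 T, Reg 0 m (b + ∫ s in (0 : ℝ)..t, a * P s) fun x => Real.sin (φ t x) := by
  obtain ⟨B, hB⟩ : ∃ B, ∀ t ∈ Icc 0 T, P t ≤ B := by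
    obtain ⟨G, hG⟩ := isCompact_Icc.bddAbove_image (hP.continuousOn (s := Icc 0 T))
    exact ⟨G, fun t ht => hG ⟨t, ht, rfl⟩⟩
  have hpm : ∀ t ∈ Icc 0 T, MemLp (p t) 2 volume := fun t ht => ((hp t ht).memLp (hP0 t ht)).1
  have hpB : ∀ t ∈ Icc 0 T, nrm (p t) ≤ B := fun t ht =>
    ((hp t ht).memLp (hP0 t ht)).2.trans (hB t ht)
  have hsl : ∀ t ∈ Icc 0 T, LocallyIntegrable (fun x => Real.sin (φ t x)) volume := fun t ht =>
    locallyIntegrable_of_bdd (Real.continuous_sin.comp_aestronglyMeasurable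
      (hφ t ht).aestronglyMeasurable) (.of_forall fun x => Real.abs_sin_le_one _)
  have hder : ∀ w : List (Fin N), w.length ≤ m → ∀ ψ, IsTest ψ → ∀ t ∈ Icc 0 T, ∃ d,
      |d| ≤ a * P t * nrm ψ ∧
      HasDerivWithinAt (fun s => ∫ x, Real.sin (φ s x) * D w ψ x) d (Icc 0 T) t :=
    fun w hw ψ hψ t ht => ⟨_, (hcos t ht).2 w (Nat.zero_le _) hw ψ hψ,
      hasDerivWithinAt_integral_sin (convex_Icc 0 T) hφ hpm hpB hd (hψ.D w) ht⟩
  have hreg : ∀ t ∈ Icc 0 T,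
      Reg 0 m (b + ∫ s in (0 : ℝ)..t, a * P s) fun x => Real.sin (φ t x) := by
    refine fun t ht => ⟨hsl t ht, fun w _ hw ψ hψ => ?_⟩
    choose! d hd1 hd2 using hder w hw ψ hψ
    have h1 := abs_sub_le_integral_of_abs_deriv_le hd2
      (g := fun s => a * P s * nrm ψ) (by fun_prop) hd1 ht
    rw [intervalIntegral.integral_mul_const] at h1
    have h2 := h0.2 w (Nat.zero_le _) hw ψ hψ
    have h3 := abs_sub_abs_le_abs_sub (∫ x, Real.sin (φ t x) * D w ψ x)
      (∫ x, Real.sin (φ 0 x) * D w ψ x)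
    rw [add_mul]
    linarith
  refine ⟨continuousOn_rn (fun t ht => ⟨_, ?_, hreg t ht⟩) fun t ht δ hδ => ?_, hreg⟩
  · refine add_nonneg hb (intervalIntegral.integral_nonneg ht.1 fun s hs => ?_)
    exact mul_nonneg ha (hP0 s ⟨hs.1, hs.2.trans ht.2⟩)
  · have : ∀ᶠ s in 𝓝[Icc 0 T] t, a * B * |s - t| < δ := by
      refine Filter.Tendsto.eventually_lt_const (v := 0) hδ ?_
      refine Tendsto.mono_left ?_ nhdsWithin_le_nhds
      have : Continuous fun s : ℝ => a * B * |s - t| := by fun_prop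
      simpa using this.tendsto t
    filter_upwards [this, self_mem_nhdsWithin] with s hs hsI
    refine ⟨(hsl s hsI).sub (hsl t ht), fun w _ hw ψ hψ => ?_⟩
    choose! d hd1 hd2 using hder w hw ψ hψ
    have h1 := (convex_Icc 0 T).norm_image_sub_le_of_norm_hasDerivWithin_le hd2
      (C := a * B * nrm ψ) (fun r hr => (hd1 r hr).trans (mul_le_mul_of_nonneg_right
        (mul_le_mul_of_nonneg_left (hB r hr) ha) (nrm_nonneg _))) ht hsI
    rw [← integral_sub ((hsl s hsI).integrable_mul_test (hψ.D w))
      ((hsl t ht).integrable_mul_test (hψ.D w))] at h1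
    have h2 := mul_le_mul_of_nonneg_right hs.le (nrm_nonneg ψ)
    simp only [Pi.sub_apply, sub_mul]
    rw [Real.norm_eq_abs, Real.norm_eq_abs] at h1
    linarith

theorem D_cons_comm {ψ : Space N → ℝ} (hψ : ContDiff ℝ ∞ ψ) (i : Fin N) (w : List (Fin N)) :
    partialDeriv i (D w ψ) = D w (partialDeriv i ψ) := by
  have := D_perm hψ (List.perm_append_comm (l₁ := [i]) (l₂ := w))
  rw [D_append, D_append] at this
  exact this

section Energy

variable {m : ℕ} {T a b : ℝ} {u φ F R₀ : ℝ → Space N → ℝ} {G R₁ : Fin N → ℝ → Space N → ℝ}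

/-- Here b measures the remainders and a the cost of the nonlinear factors. The divergence terms G
and R₁ carry one more derivative than the corresponding sources, since the system is used for ∂^w u
and ∇∂^w φ. The energy X contains b, so every source is a multiple of X and Gronwall's lemma closes.
The regularity of sin φ is part of the conclusion because it is assumed only at t = 0. -/
theorem energy_estimate (hT : 0 < T) (ha : 1 ≤ a) (hb : 0 ≤ b)
    (hu : ∀ t ∈ Icc 0 T, ∃ M, 0 ≤ M ∧ Reg 0 m M (u t))
    (hφ : ∀ t ∈ Icc 0 T, ∃ M, 0 ≤ M ∧ Reg 1 (m + 1) M (φ t))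
    (huc : ∀ t ∈ Icc 0 T, ∀ δ > 0, ∀ᶠ s in 𝓝[Icc 0 T] t, Reg 0 m δ (u s - u t))
    (hφc : ∀ t ∈ Icc 0 T, ∀ δ > 0, ∀ᶠ s in 𝓝[Icc 0 T] t, Reg 1 (m + 1) δ (φ s - φ t))
    (hF : ∀ t ∈ Icc 0 T, ∀ X, b ≤ X → Reg 0 m X (u t) → Reg 1 (m + 1) X (φ t) →
      Reg 0 m X (fun x => Real.sin (φ t x)) → Reg 0 m (a * X) (F t))
    (hG : ∀ i, ∀ t ∈ Icc 0 T, Reg 1 (m + 1) (a * b) (G i t))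
    (hR₀ : ∀ t ∈ Icc 0 T, Reg 0 (m + 1) b (R₀ t))
    (hR₁ : ∀ i, ∀ t ∈ Icc 0 T, Reg 1 (m + 2) b (R₁ i t))
    (hcos : ∀ t ∈ Icc 0 T, ∀ p P, 0 ≤ P → Reg 0 m P p →
      Reg 0 m (a * P) fun x => Real.cos (φ t x) * p x)
    (equ : ∀ ψ, IsTest ψ → ∀ t ∈ Icc 0 T, HasDerivWithinAt (fun s => ∫ x, u s x * ψ x)
      ((∑ i, ∫ x, φ t x * partialDeriv i (partialDeriv i ψ) x) + (∫ x, F t x * ψ x) +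
        ∑ i, ∫ x, G i t x * partialDeriv i ψ x) (Icc 0 T) t)
    (eqφ : ∀ ψ, IsTest ψ → ∀ t ∈ Icc 0 T, HasDerivWithinAt (fun s => ∫ x, φ s x * ψ x)
      ((∫ x, u t x * ψ x) + (∫ x, R₀ t x * ψ x) + ∑ i, ∫ x, R₁ i t x * partialDeriv i ψ x)
      (Icc 0 T) t)
    {X₀ : ℝ} (hX₀ : b ≤ X₀) (hu0 : Reg 0 m X₀ (u 0)) (hφ0 : Reg 1 (m + 1) X₀ (φ 0))
    (hs0 : Reg 0 m X₀ fun x => Real.sin (φ 0 x)) {t : ℝ} (ht : t ∈ Icc 0 T) :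
    rn 0 m (u t) + rn 1 (m + 1) (φ t) + rn 0 m (fun x => Real.sin (φ t x)) ≤
      4 * (N + 1) ^ 2 * X₀ * Real.exp (4 * (N + 1) ^ 2 * a * t) ∧
    Reg 0 m (rn 0 m fun x => Real.sin (φ t x)) fun x => Real.sin (φ t x) := by
  have h0 : (0 : ℝ) ∈ Icc 0 T := ⟨le_rfl, hT.le⟩
  have hX₀0 : 0 ≤ X₀ := hb.trans hX₀
  have ha0 : 0 ≤ a := zero_le_one.trans ha
  have hN0 : (0 : ℝ) ≤ N := Nat.cast_nonneg N
  have hu' : ∀ t ∈ Icc 0 T, Reg 0 m (rn 0 m (u t)) (u t) := fun t ht => by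
    obtain ⟨M, hM, h⟩ := hu t ht
    exact h.rn hM
  have hφ' : ∀ t ∈ Icc 0 T, Reg 1 (m + 1) (rn 1 (m + 1) (φ t)) (φ t) := fun t ht => by
    obtain ⟨M, hM, h⟩ := hφ t ht
    exact h.rn hM
  have hulc := continuousOn_rn hu huc
  have hφlc := continuousOn_rn hφ hφc
  -- the time derivative of `φ`
  have hr : ∀ i, ∀ t ∈ Icc 0 T, ∃ r : Space N → ℝ, MemLp r 2 volume ∧ nrm r ≤ b ∧
      ∀ ψ, IsTest ψ → ∫ x, R₁ i t x * D [i] ψ x = ∫ x, r x * ψ x := fun i t ht =>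
    ((hR₁ i t ht).2 [i] (by simp) (by simp)).exists_rep hb (hR₁ i t ht).1
  choose! r hrm hrb hr using hr
  set p : ℝ → Space N → ℝ := fun t => u t + R₀ t + ∑ i, r i t with hp
  have hrreg : ∀ i, ∀ t ∈ Icc 0 T, Reg 0 m b (r i t) := fun i t ht =>
    ((hR₁ i t ht).mono le_rfl (by simp) le_rfl).of_rep (w := [i]) (by simp)
      (hrm i t ht) (hr i t ht)
  have hpreg : ∀ t ∈ Icc 0 T, Reg 0 m (rn 0 m (u t) + (N + 1) * b) (p t) := fun t ht => by
    have := ((hu' t ht).add ((hR₀ t ht).mono le_rfl (Nat.le_succ m) le_rfl)).add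
      (Reg.sum (s := Finset.univ) fun i _ => hrreg i t ht)
    refine this.mono le_rfl le_rfl ?_
    rw [Finset.sum_const, Finset.card_univ, Fintype.card_fin, nsmul_eq_mul]
    linarith
  have hpd : ∀ ψ, IsTest ψ → ∀ t ∈ Icc 0 T,
      HasDerivWithinAt (fun s => ∫ x, φ s x * ψ x) (∫ x, p t x * ψ x) (Icc 0 T) t := by
    intro ψ hψ t ht
    refine (eqφ ψ hψ t ht).congr_deriv ?_
    have e1 : ∀ i, ∫ x, R₁ i t x * partialDeriv i ψ x = ∫ x, r i t x * ψ x := fun i =>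
      hr i t ht ψ hψ
    have i1 := (hu' t ht).1.integrable_mul_test hψ
    have i2 := (hR₀ t ht).1.integrable_mul_test hψ
    have i3 : ∀ i, Integrable (fun x => r i t x * ψ x) volume := fun i =>
      (hrm i t ht).locallyIntegrable_two.integrable_mul_test hψ
    have i4 : Integrable (fun x => u t x * ψ x + R₀ t x * ψ x) volume := i1.add i2
    rw [Finset.sum_congr rfl fun i _ => e1 i, ← integral_finsetSum _ fun i _ => i3 i,
      ← integral_add i1 i2, ← integral_add i4 (integrable_finsetSum _ fun i _ => i3 i)]
    congr 1
    funext x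
    simp only [hp, Pi.add_apply, Finset.sum_apply, add_mul, Finset.sum_mul]
  -- continuous extensions to the line
  set pr : ℝ → ℝ := fun s => (projIcc 0 T hT.le s : ℝ) with hpr
  have hprc : Continuous pr := continuous_subtype_val.comp continuous_projIcc
  have hprm : ∀ s, pr s ∈ Icc 0 T := fun s => (projIcc 0 T hT.le s).2
  have hpre : ∀ s ∈ Icc 0 T, pr s = s := fun s hs => by
    simp only [hpr, projIcc_of_mem hT.le hs]
  have hext : ∀ f : ℝ → ℝ, ContinuousOn f (Icc 0 T) → Continuous fun s => f (pr s) := fun f hf =>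
    hf.comp_continuous hprc hprm
  set P : ℝ → ℝ := fun s => rn 0 m (u (pr s)) + (N + 1) * b with hP
  have hPc : Continuous P := (hext _ hulc).add continuous_const
  have hPe : ∀ t ∈ Icc 0 T, P t = rn 0 m (u t) + (N + 1) * b := fun t ht => by
    simp only [hP, hpre t ht]
  have hP0 : ∀ t, 0 ≤ P t := fun t => by
    have := rn_nonneg 0 m (u (pr t))
    simp only [hP]
    positivity
  have hpreg' : ∀ t ∈ Icc 0 T, Reg 0 m (P t) (p t) := fun t ht => by
    rw [hPe t ht]
    exact hpreg t ht
  obtain ⟨hsc, hsreg⟩ := continuousOn_rn_sin (fun t ht => (hφ' t ht).1) hPc (fun t _ => hP0 t)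
    hpreg' (fun t ht => hcos t ht _ _ (hP0 t) (hpreg' t ht)) ha0 hpd hX₀0 hs0
  have hs' : ∀ t ∈ Icc 0 T, Reg 0 m (rn 0 m fun x => Real.sin (φ t x))
      fun x => Real.sin (φ t x) := fun t ht => by
    refine (hsreg t ht).rn (add_nonneg hX₀0 (intervalIntegral.integral_nonneg ht.1 fun s _ => ?_))
    exact mul_nonneg ha0 (hP0 s)
  refine ⟨?_, hs' t ht⟩
  -- the energy
  set X : ℝ → ℝ := fun t => b + (rn 0 m (u t) + rn 1 (m + 1) (φ t) +
    rn 0 m fun x => Real.sin (φ t x)) with hX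
  have hXc : ContinuousOn X (Icc 0 T) := continuousOn_const.add ((hulc.add hφlc).add hsc)
  have hXu : ∀ t, rn 0 m (u t) ≤ X t := fun t => by
    have := rn_nonneg 1 (m + 1) (φ t)
    have := rn_nonneg 0 m fun x => Real.sin (φ t x)
    simp only [hX]
    linarith
  have hXφ : ∀ t, rn 1 (m + 1) (φ t) ≤ X t := fun t => by
    have := rn_nonneg 0 m (u t)
    have := rn_nonneg 0 m fun x => Real.sin (φ t x)
    simp only [hX]
    linarith
  have hXs : ∀ t, (rn 0 m fun x => Real.sin (φ t x)) ≤ X t := fun t => by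
    have := rn_nonneg 0 m (u t)
    have := rn_nonneg 1 (m + 1) (φ t)
    simp only [hX]
    linarith
  have hXb : ∀ t, b ≤ X t := fun t => by
    have := rn_nonneg 0 m (u t)
    have := rn_nonneg 1 (m + 1) (φ t)
    have := rn_nonneg 0 m fun x => Real.sin (φ t x)
    simp only [hX]
    linarith
  have hX0 : ∀ t, 0 ≤ X t := fun t => hb.trans (hXb t)
  have hXb' : ∀ t, rn 0 m (u t) + b ≤ X t := fun t => by
    have := rn_nonneg 1 (m + 1) (φ t)
    have := rn_nonneg 0 m fun x => Real.sin (φ t x)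
    simp only [hX]
    linarith
  obtain ⟨B, hB⟩ : ∃ B, ∀ t ∈ Icc 0 T, X t ≤ B := by
    obtain ⟨G, hG⟩ := isCompact_Icc.bddAbove_image hXc
    exact ⟨G, fun t ht => hG ⟨t, ht, rfl⟩⟩
  -- Each source has one undifferentiated term and N divergence terms, all bounded by aX since b ≤
  -- X.
  set g : ℝ → ℝ := fun s => (N + 1) * a * X (pr s) with hg
  have hgc : Continuous g := continuous_const.mul (hext _ hXc)
  have hge : ∀ t ∈ Icc 0 T, g t = (N + 1) * a * X t := fun t ht => by simp only [hg, hpre t ht]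
  have hg0 : ∀ t, 0 ≤ g t := fun t => mul_nonneg (by positivity) (hX0 _)
  have hIg0 : ∀ t ∈ Icc 0 T, 0 ≤ ∫ s in (0 : ℝ)..t, g s := fun t ht =>
    intervalIntegral.integral_nonneg ht.1 fun s _ => hg0 s
  have haX : ∀ t, X t ≤ a * X t := fun t => le_mul_of_one_le_left (hX0 t) ha
  -- The wave energy inequality is applied to each derivative separately. By construction v is
  -- (−1)^|w| ∂^w u and W is −(−1)^|w| ∇∂^w φ, the signs matching the system of `wave_energy`.
  have hwave : ∀ w : List (Fin N), w.length ≤ m → ∀ t ∈ Icc 0 T,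
      ∃ (v : Space N → ℝ) (W : Fin N → Space N → ℝ), MemLp v 2 volume ∧
        (∀ i, MemLp (W i) 2 volume) ∧
        (∀ ψ, IsTest ψ → ∫ x, u t x * D w ψ x = ∫ x, v x * ψ x) ∧
        (∀ i ψ, IsTest ψ → ∫ x, φ t x * D (i :: w) ψ x = ∫ x, W i x * ψ x) ∧
        nrm v + ∑ i, nrm (W i) ≤ (N + 1) * ((N + 1) * X₀ + ∫ s in (0 : ℝ)..t, g s) := by
    intro w hw t ht
    have hv : ∀ t ∈ Icc 0 T, ∃ v : Space N → ℝ, MemLp v 2 volume ∧ nrm v ≤ rn 0 m (u t) ∧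
        ∀ ψ, IsTest ψ → ∫ x, u t x * D w ψ x = ∫ x, v x * ψ x := fun t ht =>
      ((hu' t ht).2 w (Nat.zero_le _) hw).exists_rep (rn_nonneg _ _ _) (hu' t ht).1
    choose! v hvm hvb hv using hv
    have hW : ∀ i, ∀ t ∈ Icc 0 T, ∃ W : Space N → ℝ, MemLp W 2 volume ∧
        nrm W ≤ rn 1 (m + 1) (φ t) ∧
        ∀ ψ, IsTest ψ → ∫ x, φ t x * D (i :: w) ψ x = ∫ x, W x * ψ x := fun i t ht =>
      ((hφ' t ht).2 (i :: w) (by simp) (by simpa using hw)).exists_rep (rn_nonneg _ _ _)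
        (hφ' t ht).1
    choose! W hWm hWb hW using hW
    have hf : ∀ t ∈ Icc 0 T, ∃ f : Space N → ℝ, MemLp f 2 volume ∧ nrm f ≤ a * X t ∧
        ∀ ψ, IsTest ψ → ∫ x, F t x * D w ψ x = ∫ x, f x * ψ x := fun t ht => by
      have h1 := hF t ht (X t) (hXb t) ((hu' t ht).mono le_rfl le_rfl (hXu t))
        ((hφ' t ht).mono le_rfl le_rfl (hXφ t)) ((hs' t ht).mono le_rfl le_rfl (hXs t))
      exact (h1.2 w (Nat.zero_le _) hw).exists_rep (mul_nonneg ha0 (hX0 t)) h1.1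
    choose! f hfm hfb hf using hf
    have hγ : ∀ i, ∀ t ∈ Icc 0 T, ∃ γ : Space N → ℝ, MemLp γ 2 volume ∧ nrm γ ≤ a * b ∧
        ∀ ψ, IsTest ψ → ∫ x, G i t x * D (i :: w) ψ x = ∫ x, γ x * ψ x := fun i t ht =>
      ((hG i t ht).2 (i :: w) (by simp) (by simpa using hw)).exists_rep (mul_nonneg ha0 hb)
        (hG i t ht).1
    choose! γ hγm hγb hγ using hγ
    have hρ₀ : ∀ i, ∀ t ∈ Icc 0 T, ∃ ρ : Space N → ℝ, MemLp ρ 2 volume ∧ nrm ρ ≤ b ∧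
        ∀ ψ, IsTest ψ → ∫ x, R₀ t x * D (i :: w) ψ x = ∫ x, ρ x * ψ x := fun i t ht =>
      ((hR₀ t ht).2 (i :: w) (by simp) (by simpa using hw)).exists_rep hb (hR₀ t ht).1
    choose! ρ₀ hρ₀m hρ₀b hρ₀ using hρ₀
    have hρ : ∀ i j, ∀ t ∈ Icc 0 T, ∃ ρ : Space N → ℝ, MemLp ρ 2 volume ∧ nrm ρ ≤ b ∧
        ∀ ψ, IsTest ψ → ∫ x, R₁ j t x * D (j :: i :: w) ψ x = ∫ x, ρ x * ψ x := fun i j t ht =>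
      ((hR₁ j t ht).2 (j :: i :: w) (by simp) (by simpa using hw)).exists_rep hb (hR₁ j t ht).1
    choose! ρ hρm hρb hρ using hρ
    have hsm1 : ∀ t ∈ Icc 0 T, MemLp (∑ i, γ i t) 2 volume := fun t ht =>
      memLp_finsetSum' _ fun i _ => hγm i t ht
    have hsm2 : ∀ i, ∀ t ∈ Icc 0 T, MemLp (∑ j, ρ i j t) 2 volume := fun i t ht =>
      memLp_finsetSum' _ fun j _ => hρm i j t ht
    have hsum : ∀ (f : Space N → ℝ) (γ : Fin N → Space N → ℝ) (ψ : Space N → ℝ), IsTest ψ →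
        MemLp f 2 volume → (∀ i, MemLp (γ i) 2 volume) →
        ∫ x, (f + ∑ i, γ i) x * ψ x = (∫ x, f x * ψ x) + ∑ i, ∫ x, γ i x * ψ x := by
      intro f γ ψ hψ hf hγ
      rw [← integral_finsetSum _ fun i _ => (hγ i).integrable_mul_fun (hψ.memLp 2),
        ← integral_add (hf.integrable_mul_fun (hψ.memLp 2))
          (integrable_finsetSum _ fun i _ => (hγ i).integrable_mul_fun (hψ.memLp 2))]
      congr 1
      funext x
      simp only [Pi.add_apply, Finset.sum_apply, add_mul, Finset.sum_mul]
    have hmain := wave_energy (B := B) (v := v) (W := W) (f := fun t => f t + ∑ i, γ i t)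
      (h := fun i t => ρ₀ i t + ∑ j, ρ i j t) hgc
      (fun t ht => ⟨hvm t ht, (hvb t ht).trans ((hXu t).trans (hB t ht))⟩)
      (fun i t ht => ⟨hWm i t ht, (hWb i t ht).trans ((hXφ t).trans (hB t ht))⟩)
      (fun t ht => ⟨(hfm t ht).add (hsm1 t ht), by
        refine (nrm_add_le (hfm t ht) (hsm1 t ht)).trans ?_
        have h1 := (nrm_sum_le Finset.univ _ fun i _ => hγm i t ht).trans
          (Finset.sum_le_sum fun i _ => hγb i t ht)
        rw [Finset.sum_const, Finset.card_univ, Fintype.card_fin, nsmul_eq_mul] at h1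
        have h2 := mul_le_mul_of_nonneg_left (mul_le_mul_of_nonneg_left (hXb t) ha0) hN0
        rw [hge t ht]
        linarith [hfb t ht]⟩)
      (fun i t ht => ⟨(hρ₀m i t ht).add (hsm2 i t ht), by
        refine (nrm_add_le (hρ₀m i t ht) (hsm2 i t ht)).trans ?_
        have h1 := (nrm_sum_le Finset.univ _ fun j _ => hρm i j t ht).trans
          (Finset.sum_le_sum fun j _ => hρb i j t ht)
        rw [Finset.sum_const, Finset.card_univ, Fintype.card_fin, nsmul_eq_mul] at h1
        have h2 := mul_le_mul_of_nonneg_left ((hXb t).trans (haX t)) hN0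
        rw [hge t ht]
        linarith [hρ₀b i t ht, (hXb t).trans (haX t)]⟩)
      (fun ψ hψ t ht => by
        refine ((equ _ (hψ.D w) t ht).congr_deriv ?_).congr (fun s hs => (hv s hs ψ hψ).symm)
          (hv t ht ψ hψ).symm
        rw [hsum _ _ ψ hψ (hfm t ht) fun i => hγm i t ht, hf t ht ψ hψ, add_assoc]
        congr 1
        · refine Finset.sum_congr rfl fun i _ => ?_
          rw [← hW i t ht _ (hψ.partialDeriv i), D_cons_comm hψ.1]
          rfl
        · congr 1
          exact Finset.sum_congr rfl fun i _ => hγ i t ht ψ hψ)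
      (fun i ψ hψ t ht => by
        refine ((eqφ _ (hψ.D (i :: w)) t ht).congr_deriv ?_).congr
          (fun s hs => (hW i s hs ψ hψ).symm) (hW i t ht ψ hψ).symm
        rw [hsum _ _ ψ hψ (hρ₀m i t ht) fun j => hρm i j t ht, hρ₀ i t ht ψ hψ, add_assoc]
        congr 1
        · rw [← hv t ht _ (hψ.partialDeriv i), ← D_cons_comm hψ.1]
          rfl
        · congr 1
          exact Finset.sum_congr rfl fun j _ => hρ i j t ht ψ hψ) ht
    refine ⟨v t, fun i => W i t, hvm t ht, fun i => hWm i t ht, hv t ht, fun i => hW i t ht,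
      hmain.trans ?_⟩
    refine mul_le_mul_of_nonneg_left (add_le_add ?_ le_rfl) (by positivity)
    have h1 : nrm (v 0) ≤ X₀ := (hvb 0 h0).trans (rn_le hX₀0 hu0)
    have h2 : ∑ i, nrm (W i 0) ≤ ∑ i : Fin N, X₀ := Finset.sum_le_sum fun i _ =>
      (hWb i 0 h0).trans (rn_le hX₀0 hφ0)
    rw [Finset.sum_const, Finset.card_univ, Fintype.card_fin, nsmul_eq_mul] at h2
    linarith
  -- The sum of b ≤ X₀, twice the wave bound (N + 1)((N + 1)X₀ + J), and X₀ + J for the sine is at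
  -- most 4(N + 1)²X₀ + 4(N + 1)J.
  have hXle : ∀ t ∈ Icc 0 T, X t ≤ 4 * (N + 1) ^ 2 * X₀ +
      4 * (N + 1) ^ 2 * a * ∫ s in (0 : ℝ)..t, X (pr s) := by
    intro t ht
    set J := ∫ s in (0 : ℝ)..t, g s with hJ
    have hJ0 : 0 ≤ J := hIg0 t ht
    have hY0 : 0 ≤ (N + 1) * ((N + 1) * X₀ + J) := by positivity
    have h1 : rn 0 m (u t) ≤ (N + 1) * ((N + 1) * X₀ + J) := by
      refine rn_le hY0 ⟨(hu' t ht).1, fun w _ hw ψ hψ => ?_⟩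
      obtain ⟨v, W, hvm, hWm, hv, hW, hle⟩ := hwave w hw t ht
      have : 0 ≤ ∑ i, nrm (W i) := Finset.sum_nonneg fun i _ => nrm_nonneg _
      rw [hv ψ hψ]
      refine (abs_integral_mul_le hvm (hψ.memLp 2)).trans (mul_le_mul_of_nonneg_right ?_
        (nrm_nonneg _))
      linarith
    have h2 : rn 1 (m + 1) (φ t) ≤ (N + 1) * ((N + 1) * X₀ + J) := by
      refine rn_le hY0 ⟨(hφ' t ht).1, fun w hw1 hw ψ hψ => ?_⟩
      obtain _ | ⟨i, w⟩ := w
      · simp at hw1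
      obtain ⟨v, W, hvm, hWm, hv, hW, hle⟩ := hwave w (by simpa using hw) t ht
      have h3 : nrm (W i) ≤ ∑ i, nrm (W i) :=
        Finset.single_le_sum (f := fun i => nrm (W i)) (fun i _ => nrm_nonneg _)
          (Finset.mem_univ i)
      rw [hW i ψ hψ]
      refine (abs_integral_mul_le (hWm i) (hψ.memLp 2)).trans (mul_le_mul_of_nonneg_right ?_
        (nrm_nonneg _))
      linarith [nrm_nonneg v]
    have h3 : (rn 0 m fun x => Real.sin (φ t x)) ≤ X₀ + J := by
      refine rn_le (by positivity) ((hsreg t ht).mono le_rfl le_rfl (add_le_add le_rfl ?_))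
      refine intervalIntegral.integral_mono_on ht.1
        ((continuous_const.mul hPc).intervalIntegrable _ _) (hgc.intervalIntegrable _ _)
        fun s hs => ?_
      have hsI : s ∈ Icc 0 T := ⟨hs.1, hs.2.trans ht.2⟩
      rw [hPe s hsI, hge s hsI]
      have h4 := mul_le_mul_of_nonneg_left (hXb s) hN0
      have h5 : rn 0 m (u s) + (N + 1) * b ≤ (N + 1) * X s := by linarith [hXb' s]
      calc a * (rn 0 m (u s) + (N + 1) * b) ≤ a * ((N + 1) * X s) :=
            mul_le_mul_of_nonneg_left h5 ha0
        _ = _ := by ring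
    have hJe : J = (N + 1) * a * ∫ s in (0 : ℝ)..t, X (pr s) := by
      rw [hJ, ← intervalIntegral.integral_const_mul]
    have h6 : 4 * (N + 1) ^ 2 * a * ∫ s in (0 : ℝ)..t, X (pr s) = 4 * (N + 1) * J := by
      rw [hJe]; ring
    rw [h6]
    have h7 : X t ≤ X₀ + (2 * ((N + 1) * ((N + 1) * X₀ + J)) + (X₀ + J)) := by
      simp only [hX]
      linarith
    nlinarith [mul_nonneg hN0 hX₀0, mul_nonneg hN0 hJ0, mul_nonneg (mul_nonneg hN0 hN0) hX₀0]
  have hfin := gronwall_integral (T := T) (hext _ hXc) (c₀ := 4 * (N + 1) ^ 2 * X₀)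
    (c := 4 * (N + 1) ^ 2 * a) (by positivity) (fun t ht => by
      rw [hpre t ht]
      exact hXle t ht) ht
  rw [hpre t ht] at hfin
  simp only [hX] at hfin
  linarith

end Energy

end SineGordonRegime

end


noncomputable section

namespace SineGordonRegime

variable {N : ℕ}

/-! ### The remainder terms -/

theorem Reg.weakPartial_smul {b : ℕ} {M : ℝ} {f : Space N → ℝ} (h : Reg 1 (b + 1) M f)
    (hM : 0 ≤ M) (c : ℝ) (i : Fin N) :
    SineGordonRegime.weakPartial i (fun x => c * f x) =ᵐ[volume] fun x =>
      c * SineGordonRegime.weakPartial i f x := by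
  obtain ⟨h1, h2⟩ := h.weakPartial_spec hM i
  refine isWeakDeriv_weakPartial (h.smul c).1 (h1.const_mul c).locallyIntegrable_two
    fun ψ hψ => ?_
  simp only [mul_assoc, integral_const_mul]
  rw [h2 ψ hψ]
  ring

/-- The size `K (1 + ε² K² + K³)` of the remainder terms. -/
def remSize (ε K : ℝ) : ℝ := K * (1 + ε ^ 2 * K ^ 2 + K ^ 3)

/-- These monomials are the ones that occur in the remainders. The powers K² and K³ lie between K
and K⁴, and εK² ≤ K + ε²K³ is AM-GM. -/
theorem le_remSize (ε : ℝ) {K : ℝ} (hK : 0 ≤ K) : K ≤ remSize ε K ∧ K ^ 2 ≤ remSize ε K ∧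
    K ^ 3 ≤ remSize ε K ∧ K ^ 4 ≤ remSize ε K ∧ ε * K ^ 2 ≤ remSize ε K ∧
    ε ^ 2 * K ^ 3 ≤ remSize ε K := by
  have h1 : 0 ≤ ε ^ 2 * K ^ 3 := by positivity
  have h4 : 0 ≤ K ^ 4 := by positivity
  have e : remSize ε K = K + ε ^ 2 * K ^ 3 + K ^ 4 := by simp only [remSize]; ring
  have h2 : K ^ 2 ≤ K + K ^ 4 := by
    rcases le_total K 1 with h | h
    · nlinarith
    · nlinarith [pow_le_pow_right₀ h (show 2 ≤ 4 by norm_num)]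
  have h3 : K ^ 3 ≤ K + K ^ 4 := by
    rcases le_total K 1 with h | h
    · have := pow_le_pow_of_le_one hK h (show 1 ≤ 3 by norm_num)
      rw [pow_one] at this
      linarith
    · linarith [pow_le_pow_right₀ h (show 3 ≤ 4 by norm_num)]
  have h5 : ε * K ^ 2 ≤ K + ε ^ 2 * K ^ 3 := by
    have : 0 ≤ K * ((ε * K - 1) ^ 2 + 1 + (ε * K) ^ 2) := by positivity
    nlinarith
  rw [e]
  refine ⟨?_, ?_, ?_, ?_, ?_, ?_⟩ <;> linarith

/-- The remainder terms of the rescaled Landau-Lifshitz system are bounded by `Z`. -/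
structure RemainderBound (n : ℕ) (ε Z : ℝ) (U Φ : Space N → ℝ) : Prop where
  sin_sq : Reg 0 n Z fun x => Real.sin (Φ x) * Real.sin (Φ x) * U x
  gradU_sq : ∀ i, Reg 0 n Z fun x => ε * (ε * U x * ((1 - (ε * U x) ^ 2)⁻¹ *
    (1 - (ε * U x) ^ 2)⁻¹) * (weakPartial i U x * weakPartial i U x))
  gradΦ_sq : ∀ i, Reg 0 n Z fun x => U x * (weakPartial i Φ x * weakPartial i Φ x)
  gradU : ∀ i, Reg 1 (n + 1) Z fun x => (1 - (ε * U x) ^ 2)⁻¹ * weakPartial i U x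
  U_sq_gradΦ : ∀ i, Reg 0 n Z fun x => U x * U x * weakPartial i Φ x
  U_sq_sin : Reg 0 n Z fun x => Real.sin (Φ x) * Real.cos (Φ x) * (U x * U x)

/-- Tame estimates applied to each product, with all suprema bounded by a multiple of K. The factor
L absorbs the powers of 1 + ε Cs K created by differentiating 1/(1 − ε²U²). -/
theorem exists_remainderBound (N n : ℕ) {Cs : ℝ} (hCs : 1 ≤ Cs) : ∃ C, 1 ≤ C ∧
    ∀ (ε K L : ℝ) (U Φ : Space N → ℝ), 0 < ε → 0 ≤ K → 1 ≤ L → Reg 0 (n + 2) K U →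
      Reg 1 (n + 1) K Φ → Reg 0 n K (fun x => Real.sin (Φ x)) → (∀ᵐ x, |U x| ≤ Cs * K) →
      (∀ i, ∀ᵐ x, |weakPartial i U x| ≤ Cs * K) → (∀ i, ∀ᵐ x, |weakPartial i Φ x| ≤ Cs * K) →
      (∀ᵐ x, |ε * U x| ≤ 1 / √2) → (1 + ε * (Cs * K)) ^ (n - 1) ≤ L →
      RemainderBound n ε (C * (L * remSize ε K)) U Φ := by
  obtain ⟨C, hC1, h11, h10⟩ := exists_mul_const N n
  obtain ⟨C', hC1', h11', -⟩ := exists_mul_const N (n + 1)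
  obtain ⟨Cq, hCq, hq⟩ := breg_inv N n
  obtain ⟨Cq', hCq', hq'⟩ := breg_inv N (n + 1)
  -- The cosine estimate gains one order over sin Φ. It is therefore used at order n − 1, and order
  -- n = 0 is vacuous.
  obtain ⟨Cc, hCc1, hcos⟩ : ∃ Cc, 1 ≤ Cc ∧ ∀ (Φ : Space N → ℝ) (K S : ℝ), 0 ≤ K → 0 ≤ S →
      Reg 1 (n + 1) K Φ → (∀ i, ∀ᵐ x, |weakPartial i Φ x| ≤ S) →
      Reg 0 n K (fun x => Real.sin (Φ x)) →
      BReg 1 n 1 (Cc * (K + S * K)) (fun x => Real.cos (Φ x)) := by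
    cases n with
    | zero =>
      refine ⟨1, le_rfl, fun Φ K S _ _ hΦ _ _ => BReg.ofZero ?_
        (.of_forall fun x => Real.abs_cos_le_one _)⟩
      exact Real.continuous_cos.comp_aestronglyMeasurable hΦ.1.aestronglyMeasurable
    | succ n =>
      obtain ⟨Cc, hCc1, hcos⟩ := breg_cos N n
      exact ⟨Cc, hCc1, fun Φ K S hK hS hΦ hS' hsin => hcos Φ K S hK hS
        (hΦ.mono le_rfl (by omega) le_rfl) hS' (hsin.mono le_rfl (by omega) le_rfl)⟩
  have hC0 : 0 ≤ C := zero_le_one.trans hC1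
  have hC0' : 0 ≤ C' := zero_le_one.trans hC1'
  have hCc0 : 0 ≤ Cc := zero_le_one.trans hCc1
  have hCs0 : 0 ≤ Cs := zero_le_one.trans hCs
  -- These are the coefficients obtained by expanding each product bound into monomials; `cc` serves
  -- both U|∇Φ|² and U²∇Φ.
  set ca := C + 2 * C ^ 2 * Cs with hca
  set cb := 8 * C ^ 2 * Cs + 4 * C ^ 2 * Cs ^ 2 * (C * Cq + 1) with hcb
  set cc := 2 * C ^ 2 * Cs ^ 2 + C * Cs ^ 2 with hcc
  set cd := 2 * C' + C' * Cs * Cq' * (1 + Cs) with hcd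
  set cf := 2 * C ^ 2 * Cs + C ^ 2 * Cs ^ 2 * (Cc + 1) + C ^ 2 * Cs ^ 3 * Cc with hcf
  have hca0 : 0 ≤ ca := by positivity
  have hcb0 : 0 ≤ cb := by positivity
  have hcc0 : 0 ≤ cc := by positivity
  have hcd0 : 0 ≤ cd := by positivity
  have hcf0 : 0 ≤ cf := by positivity
  refine ⟨1 + ca + cb + cc + cd + cf, by linarith, ?_⟩
  intro ε K L U Φ hε hK hL hU hΦ hsin hUS hUS' hΦS hy hLn
  set S := Cs * K with hS
  have hS0 : 0 ≤ S := by positivity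
  have hL0 : 0 ≤ L := by linarith
  have hM0 : 0 ≤ remSize ε K := hK.trans (le_remSize ε hK).1
  set Z := L * remSize ε K with hZ
  have hZ0 : 0 ≤ Z := by positivity
  obtain ⟨m1, m2, m3, m4, m5, m6⟩ := le_remSize ε hK
  have hMZ : remSize ε K ≤ Z := le_mul_of_one_le_left hM0 hL
  have k1 := m1.trans hMZ
  have k2 := m2.trans hMZ
  have k3 := m3.trans hMZ
  have k4 := m4.trans hMZ
  have k5 := m5.trans hMZ
  have k6 := m6.trans hMZ
  have l5 : L * (ε * K ^ 2) ≤ Z := mul_le_mul_of_nonneg_left m5 hL0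
  have l6 : L * (ε ^ 2 * K ^ 3) ≤ Z := mul_le_mul_of_nonneg_left m6 hL0
  have hle : ∀ c, c ≤ ca + cb + cc + cd + cf → c * Z ≤ (1 + ca + cb + cc + cd + cf) * Z :=
    fun c hc => mul_le_mul_of_nonneg_right (by linarith) hZ0
  have hU1 : Reg 1 (n + 1 + 1) K U := hU.mono zero_le_one le_rfl le_rfl
  -- regularity of the factors
  have bU : BReg 0 n S K U := ⟨hU.mono le_rfl (by omega) le_rfl, hUS⟩
  have bU1 : BReg 1 n S K U := bU.mono zero_le_one le_rfl le_rfl le_rfl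
  have bdU : ∀ i, BReg 0 (n + 1) S K (weakPartial i U) := fun i => ⟨hU1.weakPartial hK i, hUS' i⟩
  have bdUn : ∀ i, BReg 0 n S K (weakPartial i U) := fun i =>
    (bdU i).mono le_rfl (by omega) le_rfl le_rfl
  have bdΦ : ∀ i, BReg 0 n S K (weakPartial i Φ) := fun i => ⟨hΦ.weakPartial hK i, hΦS i⟩
  have bs : BReg 1 n 1 K (fun x => Real.sin (Φ x)) :=
    ⟨hsin.mono zero_le_one le_rfl le_rfl, .of_forall fun x => Real.abs_sin_le_one _⟩
  have bc := hcos Φ K S hK hS0 hΦ hΦS hsin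
  have hr1 : (1 : ℝ) / √2 ≤ 1 := by
    rw [div_le_one (by positivity)]
    exact Real.one_le_sqrt.2 (by norm_num)
  have by' := (bU1.smul ε).1
  rw [abs_of_pos hε] at by'
  have byB : BReg 1 n 1 (ε * K) (fun x => ε * U x) := ⟨by', hy.mono fun x hx => hx.trans hr1⟩
  have hyreg : Reg 1 (n + 1 + 1) (ε * K) (fun x => ε * U x) := by
    have := hU1.smul ε
    rwa [abs_of_pos hε] at this
  have hyS : ∀ i, ∀ᵐ x, |weakPartial i (fun x => ε * U x) x| ≤ ε * S := fun i => by
    filter_upwards [hU1.weakPartial_smul hK ε i, hUS' i] with x h1 h2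
    rw [h1, abs_mul, abs_of_pos hε]
    exact mul_le_mul_of_nonneg_left h2 hε.le
  set Q := Cq * (ε * K) * L with hQ
  have hQ0 : 0 ≤ Q := by positivity
  have bq : BReg 1 n 2 Q (fun x => (1 - (ε * U x) ^ 2)⁻¹) :=
    (hq _ (ε * K) (ε * S) (by positivity) (by positivity)
      (hyreg.mono le_rfl (by omega) le_rfl) hy hyS).mono le_rfl le_rfl le_rfl
      (mul_le_mul_of_nonneg_left hLn (by positivity))
  set Q' := Cq' * (ε * K) * (L * (1 + ε * S)) with hQ'
  have hQ0' : 0 ≤ Q' := by positivity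
  -- The divergence term needs order n + 1, hence the power n instead of n − 1. The extra factor 1 +
  -- εS is kept explicit and gives the monomials εK² and ε²K³. The case n = 0 is separate because n
  -- − 1 is truncated.
  have hpow : (1 + ε * S) ^ n ≤ L * (1 + ε * S) := by
    have h1 : 1 ≤ 1 + ε * S := le_add_of_nonneg_right (by positivity)
    rcases Nat.eq_zero_or_pos n with rfl | hn
    · rw [pow_zero]
      exact one_le_mul_of_one_le_of_one_le hL h1
    · obtain ⟨j, rfl⟩ := Nat.exists_eq_succ_of_ne_zero hn.ne'
      rw [pow_succ]
      exact mul_le_mul_of_nonneg_right hLn (by positivity)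
  have bq' : BReg 1 (n + 1) 2 Q' (fun x => (1 - (ε * U x) ^ 2)⁻¹) :=
    (hq' _ (ε * K) (ε * S) (by positivity) (by positivity) hyreg hy hyS).mono le_rfl le_rfl le_rfl
      (mul_le_mul_of_nonneg_left hpow (by positivity))
  have b01 : ∀ {A M : ℝ} {f : Space N → ℝ}, BReg 0 n A M f → BReg 1 n A M f := fun h =>
    h.mono zero_le_one le_rfl le_rfl le_rfl
  constructor
  · have h1 := h11 _ _ 1 1 K K zero_le_one zero_le_one hK hK bs bs
    rw [one_mul] at h1
    have h2 := h10 _ _ 1 S _ K zero_le_one hS0 (by positivity) hK h1 bU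
    refine h2.1.mono le_rfl le_rfl (le_trans ?_ (hle ca (by linarith)))
    calc C * (1 * K + S * (C * (1 * K + 1 * K))) = C * K + 2 * C ^ 2 * Cs * K ^ 2 := by
          rw [hS]; ring
      _ ≤ C * Z + 2 * C ^ 2 * Cs * Z := by gcongr
      _ = ca * Z := by rw [hca]; ring
  · intro i
    have h1 := h11 _ _ 2 2 Q Q zero_le_two zero_le_two hQ0 hQ0 bq bq
    have h2 := h11 _ _ 1 (2 * 2) (ε * K) _ zero_le_one (by norm_num) (by positivity)
      (by positivity) byB h1
    have h3 := h10 _ _ S S K K hS0 hS0 hK hK (b01 (bdUn i)) (bdUn i)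
    have h4 := (h10 _ _ _ _ _ _ (by norm_num) (by positivity) (by positivity) (by positivity)
      h2 h3).smul ε
    refine h4.1.mono le_rfl le_rfl (le_trans ?_ (hle cb (by linarith)))
    rw [abs_of_pos hε]
    calc ε * (C * (1 * (2 * 2) * (C * (S * K + S * K)) + S * S *
          (C * (1 * (C * (2 * Q + 2 * Q)) + 2 * 2 * (ε * K)))))
        = 8 * C ^ 2 * Cs * (ε * K ^ 2) + 4 * C ^ 2 * Cs ^ 2 * (C * Cq * (L * (ε ^ 2 * K ^ 3)) +
          ε ^ 2 * K ^ 3) := by rw [hS, hQ]; ring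
      _ ≤ 8 * C ^ 2 * Cs * Z + 4 * C ^ 2 * Cs ^ 2 * (C * Cq * Z + Z) := by gcongr
      _ = cb * Z := by rw [hcb]; ring
  · intro i
    have h3 := h10 _ _ S S K K hS0 hS0 hK hK (b01 (bdΦ i)) (bdΦ i)
    have h4 := h10 _ _ S _ K _ hS0 (by positivity) hK (by positivity) bU1 h3
    refine h4.1.mono le_rfl le_rfl (le_trans ?_ (hle cc (by linarith)))
    calc C * (S * (C * (S * K + S * K)) + S * S * K)
        = 2 * C ^ 2 * Cs ^ 2 * K ^ 3 + C * Cs ^ 2 * K ^ 3 := by rw [hS]; ring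
      _ ≤ 2 * C ^ 2 * Cs ^ 2 * Z + C * Cs ^ 2 * Z := by gcongr
      _ = cc * Z := by rw [hcc]; ring
  · intro i
    have h4 := h11' _ _ 2 S Q' K zero_le_two hS0 hQ0' hK bq'
      ((bdU i).mono zero_le_one le_rfl le_rfl le_rfl)
    refine h4.1.mono le_rfl le_rfl (le_trans ?_ (hle cd (by linarith)))
    calc C' * (2 * K + S * Q') = 2 * C' * K + C' * Cs * Cq' * (L * (ε * K ^ 2) +
          Cs * (L * (ε ^ 2 * K ^ 3))) := by rw [hS, hQ', hS]; ring
      _ ≤ 2 * C' * Z + C' * Cs * Cq' * (Z + Cs * Z) := by gcongr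
      _ = cd * Z := by rw [hcd]; ring
  · intro i
    have h3 := h11 _ _ S S K K hS0 hS0 hK hK bU1 bU1
    have h4 := h10 _ _ _ S _ K (by positivity) hS0 (by positivity) hK h3 (bdΦ i)
    refine h4.1.mono le_rfl le_rfl (le_trans ?_ (hle cc (by linarith)))
    calc C * (S * S * K + S * (C * (S * K + S * K)))
        = 2 * C ^ 2 * Cs ^ 2 * K ^ 3 + C * Cs ^ 2 * K ^ 3 := by rw [hS]; ring
      _ ≤ 2 * C ^ 2 * Cs ^ 2 * Z + C * Cs ^ 2 * Z := by gcongr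
      _ = cc * Z := by rw [hcc]; ring
  · have h1 := h11 _ _ 1 1 K _ zero_le_one zero_le_one hK (by positivity) bs bc
    have h2 := h10 _ _ S S K K hS0 hS0 hK hK bU1 bU
    have h3 := h10 _ _ _ _ _ _ (by norm_num) (by positivity) (by positivity) (by positivity) h1 h2
    refine h3.1.mono le_rfl le_rfl (le_trans ?_ (hle cf (by linarith)))
    calc C * (1 * 1 * (C * (S * K + S * K)) + S * S * (C * (1 * (Cc * (K + S * K)) + 1 * K)))
        = 2 * C ^ 2 * Cs * K ^ 2 + C ^ 2 * Cs ^ 2 * (Cc + 1) * K ^ 3 +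
          C ^ 2 * Cs ^ 3 * Cc * K ^ 4 := by rw [hS]; ring
      _ ≤ 2 * C ^ 2 * Cs * Z + C ^ 2 * Cs ^ 2 * (Cc + 1) * Z + C ^ 2 * Cs ^ 3 * Cc * Z := by
          gcongr
      _ = cf * Z := by rw [hcf]; ring

end SineGordonRegime

end


noncomputable section

namespace SineGordonRegime

variable {N : ℕ}

/-! ### The equations of the difference -/

/-- The remainder without derivatives in the equation of `∂_t U`. -/
def remF (σ ε : ℝ) (U Φ : Space N → ℝ) : Space N → ℝ :=
  (σ * ε ^ 2) • fun x => Real.sin (Φ x) * Real.cos (Φ x) * (U x * U x)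

/-- The remainder in divergence form in the equation of `∂_t U`. -/
def remG (ε : ℝ) (U Φ : Space N → ℝ) (i : Fin N) : Space N → ℝ :=
  ε ^ 2 • fun x => U x * U x * weakPartial i Φ x

/-- The remainder without derivatives in the equation of `∂_t Φ`. -/
def remR₀ (σ ε : ℝ) (U Φ : Space N → ℝ) : Space N → ℝ :=
  ε ^ 2 • ((-σ) • (fun x => Real.sin (Φ x) * Real.sin (Φ x) * U x) +
    ((∑ i, fun x => ε * (ε * U x * ((1 - (ε * U x) ^ 2)⁻¹ * (1 - (ε * U x) ^ 2)⁻¹) *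
      (weakPartial i U x * weakPartial i U x))) -
    ∑ i, fun x => U x * (weakPartial i Φ x * weakPartial i Φ x)))

/-- The remainder in divergence form in the equation of `∂_t Φ`. -/
def remR₁ (ε : ℝ) (U : Space N → ℝ) (i : Fin N) : Space N → ℝ :=
  ε ^ 2 • fun x => (1 - (ε * U x) ^ 2)⁻¹ * weakPartial i U x

theorem integral_inner_weakGrad {f g : Space N → ℝ}
    (hg : ∀ i, LocallyIntegrable (fun x => g x * weakPartial i f x) volume) {ψ : Space N → ℝ}
    (hψ : IsTest ψ) : ∫ x, g x * inner ℝ (weakGrad f x) (gradient ψ x) =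
      ∑ i, ∫ x, g x * weakPartial i f x * partialDeriv i ψ x := by
  rw [← integral_finsetSum _ fun i _ => (hg i).integrable_mul_test (hψ.partialDeriv i)]
  congr 1
  funext x
  rw [inner_gradient, Finset.mul_sum]
  simp only [weakGrad, mul_assoc]

theorem integral_inner_weakGrad_eq {M : ℝ} {f : Space N → ℝ} (hM : 0 ≤ M) (hf : Reg 1 1 M f)
    {ψ : Space N → ℝ} (hψ : IsTest ψ) : ∫ x, inner ℝ (weakGrad f x) (gradient ψ x) =
      -∑ i, ∫ x, f x * partialDeriv i (partialDeriv i ψ) x := by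
  have h := fun i => Reg.weakPartial_spec (b := 0) hf hM i
  have := integral_inner_weakGrad (f := f) (g := fun _ => 1)
    (fun i => by simpa using (h i).1.locallyIntegrable_two) hψ
  simp only [one_mul] at this
  rw [this, ← Finset.sum_neg_distrib]
  exact Finset.sum_congr rfl fun i _ => by rw [(h i).2 _ (hψ.partialDeriv i), neg_neg]

theorem norm_sq_weakGrad (f : Space N → ℝ) (x : Space N) :
    ‖weakGrad f x‖ ^ 2 = ∑ i, weakPartial i f x * weakPartial i f x := by
  rw [EuclideanSpace.real_norm_sq_eq]
  exact Finset.sum_congr rfl fun i _ => sq _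

section Equations

variable {n : ℕ} {σ ε Z M : ℝ} {U Φ ψ : Space N → ℝ}

theorem RemainderBound.eq_U (h : RemainderBound n ε Z U Φ) (hM : 0 ≤ M) (hΦ : Reg 1 1 M Φ)
    (hψ : IsTest ψ) :
    -(∫ x, (1 - ε ^ 2 * U x ^ 2) * inner ℝ (weakGrad Φ x) (gradient ψ x)) -
      σ / 2 * ∫ x, (1 - ε ^ 2 * U x ^ 2) * Real.sin (2 * Φ x) * ψ x =
    (∑ i, ∫ x, Φ x * partialDeriv i (partialDeriv i ψ) x) -
      σ / 2 * (∫ x, Real.sin (2 * Φ x) * ψ x) + (∫ x, remF σ ε U Φ x * ψ x) +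
      ∑ i, ∫ x, remG ε U Φ i x * partialDeriv i ψ x := by
  have hw := fun i => Reg.weakPartial_spec (b := 0) hΦ hM i
  have hG : ∀ i, LocallyIntegrable (remG ε U Φ i) volume := fun i =>
    ((h.U_sq_gradΦ i).smul (ε ^ 2)).1
  have e0 : ∀ i, (fun x => (1 - ε ^ 2 * U x ^ 2) * weakPartial i Φ x) =
      weakPartial i Φ - remG ε U Φ i := fun i => by
    funext x
    simp only [remG, Pi.sub_apply, Pi.smul_apply, smul_eq_mul]
    ring
  have e1 : ∫ x, (1 - ε ^ 2 * U x ^ 2) * inner ℝ (weakGrad Φ x) (gradient ψ x) =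
      -(∑ i, ∫ x, Φ x * partialDeriv i (partialDeriv i ψ) x) -
        ∑ i, ∫ x, remG ε U Φ i x * partialDeriv i ψ x := by
    rw [integral_inner_weakGrad (fun i => by
      rw [e0]; exact (hw i).1.locallyIntegrable_two.sub (hG i)) hψ, ← Finset.sum_neg_distrib,
      ← Finset.sum_sub_distrib]
    refine Finset.sum_congr rfl fun i _ => ?_
    rw [(hw i).2 _ (hψ.partialDeriv i), neg_neg, ← integral_sub
      ((hw i).1.locallyIntegrable_two.integrable_mul_test (hψ.partialDeriv i))
      ((hG i).integrable_mul_test (hψ.partialDeriv i))]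
    congr 1
    funext x
    rw [congrFun (e0 i) x, Pi.sub_apply, sub_mul]
  have hs : Integrable (fun x => Real.sin (2 * Φ x) * ψ x) volume :=
    (locallyIntegrable_of_bdd (Real.continuous_sin.comp_aestronglyMeasurable
      (hΦ.1.aestronglyMeasurable.const_mul 2))
      (.of_forall fun x => Real.abs_sin_le_one _)).integrable_mul_test hψ
  have hF : Integrable (fun x => remF σ ε U Φ x * ψ x) volume :=
    (h.U_sq_sin.smul (σ * ε ^ 2)).1.integrable_mul_test hψ
  have e2 : σ / 2 * ∫ x, (1 - ε ^ 2 * U x ^ 2) * Real.sin (2 * Φ x) * ψ x =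
      σ / 2 * (∫ x, Real.sin (2 * Φ x) * ψ x) - ∫ x, remF σ ε U Φ x * ψ x := by
    rw [← integral_const_mul, ← integral_const_mul, ← integral_sub (hs.const_mul _) hF]
    congr 1
    funext x
    simp only [remF, Pi.smul_apply, smul_eq_mul, Real.sin_two_mul]
    ring
  rw [e1, e2]
  ring

theorem RemainderBound.eq_Φ (h : RemainderBound n ε Z U Φ) (hU : LocallyIntegrable U volume)
    (hψ : IsTest ψ) :
    (∫ x, U x * (1 - ε ^ 2 * σ * Real.sin (Φ x) ^ 2) * ψ x) +
      ε ^ 2 * (∫ x, inner ℝ (weakGrad U x) (gradient ψ x) / (1 - ε ^ 2 * U x ^ 2)) +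
      ε ^ 4 * (∫ x, U x * ‖weakGrad U x‖ ^ 2 / (1 - ε ^ 2 * U x ^ 2) ^ 2 * ψ x) -
      ε ^ 2 * ∫ x, U x * ‖weakGrad Φ x‖ ^ 2 * ψ x =
    (∫ x, U x * ψ x) + (∫ x, remR₀ σ ε U Φ x * ψ x) +
      ∑ i, ∫ x, remR₁ ε U i x * partialDeriv i ψ x := by
  have e1 : ε ^ 2 * ∫ x, inner ℝ (weakGrad U x) (gradient ψ x) / (1 - ε ^ 2 * U x ^ 2) =
      ∑ i, ∫ x, remR₁ ε U i x * partialDeriv i ψ x := by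
    have := integral_inner_weakGrad (f := U) (g := fun x => (1 - (ε * U x) ^ 2)⁻¹)
      (fun i => (h.gradU i).1) hψ
    simp only [remR₁, Pi.smul_apply, smul_eq_mul, mul_assoc (ε ^ 2), integral_const_mul]
    rw [← Finset.mul_sum, ← this]
    congr 2
    funext x
    rw [div_eq_inv_mul, mul_pow]
  have i1 := hU.integrable_mul_test hψ
  have i2 := h.sin_sq.1.integrable_mul_test hψ
  have i3 := fun i => (h.gradU_sq i).1.integrable_mul_test hψ
  have i4 := fun i => (h.gradΦ_sq i).1.integrable_mul_test hψ
  have e2 : ∫ x, U x * (1 - ε ^ 2 * σ * Real.sin (Φ x) ^ 2) * ψ x = (∫ x, U x * ψ x) -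
      ε ^ 2 * σ * ∫ x, Real.sin (Φ x) * Real.sin (Φ x) * U x * ψ x := by
    rw [← integral_const_mul, ← integral_sub i1 (i2.const_mul _)]
    congr 1
    funext x
    ring
  have e3 : ε ^ 4 * ∫ x, U x * ‖weakGrad U x‖ ^ 2 / (1 - ε ^ 2 * U x ^ 2) ^ 2 * ψ x =
      ε ^ 2 * ∑ i, ∫ x, ε * (ε * U x * ((1 - (ε * U x) ^ 2)⁻¹ * (1 - (ε * U x) ^ 2)⁻¹) *
        (weakPartial i U x * weakPartial i U x)) * ψ x := by
    rw [← integral_finsetSum _ fun i _ => i3 i, ← integral_const_mul, ← integral_const_mul]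
    congr 1
    funext x
    rw [norm_sq_weakGrad, ← Finset.sum_mul, ← Finset.mul_sum, ← Finset.mul_sum, mul_pow,
      div_eq_mul_inv, ← inv_pow]
    ring
  have e4 : ∫ x, U x * ‖weakGrad Φ x‖ ^ 2 * ψ x =
      ∑ i, ∫ x, U x * (weakPartial i Φ x * weakPartial i Φ x) * ψ x := by
    rw [← integral_finsetSum _ fun i _ => i4 i]
    congr 1
    funext x
    rw [norm_sq_weakGrad, ← Finset.sum_mul, ← Finset.mul_sum]
  have e5 : ∫ x, remR₀ σ ε U Φ x * ψ x =
      ε ^ 2 * (-σ * (∫ x, Real.sin (Φ x) * Real.sin (Φ x) * U x * ψ x) +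
      ((∑ i, ∫ x, ε * (ε * U x * ((1 - (ε * U x) ^ 2)⁻¹ * (1 - (ε * U x) ^ 2)⁻¹) *
        (weakPartial i U x * weakPartial i U x)) * ψ x) -
      ∑ i, ∫ x, U x * (weakPartial i Φ x * weakPartial i Φ x) * ψ x)) := by
    have j3 := integrable_finsetSum Finset.univ fun i _ => i3 i
    have j4 := integrable_finsetSum Finset.univ fun i _ => i4 i
    have j5 := j3.sub j4
    simp only [Pi.sub_def] at j5
    rw [← integral_finsetSum _ fun i _ => i3 i, ← integral_finsetSum _ fun i _ => i4 i,
      ← integral_sub j3 j4, ← integral_const_mul, ← integral_add (i2.const_mul _) j5,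
      ← integral_const_mul]
    congr 1
    funext x
    simp only [remR₀, Pi.smul_apply, Pi.add_apply, Pi.sub_apply, smul_eq_mul, Finset.sum_apply,
      Finset.sum_mul, add_mul, sub_mul, mul_add, mul_sub, Finset.mul_sum, mul_assoc]
  rw [e1, e2, e3, e4, e5]
  ring

end Equations

section Difference

variable {n k : ℕ} {σ ε Z M T : ℝ} {Uε Φε U Φ : ℝ → Space N → ℝ}

/-- The forcing term in the wave equation of the difference. -/
def diffF (σ ε : ℝ) (Uε Φε Φ : Space N → ℝ) : Space N → ℝ :=
  (-σ) • (fun x => Real.cos (Φε x + Φ x) * Real.sin ((Φε - Φ) x)) + remF σ ε Uε Φε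

/-- The nonlinear terms combine through sin 2a − sin 2b = 2 cos(a + b) sin(a − b). Hence the source
is controlled by sin φ, and φ itself need not be in L². -/
theorem hasDerivWithinAt_diff_U {I : Set ℝ} (hsol : IsHLLSolution σ ε (k + 1) I Uε Φε)
    (hsg : IsSGSolution σ I U Φ) (hM : 0 ≤ M)
    (hrem : ∀ t ∈ I, RemainderBound n ε Z (Uε t) (Φε t)) (hΦε : ∀ t ∈ I, Reg 1 1 M (Φε t))
    (hΦ : ∀ t ∈ I, ∃ M, 0 ≤ M ∧ Reg 1 1 M (Φ t))
    (hUε : ∀ t ∈ I, LocallyIntegrable (Uε t) volume) (hU : ∀ t ∈ I, LocallyIntegrable (U t) volume)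
    {ψ : Space N → ℝ} (hψ : IsTest ψ) {t : ℝ} (ht : t ∈ I) :
    HasDerivWithinAt (fun s => ∫ x, (Uε s - U s) x * ψ x)
      ((∑ i, ∫ x, (Φε t - Φ t) x * partialDeriv i (partialDeriv i ψ) x) +
        (∫ x, diffF σ ε (Uε t) (Φε t) (Φ t) x * ψ x) +
        ∑ i, ∫ x, remG ε (Uε t) (Φε t) i x * partialDeriv i ψ x) I t := by
  obtain ⟨M', hM', hΦ'⟩ := hΦ t ht
  have h1 := hsol.eq_U ψ hψ t ht
  have h2 := hsg.eq_U ψ hψ t ht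
  rw [(hrem t ht).eq_U hM (hΦε t ht) hψ] at h1
  rw [integral_inner_weakGrad_eq hM' hΦ' hψ] at h2
  have hsub : ∀ {f g χ : Space N → ℝ}, LocallyIntegrable f volume → LocallyIntegrable g volume →
      IsTest χ → ∫ x, (f - g) x * χ x = (∫ x, f x * χ x) - ∫ x, g x * χ x := by
    intro f g χ hf hg hχ
    rw [← integral_sub (hf.integrable_mul_test hχ) (hg.integrable_mul_test hχ)]
    simp only [Pi.sub_apply, sub_mul]
  refine ((h1.sub h2).congr_deriv ?_).congr (fun s hs => hsub (hUε s hs) (hU s hs) hψ)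
    (hsub (hUε t ht) (hU t ht) hψ)
  have hbd : ∀ {f : Space N → ℝ} {F : ℝ → ℝ}, Continuous F → (∀ y, |F y| ≤ 1) →
      LocallyIntegrable f volume → Integrable (fun x => F (f x) * ψ x) volume := by
    intro f F hF hF1 hf
    exact (locallyIntegrable_of_bdd (hF.comp_aestronglyMeasurable hf.aestronglyMeasurable)
      (.of_forall fun x => hF1 _)).integrable_mul_test hψ
  have i1 : Integrable (fun x => Real.sin (2 * Φε t x) * ψ x) volume :=
    hbd (F := fun y => Real.sin (2 * y)) (by fun_prop) (fun y => Real.abs_sin_le_one _)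
      (hΦε t ht).1
  have i2 : Integrable (fun x => Real.sin (2 * Φ t x) * ψ x) volume :=
    hbd (F := fun y => Real.sin (2 * y)) (by fun_prop) (fun y => Real.abs_sin_le_one _) hΦ'.1
  have hF : Integrable (fun x => remF σ ε (Uε t) (Φε t) x * ψ x) volume :=
    ((hrem t ht).U_sq_sin.smul (σ * ε ^ 2)).1.integrable_mul_test hψ
  have e1 : ∫ x, diffF σ ε (Uε t) (Φε t) (Φ t) x * ψ x =
      -(σ / 2) * ((∫ x, Real.sin (2 * Φε t x) * ψ x) - ∫ x, Real.sin (2 * Φ t x) * ψ x) +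
        ∫ x, remF σ ε (Uε t) (Φε t) x * ψ x := by
    have i3 : Integrable (fun x => -(σ / 2) * (Real.sin (2 * Φε t x) * ψ x -
        Real.sin (2 * Φ t x) * ψ x)) volume := (i1.sub i2).const_mul _
    rw [← integral_sub i1 i2, ← integral_const_mul, ← integral_add i3 hF]
    congr 1
    funext x
    have e : Real.sin (2 * Φε t x) - Real.sin (2 * Φ t x) =
        2 * (Real.cos (Φε t x + Φ t x) * Real.sin (Φε t x - Φ t x)) := by
      rw [Real.sin_sub_sin]
      have h3 : (2 * Φε t x - 2 * Φ t x) / 2 = Φε t x - Φ t x := by ring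
      have h4 : (2 * Φε t x + 2 * Φ t x) / 2 = Φε t x + Φ t x := by ring
      rw [h3, h4]
      ring
    rw [← sub_mul, e]
    simp only [diffF, Pi.add_apply, Pi.smul_apply, Pi.sub_apply, smul_eq_mul]
    ring
  rw [e1, Finset.sum_congr rfl fun i _ =>
    hsub (hΦε t ht).1 hΦ'.1 ((hψ.partialDeriv i).partialDeriv i), Finset.sum_sub_distrib]
  ring

theorem hasDerivWithinAt_diff_Φ {I : Set ℝ} (hsol : IsHLLSolution σ ε (k + 1) I Uε Φε)
    (hsg : IsSGSolution σ I U Φ)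
    (hrem : ∀ t ∈ I, RemainderBound n ε Z (Uε t) (Φε t))
    (hΦε : ∀ t ∈ I, LocallyIntegrable (Φε t) volume)
    (hΦ : ∀ t ∈ I, LocallyIntegrable (Φ t) volume)
    (hUε : ∀ t ∈ I, LocallyIntegrable (Uε t) volume) (hU : ∀ t ∈ I, LocallyIntegrable (U t) volume)
    {ψ : Space N → ℝ} (hψ : IsTest ψ) {t : ℝ} (ht : t ∈ I) :
    HasDerivWithinAt (fun s => ∫ x, (Φε s - Φ s) x * ψ x)
      ((∫ x, (Uε t - U t) x * ψ x) + (∫ x, remR₀ σ ε (Uε t) (Φε t) x * ψ x) +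
        ∑ i, ∫ x, remR₁ ε (Uε t) i x * partialDeriv i ψ x) I t := by
  have h1 := hsol.eq_Φ ψ hψ t ht
  have h2 := hsg.eq_Φ ψ hψ t ht
  rw [(hrem t ht).eq_Φ (hUε t ht) hψ] at h1
  have hsub : ∀ {f g χ : Space N → ℝ}, LocallyIntegrable f volume → LocallyIntegrable g volume →
      IsTest χ → ∫ x, (f - g) x * χ x = (∫ x, f x * χ x) - ∫ x, g x * χ x := by
    intro f g χ hf hg hχ
    rw [← integral_sub (hf.integrable_mul_test hχ) (hg.integrable_mul_test hχ)]
    simp only [Pi.sub_apply, sub_mul]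
  refine ((h1.sub h2).congr_deriv ?_).congr (fun s hs => hsub (hΦε s hs) (hΦ s hs) hψ)
    (hsub (hΦε t ht) (hΦ t ht) hψ)
  rw [hsub (hUε t ht) (hU t ht) hψ]
  ring

end Difference

section RemainderRegularity

variable {n : ℕ} {σ ε Z : ℝ} {U Φ : Space N → ℝ}

theorem RemainderBound.remF (h : RemainderBound n ε Z U Φ) (hσ : 0 ≤ σ) :
    Reg 0 n (σ * (ε ^ 2 * Z)) (remF σ ε U Φ) := by
  have := h.U_sq_sin.smul (σ * ε ^ 2)
  rwa [abs_of_nonneg (by positivity), mul_assoc] at this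

theorem RemainderBound.remG (h : RemainderBound n ε Z U Φ) (i : Fin N) :
    Reg 0 n (ε ^ 2 * Z) (remG ε U Φ i) := by
  have := (h.U_sq_gradΦ i).smul (ε ^ 2)
  rwa [abs_of_nonneg (by positivity)] at this

theorem RemainderBound.remR₁ (h : RemainderBound n ε Z U Φ) (i : Fin N) :
    Reg 1 (n + 1) (ε ^ 2 * Z) (remR₁ ε U i) := by
  have := (h.gradU i).smul (ε ^ 2)
  rwa [abs_of_nonneg (by positivity)] at this

theorem RemainderBound.remR₀ (h : RemainderBound n ε Z U Φ) (hσ : 0 ≤ σ) :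
    Reg 0 n ((σ + 2 * N) * (ε ^ 2 * Z)) (remR₀ σ ε U Φ) := by
  have := ((h.sin_sq.smul (-σ)).add ((Reg.sum (s := Finset.univ) fun i _ => h.gradU_sq i).sub
    (Reg.sum (s := Finset.univ) fun i _ => h.gradΦ_sq i))).smul (ε ^ 2)
  refine this.mono le_rfl le_rfl (le_of_eq ?_)
  rw [abs_neg, abs_of_nonneg hσ, abs_of_nonneg (sq_nonneg ε), Finset.sum_const, Finset.card_univ,
    Fintype.card_fin, nsmul_eq_mul]
  ring

end RemainderRegularity

end SineGordonRegime

end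


noncomputable section

namespace SineGordonRegime

variable {N : ℕ}

/-! ### From norms to regularity -/

theorem MemH.exists_reg {k : ℕ} {f : Space N → ℝ} (h : MemH k f) : ∃ M, 0 ≤ M ∧ Reg 0 k M f :=
  ⟨_, ENNReal.toReal_nonneg, reg_of_sobNorm_le ENNReal.toReal_nonneg
    (ENNReal.ofReal_toReal (ne_of_lt h)).ge⟩

theorem MemHsin.exists_reg {k : ℕ} {f : Space N → ℝ} (h : MemHsin (k + 1) f) :
    ∃ M, 0 ≤ M ∧ Reg 1 (k + 1) M f :=
  ⟨_, ENNReal.toReal_nonneg, reg_of_gradSobNorm_le ENNReal.toReal_nonneg h.1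
    (ENNReal.ofReal_toReal (ne_of_lt h.2.1)).ge⟩

theorem ContInH.eventually_reg {k : ℕ} {I : Set ℝ} {U : ℝ → Space N → ℝ} (h : ContInH k I U)
    {t : ℝ} (ht : t ∈ I) {δ : ℝ} (hδ : 0 < δ) : ∀ᶠ s in 𝓝[I] t, Reg 0 k δ (U s - U t) := by
  filter_upwards [(h.2 t ht).eventually_lt_const (ENNReal.ofReal_pos.2 hδ)] with s hs
  exact reg_of_sobNorm_le hδ.le hs.le

theorem gradSobNorm_le_dsin (k : ℕ) (f g : Space N → ℝ) :
    gradSobNorm k (f - g) ≤ dsin (k + 1) f g := by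
  have h : gradSobNorm k (f - g) = (gradSobNorm k (f - g) ^ 2) ^ (1 / 2 : ℝ) := by
    rw [← ENNReal.rpow_natCast, ← ENNReal.rpow_mul]
    norm_num
  rw [h, dsin, Nat.add_sub_cancel]
  exact ENNReal.rpow_le_rpow le_add_self (by norm_num)

theorem ContInHsin.eventually_reg {k : ℕ} {I : Set ℝ} {Φ : ℝ → Space N → ℝ}
    (h : ContInHsin (k + 1) I Φ) {t : ℝ} (ht : t ∈ I) {δ : ℝ} (hδ : 0 < δ) :
    ∀ᶠ s in 𝓝[I] t, Reg 1 (k + 1) δ (Φ s - Φ t) := by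
  filter_upwards [(h.2 t ht).eventually_lt_const (ENNReal.ofReal_pos.2 hδ), self_mem_nhdsWithin]
    with s hs hsI
  exact reg_of_gradSobNorm_le hδ.le ((h.1 s hsI).1.sub (h.1 t ht).1)
    ((gradSobNorm_le_dsin k _ _).trans hs.le)

theorem eventually_reg_sub_sub {a b : ℕ} {I : Set ℝ} {f g : ℝ → Space N → ℝ} {t : ℝ}
    (hf : ∀ δ > 0, ∀ᶠ s in 𝓝[I] t, Reg a b δ (f s - f t))
    (hg : ∀ δ > 0, ∀ᶠ s in 𝓝[I] t, Reg a b δ (g s - g t)) {δ : ℝ} (hδ : 0 < δ) :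
    ∀ᶠ s in 𝓝[I] t, Reg a b δ ((f s - g s) - (f t - g t)) := by
  filter_upwards [hf _ (half_pos hδ), hg _ (half_pos hδ)] with s h1 h2
  have := h1.sub h2
  rwa [add_halves, sub_sub_sub_comm] at this

theorem ae_abs_mul_le_of_eLpNorm {ε c : ℝ} (hε : 0 < ε) (hc : 0 ≤ c) {f : Space N → ℝ}
    (h : ENNReal.ofReal ε * eLpNorm f ⊤ volume ≤ ENNReal.ofReal c) :
    ∀ᵐ x, |ε * f x| ≤ c := by
  rw [eLpNorm_exponent_top] at h
  filter_upwards [ae_le_eLpNormEssSup (f := f) (μ := volume)] with x hx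
  have := (mul_le_mul_right hx (ENNReal.ofReal ε)).trans h
  rw [Real.enorm_eq_ofReal_abs, ← ENNReal.ofReal_mul hε.le, ENNReal.ofReal_le_ofReal_iff hc] at this
  rwa [abs_mul, abs_of_pos hε]

theorem Kquant_bounds {ε K T : ℝ} {k : ℕ} {U Φ : ℝ → Space N → ℝ} (hK : 0 ≤ K)
    (h : Kquant ε k T U Φ ≤ ENNReal.ofReal K) {t : ℝ} (ht : t ∈ Icc 0 T)
    (hΦ : LocallyIntegrable (Φ t) volume) :
    Reg 0 k K (U t) ∧ Reg 1 (k + 1) K (Φ t) ∧ Reg 0 k K fun x => Real.sin (Φ t x) := by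
  have h1 : sobNorm k (U t) + ENNReal.ofReal ε * gradSobNorm k (U t) + gradSobNorm k (Φ t) +
      sobNorm k (sinOf (Φ t)) ≤ ENNReal.ofReal K :=
    (le_iSup₂ (f := fun t (_ : t ∈ Icc (0 : ℝ) T) => sobNorm k (U t) + ENNReal.ofReal ε *
      gradSobNorm k (U t) + gradSobNorm k (Φ t) + sobNorm k (sinOf (Φ t))) t ht).trans h
  refine ⟨reg_of_sobNorm_le hK (le_trans ?_ h1), reg_of_gradSobNorm_le hK hΦ (le_trans ?_ h1),
    reg_of_sobNorm_le hK (le_trans ?_ h1)⟩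
  · exact (le_self_add.trans le_self_add).trans le_self_add
  · exact le_add_self.trans le_self_add
  · exact le_add_self

theorem kappaQuant_bounds {ε K T : ℝ} {k : ℕ} {Uε Φε U Φ : ℝ → Space N → ℝ} (hK : 0 ≤ K)
    (h : kappaQuant ε k T Uε Φε U Φ ≤ ENNReal.ofReal K) {t : ℝ} (ht : t ∈ Icc 0 T)
    (hΦ : LocallyIntegrable (Φ t) volume) :
    Reg 0 k K (U t) ∧ Reg 1 (k + 1) K (Φ t) ∧ Reg 0 k K fun x => Real.sin (Φ t x) := by
  have h1 : sobNorm k (U t) + gradSobNorm k (Φ t) + sobNorm k (sinOf (Φ t)) ≤ ENNReal.ofReal K :=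
    ((le_iSup₂ (f := fun t (_ : t ∈ Icc (0 : ℝ) T) => sobNorm k (U t) + gradSobNorm k (Φ t) +
      sobNorm k (sinOf (Φ t))) t ht).trans le_add_self).trans h
  refine ⟨reg_of_sobNorm_le hK (le_trans ?_ h1), reg_of_gradSobNorm_le hK hΦ (le_trans ?_ h1),
    reg_of_sobNorm_le hK (le_trans ?_ h1)⟩
  · exact le_self_add.trans le_self_add
  · exact le_add_self.trans le_self_add
  · exact le_add_self

/-- Since k − 1 > N/2, the Sobolev embedding bounds not only U but also ∇U and ∇Φ. -/
theorem exists_remainderBound_of_sobolev {n k : ℕ} (hk : (N : ℝ) / 2 + 1 < k) (hn : n + 2 ≤ k) :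
    ∃ C, 1 ≤ C ∧ ∀ (ε K L : ℝ) (U Φ : Space N → ℝ), 0 < ε → 0 ≤ K → 1 ≤ L → Reg 0 k K U →
      Reg 1 (k + 1) K Φ → Reg 0 k K (fun x => Real.sin (Φ x)) →
      (∀ᵐ x, |ε * U x| ≤ 1 / √2) → (1 + ε * (C * K)) ^ (n - 1) ≤ L →
      RemainderBound n ε (C * (L * remSize ε K)) U Φ := by
  obtain ⟨s, rfl⟩ : ∃ s, k = s + 1 := ⟨k - 1, by omega⟩
  obtain ⟨Cs, hCs1, hCs⟩ := sobolev (N := N) (s := s) (by push_cast at hk; linarith)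
  obtain ⟨C, hC1, hC⟩ := exists_remainderBound N n hCs1
  refine ⟨max C Cs, le_max_of_le_left hC1, fun ε K L U Φ hε hK hL hU hΦ hsin hy hLn => ?_⟩
  have hM0 : 0 ≤ remSize ε K := hK.trans (le_remSize ε hK).1
  have h := hC ε K L U Φ hε hK hL (hU.mono le_rfl hn le_rfl) (hΦ.mono le_rfl (by omega) le_rfl)
    (hsin.mono le_rfl (by omega) le_rfl) (hCs U K hK (hU.mono le_rfl (by omega) le_rfl))
    (fun i => hCs _ K hK (Reg.weakPartial (hU.mono zero_le_one le_rfl le_rfl) hK i))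
    (fun i => hCs _ K hK (Reg.weakPartial (hΦ.mono le_rfl (by omega) le_rfl) hK i)) hy
    (le_trans (by gcongr; exact le_max_right _ _) hLn)
  have hle : C * (L * remSize ε K) ≤ max C Cs * (L * remSize ε K) :=
    mul_le_mul_of_nonneg_right (le_max_left _ _) (by positivity)
  exact ⟨h.1.mono le_rfl le_rfl hle, fun i => (h.2 i).mono le_rfl le_rfl hle,
    fun i => (h.3 i).mono le_rfl le_rfl hle, fun i => (h.4 i).mono le_rfl le_rfl hle,
    fun i => (h.5 i).mono le_rfl le_rfl hle, h.6.mono le_rfl le_rfl hle⟩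

theorem Reg.of_memLp {M : ℝ} {f : Space N → ℝ} (hf : MemLp f 2 volume) (h : nrm f ≤ M) :
    Reg 0 0 M f := by
  refine ⟨hf.locallyIntegrable_two, fun w _ hw => ?_⟩
  rw [List.eq_nil_of_length_eq_zero (Nat.le_zero.1 hw)]
  exact (DB_nil_of_memLp hf).mono h

theorem l2Norm_eq_ofReal_nrm {f : Space N → ℝ} (hf : MemLp f 2 volume) :
    l2Norm f = ENNReal.ofReal (nrm f) :=
  (ENNReal.ofReal_toReal hf.2.ne).symm

theorem ofReal_remainder {ε K : ℝ} (hε : 0 ≤ ε) (hK : 0 ≤ K) :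
    ENNReal.ofReal ε ^ 2 * ENNReal.ofReal K *
      (1 + ENNReal.ofReal ε ^ 2 * ENNReal.ofReal K ^ 2 + ENNReal.ofReal K ^ 3) =
    ENNReal.ofReal (ε ^ 2 * remSize ε K) := by
  rw [remSize, ← mul_assoc, ENNReal.ofReal_mul (by positivity), ENNReal.ofReal_mul (by positivity),
    ENNReal.ofReal_add (by positivity) (by positivity), ENNReal.ofReal_add zero_le_one
    (by positivity), ENNReal.ofReal_mul (by positivity), ENNReal.ofReal_one,
    ENNReal.ofReal_pow hε, ENNReal.ofReal_pow hK, ENNReal.ofReal_pow hK]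

theorem mul_mul_exp_eq_top {C r : ℝ} {x : ℝ≥0∞} (hC : 0 < C) (hx : x = ⊤) :
    ENNReal.ofReal C * x * ENNReal.ofReal (Real.exp r) = ⊤ := by
  rw [hx, ENNReal.mul_top (ENNReal.ofReal_pos.2 hC).ne',
    ENNReal.top_mul (ENNReal.ofReal_pos.2 (Real.exp_pos r)).ne']

theorem remainder_eq_top {ε : ℝ} (hε : 0 < ε) {x y : ℝ≥0∞} (hx : x = ⊤) :
    ENNReal.ofReal ε ^ 2 * x * (1 + y) = ⊤ := by
  rw [hx, ENNReal.mul_top (pow_ne_zero 2 (ENNReal.ofReal_pos.2 hε).ne'),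
    ENNReal.top_mul (by simp)]

end SineGordonRegime

end


noncomputable section

namespace SineGordonRegime

variable {N : ℕ}

/-! ### The estimate of the difference in the energy space -/

theorem Reg.l2Norm_le {b : ℕ} {M : ℝ} {f : Space N → ℝ} (h : Reg 0 b M f) (hM : 0 ≤ M) :
    l2Norm f ≤ ENNReal.ofReal M := by
  obtain ⟨h1, h2⟩ := h.memLp hM
  rw [l2Norm_eq_ofReal_nrm h1]
  exact ENNReal.ofReal_le_ofReal h2

theorem reg_of_l2Norm_le {M : ℝ} {f : Space N → ℝ} (hf : AEStronglyMeasurable f volume)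
    (hM : 0 ≤ M) (h : l2Norm f ≤ ENNReal.ofReal M) : Reg 0 0 M f :=
  Reg.of_memLp ⟨hf, h.trans_lt ENNReal.ofReal_lt_top⟩ (ENNReal.toReal_le_of_le_ofReal hM h)

/-- Packs prefactor and rate into one constant: each factor is at least one, so their product
dominates both. -/
theorem const_mul_exp_le {P c a ν q A B t : ℝ} (hP : 1 ≤ P) (hc : 1 ≤ c) (ha : 1 ≤ a) (hν : 0 ≤ ν)
    (hq : 0 ≤ q) (hA : 0 ≤ A) (hB : 0 ≤ B) (ht : 0 ≤ t) :
    P * (c * (A + ν * B) * Real.exp (c * (a * q) * t)) ≤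
      P * c * (ν + 1) * a * (A + B) * Real.exp (P * c * (ν + 1) * a * q * t) := by
  have h1 : A + ν * B ≤ (ν + 1) * a * (A + B) := by
    have : A + ν * B ≤ (ν + 1) * (A + B) := by nlinarith
    have h2 : (ν + 1) * (A + B) ≤ a * ((ν + 1) * (A + B)) :=
      le_mul_of_one_le_left (by positivity) ha
    linarith
  have h2 : c * (a * q) * t ≤ P * c * (ν + 1) * a * q * t := by
    have h3 : 1 ≤ P * (ν + 1) := one_le_mul_of_one_le_of_one_le hP (by linarith)
    have h4 : 0 ≤ c * (a * q) * t := by positivity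
    calc c * (a * q) * t ≤ P * (ν + 1) * (c * (a * q) * t) := le_mul_of_one_le_left h4 h3
      _ = _ := by ring
  calc P * (c * (A + ν * B) * Real.exp (c * (a * q) * t))
      ≤ P * (c * ((ν + 1) * a * (A + B)) * Real.exp (P * c * (ν + 1) * a * q * t)) := by gcongr
    _ = _ := by ring

-- Case m = 0 of `energy_estimate`. At this level multiplication by a cosine is a contraction of L²,
-- so the rate does not depend on the solutions.
set_option maxHeartbeats 1000000 in
theorem energy_error_estimate (N : ℕ) {σ : ℝ} (hσ : 0 < σ) :
    ∃ C₂ : ℝ, 0 < C₂ ∧ ∀ (k : ℕ), (N : ℝ) / 2 + 1 < k →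
      (2 ≤ N ∨ (N = 1 ∧ (N : ℝ) / 2 + 2 < k)) →
      ∀ (ε T : ℝ), 0 < ε → 0 < T → ∀ Uε Φε U Φ : ℝ → Space N → ℝ,
      IsHLLSolution σ ε (k + 1) (Icc 0 T) Uε Φε →
      (∀ t ∈ Icc 0 T, ENNReal.ofReal ε * eLpNorm (Uε t) ⊤ volume
        ≤ ENNReal.ofReal (1 / √2)) →
      IsSGSolution σ (Icc 0 T) U Φ →
      ∀ t ∈ Icc 0 T,
        l2Norm (Uε t - U t) + gradSobNorm 0 (Φε t - Φ t) + l2Norm (sinOf (Φε t - Φ t)) ≤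
          ENNReal.ofReal C₂ *
            (l2Norm (Uε 0 - U 0) + gradSobNorm 0 (Φε 0 - Φ 0) + l2Norm (sinOf (Φε 0 - Φ 0))
              + ENNReal.ofReal ε ^ 2 * Kquant ε k T Uε Φε *
                (1 + ENNReal.ofReal ε ^ 2 * Kquant ε k T Uε Φε ^ 2 + Kquant ε k T Uε Φε ^ 3)) *
            ENNReal.ofReal (Real.exp (C₂ * t)) := by
  -- The remainders are estimated at the fixed order max(3, ⌊N/2⌋ + 2), which k always reaches, so
  -- the constant does not depend on k. Order 3 is needed for R₁ to have two derivatives in L².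
  have hk₀ : (N : ℝ) / 2 + 1 < (max 3 (N / 2 + 2) : ℕ) := by
    refine lt_of_lt_of_le ?_ (Nat.cast_le.2 (le_max_right 3 (N / 2 + 2)))
    have : N < 2 * (N / 2) + 2 := by omega
    have : (N : ℝ) < 2 * (N / 2 : ℕ) + 2 := by exact_mod_cast this
    push_cast
    linarith
  obtain ⟨C, hC1, hrem⟩ := exists_remainderBound_of_sobolev (n := 1) hk₀ (le_max_left _ _)
  have hC0 : 0 ≤ C := by linarith
  set c : ℝ := 4 * (N + 1) ^ 2 with hc
  set P : ℝ := 1 + (N * (multiIndices N 0).card : ℕ) with hP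
  set ν : ℝ := (σ + 2 * N + 1) * C with hν
  have hN0 : (0 : ℝ) ≤ N := Nat.cast_nonneg N
  have hc1 : 1 ≤ c := by rw [hc]; nlinarith
  have hP1 : 1 ≤ P := by rw [hP]; exact le_add_of_nonneg_right (Nat.cast_nonneg _)
  have hν0 : 0 ≤ ν := by positivity
  -- In a = 2σ + 1, one σ comes from σ cos(Φε + Φ) sin φ and one from F, since νB ≤ X; the summand 1
  -- makes a ≥ 1.
  have ha1 : 1 ≤ 2 * σ + 1 := by linarith
  have hCpos : 0 < P * c * (ν + 1) * (2 * σ + 1) := by positivity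
  refine ⟨P * c * (ν + 1) * (2 * σ + 1), hCpos, ?_⟩
  intro k hk hNk ε T hε hT Uε Φε U Φ hsol hbd hsg t ht
  have hkk₀ : max 3 (N / 2 + 2) ≤ k := by
    have h1 : N + 2 < 2 * k := by
      have : (N : ℝ) + 2 < 2 * k := by linarith
      exact_mod_cast this
    rcases hNk with h2 | ⟨rfl, h2⟩
    · exact max_le (by omega) (by omega)
    · have : 5 < 2 * k := by
        have : (5 : ℝ) < 2 * k := by push_cast at h2; linarith
        exact_mod_cast this
      exact max_le (by omega) (by omega)
  have h0 : (0 : ℝ) ∈ Icc 0 T := ⟨le_rfl, hT.le⟩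
  -- If K or the initial error is infinite, so is the right side. Otherwise all quantities are real
  -- numbers.
  by_cases hKtop : Kquant ε k T Uε Φε = ⊤
  · rw [mul_mul_exp_eq_top hCpos]
    · exact le_top
    · rw [add_assoc (1 : ℝ≥0∞), remainder_eq_top hε hKtop, add_top]
  set K := (Kquant ε k T Uε Φε).toReal with hK
  have hK0 : 0 ≤ K := ENNReal.toReal_nonneg
  have hKe : Kquant ε k T Uε Φε = ENNReal.ofReal K := (ENNReal.ofReal_toReal hKtop).symm
  rw [hKe, ofReal_remainder hε.le hK0]
  by_cases hAtop : l2Norm (Uε 0 - U 0) + gradSobNorm 0 (Φε 0 - Φ 0) +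
      l2Norm (sinOf (Φε 0 - Φ 0)) = ⊤
  · rw [mul_mul_exp_eq_top hCpos]
    · exact le_top
    · rw [hAtop, top_add]
  set A := (l2Norm (Uε 0 - U 0) + gradSobNorm 0 (Φε 0 - Φ 0) +
      l2Norm (sinOf (Φε 0 - Φ 0))).toReal with hA
  have hA0 : 0 ≤ A := ENNReal.toReal_nonneg
  have hAe := (ENNReal.ofReal_toReal hAtop).symm
  rw [← hA] at hAe
  have hA1 : l2Norm (Uε 0 - U 0) ≤ ENNReal.ofReal A := by
    rw [← hAe]; exact le_self_add.trans le_self_add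
  have hA2 : gradSobNorm 0 (Φε 0 - Φ 0) ≤ ENNReal.ofReal A := by
    rw [← hAe]; exact le_add_self.trans le_self_add
  have hA3 : l2Norm (sinOf (Φε 0 - Φ 0)) ≤ ENNReal.ofReal A := by
    rw [← hAe]; exact le_add_self
  rw [hAe]
  set B := ε ^ 2 * remSize ε K with hB
  have hM0 : 0 ≤ remSize ε K := hK0.trans (le_remSize ε hK0).1
  have hB0 : 0 ≤ B := by positivity
  -- regularity of the two solutions
  have hΦεl : ∀ t ∈ Icc 0 T, LocallyIntegrable (Φε t) volume := fun t ht => (hsol.cont_Φ.1 t ht).1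
  have hΦl : ∀ t ∈ Icc 0 T, LocallyIntegrable (Φ t) volume := fun t ht => (hsg.cont_Φ.1 t ht).1
  have hreg := fun t (ht : t ∈ Icc 0 T) => Kquant_bounds hK0 hKe.le ht (hΦεl t ht)
  have hUr : ∀ t ∈ Icc 0 T, ∃ M, 0 ≤ M ∧ Reg 0 0 M (U t) := fun t ht => (hsg.cont_U.1 t ht).exists_reg
  have hΦr : ∀ t ∈ Icc 0 T, ∃ M, 0 ≤ M ∧ Reg 1 1 M (Φ t) := fun t ht =>
    MemHsin.exists_reg (k := 0) (hsg.cont_Φ.1 t ht)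
  have hUεl : ∀ t ∈ Icc 0 T, LocallyIntegrable (Uε t) volume := fun t ht => (hreg t ht).1.1
  have hUl : ∀ t ∈ Icc 0 T, LocallyIntegrable (U t) volume := fun t ht => by
    obtain ⟨M, -, h⟩ := hUr t ht
    exact h.1
  have hremt : ∀ t ∈ Icc 0 T, RemainderBound 1 ε (C * remSize ε K) (Uε t) (Φε t) := fun t ht => by
    obtain ⟨h1, h2, h3⟩ := hreg t ht
    have := hrem ε K 1 (Uε t) (Φε t) hε hK0 le_rfl (h1.mono le_rfl hkk₀ le_rfl)
      (h2.mono le_rfl (by omega) le_rfl) (h3.mono le_rfl hkk₀ le_rfl)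
      (ae_abs_mul_le_of_eLpNorm hε (by positivity) (hbd t ht)) (by simp)
    rwa [one_mul] at this
  have hZ : ε ^ 2 * (C * remSize ε K) = C * B := by rw [hB]; ring
  have hνB : ν * B = (σ + 2 * N + 1) * (C * B) := by rw [hν]; ring
  have hCB : 0 ≤ C * B := by positivity
  have hNB : 0 ≤ N * (C * B) := by positivity
  have hσB : 0 ≤ σ * (C * B) := by positivity
  have hCBν : C * B ≤ ν * B := by rw [hνB]; linarith
  have hνB0 : 0 ≤ ν * B := by positivity
  have hsm : ∀ t ∈ Icc 0 T, AEStronglyMeasurable (fun x => Real.sin ((Φε t - Φ t) x)) volume :=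
    fun t ht => Real.continuous_sin.comp_aestronglyMeasurable
      ((hΦεl t ht).sub (hΦl t ht)).aestronglyMeasurable
  have hmul : ∀ (f : Space N → ℝ) (θ : Space N → ℝ) (X : ℝ), AEStronglyMeasurable θ volume →
      0 ≤ X → Reg 0 0 X f → Reg 0 0 X fun x => Real.cos (θ x) * f x := by
    intro f θ X hθ hX hf
    obtain ⟨h1, h2⟩ := hf.memLp hX
    have hb : ∀ᵐ x, |Real.cos (θ x)| ≤ 1 := .of_forall fun x => Real.abs_cos_le_one _
    refine Reg.of_memLp (h1.mul_bdd (Real.continuous_cos.comp_aestronglyMeasurable hθ) hb) ?_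
    exact (nrm_mul_le h1 zero_le_one hb).trans (by rwa [one_mul])
  obtain ⟨hmain, hsin⟩ := energy_estimate (m := 0) (T := T) (a := 2 * σ + 1) (b := ν * B)
    (u := fun t => Uε t - U t) (φ := fun t => Φε t - Φ t)
    (F := fun t => diffF σ ε (Uε t) (Φε t) (Φ t)) (R₀ := fun t => remR₀ σ ε (Uε t) (Φε t))
    (G := fun i t => remG ε (Uε t) (Φε t) i) (R₁ := fun i t => remR₁ ε (Uε t) i)
    hT ha1 hνB0
    (fun t ht => by
      obtain ⟨M, hM, h⟩ := hUr t ht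
      exact ⟨K + M, by positivity, ((hreg t ht).1.mono le_rfl (Nat.zero_le _) le_rfl).sub h⟩)
    (fun t ht => by
      obtain ⟨M, hM, h⟩ := hΦr t ht
      exact ⟨K + M, by positivity, ((hreg t ht).2.1.mono le_rfl (by omega) le_rfl).sub h⟩)
    (fun t ht δ hδ => eventually_reg_sub_sub
      (fun δ hδ => (hsol.cont_U.eventually_reg ht hδ).mono fun s h =>
        h.mono le_rfl (Nat.zero_le _) le_rfl) (fun δ hδ => hsg.cont_U.eventually_reg ht hδ) hδ)
    (fun t ht δ hδ => eventually_reg_sub_sub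
      (fun δ hδ => (hsol.cont_Φ.eventually_reg ht hδ).mono fun s h =>
        h.mono le_rfl (by omega) le_rfl)
      (fun δ hδ => ContInHsin.eventually_reg (k := 0) hsg.cont_Φ ht hδ) hδ)
    (fun t ht X hX _ _ hs => by
      have hX0 : 0 ≤ X := hνB0.trans hX
      have h1 := (hmul _ (fun x => Φε t x + Φ t x) X
        ((hΦεl t ht).add (hΦl t ht)).aestronglyMeasurable hX0 hs).smul (-σ)
      have h2 := (hremt t ht).remF hσ.le
      refine (h1.add (h2.mono le_rfl (Nat.zero_le _) le_rfl)).mono le_rfl le_rfl ?_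
      rw [hZ, abs_neg, abs_of_pos hσ]
      have := mul_le_mul_of_nonneg_left (hCBν.trans hX) hσ.le
      linarith)
    (fun i t ht => ((hremt t ht).remG i).mono zero_le_one le_rfl (by
      rw [hZ]
      have := le_mul_of_one_le_left hνB0 ha1
      linarith))
    (fun t ht => ((hremt t ht).remR₀ hσ.le).mono le_rfl le_rfl (by rw [hZ, hνB]; linarith))
    (fun i t ht => ((hremt t ht).remR₁ i).mono le_rfl le_rfl (by rw [hZ]; exact hCBν))
    (fun t ht p X hX hp => (hmul p (fun x => (Φε t - Φ t) x) X
      ((hΦεl t ht).sub (hΦl t ht)).aestronglyMeasurable hX hp).mono le_rfl le_rfl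
      (le_mul_of_one_le_left hX ha1))
    (fun ψ hψ t ht => hasDerivWithinAt_diff_U hsol hsg hK0 hremt
      (fun t ht => (hreg t ht).2.1.mono le_rfl (by omega) le_rfl) hΦr hUεl hUl hψ ht)
    (fun ψ hψ t ht => hasDerivWithinAt_diff_Φ hsol hsg hremt hΦεl hΦl hUεl hUl hψ ht)
    (X₀ := A + ν * B) (by linarith)
    ((reg_of_l2Norm_le ((hUεl 0 h0).sub (hUl 0 h0)).aestronglyMeasurable hA0 hA1).mono le_rfl
      le_rfl (by linarith))
    ((reg_of_gradSobNorm_le hA0 ((hΦεl 0 h0).sub (hΦl 0 h0)) hA2).mono le_rfl le_rfl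
      (by linarith))
    ((reg_of_l2Norm_le (hsm 0 h0) hA0 hA3).mono le_rfl le_rfl (by linarith)) ht
  obtain ⟨M, hM, hUt⟩ := hUr t ht
  obtain ⟨M', hM', hΦt⟩ := hΦr t ht
  have l1 := Reg.l2Norm_le (Reg.rn (add_nonneg hK0 hM)
    (((hreg t ht).1.mono le_rfl (Nat.zero_le _) le_rfl).sub hUt)) (rn_nonneg _ _ _)
  have l2 := Reg.gradSobNorm_le (k := 0) (Reg.rn (add_nonneg hK0 hM')
    (((hreg t ht).2.1.mono le_rfl (by omega) le_rfl).sub hΦt)) (rn_nonneg _ _ _)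
  have l3 := hsin.l2Norm_le (rn_nonneg _ _ _)
  refine (add_le_add (add_le_add l1 l2) l3).trans ?_
  rw [← ENNReal.ofReal_add (rn_nonneg _ _ _) (mul_nonneg (Nat.cast_nonneg _) (rn_nonneg _ _ _)),
    ← ENNReal.ofReal_add (add_nonneg (rn_nonneg _ _ _) (mul_nonneg (Nat.cast_nonneg _)
      (rn_nonneg _ _ _))) (rn_nonneg _ _ _), ← ENNReal.ofReal_add hA0 hB0,
    ← ENNReal.ofReal_mul hCpos.le,
    ← ENNReal.ofReal_mul (mul_nonneg hCpos.le (add_nonneg hA0 hB0))]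
  refine ENNReal.ofReal_le_ofReal ?_
  have hfin := const_mul_exp_le (q := 1) hP1 hc1 ha1 hν0 zero_le_one hA0 hB0 ht.1
  rw [mul_one, mul_one] at hfin
  refine le_trans ?_ hfin
  refine le_trans ?_ (mul_le_mul_of_nonneg_left hmain (zero_le_one.trans hP1))
  have r1 := rn_nonneg 0 0 (Uε t - U t)
  have r2 := rn_nonneg 1 (0 + 1) (Φε t - Φ t)
  have r3 := rn_nonneg 0 0 fun x => Real.sin ((Φε t - Φ t) x)
  have r4 : (0 : ℝ) ≤ (N * (multiIndices N 0).card : ℕ) := Nat.cast_nonneg _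
  rw [hP]
  nlinarith [mul_nonneg r4 r1, mul_nonneg r4 r3]

end SineGordonRegime

end


noncomputable section

namespace SineGordonRegime

variable {N : ℕ}

/-! ### The estimate of the difference in higher order norms -/

/-- Expand by the addition formulas. Every term then contains only the sine, in H^m, and the cosine,
bounded with gradient in H^m, of a single phase. The term κ² comes from the supremum of ∇Φ times the
norm of sin Φ. -/
theorem exists_trig_const {m : ℕ} (hm : (N : ℝ) / 2 < m) : ∃ D, 1 ≤ D ∧
    ∀ (κ : ℝ) (Φ₁ Φ₂ : Space N → ℝ), 0 ≤ κ → Reg 1 (m + 1) κ Φ₁ → Reg 1 (m + 1) κ Φ₂ →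
      Reg 0 m κ (fun x => Real.sin (Φ₁ x)) → Reg 0 m κ (fun x => Real.sin (Φ₂ x)) →
      BReg 1 m 1 (D * (κ + κ ^ 2)) (fun x => Real.cos (Φ₁ x + Φ₂ x)) ∧
      BReg 1 m 1 (D * (κ + κ ^ 2)) (fun x => Real.cos (Φ₁ x - Φ₂ x)) ∧
      Reg 0 m (D * (κ + κ ^ 2)) (fun x => Real.sin (Φ₁ x - Φ₂ x)) := by
  obtain ⟨Cs, hCs1, hCs⟩ := sobolev hm
  obtain ⟨Cm, hCm1, h11, h10⟩ := exists_mul_const N m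
  obtain ⟨Cc, hCc1, hcos⟩ := breg_cos N m
  have hCm0 : 0 ≤ Cm := by linarith
  have hCs0 : 0 ≤ Cs := by linarith
  have hCc0 : 0 ≤ Cc := by linarith
  refine ⟨2 * Cm * (1 + Cc * Cs), ?_, ?_⟩
  · have : 0 ≤ Cc * Cs := by positivity
    nlinarith
  intro κ Φ₁ Φ₂ hκ h₁ h₂ hs₁ hs₂
  set Q := Cc * (κ + Cs * κ * κ) with hQ
  have hQ0 : 0 ≤ Q := by positivity
  have hQle : Q ≤ Cc * Cs * (κ + κ ^ 2) := by
    rw [hQ, mul_assoc Cc]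
    refine mul_le_mul_of_nonneg_left ?_ hCc0
    nlinarith
  have bcos : ∀ {Φ : Space N → ℝ}, Reg 1 (m + 1) κ Φ → Reg 0 m κ (fun x => Real.sin (Φ x)) →
      BReg 1 m 1 Q (fun x => Real.cos (Φ x)) := fun h hs =>
    (hcos _ κ (Cs * κ) hκ (by positivity) h (fun i => hCs _ κ hκ (h.weakPartial hκ i)) hs).mono
      le_rfl (Nat.le_succ m) le_rfl le_rfl
  have bsin : ∀ {Φ : Space N → ℝ}, Reg 0 m κ (fun x => Real.sin (Φ x)) →
      BReg 0 m 1 κ (fun x => Real.sin (Φ x)) := fun hs =>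
    ⟨hs, .of_forall fun x => Real.abs_sin_le_one _⟩
  have bsin1 : ∀ {Φ : Space N → ℝ}, Reg 0 m κ (fun x => Real.sin (Φ x)) →
      BReg 1 m 1 κ (fun x => Real.sin (Φ x)) := fun hs =>
    (bsin hs).mono zero_le_one le_rfl le_rfl le_rfl
  have cc := h11 _ _ 1 1 Q Q zero_le_one zero_le_one hQ0 hQ0 (bcos h₁ hs₁) (bcos h₂ hs₂)
  have ss := h11 _ _ 1 1 κ κ zero_le_one zero_le_one hκ hκ (bsin1 hs₁) (bsin1 hs₂)
  have cs := h10 _ _ 1 1 Q κ zero_le_one zero_le_one hQ0 hκ (bcos h₁ hs₁) (bsin hs₂)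
  have sc := h10 _ _ 1 1 Q κ zero_le_one zero_le_one hQ0 hκ (bcos h₂ hs₂) (bsin hs₁)
  have hκ2 : 0 ≤ κ ^ 2 := sq_nonneg κ
  have hle : Cm * (1 * Q + 1 * Q) + Cm * (1 * κ + 1 * κ) ≤
      2 * Cm * (1 + Cc * Cs) * (κ + κ ^ 2) := by
    have e1 := mul_le_mul_of_nonneg_left hQle (show 0 ≤ 2 * Cm by positivity)
    have e2 : 2 * Cm * κ ≤ 2 * Cm * (κ + κ ^ 2) :=
      mul_le_mul_of_nonneg_left (by linarith) (by positivity)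
    linarith
  refine ⟨⟨?_, .of_forall fun x => Real.abs_cos_le_one _⟩,
    ⟨?_, .of_forall fun x => Real.abs_cos_le_one _⟩, ?_⟩
  · have := (cc.1.sub ss.1).mono le_rfl le_rfl hle
    simp only [Real.cos_add]
    exact this
  · have := (cc.1.add ss.1).mono le_rfl le_rfl hle
    simp only [Real.cos_sub]
    exact this
  · have := (sc.1.sub cs.1).mono le_rfl le_rfl (le_trans (le_of_eq (by ring)) hle)
    simp only [Real.sin_sub]
    simp only [mul_comm (Real.cos (Φ₂ _))] at this
    exact this

/-- Multiplication by such a cosine costs 1 + κ² in H^m because κ + κ² ≤ 2(1 + κ²). This is the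
source of the rate 1 + κ² in the exponential. -/
theorem exists_trig_mul_const {m : ℕ} (hm : (N : ℝ) / 2 < m) {D : ℝ} (hD : 0 ≤ D) :
    ∃ D', 1 ≤ D' ∧ ∀ (κ P : ℝ) (θ p : Space N → ℝ), 0 ≤ κ → 0 ≤ P →
      BReg 1 m 1 (D * (κ + κ ^ 2)) θ → Reg 0 m P p →
      Reg 0 m (D' * (1 + κ ^ 2) * P) fun x => θ x * p x := by
  obtain ⟨Cs, hCs1, hCs⟩ := sobolev hm
  obtain ⟨Cm, hCm1, -, h10⟩ := exists_mul_const N m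
  have hCm0 : 0 ≤ Cm := by linarith
  have hCs0 : 0 ≤ Cs := by linarith
  refine ⟨Cm * (1 + 2 * Cs * D), one_le_mul_of_one_le_of_one_le hCm1
    (le_add_of_nonneg_right (by positivity)), fun κ P θ p hκ hP hθ hp => ?_⟩
  have := h10 _ _ 1 (Cs * P) (D * (κ + κ ^ 2)) P zero_le_one (by positivity) (by positivity) hP
    hθ ⟨hp, hCs p P hP hp⟩
  refine this.1.mono le_rfl le_rfl ?_
  have e : Cm * (1 + 2 * Cs * D) * (1 + κ ^ 2) * P =
      Cm * ((1 + 2 * Cs * D) * ((1 + κ ^ 2) * P)) := by ring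
  rw [e]
  refine mul_le_mul_of_nonneg_left ?_ hCm0
  have h1 : κ + κ ^ 2 ≤ 2 * (1 + κ ^ 2) := by nlinarith [sq_nonneg (κ - 1)]
  have h2 : Cs * P * (D * (κ + κ ^ 2)) ≤ Cs * P * (D * (2 * (1 + κ ^ 2))) := by gcongr
  have h3 : 0 ≤ κ ^ 2 * P := by positivity
  linarith

/-- The size of the remainder in the higher order estimate. -/
def remSizeHigh (ε κ : ℝ) : ℝ := ε ^ 2 * κ * (1 + ε ^ 2 * κ ^ 2 + (1 + ε ^ 2) * κ ^ 3)

theorem ofReal_remSizeHigh {ε κ : ℝ} (hε : 0 ≤ ε) (hκ : 0 ≤ κ) :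
    ENNReal.ofReal ε ^ 2 * ENNReal.ofReal κ * (1 + ENNReal.ofReal ε ^ 2 * ENNReal.ofReal κ ^ 2 +
      (1 + ENNReal.ofReal ε ^ 2) * ENNReal.ofReal κ ^ 3) = ENNReal.ofReal (remSizeHigh ε κ) := by
  rw [remSizeHigh, ENNReal.ofReal_mul (by positivity), ENNReal.ofReal_mul (by positivity),
    ENNReal.ofReal_add (by positivity) (by positivity), ENNReal.ofReal_add zero_le_one
    (by positivity), ENNReal.ofReal_mul (by positivity), ENNReal.ofReal_mul (by positivity),
    ENNReal.ofReal_add zero_le_one (by positivity), ENNReal.ofReal_one,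
    ENNReal.ofReal_pow hε, ENNReal.ofReal_pow hκ, ENNReal.ofReal_pow hκ]

theorem mul_remSize_le_remSizeHigh (ε κ : ℝ) :
    ε ^ 2 * remSize ε κ ≤ remSizeHigh ε κ := by
  have : remSizeHigh ε κ = ε ^ 2 * remSize ε κ + ε ^ 4 * κ ^ 4 := by
    simp only [remSizeHigh, remSize]; ring
  rw [this]
  exact le_add_of_nonneg_right (by positivity)

/-- For ε ≥ 1 the factor ε² is harmless. For ε < 1 ≤ εκ one has κ ≥ 1, and the term ε²κ⁴ = (εκ)²κ²
dominates. -/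
theorem le_remSizeHigh_of_large {ε κ : ℝ} (hκ : 0 ≤ κ) (h : 1 ≤ ε ∨ 1 ≤ ε * κ) :
    κ + κ ^ 2 ≤ 2 * remSizeHigh ε κ := by
  refine le_trans ?_ (mul_le_mul_of_nonneg_left (mul_remSize_le_remSizeHigh ε κ) zero_le_two)
  obtain ⟨m1, m2, -, -, -, -⟩ := le_remSize ε hκ
  by_cases hε1 : 1 ≤ ε
  · have h1 : 1 ≤ ε ^ 2 := one_le_pow₀ hε1
    have h2 : remSize ε κ ≤ ε ^ 2 * remSize ε κ := le_mul_of_one_le_left (hκ.trans m1) h1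
    linarith
  · have h1 : 1 ≤ ε * κ := h.resolve_left hε1
    have h3 : 1 ≤ κ := h1.trans (mul_le_of_le_one_left hκ (not_le.1 hε1).le)
    have h4 : 1 ≤ (ε * κ) ^ 2 := one_le_pow₀ h1
    have h5 : κ ^ 2 ≤ (ε * κ) ^ 2 * κ ^ 2 := le_mul_of_one_le_left (sq_nonneg κ) h4
    have h6 : ε ^ 2 * remSize ε κ = ε ^ 2 * κ * (1 + ε ^ 2 * κ ^ 2) + (ε * κ) ^ 2 * κ ^ 2 := by
      simp only [remSize]; ring
    have h7 : 0 ≤ ε ^ 2 * κ * (1 + ε ^ 2 * κ ^ 2) := by positivity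
    nlinarith

-- Two regimes: when ε ≥ 1 or εκ ≥ 1 the triangle inequality suffices; otherwise `energy_estimate`
-- applies with a proportional to 1 + κ².
set_option maxHeartbeats 2000000 in
theorem sobolev_error_estimate {σ : ℝ} (hσ : 0 < σ) {m : ℕ} (hm : (N : ℝ) / 2 < m) :
    ∃ C : ℝ, 0 < C ∧
      ∀ (ε T : ℝ), 0 < ε → 0 < T → ∀ Uε Φε U Φ : ℝ → Space N → ℝ,
      IsHLLSolution σ ε (m + 3 + 1) (Icc 0 T) Uε Φε →
      (∀ t ∈ Icc 0 T, ENNReal.ofReal ε * eLpNorm (Uε t) ⊤ volume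
        ≤ ENNReal.ofReal (1 / √2)) →
      IsSGSolution σ (Icc 0 T) U Φ →
      ContInH (m + 3) (Icc 0 T) U →
      ContInHsin (m + 3 + 1) (Icc 0 T) Φ →
      ∀ t ∈ Icc 0 T,
        sobNorm m (Uε t - U t) + gradSobNorm m (Φε t - Φ t) + sobNorm m (sinOf (Φε t - Φ t)) ≤
          ENNReal.ofReal C *
            (sobNorm m (Uε 0 - U 0) + gradSobNorm m (Φε 0 - Φ 0) + sobNorm m (sinOf (Φε 0 - Φ 0))
              + ENNReal.ofReal ε ^ 2 * kappaQuant ε (m + 3) T Uε Φε U Φ *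
                (1 + ENNReal.ofReal ε ^ 2 * kappaQuant ε (m + 3) T Uε Φε U Φ ^ 2
                  + (1 + ENNReal.ofReal ε ^ 2) * kappaQuant ε (m + 3) T Uε Φε U Φ ^ 3)) *
            ENNReal.ofReal
              (Real.exp (C * (1 + (kappaQuant ε (m + 3) T Uε Φε U Φ).toReal ^ 2) * t)) := by
  obtain ⟨C, hC1, hrem⟩ := exists_remainderBound_of_sobolev (N := N) (n := m + 1) (k := m + 3)
    (by push_cast; linarith) le_rfl
  obtain ⟨D, hD1, htrig⟩ := exists_trig_const hm
  obtain ⟨D', hD1', hmul⟩ := exists_trig_mul_const hm (zero_le_one.trans hD1)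
  have hC0 : 0 ≤ C := by linarith
  have hD0 : 0 ≤ D := by linarith
  have hD0' : 0 ≤ D' := by linarith
  set c : ℝ := 4 * (N + 1) ^ 2 with hc
  set d : ℝ := ((multiIndices N m).card : ℝ) with hd
  set d' : ℝ := ((N * (multiIndices N m).card : ℕ) : ℝ) with hd'
  have hdn : 0 ≤ d := Nat.cast_nonneg _
  have hdn' : 0 ≤ d' := Nat.cast_nonneg _
  set P : ℝ := 1 + d + d' with hP
  -- Bounds (1 + εCκ)^m, the loss from differentiating 1/(1 − ε²U²), in the regime εκ < 1.
  set L : ℝ := (1 + C) ^ m with hL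
  have hL1 : 1 ≤ L := one_le_pow₀ (by linarith)
  have hL0 : 0 ≤ L := by linarith
  set ν : ℝ := (σ + 2 * N + 1) * (C * L) with hν
  -- The part ν serves the small regime. The part 8 + 2D serves the large one, where the three norms
  -- add up to at most (4 + D)(κ + κ²).
  set ν' : ℝ := ν + (8 + 2 * D) with hν'
  set a₀ : ℝ := σ * D' + σ + D' with ha₀
  have hN0 : (0 : ℝ) ≤ N := Nat.cast_nonneg N
  have hc1 : 1 ≤ c := by rw [hc]; nlinarith
  have hc0 : 0 ≤ c := by linarith
  have hP1 : 1 ≤ P := by rw [hP]; linarith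
  have hP0 : 0 ≤ P := by linarith
  have hν0 : 0 ≤ ν := by positivity
  have hν0' : 0 ≤ ν' := by positivity
  have hσD : 0 ≤ σ * D' := by positivity
  have ha1 : 1 ≤ a₀ := by rw [ha₀]; linarith
  have ha0 : 0 ≤ a₀ := by linarith
  have hCpos : 0 < P * c * (ν' + 1) * a₀ :=
    mul_pos (mul_pos (mul_pos (by linarith) (by linarith)) (by linarith)) (by linarith)
  refine ⟨P * c * (ν' + 1) * a₀, hCpos, ?_⟩
  intro ε T hε hT Uε Φε U Φ hsol hbd hsg hcU hcΦ t ht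
  have h0 : (0 : ℝ) ∈ Icc 0 T := ⟨le_rfl, hT.le⟩
  by_cases hKtop : kappaQuant ε (m + 3) T Uε Φε U Φ = ⊤
  · rw [mul_mul_exp_eq_top hCpos]
    · exact le_top
    · rw [add_assoc (1 : ℝ≥0∞), remainder_eq_top hε hKtop, add_top]
  set κ := (kappaQuant ε (m + 3) T Uε Φε U Φ).toReal with hκ
  have hκ0 : 0 ≤ κ := ENNReal.toReal_nonneg
  have hκe : kappaQuant ε (m + 3) T Uε Φε U Φ = ENNReal.ofReal κ :=
    (ENNReal.ofReal_toReal hKtop).symm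
  have hKκ : Kquant ε (m + 3) T Uε Φε ≤ ENNReal.ofReal κ := le_self_add.trans hκe.le
  rw [hκe, ofReal_remSizeHigh hε.le hκ0]
  by_cases hAtop : sobNorm m (Uε 0 - U 0) + gradSobNorm m (Φε 0 - Φ 0) +
      sobNorm m (sinOf (Φε 0 - Φ 0)) = ⊤
  · rw [mul_mul_exp_eq_top hCpos]
    · exact le_top
    · rw [hAtop, top_add]
  set A := (sobNorm m (Uε 0 - U 0) + gradSobNorm m (Φε 0 - Φ 0) +
      sobNorm m (sinOf (Φε 0 - Φ 0))).toReal with hA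
  have hA0 : 0 ≤ A := ENNReal.toReal_nonneg
  have hAe := (ENNReal.ofReal_toReal hAtop).symm
  rw [← hA] at hAe
  have hA1 : sobNorm m (Uε 0 - U 0) ≤ ENNReal.ofReal A := by
    rw [← hAe]; exact le_self_add.trans le_self_add
  have hA2 : gradSobNorm m (Φε 0 - Φ 0) ≤ ENNReal.ofReal A := by
    rw [← hAe]; exact le_add_self.trans le_self_add
  have hA3 : sobNorm m (sinOf (Φε 0 - Φ 0)) ≤ ENNReal.ofReal A := by
    rw [← hAe]; exact le_add_self
  rw [hAe]
  set B' := remSizeHigh ε κ with hB'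
  set B := ε ^ 2 * remSize ε κ with hB
  have hM0 : 0 ≤ remSize ε κ := hκ0.trans (le_remSize ε hκ0).1
  have hB0 : 0 ≤ B := mul_nonneg (sq_nonneg ε) hM0
  have hBB' : B ≤ B' := mul_remSize_le_remSizeHigh ε κ
  have hB0' : 0 ≤ B' := hB0.trans hBB'
  -- regularity of the two solutions
  have hΦεl : ∀ t ∈ Icc 0 T, LocallyIntegrable (Φε t) volume := fun t ht => (hsol.cont_Φ.1 t ht).1
  have hΦl : ∀ t ∈ Icc 0 T, LocallyIntegrable (Φ t) volume := fun t ht => (hsg.cont_Φ.1 t ht).1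
  have hreg := fun t (ht : t ∈ Icc 0 T) => Kquant_bounds hκ0 hKκ ht (hΦεl t ht)
  have hreg' := fun t (ht : t ∈ Icc 0 T) => kappaQuant_bounds hκ0 hκe.le ht (hΦl t ht)
  have hUεl : ∀ t ∈ Icc 0 T, LocallyIntegrable (Uε t) volume := fun t ht => (hreg t ht).1.1
  have hUl : ∀ t ∈ Icc 0 T, LocallyIntegrable (U t) volume := fun t ht => (hreg' t ht).1.1
  have hudiff : ∀ t ∈ Icc 0 T, Reg 0 m (κ + κ) (Uε t - U t) := fun t ht =>
    ((hreg t ht).1.sub (hreg' t ht).1).mono le_rfl (by omega) le_rfl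
  have hφdiff : ∀ t ∈ Icc 0 T, Reg 1 (m + 1) (κ + κ) (Φε t - Φ t) := fun t ht =>
    ((hreg t ht).2.1.sub (hreg' t ht).2.1).mono le_rfl (by omega) le_rfl
  have htr := fun t (ht : t ∈ Icc 0 T) => htrig κ (Φε t) (Φ t) hκ0
    ((hreg t ht).2.1.mono le_rfl (by omega) le_rfl)
    ((hreg' t ht).2.1.mono le_rfl (by omega) le_rfl)
    ((hreg t ht).2.2.mono le_rfl (by omega) le_rfl)
    ((hreg' t ht).2.2.mono le_rfl (by omega) le_rfl)
  have hq1 : 1 ≤ 1 + κ ^ 2 := le_add_of_nonneg_right (sq_nonneg κ)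
  have hq0 : 0 ≤ 1 + κ ^ 2 := by linarith
  have hsinr : Reg 0 m (D * (κ + κ ^ 2)) (fun x => Real.sin ((Φε t - Φ t) x)) := (htr t ht).2.2
  have hDκ : 0 ≤ D * (κ + κ ^ 2) := by positivity
  have hmain : rn 0 m (Uε t - U t) + rn 1 (m + 1) (Φε t - Φ t) +
      rn 0 m (fun x => Real.sin ((Φε t - Φ t) x)) ≤
      c * (A + ν' * B') * Real.exp (c * (a₀ * (1 + κ ^ 2)) * t) := by
    -- In the first case no equation is used: both solutions have size at most κ + κ² up to
    -- constants, and so does their difference.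
    by_cases hlarge : 1 ≤ ε ∨ 1 ≤ ε * κ
    · have h1 := rn_le (add_nonneg hκ0 hκ0) (hudiff t ht)
      have h2 := rn_le (add_nonneg hκ0 hκ0) (hφdiff t ht)
      have h3 := rn_le hDκ hsinr
      have h4 := le_remSizeHigh_of_large hκ0 hlarge
      have h5 := mul_le_mul_of_nonneg_left h4 (show 0 ≤ 4 + D by linarith)
      have h6 : (4 + D) * (2 * B') ≤ A + ν' * B' := by
        have := mul_nonneg hν0 hB0'
        rw [hν']
        linarith
      have h7 : 0 ≤ A + ν' * B' := add_nonneg hA0 (mul_nonneg hν0' hB0')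
      have h8 : 1 ≤ Real.exp (c * (a₀ * (1 + κ ^ 2)) * t) :=
        Real.one_le_exp (mul_nonneg (mul_nonneg hc0 (mul_nonneg ha0 hq0)) ht.1)
      have h9 : A + ν' * B' ≤ c * (A + ν' * B') := le_mul_of_one_le_left h7 hc1
      have h10 : c * (A + ν' * B') ≤ c * (A + ν' * B') *
          Real.exp (c * (a₀ * (1 + κ ^ 2)) * t) := le_mul_of_one_le_right (h7.trans h9) h8
      linarith [sq_nonneg κ]
    · rw [not_or, not_le, not_le] at hlarge
      have hremt : ∀ t ∈ Icc 0 T, RemainderBound (m + 1) ε (C * (L * remSize ε κ)) (Uε t) (Φε t) :=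
        fun t ht => by
          obtain ⟨h1, h2, h3⟩ := hreg t ht
          refine hrem ε κ L (Uε t) (Φε t) hε hκ0 hL1 h1 h2 h3
            (ae_abs_mul_le_of_eLpNorm hε (by positivity) (hbd t ht)) ?_
          rw [Nat.add_sub_cancel]
          have h4 : ε * (C * κ) = C * (ε * κ) := by ring
          have h5 : C * (ε * κ) ≤ C * 1 := mul_le_mul_of_nonneg_left hlarge.2.le hC0
          have h6 : 0 ≤ C * (ε * κ) := by positivity
          exact pow_le_pow_left₀ (by linarith) (by linarith) m
      have hZ : ε ^ 2 * (C * (L * remSize ε κ)) = C * L * B := by rw [hB]; ring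
      have hνB : ν * B = (σ + 2 * N + 1) * (C * L * B) := by rw [hν]; ring
      have hCB : 0 ≤ C * L * B := mul_nonneg (mul_nonneg hC0 hL0) hB0
      have hNB : 0 ≤ N * (C * L * B) := mul_nonneg hN0 hCB
      have hσB : 0 ≤ σ * (C * L * B) := mul_nonneg hσ.le hCB
      have hCBν : C * L * B ≤ ν * B := by rw [hνB]; linarith
      have hνB0 : 0 ≤ ν * B := mul_nonneg hν0 hB0
      have haq1 : 1 ≤ a₀ * (1 + κ ^ 2) := one_le_mul_of_one_le_of_one_le ha1 hq1
      have hsol' := energy_estimate (m := m) (T := T) (a := a₀ * (1 + κ ^ 2)) (b := ν * B)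
        (u := fun t => Uε t - U t) (φ := fun t => Φε t - Φ t)
        (F := fun t => diffF σ ε (Uε t) (Φε t) (Φ t)) (R₀ := fun t => remR₀ σ ε (Uε t) (Φε t))
        (G := fun i t => remG ε (Uε t) (Φε t) i) (R₁ := fun i t => remR₁ ε (Uε t) i)
        hT haq1 hνB0
        (fun t ht => ⟨_, add_nonneg hκ0 hκ0, hudiff t ht⟩)
        (fun t ht => ⟨_, add_nonneg hκ0 hκ0, hφdiff t ht⟩)
        (fun t ht δ hδ => eventually_reg_sub_sub
          (fun δ hδ => (hsol.cont_U.eventually_reg ht hδ).mono fun s h =>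
            h.mono le_rfl (by omega) le_rfl)
          (fun δ hδ => (hcU.eventually_reg ht hδ).mono fun s h =>
            h.mono le_rfl (by omega) le_rfl) hδ)
        (fun t ht δ hδ => eventually_reg_sub_sub
          (fun δ hδ => (hsol.cont_Φ.eventually_reg ht hδ).mono fun s h =>
            h.mono le_rfl (by omega) le_rfl)
          (fun δ hδ => (hcΦ.eventually_reg ht hδ).mono fun s h =>
            h.mono le_rfl (by omega) le_rfl) hδ)
        (fun t ht X hX _ _ hs => by
          have hX0 : 0 ≤ X := hνB0.trans hX
          have h1 := (hmul κ X (fun x => Real.cos (Φε t x + Φ t x)) _ hκ0 hX0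
            (htr t ht).1 hs).smul (-σ)
          have h2 := (hremt t ht).remF hσ.le
          refine (h1.add (h2.mono le_rfl (Nat.le_succ m) le_rfl)).mono le_rfl le_rfl ?_
          rw [hZ, abs_neg, abs_of_pos hσ, ha₀]
          have h3 := mul_le_mul_of_nonneg_left (hCBν.trans hX) hσ.le
          have h4 : 0 ≤ κ ^ 2 * X := mul_nonneg (sq_nonneg κ) hX0
          have h5 := mul_nonneg hσ.le h4
          have h6 := mul_nonneg hD0' h4
          have h7 := mul_nonneg hD0' hX0
          linarith)
        (fun i t ht => ((hremt t ht).remG i).mono zero_le_one le_rfl (by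
          rw [hZ]
          have := le_mul_of_one_le_left hνB0 haq1
          linarith))
        (fun t ht => ((hremt t ht).remR₀ hσ.le).mono le_rfl le_rfl (by rw [hZ, hνB]; linarith))
        (fun i t ht => ((hremt t ht).remR₁ i).mono le_rfl le_rfl (by rw [hZ]; exact hCBν))
        (fun t ht p X hX hp => (hmul κ X (fun x => Real.cos ((Φε t - Φ t) x)) p hκ0 hX
          (htr t ht).2.1 hp).mono le_rfl le_rfl (by
            rw [mul_assoc, mul_assoc]
            exact mul_le_mul_of_nonneg_right (by rw [ha₀]; linarith) (mul_nonneg hq0 hX)))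
        (fun ψ hψ t ht => hasDerivWithinAt_diff_U hsol hsg hκ0 hremt
          (fun t ht => (hreg t ht).2.1.mono le_rfl (by omega) le_rfl)
          (fun t ht => ⟨κ, hκ0, (hreg' t ht).2.1.mono le_rfl (by omega) le_rfl⟩) hUεl hUl hψ ht)
        (fun ψ hψ t ht => hasDerivWithinAt_diff_Φ hsol hsg hremt hΦεl hΦl hUεl hUl hψ ht)
        (X₀ := A + ν * B) (by linarith)
        ((reg_of_sobNorm_le hA0 hA1).mono le_rfl le_rfl (by linarith))
        ((reg_of_gradSobNorm_le hA0 ((hΦεl 0 h0).sub (hΦl 0 h0)) hA2).mono le_rfl le_rfl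
          (by linarith))
        ((reg_of_sobNorm_le (f := fun x => Real.sin ((Φε 0 - Φ 0) x)) hA0 hA3).mono le_rfl le_rfl
          (by linarith)) ht
      refine hsol'.1.trans (mul_le_mul_of_nonneg_right (mul_le_mul_of_nonneg_left ?_ hc0)
        (Real.exp_pos _).le)
      have h1 : ν * B ≤ ν' * B' := mul_le_mul (by rw [hν']; linarith) hBB' hB0 hν0'
      linarith
  have r1 := rn_nonneg 0 m (Uε t - U t)
  have r2 := rn_nonneg 1 (m + 1) (Φε t - Φ t)
  have r3 := rn_nonneg 0 m fun x => Real.sin ((Φε t - Φ t) x)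
  have l1 := (Reg.rn (add_nonneg hκ0 hκ0) (hudiff t ht)).sobNorm_le r1
  have l2 := (Reg.rn (add_nonneg hκ0 hκ0) (hφdiff t ht)).gradSobNorm_le r2
  have l3 := (Reg.rn hDκ hsinr).sobNorm_le r3
  rw [← hd] at l1 l3
  rw [← hd'] at l2
  refine (add_le_add (add_le_add l1 l2) l3).trans ?_
  rw [← ENNReal.ofReal_add (mul_nonneg hdn r1) (mul_nonneg hdn' r2),
    ← ENNReal.ofReal_add (add_nonneg (mul_nonneg hdn r1) (mul_nonneg hdn' r2))
      (mul_nonneg hdn r3), ← ENNReal.ofReal_add hA0 hB0', ← ENNReal.ofReal_mul hCpos.le,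
    ← ENNReal.ofReal_mul (mul_nonneg hCpos.le (add_nonneg hA0 hB0'))]
  refine ENNReal.ofReal_le_ofReal ?_
  refine le_trans ?_ (const_mul_exp_le hP1 hc1 ha1 hν0' hq0 hA0 hB0' ht.1)
  refine le_trans ?_ (mul_le_mul_of_nonneg_left hmain hP0)
  rw [hP]
  linarith [mul_nonneg hdn r2, mul_nonneg hdn' r1, mul_nonneg hdn' r3]

end SineGordonRegime

end


noncomputable section

namespace SineGordonRegime

variable {N : ℕ}

/-! ### The estimate of the phase difference in `L²` -/

theorem rn_zero_zero {f : Space N → ℝ} (hf : MemLp f 2 volume) : rn 0 0 f = nrm f :=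
  le_antisymm (rn_le (nrm_nonneg f) (Reg.of_memLp hf le_rfl))
    (((Reg.of_memLp hf le_rfl).rn (nrm_nonneg f)).memLp (rn_nonneg _ _ _)).2

section Phase

variable {T s₀ β : ℝ} {u φ F R₀ : ℝ → Space N → ℝ} {G R₁ : Fin N → ℝ → Space N → ℝ}

-- The wave energy is used one derivative lower, for φ and W = −∫₀ᵗ ∇φ. The source u + div W has
-- time derivative F − div G, so it stays in L² and is bounded by its initial value plus a time
-- integral. Thus R₀ and div R₁ are needed only in L², and no bound on ∇φ enters the final constant.
set_option maxHeartbeats 1000000 in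
theorem phase_estimate (hT : 0 < T) (hs₀ : 0 ≤ s₀) (hβ : 0 ≤ β)
    (hu : ∀ t ∈ Icc 0 T, ∃ M, 0 ≤ M ∧ Reg 0 0 M (u t))
    (hφ : ∀ t ∈ Icc 0 T, ∃ M, 0 ≤ M ∧ Reg 1 1 M (φ t))
    (huc : ∀ t ∈ Icc 0 T, ∀ δ > 0, ∀ᶠ s in 𝓝[Icc 0 T] t, Reg 0 0 δ (u s - u t))
    (hφc : ∀ t ∈ Icc 0 T, ∀ δ > 0, ∀ᶠ s in 𝓝[Icc 0 T] t, Reg 1 1 δ (φ s - φ t))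
    (hφ0 : MemLp (φ 0) 2 volume)
    (hF : ∀ t ∈ Icc 0 T, MemLp (φ t) 2 volume →
      MemLp (F t) 2 volume ∧ nrm (F t) ≤ s₀ * nrm (φ t) + β)
    (hG : ∀ i, ∀ t ∈ Icc 0 T, Reg 1 1 β (G i t))
    (hR₀ : ∀ t ∈ Icc 0 T, Reg 0 0 β (R₀ t))
    (hR₁ : ∀ i, ∀ t ∈ Icc 0 T, Reg 1 1 β (R₁ i t))
    (equ : ∀ ψ, IsTest ψ → ∀ t ∈ Icc 0 T, HasDerivWithinAt (fun s => ∫ x, u s x * ψ x)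
      ((∑ i, ∫ x, φ t x * partialDeriv i (partialDeriv i ψ) x) + (∫ x, F t x * ψ x) +
        ∑ i, ∫ x, G i t x * partialDeriv i ψ x) (Icc 0 T) t)
    (eqφ : ∀ ψ, IsTest ψ → ∀ t ∈ Icc 0 T, HasDerivWithinAt (fun s => ∫ x, φ s x * ψ x)
      ((∫ x, u t x * ψ x) + (∫ x, R₀ t x * ψ x) + ∑ i, ∫ x, R₁ i t x * partialDeriv i ψ x)
      (Icc 0 T) t)
    {t : ℝ} (ht : t ∈ Icc 0 T) :
    MemLp (φ t) 2 volume ∧ nrm (φ t) ≤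
      ((N + 1) * nrm (φ 0) + nrm (u 0) + (N + 1) * β) * Real.exp ((N + 2 + s₀) * t) := by
  have h0 : (0 : ℝ) ∈ Icc 0 T := ⟨le_rfl, hT.le⟩
  have hN0 : (0 : ℝ) ≤ N := Nat.cast_nonneg N
  have hbdd : ∀ {f : ℝ → ℝ}, ContinuousOn f (Icc 0 T) → ∃ B, ∀ t ∈ Icc 0 T, f t ≤ B :=
    fun hf => by
      obtain ⟨B, hB⟩ := isCompact_Icc.bddAbove_image hf
      exact ⟨B, fun t ht => hB ⟨t, ht, rfl⟩⟩
  obtain ⟨Bu, hBu⟩ := hbdd (continuousOn_rn hu huc)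
  obtain ⟨Bφ, hBφ⟩ := hbdd (continuousOn_rn hφ hφc)
  have hu' : ∀ t ∈ Icc 0 T, MemLp (u t) 2 volume ∧ nrm (u t) ≤ Bu := fun t ht => by
    obtain ⟨M, hM, h⟩ := hu t ht
    have := (h.rn hM).memLp (rn_nonneg _ _ _)
    exact ⟨this.1, this.2.trans (hBu t ht)⟩
  have hφ' : ∀ t ∈ Icc 0 T, Reg 1 1 Bφ (φ t) := fun t ht => by
    obtain ⟨M, hM, h⟩ := hφ t ht
    exact (h.rn hM).mono le_rfl le_rfl (hBφ t ht)
  have hBφ0 : 0 ≤ Bφ := (rn_nonneg _ _ _).trans (hBφ 0 h0)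
  have hφl : ∀ t ∈ Icc 0 T, LocallyIntegrable (φ t) volume := fun t ht => (hφ' t ht).1
  -- the time derivative of `φ`
  have hr : ∀ i, ∀ t ∈ Icc 0 T, ∃ r : Space N → ℝ, MemLp r 2 volume ∧ nrm r ≤ β ∧
      ∀ ψ, IsTest ψ → ∫ x, R₁ i t x * D [i] ψ x = ∫ x, r x * ψ x := fun i t ht =>
    ((hR₁ i t ht).2 [i] (by simp) (by simp)).exists_rep hβ (hR₁ i t ht).1
  choose! r hrm hrb hr using hr
  set R : ℝ → Space N → ℝ := fun t => R₀ t + ∑ i, r i t with hR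
  have hR₀' := fun t (ht : t ∈ Icc 0 T) => (hR₀ t ht).memLp hβ
  have hsr : ∀ t ∈ Icc 0 T, MemLp (∑ i, r i t) 2 volume := fun t ht =>
    memLp_finsetSum' _ fun i _ => hrm i t ht
  have hRm : ∀ t ∈ Icc 0 T, MemLp (R t) 2 volume := fun t ht => (hR₀' t ht).1.add (hsr t ht)
  have hRb : ∀ t ∈ Icc 0 T, nrm (R t) ≤ (N + 1) * β := fun t ht => by
    refine (nrm_add_le (hR₀' t ht).1 (hsr t ht)).trans ?_
    have h1 := (nrm_sum_le Finset.univ _ fun i _ => hrm i t ht).trans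
      (Finset.sum_le_sum fun i _ => hrb i t ht)
    rw [Finset.sum_const, Finset.card_univ, Fintype.card_fin, nsmul_eq_mul] at h1
    linarith [(hR₀' t ht).2]
  have hRd : ∀ ψ, IsTest ψ → ∀ t ∈ Icc 0 T, HasDerivWithinAt (fun s => ∫ x, φ s x * ψ x)
      ((∫ x, u t x * ψ x) + ∫ x, R t x * ψ x) (Icc 0 T) t := by
    intro ψ hψ t ht
    refine (eqφ ψ hψ t ht).congr_deriv ?_
    have e1 : ∀ i, ∫ x, R₁ i t x * partialDeriv i ψ x = ∫ x, r i t x * ψ x := fun i =>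
      hr i t ht ψ hψ
    have i3 : ∀ i, Integrable (fun x => r i t x * ψ x) volume := fun i =>
      (hrm i t ht).integrable_mul_fun (hψ.memLp 2)
    rw [Finset.sum_congr rfl fun i _ => e1 i, ← integral_finsetSum _ fun i _ => i3 i, add_assoc,
      ← integral_add ((hR₀' t ht).1.integrable_mul_fun (hψ.memLp 2))
        (integrable_finsetSum _ fun i _ => i3 i)]
    congr 2
    funext x
    simp only [hR, Pi.add_apply, Finset.sum_apply, add_mul, Finset.sum_mul]
  -- the difference remains in `L²`
  set B := Bu + (N + 1) * β with hB
  have hB0 : 0 ≤ B := by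
    have := (nrm_nonneg _).trans (hu' 0 h0).2
    positivity
  have hlip : ∀ s ∈ Icc 0 T, ∀ t ∈ Icc 0 T,
      MemLp (φ s - φ t) 2 volume ∧ nrm (φ s - φ t) ≤ B * |s - t| := fun s hs t ht =>
    nrm_sub_le_of_weak_deriv (convex_Icc 0 T) hB0 hs ht (hφl s hs) (hφl t ht) fun ψ hψ r hr =>
      ⟨_, by
        have h1 := (abs_integral_mul_le (hu' r hr).1 (hψ.memLp 2)).trans
          (mul_le_mul_of_nonneg_right (hu' r hr).2 (nrm_nonneg ψ))
        have h2 := (abs_integral_mul_le (hRm r hr) (hψ.memLp 2)).trans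
          (mul_le_mul_of_nonneg_right (hRb r hr) (nrm_nonneg ψ))
        rw [hB, add_mul]
        exact (abs_add_le _ _).trans (add_le_add h1 h2), hRd ψ hψ r hr⟩
  have hφm : ∀ t ∈ Icc 0 T, MemLp (φ t) 2 volume := fun t ht => by
    have := (hlip t ht 0 h0).1.add hφ0
    rwa [sub_add_cancel] at this
  refine ⟨hφm t ht, ?_⟩
  have hyc : ContinuousOn (fun t => nrm (φ t)) (Icc 0 T) := by
    have : ContinuousOn (fun t => rn 0 0 (φ t)) (Icc 0 T) := by
      refine continuousOn_rn (fun t ht => ⟨_, nrm_nonneg _, Reg.of_memLp (hφm t ht) le_rfl⟩)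
        fun t ht δ hδ => ?_
      have : ∀ᶠ s in 𝓝[Icc 0 T] t, B * |s - t| < δ := by
        refine Filter.Tendsto.eventually_lt_const (v := 0) hδ ?_
        refine Tendsto.mono_left ?_ nhdsWithin_le_nhds
        have : Continuous fun s : ℝ => B * |s - t| := by fun_prop
        simpa using this.tendsto t
      filter_upwards [this, self_mem_nhdsWithin] with s hs hsI
      exact Reg.of_memLp (hlip s hsI t ht).1 ((hlip s hsI t ht).2.trans hs.le)
    exact this.congr fun t ht => (rn_zero_zero (hφm t ht)).symm
  obtain ⟨By, hBy⟩ := hbdd hyc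
  -- continuous extensions to the line
  set pr : ℝ → ℝ := fun s => (projIcc 0 T hT.le s : ℝ) with hpr
  have hprc : Continuous pr := continuous_subtype_val.comp continuous_projIcc
  have hprm : ∀ s, pr s ∈ Icc 0 T := fun s => (projIcc 0 T hT.le s).2
  have hpre : ∀ s ∈ Icc 0 T, pr s = s := fun s hs => by
    simp only [hpr, projIcc_of_mem hT.le hs]
  set y : ℝ → ℝ := fun s => nrm (φ (pr s)) with hy
  have hyc' : Continuous y := hyc.comp_continuous hprc hprm
  have hye : ∀ t ∈ Icc 0 T, y t = nrm (φ t) := fun t ht => by simp only [hy, hpre t ht]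
  have hy0 : ∀ t, 0 ≤ y t := fun t => nrm_nonneg _
  -- This is the pairing of −∂ᵢφ with χ. Integrating the scalars q in time and representing the
  -- result by Riesz defines W without vector-valued integration.
  set q : Fin N → (Space N → ℝ) → ℝ → ℝ := fun i χ s => ∫ x, φ (pr s) x * partialDeriv i χ x
    with hq
  have hqc : ∀ i χ, IsTest χ → Continuous (q i χ) := fun i χ hχ => by
    have : ContinuousOn (fun s => ∫ x, φ s x * partialDeriv i χ x) (Icc 0 T) := fun s hs =>
      (hRd _ (hχ.partialDeriv i) s hs).continuousWithinAt
    exact this.comp_continuous hprc hprm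
  have hqb : ∀ i χ, IsTest χ → ∀ s, |q i χ s| ≤ Bφ * nrm χ := fun i χ hχ s =>
    (hφ' _ (hprm s)).2 [i] (by simp) (by simp) χ hχ
  -- the time integral of the gradient
  have hW : ∀ i, ∀ t ∈ Icc 0 T, ∃ W : Space N → ℝ, MemLp W 2 volume ∧ nrm W ≤ Bφ * t ∧
      ∀ χ, IsTest χ → ∫ s in (0 : ℝ)..t, q i χ s = ∫ x, W x * χ x := by
    intro i t ht
    refine exists_rep_of_bound (fun χ => ∫ s in (0 : ℝ)..t, q i χ s) ?_ ?_
      (mul_nonneg hBφ0 ht.1) ?_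
    · intro χ₁ χ₂ h₁ h₂
      rw [← intervalIntegral.integral_add ((hqc i χ₁ h₁).intervalIntegrable _ _)
        ((hqc i χ₂ h₂).intervalIntegrable _ _)]
      congr 1
      funext s
      simp only [hq]
      rw [partialDeriv_add h₁.1 h₂.1, ← integral_add
        ((hφl _ (hprm s)).integrable_mul_test (h₁.partialDeriv i))
        ((hφl _ (hprm s)).integrable_mul_test (h₂.partialDeriv i))]
      simp only [Pi.add_apply, mul_add]
    · intro a χ hχ
      rw [← intervalIntegral.integral_const_mul]
      congr 1
      funext s
      simp only [hq]
      rw [partialDeriv_const_smul hχ.1, ← integral_const_mul]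
      simp only [Pi.smul_apply, smul_eq_mul, mul_left_comm]
    · intro χ hχ
      have := intervalIntegral.norm_integral_le_of_norm_le_const (a := 0) (b := t)
        (f := q i χ) (C := Bφ * nrm χ) fun s _ => hqb i χ hχ s
      rw [sub_zero, abs_of_nonneg ht.1] at this
      calc _ ≤ Bφ * nrm χ * t := this
        _ = _ := by ring
  choose! W hWm hWb hW using hW
  have hWd : ∀ i χ, IsTest χ → ∀ t ∈ Icc 0 T, HasDerivWithinAt (fun s => ∫ x, W i s x * χ x)
      (∫ x, φ t x * partialDeriv i χ x) (Icc 0 T) t := by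
    intro i χ hχ t ht
    have := (intervalIntegral.integral_hasDerivAt_right ((hqc i χ hχ).intervalIntegrable 0 t)
      (hqc i χ hχ).aestronglyMeasurable.stronglyMeasurableAtFilter
      (hqc i χ hχ).continuousAt).hasDerivWithinAt (s := Icc 0 T)
    have e : q i χ t = ∫ x, φ t x * partialDeriv i χ x := by simp only [hq, hpre t ht]
    rw [e] at this
    exact this.congr (fun s hs => (hW i s hs χ hχ).symm) (hW i t ht χ hχ).symm
  -- the time integral of the forcing
  set g : ℝ → ℝ := fun s => s₀ * y s + (N + 1) * β with hg
  have hgc : Continuous g := by fun_prop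
  have hg0 : ∀ s, 0 ≤ g s := fun s => by
    have := hy0 s
    simp only [hg]
    positivity
  have hJd : ∀ ψ, IsTest ψ → ∀ t ∈ Icc 0 T, HasDerivWithinAt
      (fun s => (∫ x, u s x * ψ x) - ∑ i, ∫ x, W i s x * partialDeriv i ψ x)
      ((∫ x, F t x * ψ x) + ∑ i, ∫ x, G i t x * partialDeriv i ψ x) (Icc 0 T) t := by
    intro ψ hψ t ht
    refine ((equ ψ hψ t ht).sub (HasDerivWithinAt.fun_sum fun i _ =>
      hWd i _ (hψ.partialDeriv i) t ht)).congr_deriv ?_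
    ring
  have hJb : ∀ ψ, IsTest ψ → ∀ t ∈ Icc 0 T,
      |(∫ x, F t x * ψ x) + ∑ i, ∫ x, G i t x * partialDeriv i ψ x| ≤ g t * nrm ψ := by
    intro ψ hψ t ht
    obtain ⟨h1, h2⟩ := hF t ht (hφm t ht)
    have h3 := (abs_integral_mul_le h1 (hψ.memLp 2)).trans
      (mul_le_mul_of_nonneg_right h2 (nrm_nonneg ψ))
    have h4 : |∑ i, ∫ x, G i t x * partialDeriv i ψ x| ≤ ∑ _i : Fin N, β * nrm ψ :=
      (Finset.abs_sum_le_sum_abs _ _).trans (Finset.sum_le_sum fun i _ =>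
        (hG i t ht).2 [i] (by simp) (by simp) ψ hψ)
    rw [Finset.sum_const, Finset.card_univ, Fintype.card_fin, nsmul_eq_mul] at h4
    refine (abs_add_le _ _).trans ((add_le_add h3 h4).trans (le_of_eq ?_))
    simp only [hg]
    rw [hye t ht]
    ring
  have hW0 : ∀ i, nrm (W i 0) = 0 := fun i =>
    le_antisymm ((hWb i 0 h0).trans (by rw [mul_zero])) (nrm_nonneg _)
  have hW0' : ∀ i χ, IsTest χ → ∫ x, W i 0 x * χ x = 0 := fun i χ hχ => by
    rw [← hW i 0 h0 χ hχ, intervalIntegral.integral_same]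
  -- The function f is u + div W. Neither ∂ₜu nor ∂ₜ div W need be in L², but in the sum the two
  -- second-order terms cancel.
  have hf : ∀ t ∈ Icc 0 T, ∃ f : Space N → ℝ, MemLp f 2 volume ∧
      nrm f ≤ nrm (u 0) + ∫ s in (0 : ℝ)..t, g s ∧ ∀ ψ, IsTest ψ →
      (∫ x, u t x * ψ x) - ∑ i, ∫ x, W i t x * partialDeriv i ψ x = ∫ x, f x * ψ x := by
    intro t ht
    refine exists_rep_of_bound
      (fun ψ => (∫ x, u t x * ψ x) - ∑ i, ∫ x, W i t x * partialDeriv i ψ x) ?_ ?_ ?_ ?_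
    · intro χ₁ χ₂ h₁ h₂
      have e1 : ∫ x, u t x * (χ₁ + χ₂) x = (∫ x, u t x * χ₁ x) + ∫ x, u t x * χ₂ x := by
        rw [← integral_add ((hu' t ht).1.integrable_mul_fun (h₁.memLp 2))
          ((hu' t ht).1.integrable_mul_fun (h₂.memLp 2))]
        simp only [Pi.add_apply, mul_add]
      have e2 : ∀ i, ∫ x, W i t x * partialDeriv i (χ₁ + χ₂) x =
          (∫ x, W i t x * partialDeriv i χ₁ x) + ∫ x, W i t x * partialDeriv i χ₂ x := fun i => by
        rw [← integral_add ((hWm i t ht).integrable_mul_fun ((h₁.partialDeriv i).memLp 2))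
          ((hWm i t ht).integrable_mul_fun ((h₂.partialDeriv i).memLp 2)),
          partialDeriv_add h₁.1 h₂.1]
        simp only [Pi.add_apply, mul_add]
      rw [e1, Finset.sum_congr rfl fun i _ => e2 i, Finset.sum_add_distrib]
      ring
    · intro a χ hχ
      have e1 : ∫ x, u t x * (a • χ) x = a * ∫ x, u t x * χ x := by
        rw [← integral_const_mul]
        simp only [Pi.smul_apply, smul_eq_mul, mul_left_comm]
      have e2 : ∀ i, ∫ x, W i t x * partialDeriv i (a • χ) x =
          a * ∫ x, W i t x * partialDeriv i χ x := fun i => by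
        rw [← integral_const_mul, partialDeriv_const_smul hχ.1]
        simp only [Pi.smul_apply, smul_eq_mul, mul_left_comm]
      rw [e1, Finset.sum_congr rfl fun i _ => e2 i, ← Finset.mul_sum]
      ring
    · exact add_nonneg (nrm_nonneg _) (intervalIntegral.integral_nonneg ht.1 fun s _ => hg0 s)
    · intro ψ hψ
      have h1 := abs_sub_le_integral_of_abs_deriv_le (hJd ψ hψ)
        (g := fun s => g s * nrm ψ) (by fun_prop) (hJb ψ hψ) ht
      rw [intervalIntegral.integral_mul_const, Finset.sum_congr rfl fun i _ =>
        hW0' i _ (hψ.partialDeriv i), Finset.sum_const_zero, sub_zero] at h1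
      have h2 := abs_integral_mul_le (hu' 0 h0).1 (hψ.memLp 2)
      have h3 := abs_sub_abs_le_abs_sub
        ((∫ x, u t x * ψ x) - ∑ i, ∫ x, W i t x * partialDeriv i ψ x) (∫ x, u 0 x * ψ x)
      rw [add_mul]
      linarith
  choose! f hfm hfb hf using hf
  -- the wave system satisfied by `φ` and `W`
  set γ : ℝ → ℝ := fun t => nrm (u 0) + (N + 1) * β + ∫ s in (0 : ℝ)..t, g s with hγ
  have hγc : Continuous γ := continuous_const.add
    (intervalIntegral.continuous_primitive (fun a b => hgc.intervalIntegrable a b) 0)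
  have hγ0 : ∀ t ∈ Icc 0 T, (N + 1) * β ≤ γ t := fun t ht => by
    have h1 := nrm_nonneg (u 0)
    have h2 := intervalIntegral.integral_nonneg (μ := volume) ht.1 fun s _ => hg0 s
    simp only [hγ]
    linarith
  have hNβ : 0 ≤ (N + 1) * β := by positivity
  have hwave : ∀ t ∈ Icc 0 T, nrm (φ t) ≤ (N + 1) * nrm (φ 0) +
      (N + 1) * ∫ s in (0 : ℝ)..t, γ s := by
    intro t ht
    have := wave_energy (B := max By (Bφ * T)) (v := φ) (W := W) (f := fun t => f t + R t)
      (h := fun _ _ => 0) hγc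
      (fun t ht => ⟨hφm t ht, (hBy t ht).trans (le_max_left _ _)⟩)
      (fun i t ht => ⟨hWm i t ht, (hWb i t ht).trans ((mul_le_mul_of_nonneg_left ht.2 hBφ0).trans
        (le_max_right _ _))⟩)
      (fun t ht => ⟨(hfm t ht).add (hRm t ht), (nrm_add_le (hfm t ht) (hRm t ht)).trans (by
        simp only [hγ]
        linarith [hfb t ht, hRb t ht])⟩)
      (fun i t ht => ⟨MemLp.zero, by
        have : nrm (0 : Space N → ℝ) = 0 := by simp [nrm]
        rw [this]
        exact hNβ.trans (hγ0 t ht)⟩)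
      (fun ψ hψ t ht => by
        refine (hRd ψ hψ t ht).congr_deriv ?_
        have e1 : ∫ x, (f t + R t) x * ψ x = (∫ x, f t x * ψ x) + ∫ x, R t x * ψ x := by
          rw [← integral_add ((hfm t ht).integrable_mul_fun (hψ.memLp 2))
            ((hRm t ht).integrable_mul_fun (hψ.memLp 2))]
          simp only [Pi.add_apply, add_mul]
        rw [e1, ← hf t ht ψ hψ]
        ring)
      (fun i ψ hψ t ht => by
        refine (hWd i ψ hψ t ht).congr_deriv ?_
        simp) ht
    have h1 : 0 ≤ ∑ i, nrm (W i t) := Finset.sum_nonneg fun i _ => nrm_nonneg _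
    simp only [hW0, Finset.sum_const_zero, add_zero] at this
    linarith
  -- Gronwall is applied to y + γ: the bound of y involves ∫γ, and γ involves ∫(s₀ y + (N + 1)β).
  -- Since (N + 1)β ≤ γ, the rate N + 2 + s₀ covers both.
  have hfin := gronwall_integral (T := T) (Y := fun t => y t + γ t) (hyc'.add hγc)
    (c₀ := (N + 1) * nrm (φ 0) + nrm (u 0) + (N + 1) * β) (c := N + 2 + s₀) (by positivity)
    (fun t ht => by
      have h1 := hwave t ht
      have h2 : (N + 1) * (∫ s in (0 : ℝ)..t, γ s) + ∫ s in (0 : ℝ)..t, g s ≤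
          (N + 2 + s₀) * ∫ s in (0 : ℝ)..t, (y s + γ s) := by
        rw [← intervalIntegral.integral_const_mul, ← intervalIntegral.integral_const_mul,
          ← intervalIntegral.integral_add ((hγc.const_mul _).intervalIntegrable _ _)
            (hgc.intervalIntegrable _ _)]
        refine intervalIntegral.integral_mono_on ht.1
          (((continuous_const.mul hγc).add hgc).intervalIntegrable _ _)
          ((continuous_const.mul (hyc'.add hγc)).intervalIntegrable _ _) fun s hs => ?_
        have h3 := hγ0 s ⟨hs.1, hs.2.trans ht.2⟩
        have h4 := hy0 s
        have h5 : 0 ≤ γ s := hNβ.trans h3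
        have h6 := mul_nonneg hN0 h4
        have h7 := mul_nonneg hs₀ h5
        simp only [hg]
        linarith
      have h3 : γ t = nrm (u 0) + (N + 1) * β + ∫ s in (0 : ℝ)..t, g s := rfl
      rw [hye t ht, h3]
      linarith) ht
  have h1 := hNβ.trans (hγ0 t ht)
  simp only [hye t ht] at hfin
  linarith

end Phase

/-- In (i) the order k may be 2, so the full remainder bound is available at n = 0 only, while div G
must lie in L². The term U²∇Φ contains no derivative of U and can be estimated one order higher by
itself. -/
theorem exists_U_sq_gradΦ_const (N n : ℕ) {Cs : ℝ} (hCs : 0 ≤ Cs) : ∃ C, 1 ≤ C ∧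
    ∀ (K : ℝ) (U Φ : Space N → ℝ), 0 ≤ K → Reg 0 n K U → Reg 1 (n + 1) K Φ →
      (∀ᵐ x, |U x| ≤ Cs * K) → (∀ i, ∀ᵐ x, |weakPartial i Φ x| ≤ Cs * K) →
      ∀ i, Reg 0 n (C * K ^ 3) fun x => U x * U x * weakPartial i Φ x := by
  obtain ⟨C, hC1, h11, h10⟩ := exists_mul_const N n
  have hC0 : 0 ≤ C := by linarith
  refine ⟨1 + (2 * C ^ 2 * Cs ^ 2 + C * Cs ^ 2), le_add_of_nonneg_right (by positivity),
    fun K U Φ hK hU hΦ hUS hΦS i => ?_⟩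
  have bU1 : BReg 1 n (Cs * K) K U := ⟨hU.mono zero_le_one le_rfl le_rfl, hUS⟩
  have h3 := h11 _ _ _ _ K K (by positivity) (by positivity) hK hK bU1 bU1
  have h4 := h10 _ _ _ _ _ K (by positivity) (by positivity) (by positivity) hK h3
    ⟨hΦ.weakPartial hK i, hΦS i⟩
  refine h4.1.mono le_rfl le_rfl ?_
  have : 0 ≤ K ^ 3 := by positivity
  calc C * (Cs * K * (Cs * K) * K + Cs * K * (C * (Cs * K * K + Cs * K * K)))
      = (2 * C ^ 2 * Cs ^ 2 + C * Cs ^ 2) * K ^ 3 := by ring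
    _ ≤ _ := by linarith

end SineGordonRegime

end


/-! ### The phase estimate for the two systems -/

noncomputable section

namespace SineGordonRegime

variable {N : ℕ}

-- Here |sin φ| ≤ |φ| turns the nonlinear source into a term bounded by σ times the L² norm of φ.
set_option maxHeartbeats 1000000 in
theorem phase_error_estimate (N : ℕ) {σ : ℝ} (hσ : 0 < σ) :
    ∃ C₁ : ℝ, 0 < C₁ ∧ ∀ (k : ℕ), (N : ℝ) / 2 + 1 < k →
      ∀ (ε T : ℝ), 0 < ε → 0 < T → ∀ Uε Φε U Φ : ℝ → Space N → ℝ,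
      IsHLLSolution σ ε (k + 1) (Icc 0 T) Uε Φε →
      (∀ t ∈ Icc 0 T, ENNReal.ofReal ε * eLpNorm (Uε t) ⊤ volume
        ≤ ENNReal.ofReal (1 / √2)) →
      IsSGSolution σ (Icc 0 T) U Φ →
      l2Norm (Φε 0 - Φ 0) < ⊤ →
      ∀ t ∈ Icc 0 T,
        l2Norm (Φε t - Φ t) ≤
          ENNReal.ofReal C₁ *
            (l2Norm (Φε 0 - Φ 0) + l2Norm (Uε 0 - U 0)
              + ENNReal.ofReal ε ^ 2 * Kquant ε k T Uε Φε *
                (1 + ENNReal.ofReal ε ^ 2 * Kquant ε k T Uε Φε ^ 2 + Kquant ε k T Uε Φε ^ 3)) *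
            ENNReal.ofReal (Real.exp (C₁ * t)) := by
  have hNd : (N : ℝ) < 2 * (N / 2 : ℕ) + 2 := by
    have : N < 2 * (N / 2) + 2 := by omega
    exact_mod_cast this
  obtain ⟨C, hC1, hrem⟩ := exists_remainderBound_of_sobolev (N := N) (n := 0) (k := N / 2 + 2)
    (by push_cast; linarith) (by omega)
  -- As N/2 is the integer quotient, ⌊N/2⌋ + 1 exceeds the real N/2. All estimates use order ⌊N/2⌋ +
  -- 2 ≤ k, so the constant is independent of k.
  obtain ⟨Cs, hCs1, hCs⟩ := sobolev (N := N) (s := N / 2 + 1) (by push_cast; linarith)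
  obtain ⟨Cg, hCg1, hCg⟩ := exists_U_sq_gradΦ_const N 1 (zero_le_one.trans hCs1)
  have hC0 : 0 ≤ C := by linarith
  have hCg0 : 0 ≤ Cg := by linarith
  have hN0 : (0 : ℝ) ≤ N := Nat.cast_nonneg N
  set ν : ℝ := (σ + 2 * N + 1) * C + Cg with hν
  have hν0 : 0 ≤ ν := by positivity
  set C₁ : ℝ := (N + 1) * (1 + ν) + (N + 2 + σ) with hC₁
  have hC₁pos : 0 < C₁ := by positivity
  refine ⟨C₁, hC₁pos, ?_⟩
  intro k hk ε T hε hT Uε Φε U Φ hsol hbd hsg hφ0 t ht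
  have hkk₀ : N / 2 + 2 ≤ k := by
    have h1 : N + 2 < 2 * k := by
      have : (N : ℝ) + 2 < 2 * k := by linarith
      exact_mod_cast this
    omega
  have h0 : (0 : ℝ) ∈ Icc 0 T := ⟨le_rfl, hT.le⟩
  by_cases hKtop : Kquant ε k T Uε Φε = ⊤
  · rw [mul_mul_exp_eq_top hC₁pos]
    · exact le_top
    · rw [add_assoc (1 : ℝ≥0∞), remainder_eq_top hε hKtop, add_top]
  set K := (Kquant ε k T Uε Φε).toReal with hK
  have hK0 : 0 ≤ K := ENNReal.toReal_nonneg
  have hKe : Kquant ε k T Uε Φε = ENNReal.ofReal K := (ENNReal.ofReal_toReal hKtop).symm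
  rw [hKe, ofReal_remainder hε.le hK0]
  set B := ε ^ 2 * remSize ε K with hB
  obtain ⟨m1, -, m3, -, -, -⟩ := le_remSize ε hK0
  have hM0 : 0 ≤ remSize ε K := hK0.trans m1
  have hB0 : 0 ≤ B := mul_nonneg (sq_nonneg ε) hM0
  -- regularity of the two solutions
  have hΦεl : ∀ t ∈ Icc 0 T, LocallyIntegrable (Φε t) volume := fun t ht => (hsol.cont_Φ.1 t ht).1
  have hΦl : ∀ t ∈ Icc 0 T, LocallyIntegrable (Φ t) volume := fun t ht => (hsg.cont_Φ.1 t ht).1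
  have hreg := fun t (ht : t ∈ Icc 0 T) => Kquant_bounds hK0 hKe.le ht (hΦεl t ht)
  have hUr : ∀ t ∈ Icc 0 T, ∃ M, 0 ≤ M ∧ Reg 0 0 M (U t) := fun t ht =>
    (hsg.cont_U.1 t ht).exists_reg
  have hΦr : ∀ t ∈ Icc 0 T, ∃ M, 0 ≤ M ∧ Reg 1 1 M (Φ t) := fun t ht =>
    MemHsin.exists_reg (k := 0) (hsg.cont_Φ.1 t ht)
  have hUεl : ∀ t ∈ Icc 0 T, LocallyIntegrable (Uε t) volume := fun t ht => (hreg t ht).1.1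
  have hUl : ∀ t ∈ Icc 0 T, LocallyIntegrable (U t) volume := fun t ht => by
    obtain ⟨M, -, h⟩ := hUr t ht
    exact h.1
  have hudiff : ∀ t ∈ Icc 0 T, ∃ M, 0 ≤ M ∧ Reg 0 0 M (Uε t - U t) := fun t ht => by
    obtain ⟨M, hM, h⟩ := hUr t ht
    exact ⟨K + M, by positivity, ((hreg t ht).1.mono le_rfl (Nat.zero_le _) le_rfl).sub h⟩
  have hremt : ∀ t ∈ Icc 0 T, RemainderBound 0 ε (C * remSize ε K) (Uε t) (Φε t) := fun t ht => by
    obtain ⟨h1, h2, h3⟩ := hreg t ht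
    have := hrem ε K 1 (Uε t) (Φε t) hε hK0 le_rfl (h1.mono le_rfl hkk₀ le_rfl)
      (h2.mono le_rfl (by omega) le_rfl) (h3.mono le_rfl hkk₀ le_rfl)
      (ae_abs_mul_le_of_eLpNorm hε (by positivity) (hbd t ht)) (by simp)
    rwa [one_mul] at this
  have hGt : ∀ i, ∀ t ∈ Icc 0 T, Reg 1 1 (ε ^ 2 * (Cg * remSize ε K)) (remG ε (Uε t) (Φε t) i) :=
    fun i t ht => by
      obtain ⟨h1, h2, -⟩ := hreg t ht
      have h3 := (hCg K (Uε t) (Φε t) hK0 (h1.mono le_rfl (by omega) le_rfl)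
        (h2.mono le_rfl (by omega) le_rfl) (hCs _ K hK0 (h1.mono le_rfl (by omega) le_rfl))
        (fun i => hCs _ K hK0 (Reg.weakPartial (h2.mono le_rfl (by omega) le_rfl) hK0 i)) i).smul
        (ε ^ 2)
      refine h3.mono zero_le_one le_rfl ?_
      rw [abs_of_nonneg (sq_nonneg ε)]
      exact mul_le_mul_of_nonneg_left (mul_le_mul_of_nonneg_left m3 hCg0) (sq_nonneg ε)
  have hZ : ε ^ 2 * (C * remSize ε K) = C * B := by rw [hB]; ring
  have hZ' : ε ^ 2 * (Cg * remSize ε K) = Cg * B := by rw [hB]; ring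
  have hνB : ν * B = (σ + 2 * N + 1) * (C * B) + Cg * B := by rw [hν]; ring
  have hCB : 0 ≤ C * B := mul_nonneg hC0 hB0
  have hCgB : 0 ≤ Cg * B := mul_nonneg hCg0 hB0
  have hNB : 0 ≤ N * (C * B) := mul_nonneg hN0 hCB
  have hσB : 0 ≤ σ * (C * B) := mul_nonneg hσ.le hCB
  have hνB0 : 0 ≤ ν * B := mul_nonneg hν0 hB0
  have hφ0m : MemLp (Φε 0 - Φ 0) 2 volume :=
    ⟨((hΦεl 0 h0).sub (hΦl 0 h0)).aestronglyMeasurable, hφ0⟩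
  obtain ⟨M0, hM00, hu0⟩ := hudiff 0 h0
  have hu0m := (hu0.memLp hM00).1
  obtain ⟨hφm, hmain⟩ := phase_estimate (T := T) (s₀ := σ) (β := ν * B)
    (u := fun t => Uε t - U t) (φ := fun t => Φε t - Φ t)
    (F := fun t => diffF σ ε (Uε t) (Φε t) (Φ t)) (R₀ := fun t => remR₀ σ ε (Uε t) (Φε t))
    (G := fun i t => remG ε (Uε t) (Φε t) i) (R₁ := fun i t => remR₁ ε (Uε t) i)
    hT hσ.le hνB0 hudiff
    (fun t ht => by
      obtain ⟨M, hM, h⟩ := hΦr t ht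
      exact ⟨K + M, by positivity, ((hreg t ht).2.1.mono le_rfl (by omega) le_rfl).sub h⟩)
    (fun t ht δ hδ => eventually_reg_sub_sub
      (fun δ hδ => (hsol.cont_U.eventually_reg ht hδ).mono fun s h =>
        h.mono le_rfl (Nat.zero_le _) le_rfl) (fun δ hδ => hsg.cont_U.eventually_reg ht hδ) hδ)
    (fun t ht δ hδ => eventually_reg_sub_sub
      (fun δ hδ => (hsol.cont_Φ.eventually_reg ht hδ).mono fun s h =>
        h.mono le_rfl (by omega) le_rfl)
      (fun δ hδ => ContInHsin.eventually_reg (k := 0) hsg.cont_Φ ht hδ) hδ)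
    hφ0m
    (fun t ht hφ => by
      obtain ⟨h1, h2⟩ := ((hremt t ht).remF hσ.le).memLp (by rw [hZ]; exact hσB)
      have h3 : AEStronglyMeasurable
          (fun x => Real.cos (Φε t x + Φ t x) * Real.sin ((Φε t - Φ t) x)) volume :=
        (Real.continuous_cos.comp_aestronglyMeasurable
          ((hΦεl t ht).add (hΦl t ht)).aestronglyMeasurable).mul
        (Real.continuous_sin.comp_aestronglyMeasurable hφ.1)
      have h4 : ∀ x, |Real.cos (Φε t x + Φ t x) * Real.sin ((Φε t - Φ t) x)| ≤
          |(Φε t - Φ t) x| := fun x => by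
        rw [abs_mul]
        calc _ ≤ 1 * |(Φε t - Φ t) x| := mul_le_mul (Real.abs_cos_le_one _)
              Real.abs_sin_le_abs (abs_nonneg _) zero_le_one
          _ = _ := one_mul _
      have h5 : MemLp (fun x => Real.cos (Φε t x + Φ t x) * Real.sin ((Φε t - Φ t) x)) 2 volume :=
        hφ.mono h3 (.of_forall h4)
      have h6 := nrm_mono hφ (.of_forall h4)
      refine ⟨(h5.const_smul (-σ)).add h1, (nrm_add_le (h5.const_smul (-σ)) h1).trans ?_⟩
      rw [nrm_smul, abs_neg, abs_of_pos hσ]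
      rw [hZ] at h2
      have h7 := mul_le_mul_of_nonneg_left h6 hσ.le
      rw [hνB]
      linarith)
    (fun i t ht => (hGt i t ht).mono le_rfl le_rfl (by rw [hZ', hνB]; linarith))
    (fun t ht => ((hremt t ht).remR₀ hσ.le).mono le_rfl le_rfl (by rw [hZ, hνB]; linarith))
    (fun i t ht => ((hremt t ht).remR₁ i).mono le_rfl le_rfl (by rw [hZ, hνB]; linarith))
    (fun ψ hψ t ht => hasDerivWithinAt_diff_U hsol hsg hK0 hremt
      (fun t ht => (hreg t ht).2.1.mono le_rfl (by omega) le_rfl) hΦr hUεl hUl hψ ht)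
    (fun ψ hψ t ht => hasDerivWithinAt_diff_Φ hsol hsg hremt hΦεl hΦl hUεl hUl hψ ht) ht
  have n1 := nrm_nonneg (Φε 0 - Φ 0)
  have n2 := nrm_nonneg (Uε 0 - U 0)
  rw [l2Norm_eq_ofReal_nrm hφm, l2Norm_eq_ofReal_nrm hφ0m, l2Norm_eq_ofReal_nrm hu0m,
    ← ENNReal.ofReal_add n1 n2, ← ENNReal.ofReal_add (add_nonneg n1 n2) hB0,
    ← ENNReal.ofReal_mul hC₁pos.le,
    ← ENNReal.ofReal_mul (mul_nonneg hC₁pos.le (add_nonneg (add_nonneg n1 n2) hB0))]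
  refine ENNReal.ofReal_le_ofReal (hmain.trans ?_)
  refine mul_le_mul ?_ (Real.exp_le_exp.2 (mul_le_mul_of_nonneg_right ?_ ht.1))
    (Real.exp_pos _).le (mul_nonneg hC₁pos.le (add_nonneg (add_nonneg n1 n2) hB0))
  · have h1 := mul_nonneg hN0 n2
    have h2 := mul_nonneg hν0 n1
    have h3 := mul_nonneg hν0 n2
    have h4 := mul_nonneg hN0 h2
    have h5 := mul_nonneg hN0 h3
    have h6 := mul_nonneg hN0 hB0
    have h7 := mul_nonneg hσ.le n1
    have h8 := mul_nonneg hσ.le n2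
    have h9 := mul_nonneg hσ.le hB0
    have h10 := mul_nonneg hN0 n1
    rw [hC₁]
    linarith
  · have : 0 ≤ (N + 1) * (1 + ν) := by positivity
    rw [hC₁]
    linarith

end SineGordonRegime

end

/-! ### The three error estimates -/

theorem mainTheorem11 (N : ℕ) (hN : 1 ≤ N) (σ : ℝ) (hσ : 0 < σ) :
    -- (i)
    (∃ C₁ : ℝ, 0 < C₁ ∧ ∀ (k : ℕ), (N : ℝ) / 2 + 1 < k →
      ∀ (ε T : ℝ), 0 < ε → 0 < T → ∀ Uε Φε U Φ : ℝ → Space N → ℝ,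
      IsHLLSolution σ ε (k + 1) (Icc 0 T) Uε Φε →
      MemNV ε (k + 2) (Uε 0) (Φε 0) →
      (∀ t ∈ Icc 0 T, ENNReal.ofReal ε * eLpNorm (Uε t) ⊤ volume
        ≤ ENNReal.ofReal (1 / √2)) →
      IsSGSolution σ (Icc 0 T) U Φ →
      l2Norm (Φε 0 - Φ 0) < ⊤ →
      ∀ t ∈ Icc 0 T,
        l2Norm (Φε t - Φ t) ≤
          ENNReal.ofReal C₁ *
            (l2Norm (Φε 0 - Φ 0) + l2Norm (Uε 0 - U 0)
              + ENNReal.ofReal ε ^ 2 * Kquant ε k T Uε Φε *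
                (1 + ENNReal.ofReal ε ^ 2 * Kquant ε k T Uε Φε ^ 2 + Kquant ε k T Uε Φε ^ 3)) *
            ENNReal.ofReal (Real.exp (C₁ * t)))
    ∧
    -- (ii)
    (∃ C₂ : ℝ, 0 < C₂ ∧ ∀ (k : ℕ), (N : ℝ) / 2 + 1 < k →
      (2 ≤ N ∨ (N = 1 ∧ (N : ℝ) / 2 + 2 < k)) →
      ∀ (ε T : ℝ), 0 < ε → 0 < T → ∀ Uε Φε U Φ : ℝ → Space N → ℝ,
      IsHLLSolution σ ε (k + 1) (Icc 0 T) Uε Φε →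
      MemNV ε (k + 2) (Uε 0) (Φε 0) →
      (∀ t ∈ Icc 0 T, ENNReal.ofReal ε * eLpNorm (Uε t) ⊤ volume
        ≤ ENNReal.ofReal (1 / √2)) →
      IsSGSolution σ (Icc 0 T) U Φ →
      ∀ t ∈ Icc 0 T,
        l2Norm (Uε t - U t) + gradSobNorm 0 (Φε t - Φ t) + l2Norm (sinOf (Φε t - Φ t)) ≤
          ENNReal.ofReal C₂ *
            (l2Norm (Uε 0 - U 0) + gradSobNorm 0 (Φε 0 - Φ 0) + l2Norm (sinOf (Φε 0 - Φ 0))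
              + ENNReal.ofReal ε ^ 2 * Kquant ε k T Uε Φε *
                (1 + ENNReal.ofReal ε ^ 2 * Kquant ε k T Uε Φε ^ 2 + Kquant ε k T Uε Φε ^ 3)) *
            ENNReal.ofReal (Real.exp (C₂ * t)))
    ∧
    -- (iii)
    (∀ (k : ℕ), (N : ℝ) / 2 + 3 < k → ∃ C : ℝ, 0 < C ∧
      ∀ (ε T : ℝ), 0 < ε → 0 < T → ∀ Uε Φε U Φ : ℝ → Space N → ℝ,
      IsHLLSolution σ ε (k + 1) (Icc 0 T) Uε Φε →
      MemNV ε (k + 2) (Uε 0) (Φε 0) →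
      (∀ t ∈ Icc 0 T, ENNReal.ofReal ε * eLpNorm (Uε t) ⊤ volume
        ≤ ENNReal.ofReal (1 / √2)) →
      IsSGSolution σ (Icc 0 T) U Φ →
      ContInH k (Icc 0 T) U →
      ContInHsin (k + 1) (Icc 0 T) Φ →
      ∀ t ∈ Icc 0 T,
        sobNorm (k - 3) (Uε t - U t) + gradSobNorm (k - 3) (Φε t - Φ t)
            + sobNorm (k - 3) (sinOf (Φε t - Φ t)) ≤
          ENNReal.ofReal C *
            (sobNorm (k - 3) (Uε 0 - U 0) + gradSobNorm (k - 3) (Φε 0 - Φ 0)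
              + sobNorm (k - 3) (sinOf (Φε 0 - Φ 0))
              + ENNReal.ofReal ε ^ 2 * kappaQuant ε k T Uε Φε U Φ *
                (1 + ENNReal.ofReal ε ^ 2 * kappaQuant ε k T Uε Φε U Φ ^ 2
                  + (1 + ENNReal.ofReal ε ^ 2) * kappaQuant ε k T Uε Φε U Φ ^ 3)) *
            ENNReal.ofReal
              (Real.exp (C * (1 + (kappaQuant ε k T Uε Φε U Φ).toReal ^ 2) * t))) := by
  refine ⟨?_, ?_, ?_⟩
  · obtain ⟨C, hC, h⟩ := phase_error_estimate N hσ
    exact ⟨C, hC, fun k hk ε T hε hT Uε Φε U Φ hsol _ hbd hsg hφ =>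
      h k hk ε T hε hT Uε Φε U Φ hsol hbd hsg hφ⟩
  · obtain ⟨C, hC, h⟩ := energy_error_estimate N hσ
    exact ⟨C, hC, fun k hk hNk ε T hε hT Uε Φε U Φ hsol _ hbd hsg =>
      h k hk hNk ε T hε hT Uε Φε U Φ hsol hbd hsg⟩
  · intro k hk
    obtain ⟨m, rfl⟩ : ∃ m, k = m + 3 := ⟨k - 3, by
      have : (3 : ℝ) < k := by
        have : (0 : ℝ) ≤ N := Nat.cast_nonneg N
        linarith
      have : 3 < k := by exact_mod_cast this
      omega⟩
    rw [Nat.add_sub_cancel]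
    obtain ⟨C, hC, h⟩ := sobolev_error_estimate (N := N) hσ (m := m) (by push_cast at hk; linarith)
    exact ⟨C, hC, fun ε T hε hT Uε Φε U Φ hsol _ hbd hsg hcU hcΦ =>
      h ε T hε hT Uε Φε U Φ hsol hbd hsg hcU hcΦ⟩
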